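/- **Setting.** Graphs $G=(V,E)$ are finite, undirected and unweighted, $V=\{0,\dots,n-1\}$, $m=|E|$, given by their adjacency matrix; $\delta(u,v)\in\{0,1,2,\dots,\infty\}$ is the distance in $G$. Programs are randomized RAM programs (arrays of natural numbers, arithmetic operations and comparisons, fair coin flips); each operation is charged the bit length of the numbers and addresses it handles. $\tilde O(T)$ means at most $C\cdot T\cdot\log^c(n+2)$ for all graphs with $n\ge 1$ vertices, with constants $C,c$. **Subroutine.** $\mathsf{BK2APASP}$ (Baswana and Kavitha) is a randomized program that on every graph, for every outcome of its coin flips, returns $\hat\delta$ with $\delta(u,v)\le\hat\delta(u,v)\le 2\delta(u,v)$ for all $u,v\in V$, in expected time $\tilde O(m\sqrt n+n^2)$. **Algorithm** $\mathsf{LongMultiplicativeAPASP}(G,k)$. 1. Put $\hat\delta(u,v)=1$ if $uv\in E$ and $\hat\delta(u,v)=\infty$ otherwise. Let $l=2(k-1)$, $l_0=k-2$, $s_0=\infty$, $s_i=n^{1-i/l}$ for $1\le i\le l-1$, and $s_l=0$. 2. ($\mathsf{Decompose}$) For $1\le i\le l$ let $E_i=\{uv\in E:\min(\deg u,\deg v)<s_{i-1}\}$.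 For $1\le i\le l-1$ compute greedily a set that meets the closed neighbourhood $N(v)\cup\{v\}$ of every $v$ with $\deg v\ge s_i$ (always adding a vertex that lies in the largest number of closed neighbourhoods not yet met), and let $D_i$ be its union with $D_{i-1}$, where $D_0=\emptyset$. Let $D_l=V$. Let $E^*$ consist, for each $1\le i\le l-1$ and each $v$ with $\deg v\ge s_i$, of the edge from $v$ to the first chosen vertex of $N(v)\cup\{v\}$ at level $i$ (no edge if that vertex is $v$ itself). 3. For $j=1,\dots,l$ and each $w\in D_j$: run Dijkstra's algorithm from $w$ on the graph with vertex set $V$ and edge set $$E_j\;\cup\bigcup_{\substack{1\le j_1,j_2\le l\\ j+j_1+j_2\le 2l+1}}D_{j_1}\times D_{j_2}\;\cup\;E^*\;\cup\;(\{w\}\times V),$$ each edge $xy$ having as weight the current value $\hat\delta(x,y)$; then replace $\hat\delta(w,x)$ and $\hat\delta(x,w)$ by the computed distance, for all $x\in V$. 4. Run $\mathsf{BK2APASP}$ on the graph $(V,E_{l_0+1})$ and replace $\hat\delta$ by the entrywise minimum of $\hat\delta$ and the result. Return $\hat\delta$. **Theorem.** There is a program $\mathsf{BK2APASP}$ as above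 such that, with it as the subroutine, the following holds for every even integer $k\ge 4$. (i) On every graph, and for every outcome of the coin flips, $\mathsf{LongMultiplicativeAPASP}(G,k)$ returns $\hat\delta$ with $\delta(u,v)\le\hat\delta(u,v)$ for all $u,v\in V$, and $\hat\delta(u,v)\le 2\,\delta(u,v)$ whenever $\delta(u,v)\ge k$. (ii) Its expected running time is $\tilde O\bigl(n^{2+\frac{1}{2(k-1)}}\bigr)$, where the constants may depend on $k$. -/

import Mathlib

open scoped ENNReal

namespace Apsp

/-! ### The machine model: a randomized RAM with logarithmic cost

The memory consists of finitely many named two-dimensional arrays of natural numbers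
(a scalar is the entry `(0, 0)` of an array).  Every operation is charged the bit length of its
operands, of the addresses it uses and of the value it reads or writes. -/

/-- Arithmetic expressions over arrays with names in `X`.  Comparisons return `0` or `1`. -/
inductive Exp (X : Type) : Type
  | lit (c : ℕ)
  | get (a : X) (i j : Exp X)
  | add (e f : Exp X)
  | sub (e f : Exp X)
  | mul (e f : Exp X)
  | lt (e f : Exp X)
  | eq (e f : Exp X)

/-- Statements.  `loop a e c` is the loop `for a = 0, …, e - 1 do c`, where the bound `e` is
evaluated once, before the first iteration; `flip a i j` stores a fresh uniformly random bit. -/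
inductive Cmd (X : Type) : Type
  | skip
  | set (a : X) (i j e : Exp X)
  | flip (a : X) (i j : Exp X)
  | seq (c d : Cmd X)
  | ite (e : Exp X) (c d : Cmd X)
  | loop (a : X) (e : Exp X) (c : Cmd X)

/-- A memory state: the entry `(i, j)` of the array named `a` is `σ a i j`. -/
abbrev Mem (X : Type) : Type := X → ℕ → ℕ → ℕ

/-- Overwrite one memory cell. -/
def Mem.set {X : Type} [DecidableEq X] (σ : Mem X) (a : X) (i j v : ℕ) : Mem X :=
  fun b p q => if b = a ∧ p = i ∧ q = j then v else σ b p q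

/-- The cost of handling a number: its bit length (plus one). -/
def len (x : ℕ) : ℕ := Nat.size x + 1

/-- Value of an expression. -/
def Exp.val {X : Type} (σ : Mem X) : Exp X → ℕ
  | .lit c => c
  | .get a i j => σ a (i.val σ) (j.val σ)
  | .add e f => e.val σ + f.val σ
  | .sub e f => e.val σ - f.val σ
  | .mul e f => e.val σ * f.val σ
  | .lt e f => if e.val σ < f.val σ then 1 else 0
  | .eq e f => if e.val σ = f.val σ then 1 else 0

/-- Time to evaluate an expression (schoolbook multiplication). -/
def Exp.cost {X : Type} (σ : Mem X) : Exp X → ℕ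
  | .lit c => len c
  | .get a i j =>
      i.cost σ + j.cost σ + len (i.val σ) + len (j.val σ) + len (σ a (i.val σ) (j.val σ))
  | .add e f => e.cost σ + f.cost σ + len (e.val σ) + len (f.val σ)
  | .sub e f => e.cost σ + f.cost σ + len (e.val σ) + len (f.val σ)
  | .mul e f => e.cost σ + f.cost σ + len (e.val σ) * len (f.val σ)
  | .lt e f => e.cost σ + f.cost σ + len (e.val σ) + len (f.val σ)
  | .eq e f => e.cost σ + f.cost σ + len (e.val σ) + len (f.val σ)

/-- Run `body 0, …, body (N - 1)` in this order and add up the running times. -/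
noncomputable def iterate {S : Type} (body : ℕ → S → PMF (S × ℕ)) : ℕ → S → PMF (S × ℕ)
  | 0, σ => PMF.pure (σ, 0)
  | N + 1, σ => (iterate body N σ).bind fun r =>
      (body N r.1).bind fun s => PMF.pure (s.1, r.2 + s.2)

/-- `c.run σ` is the joint law of the final memory and the running time of `c` started in `σ`. -/
noncomputable def Cmd.run {X : Type} [DecidableEq X] : Cmd X → Mem X → PMF (Mem X × ℕ)
  | .skip, σ => PMF.pure (σ, 1)
  | .set a i j e, σ =>
      PMF.pure (σ.set a (i.val σ) (j.val σ) (e.val σ),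
        i.cost σ + j.cost σ + e.cost σ + len (i.val σ) + len (j.val σ) + len (e.val σ))
  | .flip a i j, σ =>
      (PMF.uniformOfFintype Bool).bind fun b =>
        PMF.pure (σ.set a (i.val σ) (j.val σ) (if b then 1 else 0),
          i.cost σ + j.cost σ + len (i.val σ) + len (j.val σ) + 1)
  | .seq c d, σ =>
      (c.run σ).bind fun r => (d.run r.1).bind fun s => PMF.pure (s.1, r.2 + s.2)
  | .ite e c d, σ =>
      (if e.val σ ≠ 0 then c.run σ else d.run σ).bind fun r =>
        PMF.pure (r.1, e.cost σ + 1 + r.2)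
  | .loop a e c, σ =>
      (iterate (fun t τ => (c.run (τ.set a 0 0 t)).bind fun r => PMF.pure (r.1, len t + r.2))
        (e.val σ) σ).bind fun r => PMF.pure (r.1, e.cost σ + 1 + r.2)

/-- Expected running time of `c` started in `σ`. -/
noncomputable def Cmd.expectedTime {X : Type} [DecidableEq X] (c : Cmd X) (σ : Mem X) : ℝ≥0∞ :=
  ∑' r, c.run σ r * (r.2 : ℝ≥0∞)

/-- Rename the arrays of an expression. -/
def Exp.map {X Y : Type} (f : X → Y) : Exp X → Exp Y
  | .lit c => .lit c
  | .get a i j => .get (f a) (i.map f) (j.map f)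
  | .add d e => .add (d.map f) (e.map f)
  | .sub d e => .sub (d.map f) (e.map f)
  | .mul d e => .mul (d.map f) (e.map f)
  | .lt d e => .lt (d.map f) (e.map f)
  | .eq d e => .eq (d.map f) (e.map f)

/-- Rename the arrays of a program (used to call a subroutine that has its own arrays). -/
def Cmd.map {X Y : Type} (f : X → Y) : Cmd X → Cmd Y
  | .skip => .skip
  | .set a i j e => .set (f a) (i.map f) (j.map f) (e.map f)
  | .flip a i j => .flip (f a) (i.map f) (j.map f)
  | .seq c d => .seq (c.map f) (d.map f)
  | .ite e c d => .ite (e.map f) (c.map f) (d.map f)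
  | .loop a e c => .loop (f a) (e.map f) (c.map f)

/-! ### Programs whose input is a graph and whose output is a distance estimate -/

open Classical in
/-- The initial memory for the graph `G` on the vertices `0, …, n - 1`: the scalar `N` holds `n`,
the array `A` holds the adjacency matrix of `G`, everything else is zero. -/
noncomputable def inputMem {X : Type} (N A : X) {n : ℕ} (G : SimpleGraph (Fin n)) : Mem X :=
  fun a i j =>
    if a = N then (if i = 0 ∧ j = 0 then n else 0)
    else if a = A then (if ∃ u v : Fin n, G.Adj u v ∧ (u : ℕ) = i ∧ (v : ℕ) = j then 1 else 0)
    else 0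

/-- The distance estimate stored in an array; entries `≥ 4 * n` stand for `∞`. -/
def estimate {n : ℕ} (M : ℕ → ℕ → ℕ) (u v : Fin n) : ℕ∞ :=
  if M u v < 4 * n then (M u v : ℕ∞) else ⊤

/-- `est` is an `(α, β)`-approximation of the distances of `G` for all pairs at distance at
least `k`, and it never underestimates a distance. -/
def IsApprox (α β k : ℕ) {n : ℕ} (G : SimpleGraph (Fin n)) (est : Fin n → Fin n → ℕ∞) : Prop :=
  (∀ u v, G.edist u v ≤ est u v) ∧
  ∀ u v, (k : ℕ∞) ≤ G.edist u v → est u v ≤ α * G.edist u v + β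

/-- On every input graph and for every outcome of its coin flips, the program `P` (which reads
its input from `N`, `A`) leaves in the array `O` an `(α, β)`-approximation for all pairs at
distance at least `k`. -/
def Computes {X : Type} [DecidableEq X] (P : Cmd X) (N A O : X) (α β k : ℕ) : Prop :=
  ∀ (n : ℕ) (G : SimpleGraph (Fin n)), ∀ r ∈ (P.run (inputMem N A G)).support,
    IsApprox α β k G (estimate (r.1 O))

/-- The expected running time of `P` on graphs with `n ≥ 1` vertices and `m` edges is
`Õ(T n m)`, i.e. at most `C * T n m * log (n + 2) ^ c` for some constants `C`, `c`. -/
def RunsInExpected {X : Type} [DecidableEq X] (P : Cmd X) (N A : X) (T : ℕ → ℕ → ℝ) : Prop :=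
  ∃ (C : ℝ) (c : ℕ), ∀ (n : ℕ) (G : SimpleGraph (Fin n)), 1 ≤ n →
    P.expectedTime (inputMem N A G) ≤
      ENNReal.ofReal (C * T n G.edgeSet.ncard * Real.log (n + 2) ^ c)

/-- `P` is a realization of `BK2APASP`: a randomized program that returns a `(2,0)`-approximation
of all distances in expected time `Õ(m √n + n²)`.  Its input is in the arrays `0` (number of
vertices) and `1` (adjacency matrix), its output is in the array `2`. -/
def IsBK2APASP (P : Cmd ℕ) : Prop :=
  Computes P 0 1 2 2 0 0 ∧ RunsInExpected P 0 1 (fun n m => m * Real.sqrt n + (n : ℝ) ^ 2)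

/-! ### Shorthands for writing programs -/

section Shorthands

variable {X : Type}

instance (c : ℕ) : OfNat (Exp X) c := ⟨.lit c⟩
instance : Add (Exp X) := ⟨.add⟩
instance : Sub (Exp X) := ⟨.sub⟩
instance : Mul (Exp X) := ⟨.mul⟩

/-- The scalar `a`. -/
def rd0 (a : X) : Exp X := .get a 0 0
/-- The entry `i` of the one-dimensional array `a`. -/
def rd1 (a : X) (i : Exp X) : Exp X := .get a i 0
/-- The entry `(i, j)` of the array `a`. -/
def rd2 (a : X) (i j : Exp X) : Exp X := .get a i j
/-- `a := e` -/
def wr0 (a : X) (e : Exp X) : Cmd X := .set a 0 0 e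
/-- `a[i] := e` -/
def wr1 (a : X) (i e : Exp X) : Cmd X := .set a i 0 e
/-- `a[i, j] := e` -/
def wr2 (a : X) (i j e : Exp X) : Cmd X := .set a i j e

/-- Boolean negation. -/
def no (e : Exp X) : Exp X := .eq e 0

/-- `if e then c` -/
def when (e : Exp X) (c : Cmd X) : Cmd X := .ite e c .skip

/-- Sequential composition of a list of statements. -/
def block : List (Cmd X) → Cmd X
  | [] => .skip
  | c :: cs => .seq c (block cs)

/-- `for a = 1, …, N do c` with a literal bound `N` (the pass with `a = 0` does nothing). -/
def loop1 (a : X) (N : ℕ) (c : Cmd X) : Cmd X := .loop a (.lit (N + 1)) (when (rd0 a) c)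

end Shorthands

prefix:max "§" => rd0

/-! ### The algorithm `LongMultiplicativeAPASP` -/

/-- The arrays of the program.  Input: `n`, `adj`.  Output: `dhat`.  The arrays `bk 0, bk 1, …`
belong to the subroutine `BK2APASP`. -/
inductive Loc : Type
  | n | adj | dhat | inf
  | x | y | i | j | j1 | j2 | p | q | t | w | b | e | v | best | left
  | deg | degPow | nPow | hi
  | need | c | inD | rep | lst | siz
  | cnt | nbr | d | bcnt | bucket
  | bk (a : ℕ)
  deriving DecidableEq

namespace Loc

/-- Initialization: `dhat(u,v) = 1` on edges and `∞` elsewhere, where `∞` is the number `4 n`. -/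
def initEstimate : Cmd Loc := block [
  wr0 inf (4 * §n),
  .loop x §n (.loop y §n
    (.ite (rd2 adj §x §y) (wr2 dhat §x §y 1) (wr2 dhat §x §y §inf)))]

/-- `deg[x]` is the degree of `x`, `nPow[i] = n ^ i`, `degPow[x] = deg(x) ^ l`, and `hi[i, x]` is
the truth value of `deg(x) ≥ s_i`, where `s_0 = ∞`, `s_i = n ^ (1 - i / l)` for `1 ≤ i ≤ l - 1`
and `s_l = 0`.  For `1 ≤ i ≤ l - 1` the test `deg(x) ≥ s_i` is carried out exactly, in the form
`deg(x) ^ l ≥ n ^ (l - i)`. -/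
def thresholds (l : ℕ) : Cmd Loc := block [
  wr1 nPow 0 1,
  loop1 i l (wr1 nPow §i (rd1 nPow (§i - 1) * §n)),
  .loop x §n (block [
    .loop y §n (wr1 deg §x (rd1 deg §x + rd2 adj §x §y)),
    wr1 degPow §x 1,
    loop1 i l (wr1 degPow §x (rd1 degPow §x * rd1 deg §x)),
    wr2 hi 0 §x 0,
    loop1 i (l - 1) (wr2 hi §i §x (no (.lt (rd1 degPow §x) (rd1 nPow (.lit l - §i))))),
    wr2 hi (.lit l) §x 1])]

/-- Is `y` in the closed neighbourhood `N(x) ∪ {x}`? -/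
def closedAdj (x y : Exp Loc) : Exp Loc := rd2 adj x y + .eq x y

/-- The greedy algorithm `HittingSet` at level `i` for the family of the closed neighbourhoods of
the vertices `x` of degree at least `s_i`.  `need[x]` says whether the set of `x` is still unhit,
`left` is the number of unhit sets, `c[y]` the number of unhit sets containing `y`.  Each round
takes a `y` with `c[y]` maximal; the vertices `x` whose sets it hits get `rep[i, x] := y`. -/
def hittingSet : Cmd Loc := block [
  wr0 left 0,
  .loop x §n (block [
    wr1 c §x 0,
    wr1 need §x (rd2 hi §i §x),
    wr0 left (§left + rd1 need §x)]),
  .loop x §n (when (rd1 need §x)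
    (.loop y §n (when (closedAdj §x §y) (wr1 c §y (rd1 c §y + 1))))),
  .loop t §n (when §left (block [
    wr0 best 0,
    .loop y §n (when (.lt (rd1 c §best) (rd1 c §y)) (wr0 best §y)),
    wr2 inD §i §best 1,
    .loop x §n (when (rd1 need §x * closedAdj §x §best) (block [
      wr1 need §x 0,
      wr0 left (§left - 1),
      wr2 rep §i §x §best,
      .loop y §n (when (closedAdj §x §y) (wr1 c §y (rd1 c §y - 1)))]))]))]

/-- `Decompose`: for `1 ≤ i ≤ l - 1` the set `D_i = {x | inD[i, x] = 1}` is the union of `D_{i-1}`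
and of the greedy hitting set at level `i` (with `D_0 = ∅`), and `D_l` is the set of all vertices.
`lst[i, 0], …, lst[i, siz[i] - 1]` enumerates `D_i`.  The edge set `E_i` consists of the edges
`xy` for which not both `hi[i - 1, x]` and `hi[i - 1, y]`; the edge set `E*` consists of the edges
joining `x` and `rep[i, x]`, for `1 ≤ i ≤ l - 1` and `deg(x) ≥ s_i`. -/
def decompose (l : ℕ) : Cmd Loc := block [
  thresholds l,
  loop1 i (l - 1) (block [
    hittingSet,
    .loop x §n (when (rd2 inD (§i - 1) §x) (wr2 inD §i §x 1))]),
  .loop x §n (wr2 inD (.lit l) §x 1),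
  loop1 i l (.loop x §n (when (rd2 inD §i §x) (block [
    wr2 lst §i (rd1 siz §i) §x,
    wr1 siz §i (rd1 siz §i + 1)])))]

/-- Is `xy` an edge of `E_i`, i.e. an edge with `min(deg(x), deg(y)) < s_{i-1}`?
Here `im` is the expression for `i - 1`. -/
def inE (im x y : Exp Loc) : Exp Loc := rd2 adj x y * no (rd2 hi im x * rd2 hi im y)

/-- Append `y` to the list of the neighbours of `x`. -/
def push (x y : Exp Loc) : Cmd Loc := block [
  wr2 nbr x (rd1 cnt x) y,
  wr1 cnt x (rd1 cnt x + 1)]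

/-- Adjacency lists for level `j`: the edges `E_j`, `E*` and all `D_{j1} × D_{j2}` with
`j + j1 + j2 ≤ 2 l + 1`, in both directions. -/
def buildGraph (l : ℕ) : Cmd Loc := block [
  .loop x §n (wr1 cnt §x 0),
  .loop x §n (.loop y §n (when (inE (§j - 1) §x §y) (push §x §y))),
  loop1 i (l - 1) (.loop x §n (when (rd2 hi §i §x * rd2 adj §x (rd2 rep §i §x)) (block [
    push §x (rd2 rep §i §x),
    push (rd2 rep §i §x) §x]))),
  loop1 j1 l (loop1 j2 l (when (.lt (§j + §j1 + §j2) (.lit (2 * l + 2)))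
    (.loop p (rd1 siz §j1) (.loop q (rd1 siz §j2)
      (push (rd2 lst §j1 §p) (rd2 lst §j2 §q))))))]

/-- Insert `x` into the bucket `k` of the priority queue. -/
def enqueue (k x : Exp Loc) : Cmd Loc := block [
  wr2 bucket k (rd1 bcnt k) x,
  wr1 bcnt k (rd1 bcnt k + 1)]

/-- `Dijkstra` from `w` on the graph `G_{j,w}`, every edge `xy` of which has the weight
`dhat[x, y]`: the current adjacency lists together with the star `{w} × V`.  The priority queue is
an array of buckets indexed by the tentative distance `d`.  The edges of the star are relaxed
first; at the end the estimates between `w` and all vertices are updated. -/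
def dijkstra : Cmd Loc := block [
  .loop b §inf (wr1 bcnt §b 0),
  .loop x §n (wr1 d §x (rd2 dhat §w §x)),
  wr1 d §w 0,
  .loop x §n (when (.lt (rd1 d §x) §inf) (enqueue (rd1 d §x) §x)),
  .loop b §inf (.loop q (rd1 bcnt §b) (block [
    wr0 x (rd2 bucket §b §q),
    when (.eq (rd1 d §x) §b) (.loop e (rd1 cnt §x) (block [
      wr0 y (rd2 nbr §x §e),
      wr0 v (§b + rd2 dhat §x §y),
      when (.lt §v (rd1 d §y)) (block [
        wr1 d §y §v,
        enqueue §v §y])]))])),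
  .loop x §n (block [
    wr2 dhat §w §x (rd1 d §x),
    wr2 dhat §x §w (rd1 d §x)])]

/-- Call `BK2APASP` on the graph `(V, E_{l0 + 1})` and take the minimum with `dhat`. -/
def callBK (BK : Cmd ℕ) (l0 : ℕ) : Cmd Loc := block [
  wr0 (bk 0) §n,
  .loop x §n (.loop y §n (wr2 (bk 1) §x §y (inE (.lit l0) §x §y))),
  BK.map bk,
  .loop x §n (.loop y §n
    (when (.lt (rd2 (bk 2) §x §y) (rd2 dhat §x §y)) (wr2 dhat §x §y (rd2 (bk 2) §x §y))))]

end Loc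

open Loc in
/-- The algorithm `LongMultiplicativeAPASP(G, k)` with the subroutine `BK` in the role of
`BK2APASP`; here `l = 2 (k - 1)` and `l0 = k - 2`. -/
def longMultiplicativeAPASP (BK : Cmd ℕ) (k : ℕ) : Cmd Loc := block [
  initEstimate,
  decompose (2 * (k - 1)),
  loop1 j (2 * (k - 1)) (block [
    buildGraph (2 * (k - 1)),
    .loop p (rd1 siz §j) (block [
      wr0 w (rd2 lst §j §p),
      dijkstra])]),
  callBK BK (k - 2)]

end Apsp

set_option linter.constructorNameAsVariable false
set_option linter.unusedSectionVars false
set_option linter.unusedSimpArgs false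
set_option linter.unusedVariables false

/-! Write l = 2(k-1) and R = n^(1/l), so that s_i = R^(l-i) for 1 ≤ i < l. The estimate never drops
below the distance, because every number written is the length of a walk or a larger value. What
matters is the stretch, the running time, and the existence of the subroutine.

Stretch. E_1 = E, and the sets E_j decrease. A shortest path that lies in E_{i₀} but not in E_{i₀+1}
has an edge both of whose ends have degree at least s_{i₀}; these ends have neighbours in D_{i₀}, or
belong to it. The invariant `Stage` says how good the estimates from D_j are after phase j: exact,
up to the steps to and from neighbouring chosen vertices, for paths inside E_j, and with the
additional error 4 + 2 max(0, j + ⌈i₀/2⌉ - (l+1)) for paths of exact level i₀ < j. The induction is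
`Stage.step`: behind the last edge outside E_j the path is present in the phase graph, and a chosen
vertex next to that edge is reached either by one edge of a product D_{i₀} × D_c (error 4) or
directly by an edge of the star (two more than in an earlier phase). In the last phase, for i₀ ≤ k-2
and k even, the error is at most k, so a pair at distance m ≥ k gets at most m + k ≤ 2m. The
remaining pairs have a shortest path inside E_{k-1}, and they are handled by the call of the
subroutine (`Stage.final`).

Time. The greedy algorithm gives |D_j| ≤ l R^j H_n (`hittingSet_spec`). The phase graph has O(n
R^(l-j+1)) edges from E_j and, by the restriction on the indices, Õ(R^(2l+1-j)) from the products.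
With |D_j| sources, each phase costs Õ(R^(2l+1)), which is Õ(n^(2+1/l)) (`Decomposed.phase_budget`).
The subroutine runs on O(n R^(l-k+2)) edges, and √n = R^(k-1), so it stays within the same bound.

Subroutine. It is a deterministic program with scales q = 1, 2, 4, … up to about √n. At scale q
there are at most 2n H_n / q sources. A ball is grown around every vertex until it is heavy, and a
hitting set of the heavy balls provides the sources of scale 2q. The balls are small, so only O(nq)
edges have an end at distance at least 2 from the new sources, and searching from the old sources
over these edges is cheap. Let m = d(u,v) and suppose that u has an old source within m/2 while u
and v have no new source within m/2. Then the first half of a shortest path, and one further edge,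
are covered by the exploration of the ball around u, and the rest runs in the sparse graph. Going
over the old source of u therefore costs at most m + 2(m/2) = 2m (`two_approx_step`). In the last
round there are no new sources and the search uses the whole graph.

Machine. Both programs are analysed in a weakest precondition calculus that counts loop iterations
and bounds the numbers that occur; `wp_sound` turns this into running time, losing only the square
of a bit length. Dijkstra's algorithm is specified without paths (`dijkstra_spec`): its output
satisfies the inequalities of all listed edges, and it dominates every potential. -/

namespace Apsp

/-! ### A Hoare logic for deterministic programs that counts loop iterations -/

section Logic

variable {X : Type} [DecidableEq X]

/-- All memory cells are at most `M`. -/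
def Bdd (M : ℕ) (σ : Mem X) : Prop := ∀ a i j, σ a i j ≤ M

/-- Weakest precondition: started in `σ`, after `s` loop iterations so far, the deterministic
program writes only numbers `≤ M` and ends in a memory and at an iteration count satisfying `Q`. -/
def Cmd.wp (M : ℕ) : Cmd X → (Mem X → ℕ → Prop) → Mem X → ℕ → Prop
  | .skip, Q, σ, s => Q σ s
  -- The bound on the current cells may be assumed at every write, so a value that is merely copied
  -- needs no invariant of its own.
  | .set a i j e, Q, σ, s =>
      Bdd M σ → e.val σ ≤ M ∧ Q (σ.set a (i.val σ) (j.val σ) (e.val σ)) s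
  | .flip _ _ _, _, _, _ => False
  | .seq c d, Q, σ, s => c.wp M (fun τ r => d.wp M Q τ r) σ s
  | .ite e c d, Q, σ, s => (e.val σ ≠ 0 → c.wp M Q σ s) ∧ (e.val σ = 0 → d.wp M Q σ s)
  | .loop a e c, Q, σ, s => ∃ I : ℕ → Mem X → ℕ → Prop,
      (Bdd M σ → e.val σ ≤ M) ∧ I 0 σ s ∧
      (∀ t < e.val σ, ∀ τ r, I t τ r → c.wp M (I (t + 1)) (τ.set a 0 0 t) (r + 1)) ∧
      ∀ τ r, I (e.val σ) τ r → Q τ r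

/-- The arrays a program may write to. -/
def Cmd.mods : Cmd X → List X
  | .skip => []
  | .set a _ _ _ => [a]
  | .flip a _ _ => [a]
  | .seq c d => c.mods ++ d.mods
  | .ite _ c d => c.mods ++ d.mods
  | .loop a _ c => a :: c.mods

theorem wp_mono {M : ℕ} (c : Cmd X) : ∀ {Q Q' : Mem X → ℕ → Prop} {σ : Mem X} {s : ℕ},
    c.wp M Q σ s → (∀ τ r, Q τ r → Q' τ r) → c.wp M Q' σ s := by
  induction c with
  | skip => intro Q Q' σ s h hQ; exact hQ _ _ h
  | set a i j e => intro Q Q' σ s h hQ hB; exact ⟨(h hB).1, hQ _ _ (h hB).2⟩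
  | flip a i j => intro Q Q' σ s h hQ; exact h
  | seq c d ihc ihd => intro Q Q' σ s h hQ; exact ihc h fun τ r h' => ihd h' hQ
  | ite e c d ihc ihd =>
      intro Q Q' σ s h hQ; exact ⟨fun he => ihc (h.1 he) hQ, fun he => ihd (h.2 he) hQ⟩
  | loop a e c ih =>
      rintro Q Q' σ s ⟨I, h1, h2, h3, h4⟩ hQ
      exact ⟨I, h1, h2, h3, fun τ r h => hQ _ _ (h4 τ r h)⟩

@[simp] theorem Mem.set_of_ne (σ : Mem X) {a b : X} (h : b ≠ a) (i j v : ℕ) :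
    σ.set a i j v b = σ b := by
  funext p q; simp [Mem.set, h]

@[simp] theorem Mem.set_same (σ : Mem X) (a : X) (i j v p q : ℕ) :
    σ.set a i j v a p q = if p = i ∧ q = j then v else σ a p q := by
  simp [Mem.set]

/-- Invariants then need to mention only what a loop changes. Everything else is recovered from the
syntactic list of written arrays. -/
theorem wp_frame {M : ℕ} (c : Cmd X) : ∀ {Q : Mem X → ℕ → Prop} {σ : Mem X} {s : ℕ},
    c.wp M Q σ s → c.wp M (fun τ r => (∀ a, a ∉ c.mods → τ a = σ a) ∧ Q τ r) σ s := by
  induction c with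
  | skip => intro Q σ s h; exact ⟨fun _ _ => rfl, h⟩
  | set a i j e =>
      intro Q σ s h hB
      refine ⟨(h hB).1, fun b hb => ?_, (h hB).2⟩
      exact Mem.set_of_ne _ (by simpa [Cmd.mods] using hb) _ _ _
  | flip a i j => intro Q σ s h; exact h
  | seq c d ihc ihd =>
      intro Q σ s h
      refine wp_mono c (ihc h) ?_
      rintro τ r ⟨h1, h2⟩
      refine wp_mono d (ihd h2) ?_
      rintro ρ r' ⟨h3, h4⟩
      refine ⟨fun a ha => ?_, h4⟩
      simp only [Cmd.mods, List.mem_append, not_or] at ha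
      rw [h3 a ha.2, h1 a ha.1]
  | ite e c d ihc ihd =>
      intro Q σ s h
      refine ⟨fun he => wp_mono c (ihc (h.1 he)) ?_, fun he => wp_mono d (ihd (h.2 he)) ?_⟩
      all_goals
        rintro τ r ⟨h1, h2⟩
        refine ⟨fun a ha => ?_, h2⟩
        simp only [Cmd.mods, List.mem_append, not_or] at ha
      · exact h1 a ha.1
      · exact h1 a ha.2
  | loop a e c ih =>
      rintro Q σ s ⟨I, h1, h2, h3, h4⟩
      refine ⟨fun t τ r => (∀ b, b ∉ (Cmd.loop a e c).mods → τ b = σ b) ∧ I t τ r, h1,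
        ⟨fun _ _ => rfl, h2⟩, ?_, fun τ r h => ⟨h.1, h4 τ r h.2⟩⟩
      rintro t ht τ r ⟨h5, h6⟩
      refine wp_mono c (ih (h3 t ht τ r h6)) ?_
      rintro ρ r' ⟨h7, h8⟩
      refine ⟨fun b hb => ?_, h8⟩
      have hb' := hb
      simp only [Cmd.mods, List.mem_cons, not_or] at hb'
      rw [h7 b hb'.2, Mem.set_of_ne _ hb'.1, h5 b hb]

/-- Loop rule with an invariant; unmodified arrays are tracked automatically. -/
theorem wp_loop {M : ℕ} {a : X} {e : Exp X} {c : Cmd X} {Q : Mem X → ℕ → Prop} {σ : Mem X}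
    {s : ℕ} (N : ℕ) (I : ℕ → Mem X → ℕ → Prop) (hN : e.val σ = N) (hM : Bdd M σ → N ≤ M)
    (h0 : I 0 σ s)
    (hstep : ∀ t < N, ∀ τ r, (∀ b, b ∉ a :: c.mods → τ b = σ b) → I t τ r →
      c.wp M (I (t + 1)) (τ.set a 0 0 t) (r + 1))
    (hpost : ∀ τ r, (∀ b, b ∉ a :: c.mods → τ b = σ b) → I N τ r → Q τ r) :
    (Cmd.loop a e c).wp M Q σ s := by
  subst hN
  refine ⟨fun t τ r => (∀ b, b ∉ a :: c.mods → τ b = σ b) ∧ I t τ r, hM, ⟨fun _ _ => rfl, h0⟩,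
    ?_, fun τ r h => hpost τ r h.1 h.2⟩
  rintro t ht τ r ⟨h5, h6⟩
  refine wp_mono c (wp_frame c (hstep t ht τ r h5 h6)) ?_
  rintro ρ r' ⟨h7, h8⟩
  refine ⟨fun b hb => ?_, h8⟩
  have hb' := hb
  simp only [List.mem_cons, not_or] at hb'
  rw [h7 b hb'.2, Mem.set_of_ne _ hb'.1, h5 b hb]

/-- Use a specification in continuation style, with the frame. -/
theorem wp_use {M : ℕ} {c : Cmd X} {Q Q' : Mem X → ℕ → Prop} {σ : Mem X} {s : ℕ}
    (h : c.wp M Q' σ s)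
    (hQ : ∀ τ r, (∀ b, b ∉ c.mods → τ b = σ b) → Q' τ r → Q τ r) : c.wp M Q σ s :=
  wp_mono c (wp_frame c h) fun τ r h' => hQ τ r h'.1 h'.2

/-! ### Soundness of the logic -/

theorem one_le_len (x : ℕ) : 1 ≤ len x := by simp [len]

theorem len_mono {x y : ℕ} (h : x ≤ y) : len x ≤ len y := by
  simpa [len] using Nat.size_le_size h

theorem len_add_le (x y : ℕ) : len (x + y) ≤ len x + len y := by
  unfold len
  have : Nat.size (x + y) ≤ max x.size y.size + 1 := by
    rw [Nat.size_le]
    have hx := Nat.lt_size_self x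
    have hy := Nat.lt_size_self y
    have h1 : 2 ^ x.size ≤ 2 ^ max x.size y.size := Nat.pow_le_pow_right (by norm_num) (by simp)
    have h2 : 2 ^ y.size ≤ 2 ^ max x.size y.size := Nat.pow_le_pow_right (by norm_num) (by simp)
    rw [pow_succ]; omega
  have := Nat.zero_le (min x.size y.size)
  omega

theorem len_mul_le (x y : ℕ) : len (x * y) ≤ len x + len y := by
  unfold len
  have : Nat.size (x * y) ≤ x.size + y.size := by
    rw [Nat.size_le, pow_add]
    exact Nat.mul_lt_mul'' (Nat.lt_size_self x) (Nat.lt_size_self y)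
  omega

/-- A bound for the bit length of the value of an expression, in units of `len M`. -/
def Exp.vw : Exp X → ℕ
  | .lit c => len c
  | .get _ i j => i.vw + j.vw + 1
  | .add e f => e.vw + f.vw
  | .sub e f => e.vw + f.vw
  | .mul e f => e.vw + f.vw
  | .lt e f => e.vw + f.vw + 2
  | .eq e f => e.vw + f.vw + 2

/-- A bound for the cost of an expression, in units of `(len M) ^ 2`. -/
def Exp.weight : Exp X → ℕ
  | .lit c => len c
  | .get _ i j => i.weight + j.weight + i.vw + j.vw + 1
  | .add e f => e.weight + f.weight + e.vw + f.vw
  | .sub e f => e.weight + f.weight + e.vw + f.vw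
  | .mul e f => e.weight + f.weight + e.vw * f.vw
  | .lt e f => e.weight + f.weight + e.vw + f.vw
  | .eq e f => e.weight + f.weight + e.vw + f.vw

/-- A bound for the cost of a program per loop iteration, in units of `(len M) ^ 2`. -/
def Cmd.weight : Cmd X → ℕ
  | .skip => 1
  | .set _ i j e => i.weight + j.weight + e.weight + i.vw + j.vw + e.vw
  | .flip _ i j => i.weight + j.weight + i.vw + j.vw + 1
  | .seq c d => c.weight + d.weight
  | .ite e c d => e.weight + 1 + c.weight + d.weight
  | .loop _ e c => e.weight + 2 + c.weight

theorem Exp.len_val_le {M : ℕ} {σ : Mem X} (hσ : Bdd M σ) (e : Exp X) :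
    len (e.val σ) ≤ e.vw * len M := by
  have h1 := one_le_len M
  induction e with
  | lit c => simp only [Exp.val, Exp.vw]; nlinarith
  | get a i j _ _ =>
      simp only [Exp.val, Exp.vw]
      have := len_mono (hσ a (i.val σ) (j.val σ))
      nlinarith
  | add e f he hf =>
      simp only [Exp.val, Exp.vw]
      have := len_add_le (e.val σ) (f.val σ); nlinarith
  | sub e f he hf =>
      simp only [Exp.val, Exp.vw]
      have := len_mono (Nat.sub_le (e.val σ) (f.val σ)); nlinarith
  | mul e f he hf =>
      simp only [Exp.val, Exp.vw]
      have := len_mul_le (e.val σ) (f.val σ); nlinarith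
  | lt e f he hf =>
      simp only [Exp.val, Exp.vw]
      have : len (if e.val σ < f.val σ then 1 else 0) ≤ 2 := by split_ifs <;> simp [len]
      nlinarith
  | eq e f he hf =>
      simp only [Exp.val, Exp.vw]
      have : len (if e.val σ = f.val σ then 1 else 0) ≤ 2 := by split_ifs <;> simp [len]
      nlinarith

theorem Exp.cost_le {M : ℕ} {σ : Mem X} (hσ : Bdd M σ) (e : Exp X) :
    e.cost σ ≤ e.weight * len M ^ 2 := by
  have h1 := one_le_len M
  have h2 : len M ≤ len M ^ 2 := by nlinarith
  have key : ∀ {a b : ℕ}, a ≤ b * len M → a ≤ b * len M ^ 2 := fun h =>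
    h.trans (Nat.mul_le_mul_left _ h2)
  have h3 : 1 ≤ len M ^ 2 := h1.trans h2
  induction e with
  | lit c => simp only [Exp.cost, Exp.weight]; nlinarith
  | get a i j hi hj =>
      simp only [Exp.cost, Exp.weight]
      have := len_mono (hσ a (i.val σ) (j.val σ))
      have := key (i.len_val_le hσ)
      have := key (j.len_val_le hσ)
      nlinarith
  | add e f he hf =>
      simp only [Exp.cost, Exp.weight]
      have := key (e.len_val_le hσ)
      have := key (f.len_val_le hσ)
      nlinarith
  | sub e f he hf =>
      simp only [Exp.cost, Exp.weight]
      have := key (e.len_val_le hσ)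
      have := key (f.len_val_le hσ)
      nlinarith
  | mul e f he hf =>
      simp only [Exp.cost, Exp.weight]
      have := Nat.mul_le_mul (e.len_val_le hσ) (f.len_val_le hσ)
      nlinarith
  | lt e f he hf =>
      simp only [Exp.cost, Exp.weight]
      have := key (e.len_val_le hσ)
      have := key (f.len_val_le hσ)
      nlinarith
  | eq e f he hf =>
      simp only [Exp.cost, Exp.weight]
      have := key (e.len_val_le hσ)
      have := key (f.len_val_le hσ)
      nlinarith

theorem Bdd.set {M : ℕ} {σ : Mem X} (h : Bdd M σ) (a : X) (i j : ℕ) {v : ℕ} (hv : v ≤ M) :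
    Bdd M (σ.set a i j v) := by
  intro b p q
  unfold Mem.set
  split_ifs
  exacts [hv, h b p q]

/-- With all cells at most M, each elementary step costs a constant, depending on the program text,
times `len M ^ 2`; the square comes from multiplication. The number of steps is proportional to the
number k of loop passes plus one, where the extra one pays for the code outside of all loops. As k
is additive under sequencing and nesting, the bound composes by induction on the program. -/
theorem wp_sound {M : ℕ} (c : Cmd X) : ∀ {Q : Mem X → ℕ → Prop} {σ : Mem X} {s : ℕ},
    Bdd M σ → c.wp M Q σ s → ∃ τ k t, c.run σ = PMF.pure (τ, t) ∧ Bdd M τ ∧ Q τ (s + k) ∧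
      t ≤ c.weight * len M ^ 2 * (k + 1) := by
  have h1 := one_le_len M
  have h2 : len M ≤ len M ^ 2 := by nlinarith
  have h3 : 1 ≤ len M ^ 2 := h1.trans h2
  have key : ∀ {a b : ℕ}, a ≤ b * len M → a ≤ b * len M ^ 2 := fun h =>
    h.trans (Nat.mul_le_mul_left _ h2)
  induction c with
  | skip => intro Q σ s hσ h; exact ⟨σ, 0, 1, rfl, hσ, h, by simpa [Cmd.weight] using h3⟩
  | set a i j e =>
      intro Q σ s hσ h
      refine ⟨_, 0, _, rfl, hσ.set _ _ _ (h hσ).1, (h hσ).2, ?_⟩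
      have := i.cost_le hσ
      have := j.cost_le hσ
      have := e.cost_le hσ
      have := key (i.len_val_le hσ)
      have := key (j.len_val_le hσ)
      have := key (e.len_val_le hσ)
      simp only [Cmd.weight]
      nlinarith
  | flip a i j => intro Q σ s hσ h; exact h.elim
  | seq c d ihc ihd =>
      intro Q σ s hσ h
      obtain ⟨τ, k, t, e1, hτ, h', ht⟩ := ihc hσ h
      obtain ⟨ρ, k', t', e2, hρ, h'', ht'⟩ := ihd hτ h'
      refine ⟨ρ, k + k', t + t', ?_, hρ, by rwa [← add_assoc], ?_⟩
      · simp [Cmd.run, e1, e2, PMF.pure_bind]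
      · simp only [Cmd.weight]
        have : c.weight * len M ^ 2 * (k + 1) ≤ c.weight * len M ^ 2 * (k + k' + 1) :=
          Nat.mul_le_mul_left _ (by omega)
        have : d.weight * len M ^ 2 * (k' + 1) ≤ d.weight * len M ^ 2 * (k + k' + 1) :=
          Nat.mul_le_mul_left _ (by omega)
        nlinarith
  | ite e c d ihc ihd =>
      intro Q σ s hσ h
      have hc := e.cost_le hσ
      by_cases he : e.val σ = 0
      · obtain ⟨τ, k, t, e1, hτ, h', ht⟩ := ihd hσ (h.2 he)
        refine ⟨τ, k, e.cost σ + 1 + t, ?_, hτ, h', ?_⟩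
        · simp [Cmd.run, he, e1, PMF.pure_bind]
        · simp only [Cmd.weight]
          have : 0 ≤ c.weight * len M ^ 2 * (k + 1) := Nat.zero_le _
          have : 0 ≤ (e.weight + 1) * len M ^ 2 * k := Nat.zero_le _
          nlinarith
      · obtain ⟨τ, k, t, e1, hτ, h', ht⟩ := ihc hσ (h.1 he)
        refine ⟨τ, k, e.cost σ + 1 + t, ?_, hτ, h', ?_⟩
        · simp [Cmd.run, he, e1, PMF.pure_bind]
        · simp only [Cmd.weight]
          have : 0 ≤ d.weight * len M ^ 2 * (k + 1) := Nat.zero_le _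
          have : 0 ≤ (e.weight + 1) * len M ^ 2 * k := Nat.zero_le _
          nlinarith
  | loop a e c ih =>
      rintro Q σ s hσ ⟨I, hM, h0, hst, hpost⟩
      have hc := e.cost_le hσ
      -- No additive term is needed here: a pass raises k by 1 + k', and this pays for the k' + 1
      -- units of its body. The remaining unit of the theorem is used for evaluating the loop bound.
      have main : ∀ N ≤ e.val σ, ∃ τ k t,
          iterate (fun t τ => (c.run (τ.set a 0 0 t)).bind fun r =>
            PMF.pure (r.1, len t + r.2)) N σ = PMF.pure (τ, t) ∧ Bdd M τ ∧ I N τ (s + k) ∧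
            N ≤ k ∧ t ≤ (c.weight + 1) * len M ^ 2 * k := by
        intro N
        induction N with
        | zero => intro _; exact ⟨σ, 0, 0, rfl, hσ, h0, le_rfl, by simp⟩
        | succ N ihN =>
            intro hN
            obtain ⟨τ, k, t, e1, hτ, hI, hk, ht⟩ := ihN (by omega)
            have hNM : N ≤ M := by have := hM hσ; omega
            obtain ⟨ρ, k', t', e2, hρ, hI', ht'⟩ :=
              ih (hτ.set a 0 0 hNM) (hst N (by omega) τ _ hI)
            refine ⟨ρ, k + 1 + k', t + (len N + t'), ?_, hρ, ?_, by omega, ?_⟩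
            · simp [iterate, e1, e2, PMF.pure_bind]
            · rw [show s + (k + 1 + k') = s + k + 1 + k' by ring]; exact hI'
            · have := (len_mono hNM).trans h2
              have : 0 ≤ len M ^ 2 * k' := Nat.zero_le _
              nlinarith
      obtain ⟨τ, k, t, e1, hτ, hI, hk, ht⟩ := main _ le_rfl
      refine ⟨τ, k, e.cost σ + 1 + t, ?_, hτ, hpost _ _ hI, ?_⟩
      · simp only [Cmd.run, e1, PMF.pure_bind]
      · simp only [Cmd.weight]
        have : 0 ≤ (e.weight + 1) * len M ^ 2 * k := Nat.zero_le _
        nlinarith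

/-! ### Renaming of arrays -/

theorem Exp.val_map {Y : Type} (f : X → Y) (σ : Mem Y) (e : Exp X) :
    (e.map f).val σ = e.val (fun a => σ (f a)) := by
  induction e <;> simp_all [Exp.map, Exp.val]

theorem Mem.set_comp {Y : Type} [DecidableEq Y] {f : X → Y} (hf : Function.Injective f)
    (σ : Mem Y) (a : X) (i j v : ℕ) :
    (fun b => σ.set (f a) i j v (f b)) = Mem.set (fun b => σ (f b)) a i j v := by
  funext b p q; simp [Mem.set, hf.eq_iff]

/-- Used twice: `code` turns the subroutine into a program on numbered arrays, and `bk` embeds those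
into the memory of the caller. Injectivity ensures that distinct arrays stay distinct. -/
theorem wp_map {Y : Type} [DecidableEq Y] {f : X → Y} (hf : Function.Injective f) {M : ℕ}
    (c : Cmd X) : ∀ {Q : Mem X → ℕ → Prop} {σ : Mem Y} {s : ℕ},
    c.wp M Q (fun a => σ (f a)) s → (c.map f).wp M (fun τ r => Q (fun a => τ (f a)) r) σ s := by
  induction c with
  | skip => intro Q σ s h; exact h
  | set a i j e =>
      intro Q σ s h hB
      have := h fun b p q => hB (f b) p q
      simp only [Exp.val_map, Mem.set_comp hf]
      exact this
  | flip a i j => intro Q σ s h; exact h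
  | seq c d ihc ihd =>
      intro Q σ s h
      exact wp_mono (c.map f) (ihc (Q := fun τ r => d.wp M Q τ r) h) fun τ r h' => ihd h'
  | ite e c d ihc ihd =>
      intro Q σ s h
      simp only [Cmd.map, Cmd.wp, Exp.val_map]
      exact ⟨fun he => ihc (h.1 he), fun he => ihd (h.2 he)⟩
  | loop a e c ih =>
      rintro Q σ s ⟨I, hM, h0, hst, hpost⟩
      refine ⟨fun t τ r => I t (fun a => τ (f a)) r, ?_, h0, ?_, ?_⟩
      · rw [Exp.val_map]; exact fun hB => hM fun b p q => hB (f b) p q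
      · intro t ht τ r hI
        rw [Exp.val_map] at ht
        refine ih ?_
        rw [Mem.set_comp hf]
        exact hst t ht _ r hI
      · intro τ r hI
        rw [Exp.val_map] at hI
        exact hpost _ _ hI

theorem mods_map {Y : Type} (f : X → Y) (c : Cmd X) : (c.map f).mods = c.mods.map f := by
  induction c <;> simp_all [Cmd.map, Cmd.mods]

/-! ### Evaluation rules -/

@[simp] theorem val_zero (σ : Mem X) : (0 : Exp X).val σ = 0 := rfl
@[simp] theorem val_one (σ : Mem X) : (1 : Exp X).val σ = 1 := rfl
@[simp] theorem val_two (σ : Mem X) : (2 : Exp X).val σ = 2 := rfl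
@[simp] theorem val_four (σ : Mem X) : (4 : Exp X).val σ = 4 := rfl
@[simp] theorem val_lit (σ : Mem X) (c : ℕ) : (Exp.lit c : Exp X).val σ = c := rfl
@[simp] theorem val_rd0 (σ : Mem X) (a : X) : (rd0 a).val σ = σ a 0 0 := rfl
@[simp] theorem val_rd1 (σ : Mem X) (a : X) (i : Exp X) : (rd1 a i).val σ = σ a (i.val σ) 0 := rfl
@[simp] theorem val_rd2 (σ : Mem X) (a : X) (i j : Exp X) :
    (rd2 a i j).val σ = σ a (i.val σ) (j.val σ) := rfl
@[simp] theorem val_add (σ : Mem X) (e f : Exp X) : (e + f).val σ = e.val σ + f.val σ := rfl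
@[simp] theorem val_sub (σ : Mem X) (e f : Exp X) : (e - f).val σ = e.val σ - f.val σ := rfl
@[simp] theorem val_mul (σ : Mem X) (e f : Exp X) : (e * f).val σ = e.val σ * f.val σ := rfl
@[simp] theorem val_lt (σ : Mem X) (e f : Exp X) :
    (Exp.lt e f).val σ = if e.val σ < f.val σ then 1 else 0 := rfl
@[simp] theorem val_eq (σ : Mem X) (e f : Exp X) :
    (Exp.eq e f).val σ = if e.val σ = f.val σ then 1 else 0 := rfl
@[simp] theorem val_no (σ : Mem X) (e : Exp X) :
    (no e).val σ = if e.val σ = 0 then 1 else 0 := rfl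

variable {M : ℕ} {Q : Mem X → ℕ → Prop} {σ : Mem X} {s : ℕ}

@[simp] theorem wp_skip : (Cmd.skip : Cmd X).wp M Q σ s ↔ Q σ s := Iff.rfl
@[simp] theorem wp_wr0 (a : X) (e : Exp X) : (wr0 a e).wp M Q σ s ↔
    (Bdd M σ → e.val σ ≤ M ∧ Q (σ.set a 0 0 (e.val σ)) s) := Iff.rfl
@[simp] theorem wp_wr1 (a : X) (i e : Exp X) : (wr1 a i e).wp M Q σ s ↔
    (Bdd M σ → e.val σ ≤ M ∧ Q (σ.set a (i.val σ) 0 (e.val σ)) s) := Iff.rfl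
@[simp] theorem wp_wr2 (a : X) (i j e : Exp X) : (wr2 a i j e).wp M Q σ s ↔
    (Bdd M σ → e.val σ ≤ M ∧ Q (σ.set a (i.val σ) (j.val σ) (e.val σ)) s) := Iff.rfl
@[simp] theorem wp_when (e : Exp X) (c : Cmd X) : (when e c).wp M Q σ s ↔
    (e.val σ ≠ 0 → c.wp M Q σ s) ∧ (e.val σ = 0 → Q σ s) := Iff.rfl
@[simp] theorem wp_ite (e : Exp X) (c d : Cmd X) : (Cmd.ite e c d).wp M Q σ s ↔
    (e.val σ ≠ 0 → c.wp M Q σ s) ∧ (e.val σ = 0 → d.wp M Q σ s) := Iff.rfl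
@[simp] theorem wp_block_nil : (block [] : Cmd X).wp M Q σ s ↔ Q σ s := Iff.rfl
@[simp] theorem wp_block_cons (c : Cmd X) (cs : List (Cmd X)) : (block (c :: cs)).wp M Q σ s ↔
    c.wp M (fun τ r => (block cs).wp M Q τ r) σ s := Iff.rfl

/-- Rule for the loops `for a = 1, …, N`. -/
theorem wp_loop1 {a : X} {N : ℕ} {c : Cmd X} (I : ℕ → Mem X → ℕ → Prop)
    (hM : Bdd M σ → N + 1 ≤ M)
    (h0 : ∀ τ, (∀ b, b ≠ a → τ b = σ b) → I 1 τ (s + 1))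
    (hstep : ∀ t, 1 ≤ t → t ≤ N → ∀ τ r, (∀ b, b ∉ a :: c.mods → τ b = σ b) → I t τ r →
      c.wp M (I (t + 1)) (τ.set a 0 0 t) (r + 1))
    (hpost : ∀ τ r, (∀ b, b ∉ a :: c.mods → τ b = σ b) → I (N + 1) τ r → Q τ r) :
    (loop1 a N c).wp M Q σ s := by
  have hm : (when (rd0 a) c).mods = c.mods := by simp [when, Cmd.mods]
  -- The pass with index 0 only writes the loop variable. The invariant therefore says that nothing
  -- has happened before it, and `I` takes over from index 1, with the counter already raised by
  -- one.
  refine wp_loop (N + 1) (fun t τ r => (t = 0 → τ = σ ∧ r = s) ∧ (t ≠ 0 → I t τ r)) rfl hM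
    ⟨fun _ => ⟨rfl, rfl⟩, fun h => absurd rfl h⟩ ?_ ?_
  · intro t ht τ r hfr hI
    rw [hm] at hfr
    rw [wp_when]
    rcases Nat.eq_zero_or_pos t with h | h
    · subst h
      refine ⟨fun h => absurd (by simp [Mem.set]) h, fun _ => ⟨by simp, fun _ => ?_⟩⟩
      obtain ⟨rfl, rfl⟩ := hI.1 rfl
      exact h0 _ fun b hb => Mem.set_of_ne _ hb _ _ _
    · refine ⟨fun _ => ?_, fun h' => ?_⟩
      · exact wp_mono _ (hstep t h (by omega) τ r hfr (hI.2 (by omega)))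
          fun τ r h => ⟨by simp, fun _ => h⟩
      · simp [Mem.set] at h'; omega
  · intro τ r hfr hI
    rw [hm] at hfr
    exact hpost τ r hfr (hI.2 (by omega))

end Logic

/-! ### The greedy hitting set -/

section HittingSet
open Loc

/-- Double counting of the incidences between the unhit sets U and the points, each weighted by its
point: from the side of the sets the total is at least |U| θ, from the side of the points it is at
most the total weight times the largest number of unhit sets through a point. So the greedy choice
hits at least the fraction θ / (total weight) of the unhit sets. -/
theorem greedy_round {V : Type*} (U Y : Finset V) (S : V → V → Prop) [∀ x, DecidablePred (S x)]
    (wt : V → ℝ) (θ : ℝ) (b : V) (hw : ∀ y ∈ Y, 0 ≤ wt y)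
    (hθ : ∀ x ∈ U, θ ≤ ∑ y ∈ Y with S x y, wt y)
    (hb : ∀ y ∈ Y, (U.filter (S · y)).card ≤ (U.filter (S · b)).card) :
    U.card * θ ≤ (∑ y ∈ Y, wt y) * (U.filter (S · b)).card := by
  calc U.card * θ = ∑ _x ∈ U, θ := by simp
    _ ≤ ∑ x ∈ U, ∑ y ∈ Y with S x y, wt y := Finset.sum_le_sum hθ
    _ = ∑ x ∈ U, ∑ y ∈ Y, if S x y then wt y else 0 := by simp [Finset.sum_filter]
    _ = ∑ y ∈ Y, ∑ x ∈ U, if S x y then wt y else 0 := Finset.sum_comm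
    _ = ∑ y ∈ Y, (U.filter (S · y)).card * wt y := by
        refine Finset.sum_congr rfl fun y _ => ?_
        rw [← Finset.sum_filter, Finset.sum_const, nsmul_eq_mul]
    _ ≤ ∑ y ∈ Y, (U.filter (S · b)).card * wt y := Finset.sum_le_sum fun y hy =>
        mul_le_mul_of_nonneg_right (by exact_mod_cast hb y hy) (hw y hy)
    _ = _ := by rw [← Finset.mul_sum, mul_comm]

/-- The difference consists of b reciprocals, each at least 1/(a+b). This lets the greedy analysis
telescope. -/
theorem harmonic_sub_le (a b : ℕ) : (b : ℝ) ≤ (a + b : ℕ) * ((harmonic (a + b) : ℝ) - harmonic a) := by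
  have h : ((harmonic (a + b) : ℝ) - harmonic a) = ∑ i ∈ Finset.range b, ((a + i + 1 : ℕ) : ℝ)⁻¹ := by
    simp only [harmonic]
    push_cast
    rw [Finset.sum_range_add]
    push_cast
    ring
  rw [h, Finset.mul_sum]
  calc (b : ℝ) = ∑ _i ∈ Finset.range b, (1 : ℝ) := by simp
    _ ≤ _ := Finset.sum_le_sum fun i hi => by
        rw [Finset.mem_range] at hi
        have h0 : (0 : ℝ) < ((a + i + 1 : ℕ) : ℝ) := by positivity
        rw [← div_eq_mul_inv, le_div_iff₀ h0, one_mul]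
        exact_mod_cast (by omega : a + i + 1 ≤ a + b)

/-- Membership in the closed neighbourhoods described by the matrix `A`. -/
def InNbhd (A : ℕ → ℕ → ℕ) (x y : ℕ) : Prop := A x y + (if x = y then 1 else 0) ≠ 0

instance (A : ℕ → ℕ → ℕ) (x y : ℕ) : Decidable (InNbhd A x y) :=
  inferInstanceAs (Decidable (_ ≠ _))

theorem harmonic_mono {a b : ℕ} (h : a ≤ b) : harmonic a ≤ harmonic b :=
  Finset.sum_le_sum_of_subset_of_nonneg (by simpa using h) fun _ _ _ => by positivity

@[simp] theorem val_closedAdj (σ : Mem Loc) (x y : Exp Loc) : (closedAdj x y).val σ =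
    σ adj (x.val σ) (y.val σ) + if x.val σ = y.val σ then 1 else 0 := rfl

/-- The state of the greedy algorithm when the sets with index in `U` are not yet hit. -/
structure GreedyState (A : ℕ → ℕ → ℕ) (N : ℕ) (U : Finset ℕ) (τ : Mem Loc) : Prop where
  need : ∀ x < N, τ need x 0 = if x ∈ U then 1 else 0
  left : τ left 0 0 = U.card
  count : ∀ y < N, τ c y 0 = (U.filter (InNbhd A · y)).card

/-- What the greedy algorithm guarantees about the sets outside of `U`. -/
structure GreedyDone (H : ℕ → ℕ) (A : ℕ → ℕ → ℕ) (N i₀ : ℕ) (U : Finset ℕ) (σ τ : Mem Loc) :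
    Prop where
  hit : ∀ x < N, H x = 1 → x ∉ U →
    τ rep i₀ x < N ∧ InNbhd A x (τ rep i₀ x) ∧ τ inD i₀ (τ rep i₀ x) = 1
  inD_other : ∀ i, i ≠ i₀ → τ inD i = σ inD i
  rep_other : ∀ i, i ≠ i₀ → τ rep i = σ rep i

theorem card_set_le (N : ℕ) (f : ℕ → ℕ) (b : ℕ) :
    ((Finset.range N).filter fun y => (if y = b then 1 else f y) ≠ 0).card ≤
      ((Finset.range N).filter fun y => f y ≠ 0).card + 1 := by
  refine (Finset.card_le_card (t := insert b ((Finset.range N).filter fun y => f y ≠ 0)) ?_).trans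
    (Finset.card_insert_le _ _)
  intro y hy
  simp only [Finset.mem_filter, Finset.mem_insert] at hy ⊢
  by_cases h : y = b
  · exact Or.inl h
  · exact Or.inr (by simpa [h] using hy)

/-- Bookkeeping when the set of t becomes hit: one scan of length N takes t out of the counters of
all its members. -/
theorem greedy_erase {M N i₀ t b s : ℕ} {H : ℕ → ℕ} {σ₀ σ : Mem Loc} {U : Finset ℕ}
    (hn : σ n 0 0 = N) (hi₀ : σ i 0 0 = i₀) (hx : σ x 0 0 = t) (hb : σ best 0 0 = b)
    (hbN : b < N) (hNM : N + 1 ≤ M) (hUN : ∀ x ∈ U, x < N) (ht : t ∈ U)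
    (hS : InNbhd (σ adj) t b) (hD : σ inD i₀ b = 1)
    (hG : GreedyState (σ adj) N U σ) (hDn : GreedyDone H (σ adj) N i₀ U σ₀ σ) :
    (block [
      wr1 need §x 0,
      wr0 left (§left - 1),
      wr2 rep §i §x §best,
      .loop y §n (when (closedAdj §x §y) (wr1 c §y (rd1 c §y - 1)))]).wp M (fun τ r =>
        GreedyState (σ adj) N (U.erase t) τ ∧ GreedyDone H (σ adj) N i₀ (U.erase t) σ₀ τ ∧
        r = s + N) σ s := by
  have hUc : U.card ≤ N := by
    calc U.card ≤ (Finset.range N).card := Finset.card_le_card fun x hx => by simpa using hUN x hx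
      _ = N := by simp
  have hl := hG.left
  have hce : (U.erase t).card = U.card - 1 := Finset.card_erase_of_mem ht
  simp only [wp_block_cons, wp_block_nil, wp_wr0, wp_wr1, wp_wr2, val_zero, val_one, val_rd0, val_sub, ne_eq,
    reduceCtorEq, not_false_eq_true, Mem.set_of_ne, hx, hi₀, hb, hl]
  refine fun _ => ⟨by omega, fun _ => ⟨by omega, fun _ => ⟨by omega, ?_⟩⟩⟩
  refine wp_loop N (fun u τ r => (∀ y < N, τ c y 0 =
    if y < u then ((U.erase t).filter (InNbhd (σ adj) · y)).card
      else (U.filter (InNbhd (σ adj) · y)).card) ∧ r = s + u) (by simpa using hn)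
      (fun _ => by omega) ⟨fun y hy => by simpa using hG.count y hy, rfl⟩ ?_ ?_
  · rintro u hu τ r hfr ⟨h1, h2⟩
    have e1 : τ x = σ x := by simpa using hfr x (by decide)
    have e4 : τ adj = σ adj := by simpa using hfr adj (by decide)
    have hle : (U.filter (InNbhd (σ adj) · u)).card ≤ N :=
      (Finset.card_le_card (Finset.filter_subset _ _)).trans hUc
    have hcu : τ c u 0 = (U.filter (InNbhd (σ adj) · u)).card := by simpa using h1 u hu
    simp only [wp_when, wp_wr1, val_closedAdj, val_rd0, val_rd1, val_sub, val_one, Mem.set_same,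
      Mem.set_of_ne, ne_eq, reduceCtorEq, not_false_eq_true, e1, e4, hx, and_self, if_true, hcu]
    refine ⟨fun hS' _ => ⟨by omega, fun y hy => ?_, by omega⟩,
      fun hS' => ⟨fun y hy => ?_, by omega⟩⟩
    · by_cases hyu : y = u
      · subst hyu
        rw [if_pos ⟨rfl, trivial⟩, if_pos (by omega), Finset.filter_erase,
          Finset.card_erase_of_mem (by simp only [Finset.mem_filter]; exact ⟨ht, hS'⟩)]
      · have : y < u + 1 ↔ y < u := by omega
        simpa [hyu, this] using h1 y hy
    · by_cases hyu : y = u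
      · subst hyu
        rw [hcu, if_pos (by omega), Finset.filter_erase, Finset.erase_eq_of_notMem]
        simp only [Finset.mem_filter]
        exact fun h => h.2 hS'
      · have : y < u + 1 ↔ y < u := by omega
        simpa [hyu, this] using h1 y hy
  · rintro τ r hfr ⟨h1, h2⟩
    have e1 : τ need = _ := hfr need (by decide)
    have e2 : τ left = _ := hfr left (by decide)
    have e3 : τ rep = _ := hfr rep (by decide)
    have e4 : τ inD = _ := hfr inD (by decide)
    simp only [ne_eq, reduceCtorEq, not_false_eq_true, Mem.set_of_ne] at e1 e2 e3 e4
    refine ⟨⟨fun x hx => ?_, ?_, fun y hy => ?_⟩, ⟨fun x hx hH hxU => ?_, fun j hj => ?_,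
      fun j hj => ?_⟩, h2⟩
    · rw [e1, Mem.set_same, hG.need x hx]
      by_cases hxt : x = t <;> simp [hxt]
    · rw [e2, hce]; simp
    · rw [h1 y hy, if_pos hy]
    · rw [e3, e4, Mem.set_same]
      by_cases hxt : x = t
      · subst hxt
        simp only [and_self, if_true]
        exact ⟨hbN, hS, hD⟩
      · simp only [hxt, and_false, if_false]
        refine hDn.hit x hx hH fun h => hxU (by simp [hxt, h])
    · rw [e4]; exact hDn.inD_other j hj
    · rw [← hDn.rep_other j hj, e3]
      funext q; simp [Mem.set_same, hj]

/-- The equation for the iteration count is amortized: 2 N passes are spent on the two scans, and N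
more on each newly hit set, which are paid for by the drop of |U|. -/
theorem greedy_spec_round {M N i₀ s : ℕ} {H : ℕ → ℕ} {σ₀ σ : Mem Loc} {U : Finset ℕ}
    (hn : σ n 0 0 = N) (hi₀ : σ i 0 0 = i₀) (hNM : N + 1 ≤ M) (hUN : ∀ x ∈ U, x < N)
    (hU : U.Nonempty) (hcov : ∀ x ∈ U, ∃ y < N, InNbhd (σ adj) x y)
    (hG : GreedyState (σ adj) N U σ) (hDn : GreedyDone H (σ adj) N i₀ U σ₀ σ) :
    (block [
      wr0 best 0,
      .loop y §n (when (.lt (rd1 c §best) (rd1 c §y)) (wr0 best §y)),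
      wr2 inD §i §best 1,
      .loop x §n (when (rd1 need §x * closedAdj §x §best) (block [
        wr1 need §x 0,
        wr0 left (§left - 1),
        wr2 rep §i §x §best,
        .loop y §n (when (closedAdj §x §y) (wr1 c §y (rd1 c §y - 1)))]))]).wp M (fun τ r =>
      ∃ b < N, (∀ y < N, (U.filter (InNbhd (σ adj) · y)).card ≤
          (U.filter (InNbhd (σ adj) · b)).card) ∧ (U.filter (InNbhd (σ adj) · b)).Nonempty ∧
        GreedyState (σ adj) N (U.filter fun x => ¬ InNbhd (σ adj) x b) τ ∧
        GreedyDone H (σ adj) N i₀ (U.filter fun x => ¬ InNbhd (σ adj) x b) σ₀ τ ∧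
        τ inD = σ.set inD i₀ b 1 inD ∧
        r + N * (U.filter fun x => ¬ InNbhd (σ adj) x b).card = s + 2 * N + N * U.card) σ s := by
  have hN : 0 < N := by obtain ⟨x, hx⟩ := hU; have := hUN x hx; omega
  simp only [wp_block_cons, wp_block_nil, wp_wr0, val_zero]
  refine fun _ => ⟨by omega, ?_⟩
  refine wp_loop N (fun u τ r => τ best 0 0 < N ∧ (∀ y < u,
    (U.filter (InNbhd (σ adj) · y)).card ≤ (U.filter (InNbhd (σ adj) · (τ best 0 0))).card) ∧
    r = s + u) (by simpa using hn) (fun _ => by omega) (by simpa using hN) ?_ ?_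
  · rintro u hu τ r hfr ⟨h1, h2, h3⟩
    have e1 : τ c = σ c := by simpa using hfr c (by decide)
    simp only [wp_when, wp_wr0, val_lt, val_rd0, val_rd1, Mem.set_same,
      Mem.set_of_ne, ne_eq, reduceCtorEq, not_false_eq_true, and_self, if_true, e1,
      hG.count _ h1, hG.count u hu, ite_eq_right_iff, one_ne_zero, imp_false, not_lt]
    refine ⟨fun h _ => ⟨by omega, hu, fun y hy => ?_, by omega⟩, fun h => ⟨h1, fun y hy => ?_,
      by omega⟩⟩
    · rcases Nat.lt_succ_iff_lt_or_eq.1 hy with hy | rfl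
      · exact (h2 y hy).trans (not_le.1 h).le
      · exact le_rfl
    · rcases Nat.lt_succ_iff_lt_or_eq.1 hy with hy | rfl
      · exact h2 y hy
      · exact h
  rintro τ r hfr ⟨h1, h2, h3⟩
  have e2 : τ i = σ i := by simpa using hfr i (by decide)
  have e3 : τ n = σ n := by simpa using hfr n (by decide)
  have e4 : τ adj = σ adj := by simpa using hfr adj (by decide)
  have e5 : τ inD = σ inD := by simpa using hfr inD (by decide)
  have e6 : τ rep = σ rep := by simpa using hfr rep (by decide)
  have e7 : τ need = σ need := by simpa using hfr need (by decide)
  have e8 : τ left = σ left := by simpa using hfr left (by decide)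
  have e9 : τ c = σ c := by simpa using hfr c (by decide)
  obtain ⟨b, hb⟩ : ∃ b, τ best 0 0 = b := ⟨_, rfl⟩
  rw [hb] at h1 h2
  simp only [wp_wr2, val_rd0, val_one, e2, hi₀, hb]
  refine fun _ => ⟨by omega, ?_⟩
  -- Some unhit set has a member, so the maximal counter is positive and every round makes progress.
  have hne : (U.filter (InNbhd (σ adj) · b)).Nonempty := by
    obtain ⟨x, hx⟩ := hU
    obtain ⟨y, hy, hS⟩ := hcov x hx
    rw [← Finset.card_pos]
    refine lt_of_lt_of_le (Finset.card_pos.2 ⟨x, ?_⟩) (h2 y hy)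
    simp only [Finset.mem_filter]; exact ⟨hx, hS⟩
  refine wp_loop N (fun t ρ q =>
      GreedyState (σ adj) N (U.filter fun x => ¬ (x < t ∧ InNbhd (σ adj) x b)) ρ ∧
      GreedyDone H (σ adj) N i₀ (U.filter fun x => ¬ (x < t ∧ InNbhd (σ adj) x b)) σ₀ ρ ∧
      q + N * (U.filter fun x => ¬ (x < t ∧ InNbhd (σ adj) x b)).card = r + t + N * U.card)
    (by simpa [e3] using hn) (fun _ => by omega) ?_ ?_ ?_
  · simp only [Nat.not_lt_zero, false_and, not_false_eq_true, Finset.filter_true]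
    refine ⟨⟨fun x hx => ?_, ?_, fun y hy => ?_⟩, ⟨fun x hx hH hxU => ?_, fun j hj => ?_,
      fun j hj => ?_⟩, by ring⟩
    · simpa [e7] using hG.need x hx
    · simpa [e8] using hG.left
    · simpa [e9] using hG.count y hy
    · obtain ⟨h4, h5, h6⟩ := hDn.hit x hx hH hxU
      simp only [Mem.set_of_ne, ne_eq, reduceCtorEq, not_false_eq_true, e6, Mem.set_same, e5]
      refine ⟨h4, h5, ?_⟩
      split_ifs <;> simp [h6]
    · rw [← hDn.inD_other j hj]; funext q; simp [hj, e5]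
    · rw [← hDn.rep_other j hj]; simp [e6]
  · rintro t ht ρ q hfr' ⟨h4, h5, h6⟩
    have g2 : ρ i = σ i := by simpa [e2] using hfr' i (by decide)
    have g3 : ρ n = σ n := by simpa [e3] using hfr' n (by decide)
    have g4 : ρ adj = σ adj := by simpa [e4] using hfr' adj (by decide)
    have g5 : ρ inD = (τ.set inD i₀ b 1) inD := hfr' inD (by decide)
    have g10 : ρ best = τ best := by simpa using hfr' best (by decide)
    set U' := U.filter fun x => ¬ (x < t ∧ InNbhd (σ adj) x b) with hU'
    have htU : t ∈ U' ↔ t ∈ U := by simp [hU']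
    simp only [wp_when, val_mul, val_closedAdj, val_rd0, val_rd1, Mem.set_same,
      Mem.set_of_ne, ne_eq, reduceCtorEq, not_false_eq_true, and_self, if_true, g4, g10, hb,
      h4.need t ht, mul_eq_zero, not_or]
    refine ⟨fun h7 => ?_, fun h7 => ?_⟩
    · have h8 : t ∈ U' := by by_contra h; simp [h] at h7
      have hUe : (U.filter fun x => ¬ (x < t + 1 ∧ InNbhd (σ adj) x b)) = U'.erase t := by
        ext x
        by_cases hxt : x = t
        · subst hxt
          have : InNbhd (σ adj) x b := h7.2
          simp [this]
        · have : x < t + 1 ↔ x < t := by omega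
          simp only [hU', Finset.mem_erase, Finset.mem_filter, this, ne_eq, hxt, not_false_eq_true,
            true_and]
      rw [hUe]
      refine wp_use (greedy_erase (t := t) (b := b) (U := U') (i₀ := i₀) (N := N) (H := H)
        (σ₀ := σ₀) (by simpa [g3] using hn)
        (by simpa [g2] using hi₀) (by simp) (by simpa [g10] using hb) h1 hNM
        (fun x hx => hUN x (Finset.filter_subset _ _ hx)) h8 (by rw [Mem.set_of_ne _ (by decide), g4]; exact h7.2)
        (by simp [g5]) ?_ ?_) ?_
      · refine ⟨?_, ?_, ?_⟩
        · simpa using h4.need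
        · simpa using h4.left
        · simpa [g4] using h4.count
      · refine ⟨?_, ?_, ?_⟩
        · simpa [g4] using h5.hit
        · simpa using h5.inD_other
        · simpa using h5.rep_other
      · rintro π k - ⟨h9, h10, h11⟩
        rw [Finset.card_erase_of_mem h8]
        simp only [Mem.set_of_ne, ne_eq, reduceCtorEq, not_false_eq_true, g4] at h9 h10
        refine ⟨h9, h10, ?_⟩
        have : 1 ≤ U'.card := Finset.card_pos.2 ⟨t, h8⟩
        obtain ⟨m, hm⟩ := Nat.exists_eq_add_of_le this
        rw [hm] at h6 ⊢
        simp only [Nat.add_sub_cancel_left]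
        rw [h11]; linarith
    · have hUe : (U.filter fun x => ¬ (x < t + 1 ∧ InNbhd (σ adj) x b)) = U' := by
        ext x
        by_cases hxt : x = t
        · subst hxt
          rw [htU, Finset.mem_filter]
          refine ⟨fun h => h.1, fun h => ⟨h, fun h8 => ?_⟩⟩
          rcases h7 with h7 | h7
          · rw [if_pos (htU.2 h)] at h7; exact one_ne_zero h7
          · exact h8.2 h7
        · have : x < t + 1 ↔ x < t := by omega
          simp only [hU', Finset.mem_filter, this]
      rw [hUe]
      refine ⟨⟨?_, ?_, ?_⟩, ⟨?_, ?_, ?_⟩, by linarith⟩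
      · simpa using h4.need
      · simpa using h4.left
      · simpa using h4.count
      · simpa using h5.hit
      · simpa using h5.inD_other
      · simpa using h5.rep_other
  · rintro ρ q hfr' ⟨h4, h5, h6⟩
    have hUe : (U.filter fun x => ¬ (x < N ∧ InNbhd (σ adj) x b)) =
        U.filter fun x => ¬ InNbhd (σ adj) x b :=
      Finset.filter_congr fun x hx => by simp [hUN x hx]
    rw [hUe] at h4 h5 h6
    refine ⟨b, h1, h2, hne, h4, h5, ?_, by rw [h6, h3]; ring⟩
    rw [hfr' inD (by decide)]
    funext p k; simp [e5]

/-- If a round takes the number of unhit sets from a to b, then θ ≤ Y (H_a - H_b), where Y is the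
total weight; summing over the rounds bounds the number of chosen points times θ by Y H_N. The
matrix need not be symmetric: its rows describe arbitrary sets. The statement is therefore applied
with unit weights to neighbourhoods, and with the weights `gwt` to balls. -/
theorem hittingSet_spec {M N i₀ s : ℕ} {σ : Mem Loc} (hn : σ n 0 0 = N) (hi₀ : σ i 0 0 = i₀)
    (hNM : N + 1 ≤ M) (hhi : ∀ x < N, σ hi i₀ x ≤ 1)
    (wt : ℕ → ℝ) (θ : ℝ) (hθ0 : 0 ≤ θ)
    (hw : ∀ y < N, 0 ≤ wt y)
    (hθ : ∀ x < N, σ hi i₀ x = 1 → θ ≤ ∑ y ∈ Finset.range N with InNbhd (σ adj) x y, wt y)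
    (hD : ∀ y < N, σ inD i₀ y = 0) :
    hittingSet.wp M (fun τ r =>
      (∀ x < N, σ hi i₀ x = 1 → τ rep i₀ x < N ∧ InNbhd (σ adj) x (τ rep i₀ x) ∧
        τ inD i₀ (τ rep i₀ x) = 1) ∧
      (∀ i, i ≠ i₀ → τ inD i = σ inD i) ∧ (∀ i, i ≠ i₀ → τ rep i = σ rep i) ∧
      (((Finset.range N).filter fun y => τ inD i₀ y ≠ 0).card : ℝ) * θ ≤
        (∑ y ∈ Finset.range N, wt y) * harmonic N ∧
      r ≤ s + 8 * N ^ 2) σ s := by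
  set U₀ := (Finset.range N).filter fun x => σ hi i₀ x = 1 with hU₀
  have hU₀N : ∀ U : Finset ℕ, U ⊆ U₀ → U.card ≤ N := fun U h =>
    (Finset.card_le_card (h.trans (Finset.filter_subset _ _))).trans (by simp)
  unfold hittingSet
  simp only [wp_block_cons, wp_block_nil, wp_wr0, val_zero]
  refine fun _ => ⟨by omega, ?_⟩
  -- the initialization of `need`, `left` and `c`
  refine wp_loop N (fun t τ r => (∀ y < t, τ c y 0 = 0 ∧ τ need y 0 = σ hi i₀ y) ∧
    τ left 0 0 = ∑ y ∈ Finset.range t, σ hi i₀ y ∧ r = s + t) (by simpa using hn)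
    (fun _ => by omega) (by simp) ?_ ?_
  · rintro t ht τ r hfr ⟨h1, h2, h3⟩
    have e1 : τ hi = σ hi := by simpa using hfr hi (by decide)
    have e2 : τ i = σ i := by simpa using hfr i (by decide)
    have hs : ∑ y ∈ Finset.range (t + 1), σ hi i₀ y ≤ t + 1 := by
      calc _ ≤ ∑ y ∈ Finset.range (t + 1), 1 := Finset.sum_le_sum fun y hy =>
            hhi y (by rw [Finset.mem_range] at hy; omega)
        _ = t + 1 := by simp
    rw [Finset.sum_range_succ] at hs
    simp only [wp_block_cons, wp_block_nil, wp_wr0, wp_wr1, val_zero, val_rd0, val_rd1, val_rd2, val_add, ne_eq,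
      reduceCtorEq, not_false_eq_true, Mem.set_of_ne, Mem.set_same, and_self, if_true, e1, e2,
      hi₀, h2]
    have := hhi t ht
    refine fun _ => ⟨by omega, fun _ => ⟨by omega, fun _ => ⟨by omega, ?_, ?_, by omega⟩⟩⟩
    · intro y hy
      by_cases hyt : y = t
      · simp [hyt]
      · simpa [hyt] using h1 y (by omega)
    · rw [Finset.sum_range_succ]
  rintro τ r hfr ⟨h1, h2, h3⟩
  have e1 : τ hi = σ hi := by simpa using hfr hi (by decide)
  have e2 : τ i = σ i := by simpa using hfr i (by decide)
  have e3 : τ n = σ n := by simpa using hfr n (by decide)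
  have e4 : τ adj = σ adj := by simpa using hfr adj (by decide)
  have e5 : τ inD = σ inD := by simpa using hfr inD (by decide)
  have e6 : τ rep = σ rep := by simpa using hfr rep (by decide)
  have h4 : τ left 0 0 = U₀.card := by
    rw [h2, hU₀, Finset.card_filter]
    refine Finset.sum_congr rfl fun x hx => ?_
    have := hhi x (by simpa using hx)
    split_ifs <;> omega
  clear hfr h2
  -- the initialization of the counters
  refine wp_loop N (fun t ρ r' => (∀ y < N, ρ c y 0 =
    ((U₀.filter fun x => x < t).filter (InNbhd (σ adj) · y)).card) ∧ r' ≤ r + t * (N + 1))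
    (by simpa [e3] using hn) (fun _ => by omega) ⟨fun y hy => by simp [h1 y hy], by simp⟩ ?_ ?_
  · rintro t ht ρ r' hfr ⟨h5, h6⟩
    have f1 : ρ need = τ need := by simpa using hfr need (by decide)
    have f3 : ρ n = σ n := by rw [← e3]; simpa using hfr n (by decide)
    have f4 : ρ adj = σ adj := by rw [← e4]; simpa using hfr adj (by decide)
    simp only [wp_when, val_rd1, val_rd0, Mem.set_same, Mem.set_of_ne, ne_eq, reduceCtorEq,
      not_false_eq_true, f1, and_self, if_true, (h1 t ht).2]
    have := hhi t ht
    have hsucc : (U₀.filter fun x => x < t + 1) = if σ hi i₀ t = 1 then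
        insert t (U₀.filter fun x => x < t) else U₀.filter fun x => x < t := by
      ext x
      by_cases hxt : x = t
      · subst hxt
        split_ifs with h <;> simp [hU₀, h, ht]
      · have : x ≤ t ↔ x < t := by omega
        split_ifs with h <;> simp [hxt, this]
    refine ⟨fun h7 => ?_, fun h7 => ⟨fun y hy => ?_, by nlinarith⟩⟩
    · have h8 : σ hi i₀ t = 1 := by omega
      refine wp_loop N (fun u π q => (∀ y < N, π c y 0 =
        ((U₀.filter fun x => x < t).filter (InNbhd (σ adj) · y)).card +
          if y < u ∧ InNbhd (σ adj) t y then 1 else 0) ∧ q = r' + 1 + u)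
        (by simpa [f3] using hn) (fun _ => by omega) ⟨fun y hy => by simpa using h5 y hy, rfl⟩ ?_ ?_
      · rintro u hu π q hfr' ⟨h9, h10⟩
        have g1 : π x = (ρ.set x 0 0 t) x := hfr' x (by decide)
        have g4 : π adj = σ adj := by rw [← f4]; simpa using hfr' adj (by decide)
        simp only [wp_when, wp_wr1, val_closedAdj, val_rd0, val_rd1, val_add, val_one, Mem.set_same, Mem.set_of_ne,
          ne_eq, reduceCtorEq, not_false_eq_true, g1, g4, and_self, if_true]
        have hle : ((U₀.filter fun x => x < t).filter (InNbhd (σ adj) · u)).card ≤ N :=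
          hU₀N _ ((Finset.filter_subset _ _).trans (Finset.filter_subset _ _))
        have hπu : π c u 0 = ((U₀.filter fun x => x < t).filter (InNbhd (σ adj) · u)).card := by
          simpa using h9 u hu
        refine ⟨fun hS _ => ⟨by omega, fun y hy => ?_, by omega⟩, fun hS => ⟨fun y hy => ?_, by omega⟩⟩
        · by_cases hyu : y = u
          · subst hyu
            rw [if_pos ⟨rfl, trivial⟩, hπu, if_pos ⟨by omega, hS⟩]
          · have : y < u + 1 ↔ y < u := by omega
            simpa [hyu, this] using h9 y hy
        · by_cases hyu : y = u
          · subst hyu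
            rw [hπu, if_neg fun h => h.2 hS]; rfl
          · have : y < u + 1 ↔ y < u := by omega
            simpa [hyu, this] using h9 y hy
      · rintro π q hfr' ⟨h9, h10⟩
        refine ⟨fun y hy => ?_, by rw [h10]; nlinarith⟩
        rw [h9 y hy, hsucc, if_pos h8, Finset.filter_insert]
        by_cases hS : InNbhd (σ adj) t y
        · rw [if_pos ⟨hy, hS⟩, if_pos hS, Finset.card_insert_of_notMem (by simp)]
        · rw [if_neg fun h => hS h.2, if_neg hS]; rfl
    · rw [h5 y hy, hsucc, if_neg (by omega)]
  rintro ρ r' hfr ⟨h5, h6⟩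
  have f1 : ρ need = τ need := by simpa using hfr need (by decide)
  have f2 : ρ left = τ left := by simpa using hfr left (by decide)
  have f3 : ρ n = σ n := by rw [← e3]; simpa using hfr n (by decide)
  have f4 : ρ adj = σ adj := by rw [← e4]; simpa using hfr adj (by decide)
  have f5 : ρ inD = σ inD := by rw [← e5]; simpa using hfr inD (by decide)
  have f6 : ρ rep = σ rep := by rw [← e6]; simpa using hfr rep (by decide)
  have f7 : ρ i = σ i := by rw [← e2]; simpa using hfr i (by decide)
  clear hfr
  have hG : GreedyState (σ adj) N U₀ ρ := by
    refine ⟨fun x hx => ?_, by rw [f2, h4], fun y hy => ?_⟩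
    · rw [f1, (h1 x hx).2]
      have := hhi x hx
      by_cases h : σ hi i₀ x = 1
      · simp [hU₀, hx, h]
      · simp only [hU₀, Finset.mem_filter, h, and_false, if_false]; omega
    · rw [h5 y hy, Finset.filter_true_of_mem (s := U₀)]
      intro x hx; simp [hU₀] at hx; exact hx.1
  have hDn : GreedyDone (fun x => σ hi i₀ x) (σ adj) N i₀ U₀ σ ρ :=
    ⟨fun x hx h h' => absurd (by simp [hU₀, hx, h]) h', fun _ _ => by rw [f5], fun _ _ => by rw [f6]⟩
  set Y := ∑ y ∈ Finset.range N, wt y with hY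
  have hY0 : 0 ≤ Y := Finset.sum_nonneg fun y hy => hw y (by simpa using hy)
  clear_value U₀
  have hU₀' : ∀ x ∈ U₀, x < N ∧ σ hi i₀ x = 1 := fun x hx => by simpa [hU₀] using hx
  -- the greedy rounds
  refine wp_loop N (fun t π q => ∃ U ⊆ U₀, GreedyState (σ adj) N U π ∧
      GreedyDone (fun x => σ hi i₀ x) (σ adj) N i₀ U σ π ∧ (U.card ≤ N - t) ∧
      (((Finset.range N).filter fun y => π inD i₀ y ≠ 0).card : ℝ) * θ + Y * harmonic U.card ≤
        Y * harmonic N ∧ q + N * U.card ≤ r' + t * (2 * N + 1) + N * N)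
    (by simpa [f3] using hn) (fun _ => by omega) ?_ ?_ ?_
  · have hle := hU₀N U₀ le_rfl
    refine ⟨U₀, le_rfl, hG, hDn, by simpa using hle, ?_, by nlinarith⟩
    rw [f5, Finset.filter_false_of_mem (by simpa using hD)]
    simp only [Finset.card_empty, Nat.cast_zero, zero_mul, zero_add]
    refine mul_le_mul_of_nonneg_left ?_ hY0
    exact_mod_cast harmonic_mono hle
  · rintro t ht π q hfr ⟨U, hUU, h7, h8, h9, h10, h11⟩
    have g2 : π i = σ i := by rw [← f7]; simpa using hfr i (by decide)
    have g3 : π n = σ n := by rw [← f3]; simpa using hfr n (by decide)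
    have g4 : π adj = σ adj := by rw [← f4]; simpa using hfr adj (by decide)
    have hG' : GreedyState (σ adj) N U (π.set Loc.t 0 0 t) :=
      ⟨by simpa using h7.need, by simpa using h7.left, by simpa using h7.count⟩
    have hD' : GreedyDone (fun x => σ hi i₀ x) (σ adj) N i₀ U σ (π.set Loc.t 0 0 t) :=
      ⟨by simpa using h8.hit, by simpa using h8.inD_other, by simpa using h8.rep_other⟩
    rw [wp_when]
    simp only [val_rd0, Mem.set_of_ne, ne_eq, reduceCtorEq, not_false_eq_true, h7.left]
    refine ⟨fun hne => ?_, fun he => ?_⟩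
    · have hUne : U.Nonempty := Finset.card_ne_zero.1 hne
      refine wp_use (greedy_spec_round (M := M) (U := U) (by simpa [g3] using hn) (by simpa [g2] using hi₀) hNM
        (fun x hx => (hU₀' x (hUU hx)).1) hUne
        (fun x hx => ⟨x, (hU₀' x (hUU hx)).1, by simp [InNbhd]⟩)
        (by simpa [g4] using hG') (by simpa [g4] using hD')) ?_
      simp only [Mem.set_of_ne, ne_eq, reduceCtorEq, not_false_eq_true, g4]
      rintro κ k - ⟨b, hb, hmax, hbne, h12, h13, h14, h15⟩
      have hadd := Finset.card_filter_add_card_filter_not (s := U) (fun x => InNbhd (σ adj) x b)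
      have hpos := Finset.card_pos.2 hbne
      refine ⟨_, (Finset.filter_subset _ _).trans hUU, h12, h13, by omega, ?_, ?_⟩
      · have hr := greedy_round U (Finset.range N) (InNbhd (σ adj)) wt θ b
          (fun y hy => hw y (by simpa using hy))
          (fun x hx => hθ x (hU₀' x (hUU hx)).1 (hU₀' x (hUU hx)).2)
          (fun y hy => hmax y (by simpa using hy))
        have hh := harmonic_sub_le (U.filter fun x => ¬ InNbhd (σ adj) x b).card
          (U.filter (InNbhd (σ adj) · b)).card
        rw [add_comm (U.filter fun x => ¬ InNbhd (σ adj) x b).card, hadd] at hh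
        have hc := card_set_le N (π inD i₀) b
        have hκ : ∀ y, κ inD i₀ y = if y = b then 1 else π inD i₀ y := by
          intro y; rw [h14]; simp
        simp only [hκ]
        have hUpos : (0 : ℝ) < U.card := by exact_mod_cast Finset.card_pos.2 hUne
        have hc' : (((Finset.range N).filter fun y =>
            (if y = b then 1 else π inD i₀ y) ≠ 0).card : ℝ) ≤
            ((Finset.range N).filter fun y => π inD i₀ y ≠ 0).card + 1 := by exact_mod_cast hc
        -- Combines |U| θ ≤ Y · (number of newly hit sets) with `harmonic_sub_le` and cancels |U|.
        have hθY : θ ≤ Y * ((harmonic U.card : ℝ) -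
            harmonic (U.filter fun x => ¬ InNbhd (σ adj) x b).card) := by
          have := hr.trans (mul_le_mul_of_nonneg_left hh hY0)
          have h16 : (U.card : ℝ) * θ ≤ U.card * (Y * ((harmonic U.card : ℝ) -
            harmonic (U.filter fun x => ¬ InNbhd (σ adj) x b).card)) := by
            rw [← hY] at this; linarith
          exact le_of_mul_le_mul_left h16 hUpos
        have := mul_le_mul_of_nonneg_right hc' hθ0
        linarith
      · have e : k + N * (U.filter fun x => ¬ InNbhd (σ adj) x b).card =
          q + 1 + 2 * N + N * U.card := h15
        nlinarith
    · refine ⟨U, hUU, hG', hD', by omega, by simpa using h10, by nlinarith⟩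
  · rintro π q hfr ⟨U, hUU, h7, h8, h9, h10, h11⟩
    -- Each round hits at least one set, so N rounds exhaust all of them.
    have hU : U = ∅ := by rw [← Finset.card_eq_zero]; omega
    subst hU
    refine ⟨fun x hx hH => h8.hit x hx hH (by simp), h8.inD_other, h8.rep_other, ?_, ?_⟩
    · simpa using h10
    · simp only [Finset.card_empty, mul_zero, add_zero] at h11
      rcases Nat.eq_zero_or_pos N with hN | hN
      · subst hN; simp at *; omega
      · nlinarith

end HittingSet
/-! ### Dijkstra's algorithm -/

section Dijkstra
open Loc

/-- A lower bound function for the distances from `w` with respect to the weights `D`. -/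
def IsPotential (N w : ℕ) (D : ℕ → ℕ → ℕ) (g : ℕ → ℕ) : Prop :=
  g w = 0 ∧ (∀ x < N, g x ≤ D w x) ∧ ∀ x < N, ∀ y < N, g y ≤ g x + D x y

/-- The vertices processed before the entry `q` of the bucket `b`. -/
def Processed (b q : ℕ) (τ : Mem Loc) (x : ℕ) : Prop :=
  τ d x 0 < b ∨ (τ d x 0 = b ∧ ∃ i < q, τ bucket b i = x)

/-- The invariant of Dijkstra's algorithm. -/
structure DijkstraInv (N w : ℕ) (ct : ℕ → ℕ) (nb D : ℕ → ℕ → ℕ) (b q : ℕ) (Done : Finset ℕ)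
    (k : ℕ) (τ : Mem Loc) : Prop where
  source : τ d w 0 = 0
  le : ∀ x < N, τ d x 0 ≤ D w x
  sound : ∀ g, IsPotential N w D g → ∀ x < N, g x ≤ τ d x 0
  entry : ∀ c < 4 * N, ∀ i < τ bcnt c 0, τ bucket c i < N ∧ τ d (τ bucket c i) 0 ≤ c
  inj : ∀ c < 4 * N, ∀ i < τ bcnt c 0, ∀ j < τ bcnt c 0, τ bucket c i = τ bucket c j → i = j
  mem : ∀ x < N, τ d x 0 < 4 * N → ∃ i < τ bcnt (τ d x 0) 0, τ bucket (τ d x 0) i = x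
  done : ∀ x ∈ Done, x < N ∧ Processed b q τ x
  relaxed : ∀ x < N, Processed b q τ x → ∀ e < ct x, τ d (nb x e) 0 ≤ τ d x 0 + D x (nb x e)
  total : ∑ c ∈ Finset.range (4 * N), τ bcnt c 0 ≤ N + k

variable {N w₀ b q k : ℕ} {ct : ℕ → ℕ} {nb D : ℕ → ℕ → ℕ} {Done : Finset ℕ} {τ : Mem Loc}

theorem DijkstraInv.congr {τ' : Mem Loc} (h : DijkstraInv N w₀ ct nb D b q Done k τ)
    (h1 : τ' d = τ d) (h2 : τ' bcnt = τ bcnt) (h3 : τ' bucket = τ bucket) :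
    DijkstraInv N w₀ ct nb D b q Done k τ' := by
  obtain ⟨a1, a2, a3, a4, a5, a6, a7, a8, a9⟩ := h
  unfold Processed at a7 a8
  constructor <;> (try unfold Processed) <;> simp only [h1, h2, h3] <;> assumption

theorem DijkstraInv.le_inf (h : DijkstraInv N w₀ ct nb D b q Done k τ) (hw : w₀ < N)
    (hD : ∀ x < N, ∀ y < N, D x y ≤ 4 * N) {x : ℕ} (hx : x < N) : τ d x 0 ≤ 4 * N :=
  (h.le x hx).trans (hD _ hw _ hx)

theorem DijkstraInv.bcnt_le (h : DijkstraInv N w₀ ct nb D b q Done k τ) {c : ℕ}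
    (hc : c < 4 * N) : τ bcnt c 0 ≤ N + k :=
  (Finset.single_le_sum (f := fun c => τ bcnt c 0) (fun _ _ => Nat.zero_le _)
    (Finset.mem_range.2 hc)).trans h.total

theorem sum_set_succ {m c : ℕ} (f : ℕ → ℕ) (hc : c < m) :
    ∑ i ∈ Finset.range m, (if i = c then f c + 1 else f i) = ∑ i ∈ Finset.range m, f i + 1 := by
  have : ∀ i, (if i = c then f c + 1 else f i) = f i + if i = c then 1 else 0 := by
    intro i; split_ifs with h <;> simp [h]
  simp [this, Finset.sum_add_distrib, hc]

/-- Distinct vertices have weight at least 1, so a relaxation from bucket b only touches later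
buckets. The processed vertices, whose edges already satisfy their inequalities, keep their values,
and lowering the value of y can only help the inequalities that end in y. The entry of y with its
old value stays behind as a stale entry and is skipped later. -/
theorem DijkstraInv.relax {x y : ℕ} (h : DijkstraInv N w₀ ct nb D b q Done k τ)
    (hpos : ∀ x < N, ∀ y < N, x ≠ y → 1 ≤ D x y) (hw : w₀ < N)
    (hD : ∀ x < N, ∀ y < N, D x y ≤ 4 * N) (hx : x < N) (hy : y < N) (hdx : τ d x 0 = b)
    (hv : b + D x y < τ d y 0) {τ' : Mem Loc}
    (h1 : ∀ z, τ' d z 0 = if z = y then b + D x y else τ d z 0)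
    (h2 : ∀ c, τ' bcnt c 0 = if c = b + D x y then τ bcnt (b + D x y) 0 + 1 else τ bcnt c 0)
    (h3 : ∀ c i, τ' bucket c i =
      if c = b + D x y ∧ i = τ bcnt (b + D x y) 0 then y else τ bucket c i) :
    DijkstraInv N w₀ ct nb D b q Done (k + 1) τ' ∧ b < b + D x y := by
  have hxy : x ≠ y := by rintro rfl; omega
  have hbv : b < b + D x y := by have := hpos x hx y hy hxy; omega
  have hle := h.le_inf hw hD hy
  obtain ⟨v, hv'⟩ : ∃ v, b + D x y = v := ⟨_, rfl⟩
  have hdle : ∀ z, τ' d z 0 ≤ τ d z 0 := by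
    intro z; rw [h1]; split_ifs with hz
    · rw [hz]; omega
    · exact le_rfl
  -- The new entry lies in a later bucket, and y has a value greater than b both before and after
  -- the change. So y is unprocessed in either state.
  have hproc : ∀ z, Processed b q τ' z ↔ Processed b q τ z := by
    intro z
    unfold Processed
    have e : ∀ i, τ' bucket b i = τ bucket b i := fun i => by
      rw [h3, if_neg (by omega)]
    simp only [e]
    by_cases hz : z = y
    · have e1 : τ' d z 0 = b + D x y := by rw [h1, if_pos hz]
      rw [← hz] at hv
      constructor
      · rintro (h | ⟨h, -⟩) <;> omega
      · rintro (h | ⟨h, -⟩) <;> omega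
    · rw [h1, if_neg hz]
  refine ⟨⟨?_, ?_, ?_, ?_, ?_, ?_, ?_, ?_, ?_⟩, hbv⟩
  · rw [h1, if_neg]
    · exact h.source
    · rintro rfl; rw [h.source] at hv; omega
  · exact fun z hz => (hdle z).trans (h.le z hz)
  · intro g hg z hz
    rw [h1]
    split_ifs with hzy
    · subst hzy
      have := hg.2.2 x hx z hz
      have := h.sound g hg x hx
      omega
    · exact h.sound g hg z hz
  · intro c hc i hi
    rw [h2] at hi
    rw [h3]
    by_cases hcv : c = b + D x y ∧ i = τ bcnt (b + D x y) 0
    · rw [if_pos hcv]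
      exact ⟨hy, by rw [h1, if_pos rfl]; omega⟩
    · rw [if_neg hcv]
      have hi' : i < τ bcnt c 0 := by
        by_cases hc' : c = b + D x y
        · rw [if_pos hc'] at hi
          have : i ≠ τ bcnt (b + D x y) 0 := fun h => hcv ⟨hc', h⟩
          rw [hc']; omega
        · rwa [if_neg hc'] at hi
      exact ⟨(h.entry c hc i hi').1, (hdle _).trans (h.entry c hc i hi').2⟩
  -- An entry of bucket c has a tentative distance of at most c. Before the change that of y was
  -- greater than the index of its new bucket, so y was not in that bucket yet.
  · intro c hc i hi j hj hij
    by_cases hc' : c = b + D x y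
    · subst hc'
      rw [h2, if_pos rfl] at hi hj
      simp only [h3, true_and] at hij
      by_cases hi' : i = τ bcnt (b + D x y) 0 <;> by_cases hj' : j = τ bcnt (b + D x y) 0
      · rw [hi', hj']
      · rw [if_pos hi', if_neg hj'] at hij
        have := (h.entry _ hc j (by omega)).2
        rw [← hij] at this; omega
      · rw [if_neg hi', if_pos hj'] at hij
        have := (h.entry _ hc i (by omega)).2
        rw [hij] at this; omega
      · rw [if_neg hi', if_neg hj'] at hij
        exact h.inj _ hc i (by omega) j (by omega) hij
    · rw [h2, if_neg hc'] at hi hj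
      simp only [h3, hc', false_and, if_false] at hij
      exact h.inj c hc i hi j hj hij
  · intro z hz hd
    by_cases hzy : z = y
    · refine ⟨τ bcnt (b + D x y) 0, ?_, ?_⟩
      · rw [h1, if_pos hzy, h2, if_pos rfl]; omega
      · rw [h1, if_pos hzy, h3, if_pos ⟨rfl, rfl⟩, hzy]
    · rw [h1, if_neg hzy] at hd ⊢
      obtain ⟨i, hi, hi'⟩ := h.mem z hz hd
      refine ⟨i, ?_, ?_⟩
      · rw [h2]; split_ifs with hc
        · rw [← hc]; omega
        · exact hi
      · rw [h3, if_neg, hi']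
        rintro ⟨hc, hi''⟩
        rw [hc] at hi; omega
  · exact fun z hz => ⟨(h.done z hz).1, (hproc z).2 (h.done z hz).2⟩
  · intro z hz hp e he
    have hp' := (hproc z).1 hp
    have hzy : z ≠ y := by
      rintro rfl
      rcases hp' with h | ⟨h, -⟩ <;> omega
    rw [h1 z, if_neg hzy]
    exact (hdle _).trans (h.relaxed z hz hp' e he)
  · have := sum_set_succ (fun c => τ bcnt c 0) (show b + D x y < 4 * N by omega)
    simp only [h2]
    have := h.total
    omega

/-- A vertex with tentative distance b occurs in bucket b, so once the bucket is exhausted it is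
processed. -/
theorem DijkstraInv.next_bucket (h : DijkstraInv N w₀ ct nb D b (τ bcnt b 0) Done k τ)
    (hb : b < 4 * N) : DijkstraInv N w₀ ct nb D (b + 1) 0 Done k τ := by
  have hp : ∀ x < N, Processed (b + 1) 0 τ x ↔ Processed b (τ bcnt b 0) τ x := by
    intro x hx
    unfold Processed
    constructor
    · rintro (h' | ⟨-, i, hi, -⟩)
      · rcases Nat.lt_succ_iff_lt_or_eq.1 h' with h' | h'
        · exact Or.inl h'
        · right
          obtain ⟨i, hi⟩ := h.mem x hx (by omega)
          rw [h'] at hi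
          exact ⟨h', i, hi⟩
      · omega
    · rintro (h' | ⟨h', -⟩) <;> left <;> omega
  exact ⟨h.source, h.le, h.sound, h.entry, h.inj, h.mem,
    fun x hx => ⟨(h.done x hx).1, (hp x (h.done x hx).1).2 (h.done x hx).2⟩,
    fun x hx hpx => h.relaxed x hx ((hp x hx).1 hpx), h.total⟩

theorem processed_succ {x : ℕ} : Processed b (q + 1) τ x ↔
    Processed b q τ x ∨ (τ d x 0 = b ∧ τ bucket b q = x) := by
  unfold Processed
  simp only [Nat.lt_succ_iff_lt_or_eq, or_and_right, exists_or, exists_eq_left, and_or_left,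
    or_assoc]

theorem DijkstraInv.next_entry (h : DijkstraInv N w₀ ct nb D b q Done k τ)
    {E : Finset ℕ} (hE : ∀ x ∈ E, x < N ∧ Processed b (q + 1) τ x)
    (hr : τ d (τ bucket b q) 0 = b → ∀ e < ct (τ bucket b q),
      τ d (nb (τ bucket b q) e) 0 ≤ b + D (τ bucket b q) (nb (τ bucket b q) e)) :
    DijkstraInv N w₀ ct nb D b (q + 1) E k τ := by
  refine ⟨h.source, h.le, h.sound, h.entry, h.inj, h.mem, hE, fun x hx hp => ?_, h.total⟩
  rcases processed_succ.1 hp with hp | ⟨h1, h2⟩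
  · exact h.relaxed x hx hp
  · subst h2
    rw [h1]
    exact hr h1

/-- One bucket entry is processed. -/
theorem dijkstra_entry {M s C : ℕ} {σ : Mem Loc} (hM : N + C + 8 * N + 1 ≤ M) (hw : w₀ < N)
    (hct : ∀ x, ct x = σ cnt x 0) (hnb : σ nbr = nb) (hDD : σ dhat = D)
    (hC : ∑ x ∈ Finset.range N, ct x ≤ C)
    (hnbr : ∀ x < N, ∀ e < ct x, nb x e < N)
    (hD : ∀ x < N, ∀ y < N, D x y ≤ 4 * N) (hpos : ∀ x < N, ∀ y < N, x ≠ y → 1 ≤ D x y)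
    (hb : σ Loc.b 0 0 = b) (hbN : b < 4 * N) (hq : σ Loc.q 0 0 = q) (hqb : q < σ bcnt b 0)
    (h : DijkstraInv N w₀ ct nb D b q Done (∑ x ∈ Done, ct x) σ) :
    (block [
      wr0 x (rd2 bucket §Loc.b §Loc.q),
      when (.eq (rd1 d §x) §Loc.b) (.loop e (rd1 cnt §x) (block [
        wr0 y (rd2 nbr §x §e),
        wr0 v (§Loc.b + rd2 dhat §x §y),
        when (.lt §v (rd1 d §y)) (block [
          wr1 d §y §v,
          enqueue §v §y])]))]).wp M (fun τ r => ∃ Done' : Finset ℕ,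
      DijkstraInv N w₀ ct nb D b (q + 1) Done' (∑ x ∈ Done', ct x) τ ∧
      (∀ c ≤ b, τ bcnt c 0 = σ bcnt c 0) ∧ r + ∑ x ∈ Done, ct x = s + ∑ x ∈ Done', ct x) σ s := by
  obtain ⟨x₀, hx₀⟩ : ∃ x₀, σ bucket b q = x₀ := ⟨_, rfl⟩
  have hx₀N : x₀ < N := hx₀ ▸ (h.entry b hbN q hqb).1
  simp only [wp_block_cons, wp_block_nil, wp_wr0, val_rd2, val_rd0, hb, hq, hx₀, wp_when, val_eq, val_rd1,
    Mem.set_of_ne, Mem.set_same, ne_eq, reduceCtorEq, not_false_eq_true, and_self, if_true,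
    ite_eq_right_iff, one_ne_zero, imp_false, not_not]
  refine fun _ => ⟨by omega, fun hdx => ?_, fun hdx => ?_⟩
  -- A scanned vertex is processed. As d x₀ = b, it would occur at an earlier position of the same
  -- bucket, against the distinctness of the entries. So every adjacency list is scanned at most
  -- once, which keeps the total within C.
  · have hnotin : x₀ ∉ Done := by
      intro hin
      rcases (h.done x₀ hin).2 with h' | ⟨-, i, hi, h'⟩
      · omega
      · have := h.inj b hbN i (by omega) q hqb (by rw [h', hx₀])
        omega
    have hsum : ∀ e, e ≤ ct x₀ → ∑ x ∈ Done, ct x + e ≤ C := by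
      intro e he
      have h1 : ∑ x ∈ insert x₀ Done, ct x ≤ ∑ x ∈ Finset.range N, ct x := by
        refine Finset.sum_le_sum_of_subset fun z hz => ?_
        rcases Finset.mem_insert.1 hz with rfl | hz
        · simpa using hx₀N
        · simpa using (h.done z hz).1
      rw [Finset.sum_insert hnotin] at h1
      omega
    refine wp_loop (ct x₀) (fun e τ r => DijkstraInv N w₀ ct nb D b q Done (∑ x ∈ Done, ct x + e) τ ∧
      τ d x₀ 0 = b ∧ (∀ c ≤ b, τ bcnt c 0 = σ bcnt c 0) ∧ (∀ i, τ bucket b i = σ bucket b i) ∧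
      (∀ e' < e, τ d (nb x₀ e') 0 ≤ b + D x₀ (nb x₀ e')) ∧ r = s + e) (by simp [hct]) (fun _ => ?_)
      ?_ ?_ ?_
    · have := hsum _ le_rfl; omega
    · refine ⟨h.congr (by simp) (by simp) (by simp), by simpa using hdx, by simp, by simp,
        by simp, rfl⟩
    · rintro e₀ he τ r hfr ⟨h1, h2, h3, h4, h5, h6⟩
      have f1 : τ nbr = nb := by simpa [hnb] using hfr nbr (by decide)
      have f2 : τ x 0 0 = x₀ := by rw [hfr x (by decide)]; simp
      have f3 : τ dhat = D := by simpa [hDD] using hfr dhat (by decide)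
      have f4 : τ Loc.b 0 0 = b := by rw [hfr Loc.b (by decide)]; simpa using hb
      obtain ⟨y₀, hy₀⟩ : ∃ y₀, nb x₀ e₀ = y₀ := ⟨_, rfl⟩
      have hy₀N : y₀ < N := hy₀ ▸ hnbr x₀ hx₀N e₀ he
      have hle := h1.le_inf hw hD hy₀N
      have hDle := hD x₀ hx₀N y₀ hy₀N
      have hs := hsum (e₀ + 1) he
      simp only [enqueue, wp_block_cons, wp_block_nil, wp_wr0, wp_wr1, wp_wr2, val_rd2, val_rd0, wp_when, val_rd1, val_add,
        val_lt, val_one, Mem.set_of_ne, Mem.set_same, ne_eq, reduceCtorEq, not_false_eq_true, and_self, if_true,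
        ite_eq_right_iff, one_ne_zero, imp_false, not_not, f1, f2, f3, f4, hy₀]
      intro hB
      have hbM : b + D x₀ y₀ ≤ M := by omega
      refine ⟨by omega, fun _ => ⟨hbM, fun hv _ => ⟨hbM, fun _ => ⟨by omega, fun _ => ⟨?_, ?_⟩⟩⟩, fun hv => ?_⟩⟩
      · have := h1.bcnt_le (c := b + D x₀ y₀) (by omega)
        omega
      · obtain ⟨h7, h8⟩ := h1.relax hpos hw hD hx₀N hy₀N h2 hv
          (τ' := (((((τ.set e 0 0 e₀).set y 0 0 y₀).set v 0 0 (b + D x₀ y₀)).set d y₀ 0 (b + D x₀ y₀)).set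
            bucket (b + D x₀ y₀) (τ bcnt (b + D x₀ y₀) 0) y₀).set bcnt (b + D x₀ y₀) 0
              (τ bcnt (b + D x₀ y₀) 0 + 1)) (by simp) (by simp) (by simp)
        have hne : x₀ ≠ y₀ := by rintro rfl; omega
        refine ⟨h7, by simp [hne, h2], ?_, fun i => ?_, fun e' he' => ?_, by omega⟩
        · intro c hc
          rw [if_neg (by omega), h3 c hc]
        · rw [if_neg (by omega), h4]
        · split_ifs with hz
          · rw [hz.1]
          · rcases Nat.lt_succ_iff_lt_or_eq.1 he' with he' | rfl
            · exact h5 e' he'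
            · rw [hy₀] at hz; simp at hz
      · have h1' := h1.congr (τ' := ((τ.set e 0 0 e₀).set y 0 0 y₀).set v 0 0 (b + D x₀ y₀))
          (by simp) (by simp) (by simp)
        refine ⟨⟨h1'.source, h1'.le, h1'.sound, h1'.entry, h1'.inj, h1'.mem, h1'.done, h1'.relaxed,
          by have := h1'.total; omega⟩, by simpa using h2, by simpa using h3, by simpa using h4,
          fun e' he' => ?_, by omega⟩
        rcases Nat.lt_succ_iff_lt_or_eq.1 he' with he' | rfl
        · exact h5 e' he'
        · rw [hy₀]; omega
    · rintro τ r - ⟨h1, h2, h3, h4, h5, h6⟩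
      refine ⟨insert x₀ Done, ?_, h3, ?_⟩
      · rw [Finset.sum_insert hnotin, add_comm (ct x₀)]
        have hbq : τ bucket b q = x₀ := by rw [h4, hx₀]
        refine h1.next_entry (fun z hz => ?_) (fun _ => by rw [hbq]; exact h5)
        rw [processed_succ]
        rcases Finset.mem_insert.1 hz with rfl | hz
        · exact ⟨hx₀N, Or.inr ⟨h2, hbq⟩⟩
        · exact ⟨(h1.done z hz).1, Or.inl (h1.done z hz).2⟩
      · rw [Finset.sum_insert hnotin, h6]; ring
  · refine ⟨Done, ?_, fun _ _ => trivial, rfl⟩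
    have h' := h.congr (τ' := σ.set x 0 0 x₀) (by simp) (by simp) (by simp)
    refine h'.next_entry (fun z hz => ?_) fun h1 => ?_
    · rw [processed_succ]
      exact ⟨(h'.done z hz).1, Or.inl (h'.done z hz).2⟩
    · simp [hx₀] at h1; exact absurd h1 hdx

/-- No path or distance occurs in the specification. Upper bounds follow from the edge inequalities
of f, and lower bounds from the fact that relaxation preserves every potential below the tentative
values. The weights stay fixed until the final update of row and column w₀. There are at most N + C
bucket entries and C scanned list entries; the other loops are linear in N. -/
theorem dijkstra_spec {M s C : ℕ} {σ : Mem Loc} (hM : N + C + 8 * N + 1 ≤ M) (hw : w₀ < N)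
    (hn : σ n 0 0 = N) (hinf : σ inf 0 0 = 4 * N) (hw₀ : σ w 0 0 = w₀)
    (hnbr : ∀ x < N, ∀ e < σ cnt x 0, σ nbr x e < N)
    (hC : ∑ x ∈ Finset.range N, σ cnt x 0 ≤ C)
    (hD : ∀ x < N, ∀ y < N, σ dhat x y ≤ 4 * N)
    (hpos : ∀ x < N, ∀ y < N, x ≠ y → 1 ≤ σ dhat x y) :
    dijkstra.wp M (fun τ r => ∃ f : ℕ → ℕ, f w₀ = 0 ∧ (∀ x < N, f x ≤ σ dhat w₀ x) ∧
      (∀ x < N, ∀ e < σ cnt x 0, f (σ nbr x e) ≤ f x + σ dhat x (σ nbr x e)) ∧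
      (∀ g, IsPotential N w₀ (σ dhat) g → ∀ x < N, g x ≤ f x) ∧
      (∀ x y, τ dhat x y = if x = w₀ ∧ y < N then f y else if y = w₀ ∧ x < N then f x
        else σ dhat x y) ∧ r ≤ s + 16 * N + 2 * C) σ s := by
  unfold dijkstra
  simp only [wp_block_cons, wp_block_nil]
  -- the buckets are emptied
  refine wp_loop (4 * N) (fun t τ r => (∀ c < t, τ bcnt c 0 = 0) ∧ r = s + t) (by simpa using hinf)
    (fun _ => by omega) (by simp) ?_ ?_
  · rintro t ht τ r hfr ⟨h1, h2⟩
    simp only [wp_wr1, val_rd0, val_zero, Mem.set_same, Mem.set_of_ne, ne_eq, reduceCtorEq,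
      not_false_eq_true, and_self, if_true]
    refine fun _ => ⟨by omega, fun c hc => ?_, by omega⟩
    by_cases hct : c = t
    · simp [hct]
    · simpa [hct] using h1 c (by omega)
  rintro τ r hfr ⟨h1, rfl⟩
  have e1 : τ n = σ n := hfr n (by decide)
  have e2 : τ w = σ w := hfr w (by decide)
  have e3 : τ dhat = σ dhat := hfr dhat (by decide)
  have e4 : τ cnt = σ cnt := hfr cnt (by decide)
  have e5 : τ nbr = σ nbr := hfr nbr (by decide)
  have e6 : τ inf = σ inf := hfr inf (by decide)
  clear hfr
  -- the star is relaxed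
  refine wp_loop N (fun t ρ q => (∀ x < t, ρ d x 0 = σ dhat w₀ x) ∧ q = s + 4 * N + t)
    (by simpa [e1] using hn) (fun _ => by omega) (by simp) ?_ ?_
  · rintro t ht ρ q hfr ⟨h2, h3⟩
    have f2 : ρ w = τ w := hfr w (by decide)
    have f3 : ρ dhat = τ dhat := hfr dhat (by decide)
    simp only [wp_wr1, val_rd0, val_rd2, Mem.set_same, Mem.set_of_ne, ne_eq, reduceCtorEq,
      not_false_eq_true, and_self, if_true, f2, f3, e2, e3, hw₀]
    refine fun _ => ⟨by have := hD _ hw _ ht; omega, fun c hc => ?_, by omega⟩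
    by_cases hct : c = t
    · simp [hct]
    · simpa [hct] using h2 c (by omega)
  rintro ρ q hfr ⟨h2, rfl⟩
  have f1 : ρ n = σ n := by rw [← e1]; exact hfr n (by decide)
  have f2 : ρ w = σ w := by rw [← e2]; exact hfr w (by decide)
  have f3 : ρ dhat = σ dhat := by rw [← e3]; exact hfr dhat (by decide)
  have f4 : ρ cnt = σ cnt := by rw [← e4]; exact hfr cnt (by decide)
  have f5 : ρ nbr = σ nbr := by rw [← e5]; exact hfr nbr (by decide)
  have f6 : ρ inf = σ inf := by rw [← e6]; exact hfr inf (by decide)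
  have f7 : ρ bcnt = τ bcnt := hfr bcnt (by decide)
  clear hfr
  simp only [wp_wr1, val_rd0, val_zero, f2, hw₀]
  refine fun _ => ⟨by omega, ?_⟩
  -- The source gets 0 separately, since the diagonal of the estimate may still hold the value ∞.
  set d₀ := fun x => if x = w₀ then 0 else σ dhat w₀ x with hd₀
  have hd₀le : ∀ x < N, d₀ x ≤ 4 * N := by
    intro x hx; simp only [hd₀]; split_ifs
    · omega
    · exact hD _ hw _ hx
  -- the initial entries
  refine wp_loop N (fun t π k => (∀ x < N, π d x 0 = d₀ x) ∧
      (∀ c < 4 * N, ∀ i < π bcnt c 0, π bucket c i < t ∧ d₀ (π bucket c i) = c) ∧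
      (∀ c < 4 * N, ∀ i < π bcnt c 0, ∀ j < π bcnt c 0, π bucket c i = π bucket c j → i = j) ∧
      (∀ x < t, d₀ x < 4 * N → ∃ i < π bcnt (d₀ x) 0, π bucket (d₀ x) i = x) ∧
      ∑ c ∈ Finset.range (4 * N), π bcnt c 0 ≤ t ∧ k = s + 4 * N + N + t)
    (by simpa [f1] using hn) (fun _ => by omega) ?_ ?_ ?_
  · have hz : ∀ c < 4 * N, (ρ.set d w₀ 0 0) bcnt c 0 = 0 := by
      intro c hc; simpa [f7] using h1 c hc
    refine ⟨fun x hx => ?_, fun c hc i hi => ?_, fun c hc i hi => ?_, by simp, ?_, rfl⟩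
    · simp only [Mem.set_same, hd₀]; split_ifs <;> simp_all
    · rw [hz c hc] at hi; omega
    · rw [hz c hc] at hi; omega
    · rw [Finset.sum_eq_zero fun c hc => hz c (by simpa using hc)]
  · rintro t ht π k hfr ⟨h3, h4, h5, h6, h7, h8⟩
    have g6 : π inf = σ inf := by rw [← f6, hfr inf (by decide)]; simp
    have hb : ∀ c < 4 * N, π bcnt c 0 ≤ t := fun c hc =>
      (Finset.single_le_sum (f := fun c => π bcnt c 0) (fun _ _ => Nat.zero_le _)
        (Finset.mem_range.2 hc)).trans h7
    simp only [enqueue, wp_block_cons, wp_block_nil, wp_when, wp_wr1, wp_wr2, val_lt, val_rd0, val_rd1, val_add, val_one,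
      Mem.set_same, Mem.set_of_ne, ne_eq, reduceCtorEq,
      not_false_eq_true, and_self, if_true, g6, hinf, h3 t ht, ite_eq_right_iff, one_ne_zero,
      imp_false, not_lt]
    refine ⟨fun hlt _ => ⟨by omega, fun _ => ⟨by have := hb _ (not_le.1 hlt); omega, h3, ?_, ?_, ?_, ?_,
      by omega⟩⟩, fun hge => ⟨h3, fun c hc i hi => ?_, h5, fun x hx hxd => ?_, by omega, by omega⟩⟩
    · intro c hc i hi
      by_cases hci : c = d₀ t ∧ i = π bcnt (d₀ t) 0
      · rw [if_pos hci]; exact ⟨by omega, hci.1.symm⟩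
      · rw [if_neg hci]
        have hi' : i < π bcnt c 0 := by
          simp only [and_true] at hi
          split_ifs at hi with h
          · have : i ≠ π bcnt (d₀ t) 0 := fun h' => hci ⟨h, h'⟩
            rw [h]; omega
          · exact hi
        have := h4 c hc i hi'
        exact ⟨by omega, this.2⟩
    · intro c hc i hi j hj hij
      simp only [and_true] at hi hj
      by_cases hc' : c = d₀ t
      · subst hc'
        rw [if_pos rfl] at hi hj
        simp only [true_and] at hij
        by_cases hi' : i = π bcnt (d₀ t) 0 <;> by_cases hj' : j = π bcnt (d₀ t) 0
        · rw [hi', hj']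
        · rw [if_pos hi', if_neg hj'] at hij
          have := (h4 _ hc j (by omega)).1
          omega
        · rw [if_neg hi', if_pos hj'] at hij
          have := (h4 _ hc i (by omega)).1
          omega
        · rw [if_neg hi', if_neg hj'] at hij
          exact h5 _ hc i (by omega) j (by omega) hij
      · rw [if_neg hc'] at hi hj
        simp only [hc', false_and, if_false] at hij
        exact h5 c hc i hi j hj hij
    · intro x hx hxd
      simp only [and_true]
      rcases Nat.lt_succ_iff_lt_or_eq.1 hx with hx | rfl
      · obtain ⟨i, hi, hi'⟩ := h6 x hx hxd
        refine ⟨i, ?_, ?_⟩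
        · split_ifs with h
          · rw [← h]; omega
          · exact hi
        · rw [if_neg, hi']
          rintro ⟨h, h'⟩
          rw [h] at hi; omega
      · exact ⟨π bcnt (d₀ x) 0, by simp, by simp⟩
    · have := sum_set_succ (fun c => π bcnt c 0) (not_le.1 hlt)
      simp only [and_true]
      omega
    · have := h4 c hc i hi
      exact ⟨by omega, this.2⟩
    · rcases Nat.lt_succ_iff_lt_or_eq.1 hx with hx | rfl
      · exact h6 x hx hxd
      · omega
  rintro π k hfr ⟨h3, h4, h5, h6, h7, rfl⟩
  have g1 : π n = σ n := by rw [← f1, hfr n (by decide)]; simp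
  have g2 : π w = σ w := by rw [← f2, hfr w (by decide)]; simp
  have g3 : π dhat = σ dhat := by rw [← f3, hfr dhat (by decide)]; simp
  have g4 : π cnt = σ cnt := by rw [← f4, hfr cnt (by decide)]; simp
  have g5 : π nbr = σ nbr := by rw [← f5, hfr nbr (by decide)]; simp
  have g6 : π inf = σ inf := by rw [← f6, hfr inf (by decide)]; simp
  clear hfr
  have hI : DijkstraInv N w₀ (fun x => σ cnt x 0) (σ nbr) (σ dhat) 0 0 ∅ 0 π := by
    have hnp : ∀ x < N, ¬ Processed 0 0 π x := by
      rintro x hx (h | ⟨-, i, hi, -⟩) <;> omega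
    refine ⟨by rw [h3 _ hw]; simp [hd₀], fun x hx => ?_, fun g hg x hx => ?_, fun c hc i hi => ?_,
      h5, fun x hx hxd => ?_, by simp, fun x hx h => absurd h (hnp x hx), h7⟩
    · rw [h3 x hx]; simp only [hd₀]; split_ifs <;> omega
    · rw [h3 x hx]; simp only [hd₀]; split_ifs with h
      · rw [h, hg.1]
      · exact hg.2.1 x hx
    · have := h4 c hc i hi
      exact ⟨this.1, by rw [h3 _ this.1]; exact this.2.le⟩
    · rw [h3 x hx] at hxd ⊢
      exact h6 x hx hxd
  -- the main loop
  refine wp_loop (4 * N) (fun b κ l => ∃ Done, DijkstraInv N w₀ (fun x => σ cnt x 0) (σ nbr)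
      (σ dhat) b 0 Done (∑ x ∈ Done, σ cnt x 0) κ ∧
      l ≤ s + 6 * N + b + ∑ c ∈ Finset.range b, κ bcnt c 0 + ∑ x ∈ Done, σ cnt x 0)
    (by simpa [g6] using hinf) (fun _ => by omega) ?_ ?_ ?_
  · exact ⟨∅, by simpa using hI, by simp; omega⟩
  · rintro b hb κ l hfr ⟨Done, h8, h9⟩
    have i2 : κ w = σ w := by rw [← g2]; exact hfr w (by decide)
    have i3 : κ dhat = σ dhat := by rw [← g3]; exact hfr dhat (by decide)
    have i4 : κ cnt = σ cnt := by rw [← g4]; exact hfr cnt (by decide)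
    have i5 : κ nbr = σ nbr := by rw [← g5]; exact hfr nbr (by decide)
    have h10 : DijkstraInv N w₀ (fun x => σ cnt x 0) (σ nbr) (σ dhat) b 0 Done
      (∑ x ∈ Done, σ cnt x 0) (κ.set Loc.b 0 0 b) := h8.congr (by simp) (by simp) (by simp)
    have hDC : ∀ {E : Finset ℕ}, (∀ x ∈ E, x < N) → ∑ x ∈ E, σ cnt x 0 ≤ C := fun hE =>
      (Finset.sum_le_sum_of_subset fun x hx => by simpa using hE x hx).trans hC
    refine wp_loop (κ bcnt b 0) (fun q μ m => ∃ Done', DijkstraInv N w₀ (fun x => σ cnt x 0) (σ nbr)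
      (σ dhat) b q Done' (∑ x ∈ Done', σ cnt x 0) μ ∧ (∀ c ≤ b, μ bcnt c 0 = κ bcnt c 0) ∧
      m + ∑ x ∈ Done, σ cnt x 0 = l + 1 + q + ∑ x ∈ Done', σ cnt x 0) (by simp) (fun _ => ?_)
      ⟨Done, h10, by simp, rfl⟩ ?_ ?_
    · have := h8.bcnt_le hb
      have := hDC fun x hx => (h8.done x hx).1
      omega
    · rintro q hq μ m hfr' ⟨Done', h11, h12, h13⟩
      have j3 : μ dhat = σ dhat := by rw [← i3, hfr' dhat (by decide)]; simp
      have j4 : μ cnt = σ cnt := by rw [← i4, hfr' cnt (by decide)]; simp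
      have j5 : μ nbr = σ nbr := by rw [← i5, hfr' nbr (by decide)]; simp
      have j6 : μ Loc.b 0 0 = b := by rw [hfr' Loc.b (by decide)]; simp
      refine wp_mono _ (dijkstra_entry (N := N) (w₀ := w₀) (b := b) (q := q) (Done := Done')
        (ct := fun x => σ cnt x 0) (nb := σ nbr) (D := σ dhat) (C := C) (by omega) hw (by simp [j4])
        (by simp [j5]) (by simp [j3]) hC hnbr hD hpos (by simpa using j6) hb (by simp)
        (by simpa [h12 b le_rfl] using hq) (h11.congr (by simp) (by simp) (by simp))) ?_
      rintro ν o ⟨Done'', h15, h16, h17⟩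
      exact ⟨Done'', h15, fun c hc => by rw [h16 c hc]; simpa using h12 c hc, by omega⟩
    · rintro μ m - ⟨Done', h11, h12, h13⟩
      rw [← h12 b le_rfl] at h11
      refine ⟨Done', h11.next_bucket hb, ?_⟩
      have h14 : ∑ c ∈ Finset.range b, μ bcnt c 0 = ∑ c ∈ Finset.range b, κ bcnt c 0 :=
        Finset.sum_congr rfl fun c hc => h12 c (Finset.mem_range.1 hc).le
      rw [Finset.sum_range_succ, h14, h12 b le_rfl]
      omega
  rintro κ l hfr ⟨Done, h8, h9⟩
  have i1 : κ n = σ n := by rw [← g1]; exact hfr n (by decide)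
  have i2 : κ w = σ w := by rw [← g2]; exact hfr w (by decide)
  have i3 : κ dhat = σ dhat := by rw [← g3]; exact hfr dhat (by decide)
  have hDC : ∑ x ∈ Done, σ cnt x 0 ≤ C :=
    (Finset.sum_le_sum_of_subset fun x hx => by simpa using (h8.done x hx).1).trans hC
  have hle : ∀ x < N, κ d x 0 ≤ 4 * N := fun x hx => h8.le_inf hw hD hx
  -- the estimates are updated
  refine wp_loop N (fun t μ m => (∀ x y, μ dhat x y = if x = w₀ ∧ y < t then κ d y 0 else
      if y = w₀ ∧ x < t then κ d x 0 else σ dhat x y) ∧ m = l + t)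
    (by simpa [i1] using hn) (fun _ => by omega) (by simp [i3]) ?_ ?_
  · rintro t ht μ m hfr' ⟨h10, h11⟩
    have j1 : μ w = κ w := hfr' w (by decide)
    have j2 : μ d = κ d := hfr' d (by decide)
    have := hle t ht
    simp only [wp_block_cons, wp_block_nil, wp_wr2, val_rd0, val_rd1, Mem.set_same, Mem.set_of_ne, ne_eq, reduceCtorEq,
      not_false_eq_true, and_self, if_true, j1, j2, i2, hw₀]
    refine fun _ => ⟨by omega, fun _ => ⟨by omega, fun x y => ?_, by omega⟩⟩
    rw [h10]
    clear * -
    grind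
  · rintro μ m - ⟨h10, h11⟩
    refine ⟨fun x => κ d x 0, h8.source, h8.le, fun x hx e he => ?_, h8.sound, h10, ?_⟩
    -- A vertex with the value 4 N counts as unreached and is never enqueued. Its edge inequalities
    -- hold because no value exceeds 4 N.
    · by_cases hxd : κ d x 0 < 4 * N
      · exact h8.relaxed x hx (Or.inl hxd) e he
      · have := hle _ (hnbr x hx e he)
        show κ d _ 0 ≤ κ d _ 0 + _
        omega
    · have := h8.total; omega

end Dijkstra
/-! ### Truncated distances and distance estimates -/

section Distances

/-- All edges of `H` are between vertices `< N`. -/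
def OnRange (H : SimpleGraph ℕ) (N : ℕ) : Prop := ∀ x y, H.Adj x y → x < N

open Classical in
/-- The distance in `H`, with the number `4 N` in the role of `∞`. -/
noncomputable def tdist (H : SimpleGraph ℕ) (N x y : ℕ) : ℕ :=
  if H.Reachable x y then H.dist x y else 4 * N

variable {H : SimpleGraph ℕ} {N : ℕ}

theorem tdist_of_reachable {x y : ℕ} (h : H.Reachable x y) : tdist H N x y = H.dist x y := if_pos h

theorem tdist_of_not_reachable {x y : ℕ} (h : ¬ H.Reachable x y) : tdist H N x y = 4 * N :=
  if_neg h

theorem tdist_self (x : ℕ) : tdist H N x x = 0 := by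
  rw [tdist_of_reachable (SimpleGraph.Reachable.refl x)]; simp

theorem tdist_comm (x y : ℕ) : tdist H N x y = tdist H N y x := by
  unfold tdist; rw [SimpleGraph.reachable_comm, SimpleGraph.dist_comm]

/-- A shortest path has distinct vertices. Each of them is below N: it is x itself, or it is joined
to x by a walk and hence is the end of some edge. -/
theorem dist_lt_of_onRange (hH : OnRange H N) {x y : ℕ} (hx : x < N) (h : H.Reachable x y) :
    H.dist x y < N := by
  obtain ⟨p, hp, hl⟩ := h.exists_path_of_dist
  have hsub : p.support.toFinset ⊆ Finset.range N := by
    intro z hz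
    rw [List.mem_toFinset] at hz
    rw [Finset.mem_range]
    by_cases hzx : z = x
    · omega
    · have : ∃ q : H.Walk x z, True := ⟨p.takeUntil z hz, trivial⟩
      obtain ⟨q, -⟩ := this
      obtain ⟨w, hw⟩ := (SimpleGraph.Walk.reachable q.reverse).exists_isPath
      cases w with
      | nil => exact absurd rfl hzx
      | cons h' _ => exact hH _ _ h'
  have := Finset.card_le_card hsub
  rw [List.toFinset_card_of_nodup hp.support_nodup, SimpleGraph.Walk.length_support,
    Finset.card_range] at this
  omega

theorem tdist_le (hH : OnRange H N) {x y : ℕ} (hx : x < N) : tdist H N x y ≤ 4 * N := by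
  by_cases h : H.Reachable x y
  · rw [tdist_of_reachable h]; have := dist_lt_of_onRange hH hx h; omega
  · rw [tdist_of_not_reachable h]

theorem reachable_of_tdist_lt {x y : ℕ} (h : tdist H N x y < 4 * N) : H.Reachable x y := by
  by_contra h'; rw [tdist_of_not_reachable h'] at h; omega

theorem tdist_lt_of_reachable (hH : OnRange H N) {x y : ℕ} (hx : x < N) (h : H.Reachable x y) :
    tdist H N x y < N := by
  rw [tdist_of_reachable h]; exact dist_lt_of_onRange hH hx h

theorem tdist_triangle (hH : OnRange H N) {x : ℕ} (hx : x < N) (y z : ℕ) :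
    tdist H N x z ≤ tdist H N x y + tdist H N y z := by
  by_cases h1 : H.Reachable x y
  · by_cases h2 : H.Reachable y z
    · rw [tdist_of_reachable h1, tdist_of_reachable h2, tdist_of_reachable (h1.trans h2)]
      obtain ⟨p, hp⟩ := h1.exists_walk_length_eq_dist
      obtain ⟨q, hq⟩ := h2.exists_walk_length_eq_dist
      rw [← hp, ← hq, ← SimpleGraph.Walk.length_append]
      exact SimpleGraph.dist_le _
    · have := tdist_le (y := z) hH hx
      rw [tdist_of_not_reachable h2]; omega
  · have := tdist_le (y := z) hH hx
    rw [tdist_of_not_reachable h1]; omega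

theorem tdist_pos {x y : ℕ} (hx : x < N) (hxy : x ≠ y) : 1 ≤ tdist H N x y := by
  by_cases h : H.Reachable x y
  · rw [tdist_of_reachable h]; exact h.pos_dist_of_ne hxy
  · rw [tdist_of_not_reachable h]; omega

theorem tdist_adj {x y : ℕ} (h : H.Adj x y) : tdist H N x y = 1 := by
  rw [tdist_of_reachable h.reachable, SimpleGraph.dist_eq_one_iff_adj.2 h]

/-- `p 0, …, p m` is a walk from `x` to `y` in `H`. -/
def IsRoute (H : SimpleGraph ℕ) (p : ℕ → ℕ) (m x y : ℕ) : Prop :=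
  p 0 = x ∧ p m = y ∧ ∀ i < m, H.Adj (p i) (p (i + 1))

theorem exists_route {x y : ℕ} (h : H.Reachable x y) : ∃ p, IsRoute H p (H.dist x y) x y := by
  obtain ⟨p, hp⟩ := h.exists_walk_length_eq_dist
  refine ⟨p.getVert, by simp, by rw [← hp]; simp, fun i hi => p.adj_getVert_succ (by omega)⟩

theorem IsRoute.reachable_aux {p : ℕ → ℕ} {m x y : ℕ} (h : IsRoute H p m x y) (i : ℕ) :
    ∀ j, i + j ≤ m → ∃ w : H.Walk (p i) (p (i + j)), w.length = j
  | 0, _ => ⟨SimpleGraph.Walk.nil, rfl⟩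
  | j + 1, hj => by
      obtain ⟨w, hw⟩ := h.reachable_aux i j (by omega)
      exact ⟨w.concat (h.2.2 (i + j) (by omega)), by simp [hw]⟩

theorem IsRoute.tdist_le {p : ℕ → ℕ} {m x y i j : ℕ} (h : IsRoute H p m x y) (hij : i ≤ j)
    (hj : j ≤ m) : tdist H N (p i) (p j) ≤ j - i := by
  have key := h.reachable_aux i (j - i) (by omega)
  rw [show i + (j - i) = j by omega] at key
  obtain ⟨w, hw⟩ := key
  rw [tdist_of_reachable w.reachable, ← hw]
  exact SimpleGraph.dist_le w

theorem IsRoute.lt {p : ℕ → ℕ} {m x y : ℕ} (hH : OnRange H N) (hy : y < N)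
    (h : IsRoute H p m x y) {i : ℕ} (hi : i ≤ m) : p i < N := by
  rcases Nat.lt_or_ge i m with hi' | hi'
  · exact hH _ _ (h.2.2 i hi')
  · rw [show i = m by omega, h.2.1]; exact hy

theorem IsRoute.reverse {p : ℕ → ℕ} {m x y : ℕ} (h : IsRoute H p m x y) :
    IsRoute H (fun i => p (m - i)) m y x := by
  refine ⟨by simpa using h.2.1, by simpa using h.1, fun i hi => ?_⟩
  have := h.2.2 (m - (i + 1)) (by omega)
  rw [show m - (i + 1) + 1 = m - i by omega] at this
  exact this.symm

/-- Every vertex has a neighbour that is closer to a given other vertex. -/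
theorem exists_pred {x y : ℕ} (h : H.Reachable x y) (hxy : x ≠ y) :
    ∃ z, H.Adj z y ∧ H.Reachable x z ∧ H.dist x z + 1 = H.dist x y := by
  obtain ⟨p, hp⟩ := exists_route h
  have hpos := h.pos_dist_of_ne hxy
  have hadj := hp.2.2 (H.dist x y - 1) (by omega)
  rw [show H.dist x y - 1 + 1 = H.dist x y by omega, hp.2.1] at hadj
  have hle := hp.tdist_le (N := 0) (i := 0) (j := H.dist x y - 1) (by omega) (by omega)
  have hr : H.Reachable x (p (H.dist x y - 1)) := h.trans hadj.symm.reachable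
  rw [hp.1, tdist_of_reachable hr] at hle
  refine ⟨_, hadj, hr, ?_⟩
  have := tdist_of_reachable (N := 0) hr
  obtain ⟨w, hw⟩ := hr.exists_walk_length_eq_dist
  have := SimpleGraph.dist_le (w.concat hadj)
  simp only [SimpleGraph.Walk.length_concat] at this
  omega

theorem tdist_anti {H' : SimpleGraph ℕ} (hH : OnRange H N) (hle : H' ≤ H) {x : ℕ} (hx : x < N)
    (y : ℕ) : tdist H N x y ≤ tdist H' N x y := by
  by_cases h : H'.Reachable x y
  · rw [tdist_of_reachable h, tdist_of_reachable (h.mono hle)]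
    obtain ⟨p, hp⟩ := h.exists_walk_length_eq_dist
    rw [← hp, ← SimpleGraph.Walk.length_map (SimpleGraph.Hom.ofLE hle) p]
    exact SimpleGraph.dist_le _
  · rw [tdist_of_not_reachable h]; exact tdist_le hH hx

/-- `D` is a symmetric matrix of upper bounds for the distances that is exact on edges. -/
structure IsEst (H : SimpleGraph ℕ) (N : ℕ) (D : ℕ → ℕ → ℕ) : Prop where
  symm : ∀ x < N, ∀ y < N, D x y = D y x
  sound : ∀ x < N, ∀ y < N, tdist H N x y ≤ D x y
  le : ∀ x < N, ∀ y < N, D x y ≤ 4 * N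
  adj : ∀ x < N, ∀ y < N, H.Adj x y → D x y ≤ 1

/-- The order on matrices. -/
def EstLE (N : ℕ) (D D' : ℕ → ℕ → ℕ) : Prop := ∀ x < N, ∀ y < N, D x y ≤ D' x y

theorem EstLE.refl (D : ℕ → ℕ → ℕ) : EstLE N D D := fun _ _ _ _ => le_rfl

theorem EstLE.trans {D D' D'' : ℕ → ℕ → ℕ} (h : EstLE N D D') (h' : EstLE N D' D'') :
    EstLE N D D'' := fun x hx y hy => (h x hx y hy).trans (h' x hx y hy)

/-- A matrix that satisfies `sound` and lies below an estimate is an estimate if it is symmetric. -/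
theorem IsEst.of_le {D D' : ℕ → ℕ → ℕ} (h : IsEst H N D) (hle : EstLE N D' D)
    (hs : ∀ x < N, ∀ y < N, D' x y = D' y x) (hsd : ∀ x < N, ∀ y < N, tdist H N x y ≤ D' x y) :
    IsEst H N D' :=
  ⟨hs, hsd, fun x hx y hy => (hle x hx y hy).trans (h.le x hx y hy),
    fun x hx y hy ha => (hle x hx y hy).trans (h.adj x hx y hy ha)⟩

theorem IsEst.pos {D : ℕ → ℕ → ℕ} (h : IsEst H N D) : ∀ x < N, ∀ y < N, x ≠ y → 1 ≤ D x y :=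
  fun x hx y hy hxy => (tdist_pos hx hxy).trans (h.sound x hx y hy)

/-- Overwriting a symmetric pair of entries by a smaller upper bound. -/
theorem IsEst.update {D D' : ℕ → ℕ → ℕ} (h : IsEst H N D) {a b v : ℕ}
    (hs : tdist H N a b ≤ v) (hv : v ≤ D a b) (ha : a < N) (hb : b < N)
    (hD' : ∀ x y, D' x y = if (x = a ∧ y = b) ∨ (x = b ∧ y = a) then v else D x y) :
    IsEst H N D' ∧ EstLE N D' D := by
  have hle : EstLE N D' D := by
    intro x hx y hy
    rw [hD']
    split_ifs with h1
    · rcases h1 with ⟨rfl, rfl⟩ | ⟨rfl, rfl⟩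
      · exact hv
      · rw [h.symm _ hx _ hy]; exact hv
    · exact le_rfl
  refine ⟨h.of_le hle (fun x hx y hy => ?_) (fun x hx y hy => ?_), hle⟩
  · rw [hD', hD', h.symm x hx y hy]
    have : ((x = a ∧ y = b) ∨ (x = b ∧ y = a)) ↔ ((y = a ∧ x = b) ∨ (y = b ∧ x = a)) := by tauto
    simp only [this]
  · rw [hD']
    split_ifs with h1
    · rcases h1 with ⟨rfl, rfl⟩ | ⟨rfl, rfl⟩
      · exact hs
      · rw [tdist_comm]; exact hs
    · exact h.sound x hx y hy

/-- An estimate dominates the distances, so the triangle inequality makes the distance from w a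
potential. This is why a search with estimated weights never underestimates. -/
theorem IsEst.isPotential {D : ℕ → ℕ → ℕ} (hH : OnRange H N) (h : IsEst H N D) {w : ℕ}
    (hw : w < N) : IsPotential N w D (tdist H N w) :=
  ⟨tdist_self w, fun x hx => h.sound w hw x hx, fun x hx y hy =>
    (tdist_triangle hH hw x y).trans (by have := h.sound x hx y hy; omega)⟩

/-- Turns the output of one search into the invariant of all later phases: the matrix remains a
symmetric valid estimate, and its entries only decrease. -/
theorem IsEst.dijkstra {D D' : ℕ → ℕ → ℕ} (hH : OnRange H N) (h : IsEst H N D) {w : ℕ}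
    (hw : w < N) {f : ℕ → ℕ} (hf : ∀ x < N, f x ≤ D w x)
    (hs : ∀ g, IsPotential N w D g → ∀ x < N, g x ≤ f x)
    (hD' : ∀ x y, D' x y = if x = w ∧ y < N then f y else if y = w ∧ x < N then f x else D x y) :
    IsEst H N D' ∧ EstLE N D' D := by
  have hs' := hs _ (h.isPotential hH hw)
  have hle : EstLE N D' D := by
    intro x hx y hy
    rw [hD']
    split_ifs with h1 h2
    · rw [h1.1]; exact hf y hy
    · rw [h2.1, h.symm x hx w hw]; exact hf x hx
    · exact le_rfl
  refine ⟨h.of_le hle (fun x hx y hy => ?_) (fun x hx y hy => ?_), hle⟩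
  · rw [hD', hD', h.symm x hx y hy]
    by_cases h1 : x = w <;> by_cases h2 : y = w <;> simp [h1, h2, hx, hy, hw]
  · rw [hD']
    split_ifs with h1 h2
    · rw [h1.1]; exact hs' y hy
    · rw [h2.1, tdist_comm]; exact hs' x hx
    · exact h.sound x hx y hy

end Distances
/-! ### The program for two-approximate distances: preparation and balls -/

section TwoApproxBalls
open Loc

/-- The arrays are set up: `bk 0` is the input matrix, `lst` the adjacency lists, `deg` the degrees,
`siz` the current set of sources, `p` and `degPow` the nearest sources and their distances, `j2`
the current scale and `bk 3` the number of vertices plus twice the number of edges. -/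
def prepare : Cmd Loc := block [
  wr0 inf (4 * §n),
  .loop x §n (block [
    .loop y §n (.ite (rd2 (bk 0) §x §y)
      (block [
        wr2 dhat §x §y 1,
        wr2 lst §x (rd1 deg §x) §y,
        wr1 deg §x (rd1 deg §x + 1)])
      (wr2 dhat §x §y §inf)),
    wr0 (bk 3) (§(bk 3) + rd1 deg §x + 1)]),
  .loop x §n (block [wr1 siz §x 1, wr1 p §x §x, wr2 dhat §x §x 0]),
  wr0 j2 1]

/-- The weight of a vertex. -/
def vertexWeight (x : Exp Loc) : Exp Loc := (rd1 deg x + 1) * §n + §(bk 3)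

/-- Breadth first search from `w`, layer by layer, until the ball has weight at least
`j2 * bk 3`.  The row `w` of `adj` becomes the indicator of the ball. -/
def growBall : Cmd Loc := block [
  .loop b (§n + 1) (wr1 bcnt §b 0),
  .loop y §n (wr2 adj §w §y 0),
  wr2 adj §w §w 1,
  wr2 bucket 0 0 §w,
  wr1 bcnt 0 1,
  wr0 (bk 4) (vertexWeight §w),
  .loop b §n (when (.lt §(bk 4) (§j2 * §(bk 3))) (.loop t (rd1 bcnt §b) (block [
    wr0 x (rd2 bucket §b §t),
    .loop e (rd1 deg §x) (block [
      wr0 y (rd2 lst §x §e),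
      when (no (rd2 adj §w §y)) (block [
        wr2 adj §w §y 1,
        wr2 dhat §w §y (§b + 1),
        wr2 dhat §y §w (§b + 1),
        wr2 bucket (§b + 1) (rd1 bcnt (§b + 1)) §y,
        wr1 bcnt (§b + 1) (rd1 bcnt (§b + 1) + 1),
        wr0 (bk 4) (§(bk 4) + vertexWeight §y)])])]))),
  wr2 hi 0 §w (no (.lt §(bk 4) (§j2 * §(bk 3))))]

open Classical in
/-- The degree of `x`. -/
noncomputable def gdeg (H : SimpleGraph ℕ) (N x : ℕ) : ℕ :=
  ((Finset.range N).filter (H.Adj x)).card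

/-- The number of vertices plus twice the number of edges. -/
noncomputable def gsize (H : SimpleGraph ℕ) (N : ℕ) : ℕ := ∑ x ∈ Finset.range N, (gdeg H N x + 1)

/-- The weight of a vertex. -/
noncomputable def gwt (H : SimpleGraph ℕ) (N x : ℕ) : ℕ := (gdeg H N x + 1) * N + gsize H N

theorem gdeg_le (H : SimpleGraph ℕ) (N x : ℕ) : gdeg H N x ≤ N := by
  classical
  exact (Finset.card_le_card (Finset.filter_subset _ _)).trans (by simp)

theorem gsize_le (H : SimpleGraph ℕ) (N : ℕ) : gsize H N ≤ N * (N + 1) := by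
  unfold gsize
  calc _ ≤ ∑ x ∈ Finset.range N, (N + 1) :=
        Finset.sum_le_sum fun x _ => Nat.succ_le_succ (gdeg_le H N x)
    _ = _ := by simp

/-- The summands (deg + 1) N and `gsize` of the weight both add up to N times `gsize`. A ball of
weight below q · `gsize` thus has fewer than q vertices, and its sum of deg + 1 is below q · `gsize`
/ N. One threshold controls both quantities. -/
theorem sum_gwt (H : SimpleGraph ℕ) (N : ℕ) :
    ∑ x ∈ Finset.range N, gwt H N x = 2 * N * gsize H N := by
  simp only [gwt, Finset.sum_add_distrib, ← Finset.sum_mul, Finset.sum_const, Finset.card_range]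
  rw [show ∑ i ∈ Finset.range N, gdeg H N i + N • 1 = gsize H N by
    simp [gsize, Finset.sum_add_distrib]]
  simp; ring

/-- The part of the memory that describes the input. -/
structure InputData (H : SimpleGraph ℕ) (N : ℕ) (τ : Mem Loc) : Prop where
  n : τ n 0 0 = N
  inf : τ inf 0 0 = 4 * N
  deg : ∀ x < N, τ deg x 0 = gdeg H N x
  list : ∀ x < N, ∀ e < gdeg H N x, H.Adj x (τ lst x e)
  mem : ∀ x y, H.Adj x y → ∃ e < gdeg H N x, τ lst x e = y
  size : τ (bk 3) 0 0 = gsize H N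
  input : ∀ x < N, ∀ y < N, τ (bk 0) x y ≠ 0 ↔ H.Adj x y

variable {H : SimpleGraph ℕ} {N M : ℕ}

theorem InputData.congr {τ τ' : Mem Loc} (h : InputData H N τ) (h1 : τ' Loc.n = τ Loc.n)
    (h2 : τ' Loc.inf = τ Loc.inf) (h3 : τ' Loc.deg = τ Loc.deg) (h4 : τ' lst = τ lst)
    (h5 : τ' (bk 3) = τ (bk 3)) (h6 : τ' (bk 0) = τ (bk 0)) : InputData H N τ' := by
  obtain ⟨a1, a2, a3, a4, a5, a6, a7⟩ := h
  constructor <;> simp only [h1, h2, h3, h4, h5, h6] <;> assumption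

theorem OnRange.lt_right (hH : OnRange H N) {x y : ℕ} (h : H.Adj x y) : y < N := hH _ _ h.symm

-- Establishes the situation before the first round: every vertex is its own source, at distance 0.
open Classical in
theorem prepare_spec {s : ℕ} {σ : Mem Loc} (hH : OnRange H N) (hn : σ n 0 0 = N)
    (hM : 8 * (N + 2) ^ 4 ≤ M)
    (hA : ∀ x < N, ∀ y < N, σ (bk 0) x y ≠ 0 ↔ H.Adj x y)
    (hz : ∀ a i j, a ≠ n → a ≠ bk 0 → σ a i j = 0) :
    prepare.wp M (fun τ r => InputData H N τ ∧ IsEst H N (τ dhat) ∧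
      (∀ x < N, τ siz x 0 = 1 ∧ τ p x 0 = x ∧ τ degPow x 0 = 0 ∧ τ dhat x x = 0) ∧ τ j2 0 0 = 1 ∧
      τ (bk 2) 0 0 = 0 ∧ r ≤ s + N ^ 2 + 2 * N) σ s := by
  have hNM : 4 * N + N + 4 ≤ M := by nlinarith [Nat.zero_le (N ^ 4), Nat.zero_le (N ^ 3), Nat.zero_le (N^2)]
  have hN2M : N * (N + 1) ≤ M := by nlinarith [Nat.zero_le (N ^ 4), Nat.zero_le (N ^ 3)]
  unfold prepare
  simp only [wp_block_cons, wp_block_nil, wp_wr0, val_mul, val_four, val_rd0, hn]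
  refine fun _ => ⟨by omega, ?_⟩
  refine wp_loop N (fun t τ r =>
    (∀ x < t, ∀ y < N, τ dhat x y = if H.Adj x y then 1 else 4 * N) ∧
    (∀ x < t, τ deg x 0 = gdeg H N x) ∧ (∀ x, t ≤ x → τ deg x 0 = 0) ∧
    (∀ x < t, ∀ e < gdeg H N x, H.Adj x (τ lst x e)) ∧
    (∀ x < t, ∀ y, H.Adj x y → ∃ e < gdeg H N x, τ lst x e = y) ∧
    τ (bk 3) 0 0 = ∑ x ∈ Finset.range t, (gdeg H N x + 1) ∧ r = s + t * (N + 1))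
    (by simpa using hn) (fun _ => by omega) ?_ ?_ ?_
  · simp [hz]
  · rintro t ht τ r hfr ⟨h1, h2, h3, h4, h5, h6, h7⟩
    have e1 : τ n = σ n := by rw [hfr n (by decide)]; simp
    have e2 : τ (bk 0) = σ (bk 0) := by rw [hfr (bk 0) (by decide)]; simp
    have e3 : τ inf 0 0 = 4 * N := by rw [hfr inf (by decide)]; simp
    simp only [wp_block_cons, wp_block_nil]
    refine wp_loop N (fun u ρ q =>
      (∀ y < u, ρ dhat t y = if H.Adj t y then 1 else 4 * N) ∧
      (∀ x, x ≠ t → ρ dhat x = τ dhat x ∧ ρ deg x = τ deg x ∧ ρ lst x = τ lst x) ∧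
      (ρ deg t 0 = ((Finset.range u).filter (H.Adj t)).card) ∧
      (∀ e < ρ deg t 0, H.Adj t (ρ lst t e)) ∧
      (∀ y < u, H.Adj t y → ∃ e < ρ deg t 0, ρ lst t e = y) ∧ q = r + 1 + u)
      (by simpa [e1] using hn) (fun _ => by omega) ?_ ?_ ?_
    · simp [h3]
    · rintro u hu ρ q hfr' ⟨g1, g2, g3, g4, g5, g6⟩
      have f1 : ρ x 0 0 = t := by rw [hfr' x (by decide)]; simp
      have f2 : ρ (bk 0) = σ (bk 0) := by rw [hfr' (bk 0) (by decide)]; simpa using e2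
      have f3 : ρ inf 0 0 = 4 * N := by rw [hfr' inf (by decide)]; simpa using e3
      have hle : ((Finset.range u).filter (H.Adj t)).card ≤ u :=
        (Finset.card_le_card (Finset.filter_subset _ _)).trans (by simp)
      have hsucc : ((Finset.range (u + 1)).filter (H.Adj t)).card =
          ((Finset.range u).filter (H.Adj t)).card + if H.Adj t u then 1 else 0 := by
        rw [Finset.range_add_one, Finset.filter_insert]
        split_ifs with h
        · rw [Finset.card_insert_of_notMem (by simp)]
        · rfl
      simp only [wp_block_cons, wp_block_nil, wp_ite, wp_wr2, wp_wr1, val_rd0, val_rd1, val_rd2, val_add,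
        val_one, Mem.set_of_ne, Mem.set_same, ne_eq, reduceCtorEq, not_false_eq_true, and_self,
        if_true, f1, f2, f3]
      refine ⟨fun h _ => ⟨by omega, fun _ => ⟨by omega, fun _ => ⟨by omega, ?_⟩⟩⟩, fun h _ => ⟨by omega, ?_⟩⟩
      · have hadj : H.Adj t u := (hA t ht u hu).1 h
        refine ⟨fun y hy => ?_, fun z hz' => ?_, ?_, fun e he => ?_, fun y hy hy' => ?_, by omega⟩
        · by_cases hyu : y = u
          · simp [hyu, hadj]
          · simpa [hyu] using g1 y (by omega)
        · obtain ⟨k1, k2, k3⟩ := g2 z hz'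
          refine ⟨?_, ?_, ?_⟩ <;> funext i <;> simp [hz', k1, k2, k3]
        · rw [hsucc, if_pos hadj, g3]
        · by_cases heq : e = ρ deg t 0
          · simpa [heq] using hadj
          · simpa [heq] using g4 e (by omega)
        · rcases Nat.lt_succ_iff_lt_or_eq.1 hy with hy | rfl
          · obtain ⟨e, he, he'⟩ := g5 y hy hy'
            exact ⟨e, by omega, by rw [if_neg (by omega), he']⟩
          · exact ⟨ρ deg t 0, by omega, by simp⟩
      · have hadj : ¬ H.Adj t u := fun h' => (hA t ht u hu).2 h' h
        refine ⟨fun y hy => ?_, fun z hz' => ?_, ?_, g4, fun y hy hy' => ?_, by omega⟩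
        · by_cases hyu : y = u
          · simp [hyu, hadj]
          · simpa [hyu] using g1 y (by omega)
        · obtain ⟨k1, k2, k3⟩ := g2 z hz'
          refine ⟨?_, ?_, ?_⟩ <;> first | assumption | (funext i; simp [hz', k1])
        · rw [hsucc, if_neg hadj, g3]; rfl
        · rcases Nat.lt_succ_iff_lt_or_eq.1 hy with hy | rfl
          · exact g5 y hy hy'
          · exact absurd hy' hadj
    · rintro ρ q hfr' ⟨g1, g2, g3, g4, g5, g6⟩
      have f1 : ρ x 0 0 = t := by rw [hfr' x (by decide)]; simp
      have f4 : ρ (bk 3) = τ (bk 3) := by rw [hfr' (bk 3) (by decide)]; simp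
      have hs : ∑ x ∈ Finset.range (t + 1), (gdeg H N x + 1) ≤ M := by
        refine le_trans ?_ ((gsize_le H N).trans hN2M)
        exact Finset.sum_le_sum_of_subset (by simp; omega)
      rw [Finset.sum_range_succ] at hs
      have g3' : ρ deg t 0 = gdeg H N t := g3
      simp only [wp_wr0, val_add, val_rd0, val_rd1, val_one, f1, f4, h6, g3',
        Mem.set_of_ne, Mem.set_same, ne_eq, reduceCtorEq, not_false_eq_true, and_self, if_true]
      refine fun _ => ⟨by omega, ?_⟩
      have key : ∀ x < t + 1, x ≠ t → x < t := fun x _ _ => by omega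
      refine ⟨fun x hx y hy => ?_, fun x hx => ?_, fun x hx => ?_, fun x hx e he => ?_,
        fun x hx y hy => ?_, by rw [Finset.sum_range_succ]; ring, by rw [g6, h7]; ring⟩
      · by_cases hxt : x = t
        · rw [hxt]; exact g1 y hy
        · rw [(g2 x hxt).1]; exact h1 x (key x hx hxt) y hy
      · by_cases hxt : x = t
        · rw [hxt]; exact g3
        · rw [(g2 x hxt).2.1]; exact h2 x (key x hx hxt)
      · rw [(g2 x (by omega)).2.1]; exact h3 x (by omega)
      · by_cases hxt : x = t
        · rw [hxt]; exact g4 e (by rw [g3', ← hxt]; exact he)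
        · rw [(g2 x hxt).2.2]; exact h4 x (key x hx hxt) e he
      · by_cases hxt : x = t
        · rw [hxt] at hy ⊢
          obtain ⟨e, he, he'⟩ := g5 y (hH.lt_right hy) hy
          exact ⟨e, by rwa [← g3'], he'⟩
        · rw [(g2 x hxt).2.2]; exact h5 x (key x hx hxt) y hy
  rintro τ r hfr ⟨h1, h2, h3, h4, h5, h6, h7⟩
  have e1 : τ n = σ n := by rw [hfr n (by decide)]; simp
  have e2 : τ (bk 0) = σ (bk 0) := by rw [hfr (bk 0) (by decide)]; simp
  have e3 : τ inf 0 0 = 4 * N := by rw [hfr inf (by decide)]; simp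
  have e4 : τ degPow = σ degPow := by rw [hfr degPow (by decide)]; simp
  have e5 : τ (bk 2) = σ (bk 2) := by rw [hfr (bk 2) (by decide)]; simp
  have hI : InputData H N τ := ⟨by rw [e1, hn], e3, h2, h4, fun x y h => h5 x (hH _ _ h) y h, h6,
    by rw [e2]; exact hA⟩
  refine wp_loop N (fun t ρ q => (∀ x < t, ρ siz x 0 = 1 ∧ ρ p x 0 = x) ∧
    (∀ x y, ρ dhat x y = if x = y ∧ x < t then 0 else τ dhat x y) ∧ q = r + t)
    (by simpa [e1] using hn) (fun _ => by omega) (by simp) ?_ ?_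
  · rintro t ht ρ q hfr' ⟨g1, g2, g3⟩
    simp only [wp_block_cons, wp_block_nil, wp_wr1, wp_wr2, val_rd0, val_one, val_zero,
      Mem.set_of_ne, Mem.set_same, ne_eq, reduceCtorEq, not_false_eq_true, and_self, if_true]
    refine fun _ => ⟨by omega, fun _ => ⟨by omega, fun _ => ⟨by omega, fun x hx => ?_, fun x y => ?_,
      by omega⟩⟩⟩
    · by_cases hxt : x = t
      · simp [hxt]
      · simpa [hxt] using g1 x (by omega)
    · rw [g2]; clear * -; grind
  · rintro ρ q hfr' ⟨g1, g2, g3⟩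
    simp only [wp_wr0, val_one]
    have f4 : ρ degPow = σ degPow := by rw [hfr' degPow (by decide), e4]
    have f5 : ρ (bk 2) = σ (bk 2) := by rw [hfr' (bk 2) (by decide), e5]
    refine fun _ => ⟨by omega, ?_, ?_, fun x hx => ⟨by simpa using (g1 x hx).1,
      by simpa using (g1 x hx).2, by simp [f4, hz], by simp [g2, hx]⟩, by simp, by simp [f5, hz], ?_⟩
    · refine hI.congr ?_ ?_ ?_ ?_ ?_ ?_
      · simpa using hfr' n (by decide)
      · simpa using hfr' inf (by decide)
      · simpa using hfr' Loc.deg (by decide)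
      · simpa using hfr' lst (by decide)
      · simpa using hfr' (bk 3) (by decide)
      · simpa using hfr' (bk 0) (by decide)
    · simp only [Mem.set_of_ne, ne_eq, reduceCtorEq, not_false_eq_true]
      have hval : ∀ x < N, ∀ y < N, ρ dhat x y = if x = y then 0 else
          if H.Adj x y then 1 else 4 * N := by
        intro x hx y hy
        rw [g2, h1 x hx y hy]; simp [hx]
      refine ⟨fun x hx y hy => ?_, fun x hx y hy => ?_, fun x hx y hy => ?_, fun x hx y hy hxy => ?_⟩
      · rw [hval x hx y hy, hval y hy x hx, H.adj_comm]; simp only [eq_comm]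
      · rw [hval x hx y hy]
        split_ifs with k1 k2
        · rw [k1, tdist_self]
        · rw [tdist_adj k2]
        · exact tdist_le hH hx
      · rw [hval x hx y hy]; split_ifs <;> omega
      · rw [hval x hx y hy, if_neg hxy.ne, if_pos hxy]
    · rw [g3, h7]; nlinarith

end TwoApproxBalls
-- Breadth first search for a ball of prescribed weight
section TwoApproxBalls2
open Loc

variable {H : SimpleGraph ℕ} {N M : ℕ}

/-- The ball with center `w` and radius `ρ`. -/
noncomputable def gball (H : SimpleGraph ℕ) (N w ρ : ℕ) : Finset ℕ :=
  (Finset.range N).filter fun y => tdist H N w y ≤ ρ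

theorem mem_gball {w ρ y : ℕ} : y ∈ gball H N w ρ ↔ y < N ∧ tdist H N w y ≤ ρ := by
  simp [gball]

/-- The vertices in `S` have been found by the search from `w`. -/
structure BallData (H : SimpleGraph ℕ) (N w : ℕ) (A D : ℕ → ℕ → ℕ) (S : Finset ℕ) (τ : Mem Loc) :
    Prop where
  ind : ∀ y < N, τ adj w y = if y ∈ S then 1 else 0
  other : ∀ z, z ≠ w → τ adj z = A z
  acc : τ (bk 4) 0 0 = ∑ y ∈ S, gwt H N y
  est : IsEst H N (τ dhat)
  le : EstLE N (τ dhat) D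
  exact : ∀ y ∈ S, τ dhat w y = tdist H N w y

theorem BallData.congr {w : ℕ} {A D : ℕ → ℕ → ℕ} {S : Finset ℕ} {τ τ' : Mem Loc}
    (h : BallData H N w A D S τ) (h1 : τ' adj = τ adj) (h2 : τ' (bk 4) = τ (bk 4))
    (h3 : τ' dhat = τ dhat) : BallData H N w A D S τ' := by
  obtain ⟨a1, a2, a3, a4, a5, a6⟩ := h
  constructor <;> simp only [h1, h2, h3] <;> assumption

/-- The entries of the layer `b` of the search. -/
structure LayerData (H : SimpleGraph ℕ) (N w b : ℕ) (S : Finset ℕ) (τ : Mem Loc) : Prop where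
  entry : ∀ i < τ bcnt b 0, τ bucket b i ∈ S ∧ tdist H N w (τ bucket b i) = b
  cover : ∀ y ∈ S, tdist H N w y = b → ∃ i < τ bcnt b 0, τ bucket b i = y
  inj : ∀ i < τ bcnt b 0, ∀ j < τ bcnt b 0, τ bucket b i = τ bucket b j → i = j
  zero : ∀ c, b < c → c ≤ N → τ bcnt c 0 = 0

theorem LayerData.congr {w b : ℕ} {S : Finset ℕ} {τ τ' : Mem Loc} (h : LayerData H N w b S τ)
    (h1 : τ' bcnt = τ bcnt) (h2 : τ' bucket = τ bucket) : LayerData H N w b S τ' := by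
  obtain ⟨a1, a2, a3, a4⟩ := h
  constructor <;> simp only [h1, h2] <;> assumption

theorem LayerData.card_le {w b : ℕ} {S : Finset ℕ} {τ : Mem Loc} (h : LayerData H N w b S τ) :
    τ bcnt b 0 ≤ S.card := by
  have := Finset.card_le_card_of_injOn (s := Finset.range (τ bcnt b 0)) (t := S) (τ bucket b)
    (fun i hi => (h.entry i (by simpa using hi)).1)
    (fun i hi j hj hij => h.inj i (by simpa using hi) j (by simpa using hj) hij)
  simpa using this

/-- One vertex is added to the ball and to the next layer. -/
theorem BallData.insert {w b y : ℕ} {A D : ℕ → ℕ → ℕ} {S : Finset ℕ} {τ τ' : Mem Loc}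
    (hH : OnRange H N) (hw : w < N) (h : BallData H N w A D S τ)
    (hL : LayerData H N w (b + 1) S τ) (hy : y < N) (hyS : y ∉ S) (hd : tdist H N w y = b + 1)
    (h1 : ∀ x z, τ' adj x z = if x = w ∧ z = y then 1 else τ adj x z)
    (h2 : ∀ x z, τ' dhat x z = if (x = w ∧ z = y) ∨ (x = y ∧ z = w) then b + 1 else τ dhat x z)
    (h3 : τ' (bk 4) 0 0 = τ (bk 4) 0 0 + gwt H N y)
    (h4 : ∀ c, τ' bcnt c 0 = if c = b + 1 then τ bcnt (b + 1) 0 + 1 else τ bcnt c 0)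
    (h5 : ∀ c i, τ' bucket c i =
      if c = b + 1 ∧ i = τ bcnt (b + 1) 0 then y else τ bucket c i) :
    BallData H N w A D (insert y S) τ' ∧ LayerData H N w (b + 1) (insert y S) τ' := by
  obtain ⟨hE, hle⟩ := h.est.update (a := w) (b := y) hd.le (hd ▸ h.est.sound w hw y hy) hw hy h2
  refine ⟨⟨fun z hz => ?_, fun z hz => ?_, ?_, hE, hle.trans h.le, fun z hz => ?_⟩,
    ⟨fun i hi => ?_, fun z hz hzd => ?_, fun i hi j hj hij => ?_, fun c hc hcN => ?_⟩⟩
  · rw [h1, h.ind z hz]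
    by_cases hzy : z = y <;> simp [hzy]
  · rw [← h.other z hz]; funext q; rw [h1, if_neg (fun h => hz h.1)]
  · rw [h3, h.acc, Finset.sum_insert hyS, add_comm]
  · rw [h2]
    split_ifs with hc
    · rcases hc with ⟨-, rfl⟩ | ⟨rfl, rfl⟩
      · exact hd.symm
      · exact hd.symm
    · rcases Finset.mem_insert.1 hz with rfl | hz
      · simp at hc
      · exact h.exact z hz
  · rw [h4, if_pos rfl] at hi
    rw [h5]
    split_ifs with hc
    · exact ⟨Finset.mem_insert_self _ _, hd⟩
    · have := hL.entry i (by have : i ≠ τ bcnt (b + 1) 0 := fun h => hc ⟨rfl, h⟩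
                             omega)
      exact ⟨Finset.mem_insert_of_mem this.1, this.2⟩
  · rw [h4, if_pos rfl]
    rcases Finset.mem_insert.1 hz with rfl | hz
    · exact ⟨τ bcnt (b + 1) 0, by omega, by rw [h5, if_pos ⟨rfl, rfl⟩]⟩
    · obtain ⟨i, hi, hi'⟩ := hL.cover z hz hzd
      exact ⟨i, by omega, by rw [h5, if_neg (by omega), hi']⟩
  · rw [h4, if_pos rfl] at hi hj
    simp only [h5, true_and] at hij
    by_cases hi' : i = τ bcnt (b + 1) 0 <;> by_cases hj' : j = τ bcnt (b + 1) 0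
    · rw [hi', hj']
    · rw [if_pos hi', if_neg hj'] at hij
      exact absurd (hij ▸ (hL.entry j (by omega)).1) hyS
    · rw [if_neg hi', if_pos hj'] at hij
      exact absurd (hij ▸ (hL.entry i (by omega)).1) hyS
    · rw [if_neg hi', if_neg hj'] at hij
      exact hL.inj i (by omega) j (by omega) hij
  · rw [h4, if_neg (by omega)]; exact hL.zero c hc hcN

theorem gball_subset {w ρ : ℕ} : gball H N w ρ ⊆ Finset.range N := Finset.filter_subset _ _

theorem gball_mono {w ρ ρ' : ℕ} (h : ρ ≤ ρ') : gball H N w ρ ⊆ gball H N w ρ' := by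
  intro y hy
  rw [mem_gball] at hy ⊢
  exact ⟨hy.1, hy.2.trans h⟩

/-- All vertices of the layer `b` are scanned. -/
theorem growLayer {s w₀ b : ℕ} {A D : ℕ → ℕ → ℕ} {σ : Mem Loc} (hH : OnRange H N) (hw : w₀ < N)
    (hM : 8 * (N + 2) ^ 4 ≤ M) (hI : InputData H N σ) (hwσ : σ w 0 0 = w₀) (hb : σ Loc.b 0 0 = b)
    (hbN : b < N)
    (hB : BallData H N w₀ A D (gball H N w₀ b) σ) (hL : LayerData H N w₀ b (gball H N w₀ b) σ) :
    (Cmd.loop t (rd1 bcnt §Loc.b) (block [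
      wr0 x (rd2 bucket §Loc.b §t),
      .loop e (rd1 deg §x) (block [
        wr0 y (rd2 lst §x §e),
        when (no (rd2 adj §w §y)) (block [
          wr2 adj §w §y 1,
          wr2 dhat §w §y (§Loc.b + 1),
          wr2 dhat §y §w (§Loc.b + 1),
          wr2 bucket (§Loc.b + 1) (rd1 bcnt (§Loc.b + 1)) §y,
          wr1 bcnt (§Loc.b + 1) (rd1 bcnt (§Loc.b + 1) + 1),
          wr0 (bk 4) (§(bk 4) + vertexWeight §y)])])])).wp M (fun τ r =>
      BallData H N w₀ A D (gball H N w₀ (b + 1)) τ ∧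
      LayerData H N w₀ (b + 1) (gball H N w₀ (b + 1)) τ ∧
      r ≤ s + ∑ y ∈ (Finset.range N).filter (fun y => tdist H N w₀ y = b), (gdeg H N y + 1)) σ s := by
  have hNM : 4 * N + N + 4 ≤ M := by nlinarith [Nat.zero_le (N ^ 4), Nat.zero_le (N ^ 3), Nat.zero_le (N^2)]
  have hWM : 2 * N * gsize H N ≤ M := by
    have := Nat.mul_le_mul_left (2 * N) (gsize_le H N)
    nlinarith [Nat.zero_le (N ^ 4), Nat.zero_le (N ^ 3), Nat.zero_le (N^2)]
  have hcN : ∀ S ⊆ Finset.range N, S.card ≤ N := fun S hS => by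
    simpa using Finset.card_le_card hS
  -- No vertex of the ball of radius b is at distance b + 1, and the next bucket is still empty.
  have hL' : LayerData H N w₀ (b + 1) (gball H N w₀ b) σ := by
    have h0 := hL.zero (b + 1) (by omega) (by omega)
    refine ⟨fun i hi => by omega, fun y hy hyd => ?_, fun i hi => by omega,
      fun c hc => hL.zero c (by omega)⟩
    rw [mem_gball] at hy; omega
  refine wp_loop (σ bcnt b 0) (fun u τ r => ∃ S, gball H N w₀ b ⊆ S ∧ S ⊆ gball H N w₀ (b + 1) ∧
    BallData H N w₀ A D S τ ∧ LayerData H N w₀ (b + 1) S τ ∧ τ bcnt b 0 = σ bcnt b 0 ∧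
    (∀ i, τ bucket b i = σ bucket b i) ∧ (∀ i < u, ∀ y, H.Adj (σ bucket b i) y → y ∈ S) ∧
    r = s + ∑ i ∈ Finset.range u, (gdeg H N (σ bucket b i) + 1)) (by simp [hb])
    (fun _ => (hL.card_le.trans (hcN _ gball_subset)).trans (by omega)) ?_ ?_ ?_
  · exact ⟨_, le_rfl, gball_mono (by omega), hB, hL', rfl, fun _ => rfl, by simp, by simp⟩
  · rintro u hu τ r hfr ⟨S, hS1, hS2, h1, h2, h3, h4, h5, h6⟩
    have e1 : τ Loc.b = σ Loc.b := hfr Loc.b (by decide)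
    obtain ⟨x₀, hx₀⟩ : ∃ x₀, σ bucket b u = x₀ := ⟨_, rfl⟩
    have hx₀' := hL.entry u hu
    rw [hx₀, mem_gball] at hx₀'
    obtain ⟨⟨hx₀N, -⟩, hx₀d⟩ := hx₀'
    simp only [wp_block_cons, wp_block_nil, wp_wr0, val_rd2, val_rd0,
      Mem.set_of_ne, Mem.set_same, ne_eq, reduceCtorEq, not_false_eq_true, and_self, if_true,
      e1, hb, h4, hx₀]
    refine fun _ => ⟨by omega, ?_⟩
    have e2 : τ Loc.deg = σ Loc.deg := hfr Loc.deg (by decide)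
    refine wp_loop (gdeg H N x₀) (fun e τ q => ∃ S, gball H N w₀ b ⊆ S ∧ S ⊆ gball H N w₀ (b + 1) ∧
      BallData H N w₀ A D S τ ∧ LayerData H N w₀ (b + 1) S τ ∧ τ bcnt b 0 = σ bcnt b 0 ∧
      (∀ i, τ bucket b i = σ bucket b i) ∧ (∀ i < u, ∀ y, H.Adj (σ bucket b i) y → y ∈ S) ∧
      (∀ i < e, σ lst x₀ i ∈ S) ∧ q = r + 1 + e)
      (by simpa [e2] using hI.deg x₀ hx₀N) (fun _ => (gdeg_le H N _).trans (by omega)) ?_ ?_ ?_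
    · exact ⟨S, hS1, hS2, h1.congr (by simp) (by simp) (by simp), h2.congr (by simp) (by simp),
        by simpa using h3, by simpa using h4, h5, by simp, rfl⟩
    · rintro e₀ he ρ q hfr' ⟨S, hS1, hS2, g1, g2, g3, g4, g5, g6, g7⟩
      have f1 : ρ Loc.b 0 0 = b := by rw [hfr' Loc.b (by decide)]; simpa [e1] using hb
      have f2 : ρ x 0 0 = x₀ := by rw [hfr' x (by decide)]; simp
      have f3 : ρ lst = σ lst := by
        rw [hfr' lst (by decide)]; simpa using hfr lst (by decide)
      have f4 : ρ w 0 0 = w₀ := by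
        rw [hfr' w (by decide)]; simpa [hfr w (by decide)] using hwσ
      have f5 : ρ n 0 0 = N := by
        rw [hfr' n (by decide)]; simpa [hfr n (by decide)] using hI.n
      have f6 : ρ (bk 3) 0 0 = gsize H N := by
        rw [hfr' (bk 3) (by decide)]; simpa [hfr (bk 3) (by decide)] using hI.size
      have f7 : ρ Loc.deg = σ Loc.deg := by
        rw [hfr' Loc.deg (by decide)]; simpa using hfr Loc.deg (by decide)
      obtain ⟨y₀, hy₀⟩ : ∃ y₀, σ lst x₀ e₀ = y₀ := ⟨_, rfl⟩
      have hadj : H.Adj x₀ y₀ := hy₀ ▸ hI.list x₀ hx₀N e₀ he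
      have hy₀N : y₀ < N := hH.lt_right hadj
      have f8 := hI.deg y₀ hy₀N
      simp only [vertexWeight, wp_block_cons, wp_block_nil, wp_when, wp_wr0, wp_wr1, wp_wr2, val_no, val_add,
        val_mul, val_one, val_rd2, val_rd0, val_rd1, Loc.bk.injEq,
        Mem.set_of_ne, Mem.set_same, ne_eq, reduceCtorEq, not_false_eq_true, and_self, if_true,
        f1, f2, f3, f4, f5, f6, f7, f8, hy₀, g1.ind y₀ hy₀N]
      refine fun _ => ⟨by omega, fun hc => ?_, fun hc => ?_⟩
      · have hyS : y₀ ∉ S := by intro h; simp [h] at hc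
        have hyd : tdist H N w₀ y₀ = b + 1 := by
          refine le_antisymm ?_ ?_
          · have := tdist_triangle hH hw x₀ y₀
            rw [tdist_adj hadj, hx₀d] at this; exact this
          · by_contra hlt
            exact hyS (hS1 (mem_gball.2 ⟨hy₀N, by omega⟩))
        have hSN : S ⊆ Finset.range N := hS2.trans gball_subset
        have hc1 := g2.card_le.trans (Finset.card_le_card hSN)
        rw [Finset.card_range] at hc1
        have hacc : ρ (bk 4) 0 0 + ((gdeg H N y₀ + 1) * N + gsize H N) ≤ M := by
          rw [g1.acc]
          have : ∑ y ∈ insert y₀ S, gwt H N y ≤ ∑ y ∈ Finset.range N, gwt H N y :=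
            Finset.sum_le_sum_of_subset (by
              intro z hz
              rcases Finset.mem_insert.1 hz with rfl | hz
              · simpa using hy₀N
              · exact hSN hz)
          rw [Finset.sum_insert hyS, sum_gwt] at this
          unfold gwt at this ⊢
          omega
        refine fun _ => ⟨by omega, fun _ => ⟨by omega, fun _ => ⟨by omega, fun _ => ⟨by omega,
          fun _ => ⟨by omega, fun _ => ⟨hacc, insert y₀ S, hS1.trans (Finset.subset_insert _ _), ?_, ?_⟩⟩⟩⟩⟩⟩
        · intro z hz
          rcases Finset.mem_insert.1 hz with rfl | hz
          · exact mem_gball.2 ⟨hy₀N, hyd.le⟩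
          · exact hS2 hz
        · rw [← and_assoc]
          refine ⟨g1.insert hH hw g2 hy₀N hyS hyd (by simp) ?_ (by simp [gwt]) (by simp) (by simp),
            ?_, fun i => ?_, fun i hi y hy => Finset.mem_insert_of_mem (g5 i hi y hy), fun i hi => ?_,
            by omega⟩
          · intro x z; simp; clear * -; grind
          · rw [if_neg (by omega), g3]
          · rw [if_neg (by omega), g4]
          · rcases Nat.lt_succ_iff_lt_or_eq.1 hi with hi | rfl
            · exact Finset.mem_insert_of_mem (g6 i hi)
            · rw [hy₀]; exact Finset.mem_insert_self _ _
      · have hyS : y₀ ∈ S := by by_contra h; simp [h] at hc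
        refine ⟨S, hS1, hS2, g1.congr (by simp) (by simp) (by simp), g2.congr (by simp) (by simp),
          g3, g4, g5, fun i hi => ?_, by omega⟩
        rcases Nat.lt_succ_iff_lt_or_eq.1 hi with hi | rfl
        · exact g6 i hi
        · rwa [hy₀]
    · rintro ρ q hfr' ⟨S, hS1, hS2, g1, g2, g3, g4, g5, g6, g7⟩
      refine ⟨S, hS1, hS2, g1, g2, g3, g4, fun i hi y hy => ?_, ?_⟩
      · rcases Nat.lt_succ_iff_lt_or_eq.1 hi with hi | rfl
        · exact g5 i hi y hy
        · rw [hx₀] at hy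
          obtain ⟨e, he, rfl⟩ := hI.mem x₀ y hy
          exact g6 e he
      · rw [Finset.sum_range_succ, g7, h6, hx₀]; ring
  · rintro τ r hfr ⟨S, hS1, hS2, h1, h2, h3, h4, h5, h6⟩
    -- A vertex at distance b + 1 has a predecessor at distance b, and that predecessor was among
    -- the scanned entries.
    have hSe : S = gball H N w₀ (b + 1) := by
      refine le_antisymm hS2 fun y hy => ?_
      obtain ⟨hyN, hyd⟩ := mem_gball.1 hy
      rcases Nat.lt_or_ge b (tdist H N w₀ y) with hlt | hge
      · have hyd' : tdist H N w₀ y = b + 1 := by omega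
        have hr : H.Reachable w₀ y := reachable_of_tdist_lt (N := N) (by omega)
        rw [tdist_of_reachable hr] at hyd'
        obtain ⟨z, hz1, hz2, hz3⟩ := exists_pred hr (by rintro rfl; simp at hyd')
        have hzd : tdist H N w₀ z = b := by rw [tdist_of_reachable hz2]; omega
        obtain ⟨i, hi, hi'⟩ := hL.cover z (mem_gball.2 ⟨hH _ _ hz1, hzd.le⟩) hzd
        exact h5 i hi y (hi' ▸ hz1)
      · exact hS1 (mem_gball.2 ⟨hyN, hge⟩)
    subst hSe
    refine ⟨h1, h2, ?_⟩
    rw [h6]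
    refine Nat.add_le_add_left ?_ _
    -- The entries of a layer are distinct, so the cost of the scan is bounded by a sum over the
    -- vertices at distance b.
    rw [← Finset.sum_image (s := Finset.range (σ bcnt b 0)) (g := σ bucket b)
      (f := fun y => gdeg H N y + 1)]
    · refine Finset.sum_le_sum_of_subset fun y hy => ?_
      obtain ⟨i, hi, rfl⟩ := Finset.mem_image.1 hy
      have := hL.entry i (by simpa using hi)
      simp only [Finset.mem_filter]
      exact ⟨gball_subset this.1, this.2⟩
    · intro i hi j hj hij
      exact hL.inj i (by simpa using hi) j (by simpa using hj) hij

/-- The result of `growBall`: the ball of radius `ρ`, where `ρ` is minimal such that the weight is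
at least `θ`, or the whole component if there is no such `ρ`. -/
structure IsGrown (H : SimpleGraph ℕ) (N θ w ρ : ℕ) : Prop where
  small : ∀ ρ' < ρ, ∑ y ∈ gball H N w ρ', gwt H N y < θ
  full : ∑ y ∈ gball H N w ρ, gwt H N y < θ → ∀ y < N, H.Reachable w y → tdist H N w y ≤ ρ

/-- The vertices at distance less than ρ form the ball of radius ρ - 1, which is still light, and
each of them weighs at least (deg + 1) N. -/
theorem sum_gdeg_le {w ρ θ : ℕ} (hw : w < N) (h : ∀ ρ' < ρ, ∑ y ∈ gball H N w ρ', gwt H N y < θ) :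
    ∑ y ∈ (Finset.range N).filter (fun y => tdist H N w y < ρ), (gdeg H N y + 1) ≤ θ / N := by
  rcases Nat.eq_zero_or_pos ρ with rfl | hρ
  · simp
  · have h1 := h (ρ - 1) (by omega)
    have h2 : (Finset.range N).filter (fun y => tdist H N w y < ρ) = gball H N w (ρ - 1) := by
      ext y; rw [mem_gball, Finset.mem_filter, Finset.mem_range]; omega
    rw [h2, Nat.le_div_iff_mul_le (by omega), Finset.sum_mul]
    refine le_trans (Finset.sum_le_sum fun y _ => ?_) h1.le
    unfold gwt; omega

/-- The last layer is added as a whole and may overshoot the threshold, but its own adjacency lists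
are not scanned. The cost is therefore governed by the smaller ball, whose weight is below the
threshold. -/
theorem growBall_spec {s w₀ q : ℕ} {σ : Mem Loc} (hH : OnRange H N) (hw : w₀ < N)
    (hM : 8 * (N + 2) ^ 4 ≤ M) (hI : InputData H N σ) (hwσ : σ w 0 0 = w₀) (hq : σ j2 0 0 = q)
    (hE : IsEst H N (σ dhat)) (hd : σ dhat w₀ w₀ = 0) :
    growBall.wp M (fun τ r => ∃ ρ, IsGrown H N (q * gsize H N) w₀ ρ ∧
      BallData H N w₀ (σ adj) (σ dhat) (gball H N w₀ ρ) τ ∧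
      τ hi 0 w₀ = (if q * gsize H N ≤ ∑ y ∈ gball H N w₀ ρ, gwt H N y then 1 else 0) ∧
      (∀ z, z ≠ w₀ → τ hi 0 z = σ hi 0 z) ∧
      r ≤ s + 3 * N + 1 + q * gsize H N / N) σ s := by
  have hNM : 4 * N + N + 4 ≤ M := by nlinarith [Nat.zero_le (N ^ 4), Nat.zero_le (N ^ 3), Nat.zero_le (N^2)]
  have hwM : ∀ y, y < N → gwt H N y ≤ M := by
    intro y hy
    have h1 : gwt H N y ≤ ∑ x ∈ Finset.range N, gwt H N x :=
      Finset.single_le_sum (f := gwt H N) (fun _ _ => Nat.zero_le _) (by simpa using hy)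
    rw [sum_gwt] at h1
    have := Nat.mul_le_mul_left (2 * N) (gsize_le H N)
    nlinarith [Nat.zero_le (N ^ 4), Nat.zero_le (N ^ 3), Nat.zero_le (N^2)]
  unfold growBall
  simp only [wp_block_cons, wp_block_nil]
  refine wp_loop (N + 1) (fun t τ r => (∀ c < t, τ bcnt c 0 = 0) ∧ r = s + t) (by simp [hI.n])
    (fun _ => by omega) (by simp) ?_ ?_
  · rintro t ht τ r hfr ⟨h1, h2⟩
    simp only [wp_wr1, val_rd0, val_zero, Mem.set_same, Mem.set_of_ne, ne_eq, reduceCtorEq,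
      not_false_eq_true, and_self, if_true]
    refine fun _ => ⟨by omega, fun c hc => ?_, by omega⟩
    by_cases hct : c = t
    · simp [hct]
    · simpa [hct] using h1 c (by omega)
  rintro τ r hfr ⟨h1, rfl⟩
  have e1 : τ n = σ n := hfr n (by decide)
  have e2 : τ w = σ w := hfr w (by decide)
  have e3 : τ adj = σ adj := hfr adj (by decide)
  refine wp_loop N (fun t ρ r => (∀ y < t, ρ adj w₀ y = 0) ∧ (∀ z, z ≠ w₀ → ρ adj z = σ adj z) ∧
    r = s + (N + 1) + t) (by simpa [e1] using hI.n)
    (fun _ => by omega) (by simp [e3]) ?_ ?_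
  · rintro t ht ρ r hfr' ⟨h2, h3, h4⟩
    have f2 : ρ w = τ w := hfr' w (by decide)
    simp only [wp_wr2, val_rd0, val_zero, Mem.set_same, Mem.set_of_ne, ne_eq, reduceCtorEq,
      not_false_eq_true, and_self, if_true, f2, e2, hwσ]
    refine fun _ => ⟨by omega, fun c hc => ?_, fun z hz => ?_, by omega⟩
    · by_cases hct : c = t
      · simp [hct]
      · simpa [hct] using h2 c (by omega)
    · rw [← h3 z hz]; funext i; simp [hz]
  rintro ρ r hfr' ⟨h2, h3, rfl⟩
  have f1 : ρ n = σ n := by rw [← e1]; exact hfr' n (by decide)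
  have f2 : ρ w = σ w := by rw [← e2]; exact hfr' w (by decide)
  have f4 : ρ bcnt = τ bcnt := hfr' bcnt (by decide)
  have f5 : ρ Loc.inf = σ Loc.inf := by rw [hfr' Loc.inf (by decide), hfr Loc.inf (by decide)]
  have f6 : ρ Loc.deg = σ Loc.deg := by rw [hfr' Loc.deg (by decide), hfr Loc.deg (by decide)]
  have f7 : ρ lst = σ lst := by rw [hfr' lst (by decide), hfr lst (by decide)]
  have f8 : ρ (bk 3) = σ (bk 3) := by rw [hfr' (bk 3) (by decide), hfr (bk 3) (by decide)]
  have f9 : ρ (bk 0) = σ (bk 0) := by rw [hfr' (bk 0) (by decide), hfr (bk 0) (by decide)]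
  have f10 : ρ dhat = σ dhat := by rw [hfr' dhat (by decide), hfr dhat (by decide)]
  have f11 : ρ j2 = σ j2 := by rw [hfr' j2 (by decide), hfr j2 (by decide)]
  have f12 : ρ hi = σ hi := by rw [hfr' hi (by decide), hfr hi (by decide)]
  have hIρ : InputData H N ρ := hI.congr f1 f5 f6 f7 f8 f9
  clear hfr hfr'
  have hball0 : gball H N w₀ 0 = {w₀} := by
    ext y
    rw [mem_gball, Finset.mem_singleton]
    constructor
    · rintro ⟨hy, hd0⟩
      by_contra hne
      have := tdist_pos (H := H) hw (Ne.symm hne)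
      omega
    · rintro rfl; exact ⟨hw, by rw [tdist_self]⟩
  simp only [vertexWeight, wp_wr0, wp_wr1, wp_wr2, val_rd0, val_rd1, val_one, val_zero, val_add, val_mul,
    Mem.set_of_ne, Mem.set_same, ne_eq, reduceCtorEq, not_false_eq_true, and_self, if_true, f2, hwσ,
    hIρ.n, hIρ.deg w₀ hw, hIρ.size]
  have hgw := hwM w₀ hw
  unfold gwt at hgw
  refine fun _ => ⟨by omega, fun _ => ⟨by omega, fun _ => ⟨by omega, fun _ => ⟨hgw, ?_⟩⟩⟩⟩
  -- R is the radius reached so far. It agrees with the loop variable as long as the ball is light,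
  -- and is frozen once the ball is heavy.
  refine wp_loop N (fun b π k => ∃ R, (∀ ρ' < R, ∑ y ∈ gball H N w₀ ρ', gwt H N y < q * gsize H N) ∧
    BallData H N w₀ (σ adj) (σ dhat) (gball H N w₀ R) π ∧
    ((R = b ∧ LayerData H N w₀ b (gball H N w₀ b) π) ∨
      q * gsize H N ≤ ∑ y ∈ gball H N w₀ R, gwt H N y) ∧
    k ≤ s + (N + 1) + N + b +
      ∑ y ∈ (Finset.range N).filter (fun y => tdist H N w₀ y < R), (gdeg H N y + 1))
    (by simpa using hIρ.n) (fun _ => by omega) ?_ ?_ ?_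
  · refine ⟨0, by simp, ⟨fun y hy => ?_, fun z hz => ?_, ?_, ?_, ?_, ?_⟩, Or.inl ⟨rfl, ?_⟩, by simp⟩
    · rw [hball0]
      by_cases hyw : y = w₀ <;> simp [hyw, h2 y hy]
    · rw [← h3 z hz]; funext i; simp [hz]
    · simp [hball0, gwt]
    · simpa [f10] using hE
    · simpa [f10] using EstLE.refl (N := N) (σ dhat)
    · simp [hball0, tdist_self, f10, hd]
    · rw [hball0]
      refine ⟨fun i hi => ?_, fun y hy _ => ?_, fun i hi j hj _ => ?_, fun c hc hcN => ?_⟩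
      · simp at hi; simp [hi, tdist_self]
      · simp at hy; simp [hy]
      · simp at hi hj; omega
      · have hc0 : c ≠ 0 := by omega
        simpa [hc0, f4] using h1 c (by omega)
  · rintro b hb π k hfr ⟨R, g1, g2, g3, g4⟩
    have i1 : π n = σ n := by rw [hfr n (by decide)]; simp [f1]
    have i2 : π w = σ w := by rw [hfr w (by decide)]; simp [f2]
    have i5 : π Loc.inf = σ Loc.inf := by rw [hfr Loc.inf (by decide)]; simp [f5]
    have i6 : π Loc.deg = σ Loc.deg := by rw [hfr Loc.deg (by decide)]; simp [f6]
    have i7 : π lst = σ lst := by rw [hfr lst (by decide)]; simp [f7]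
    have i8 : π (bk 3) = σ (bk 3) := by rw [hfr (bk 3) (by decide)]; simp [f8]
    have i9 : π (bk 0) = σ (bk 0) := by rw [hfr (bk 0) (by decide)]; simp [f9]
    have i11 : π j2 = σ j2 := by rw [hfr j2 (by decide)]; simp [f11]
    have hacc := g2.acc
    simp only [wp_when, val_lt, val_mul, val_rd0,
      Mem.set_of_ne, Mem.set_same, ne_eq, reduceCtorEq, not_false_eq_true, and_self, if_true,
      i11, i8, hq, hI.size, hacc, ite_eq_right_iff, one_ne_zero, imp_false, not_lt]
    refine ⟨fun h => ?_, fun h => ?_⟩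
    · rw [not_le] at h
      obtain ⟨rfl, hL⟩ : R = b ∧ LayerData H N w₀ b (gball H N w₀ b) π := by
        rcases g3 with g3 | g3
        · exact g3
        · omega
      refine wp_mono _ (growLayer hH hw hM (hI.congr (by simpa using i1) (by simpa using i5)
        (by simpa using i6) (by simpa using i7) (by simpa using i8) (by simpa using i9))
        (by simpa [i2] using hwσ) (by simp) hb (g2.congr (by simp) (by simp) (by simp))
        (hL.congr (by simp) (by simp))) ?_
      rintro κ l ⟨k1, k2, k3⟩
      refine ⟨R + 1, fun ρ' hρ' => ?_, k1, Or.inl ⟨rfl, k2⟩, ?_⟩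
      · rcases Nat.lt_succ_iff_lt_or_eq.1 hρ' with hρ' | rfl
        · exact g1 ρ' hρ'
        · exact h
      · have : (Finset.range N).filter (fun y => tdist H N w₀ y < R + 1) =
            (Finset.range N).filter (fun y => tdist H N w₀ y < R) ∪
            (Finset.range N).filter (fun y => tdist H N w₀ y = R) := by
          ext y; simp only [Finset.mem_filter, Finset.mem_union]
          constructor
          · rintro ⟨h1, h2⟩
            rcases Nat.lt_succ_iff_lt_or_eq.1 h2 with h2 | h2
            · exact Or.inl ⟨h1, h2⟩
            · exact Or.inr ⟨h1, h2⟩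
          · rintro (⟨h1, h2⟩ | ⟨h1, h2⟩) <;> exact ⟨h1, by omega⟩
        rw [this, Finset.sum_union]
        · omega
        · rw [Finset.disjoint_filter]; intro y _ h1 h2; omega
    · exact ⟨R, g1, g2.congr (by simp) (by simp) (by simp), Or.inr h, by omega⟩
  · rintro π k hfr ⟨R, g1, g2, g3, g4⟩
    have i2 : π w = σ w := by rw [hfr w (by decide)]; simp [f2]
    have i8 : π (bk 3) = σ (bk 3) := by rw [hfr (bk 3) (by decide)]; simp [f8]
    have i11 : π j2 = σ j2 := by rw [hfr j2 (by decide)]; simp [f11]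
    have i12 : π hi = σ hi := by rw [hfr hi (by decide)]; simp [f12]
    have hacc := g2.acc
    simp only [wp_wr2, val_no, val_lt, val_mul, val_rd0, val_zero,
      i11, i8, i2, hwσ, hq, hI.size, hacc]
    refine fun _ => ⟨by split_ifs <;> omega, R, ⟨g1, fun h y hy hr => ?_⟩,
      g2.congr (by simp) (by simp) (by simp), ?_, fun z hz => by simp [hz, i12], ?_⟩
    -- If the ball stayed light for all N layers, then it is the whole component, since finite
    -- distances are below N.
    · rcases g3 with ⟨rfl, -⟩ | g3
      · exact (tdist_lt_of_reachable hH hw hr).le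
      · omega
    · simp
    · have := sum_gdeg_le hw g1
      omega

end TwoApproxBalls2
/-! ### The program for two-approximate distances: one level -/

section TwoApproxLevel
open Loc

/-- Lower the estimate for `x`, `y` to `v`. -/
def lowerEst (x y : Exp Loc) : Cmd Loc := when (.lt §v (rd2 dhat x y)) (block [
  wr2 dhat x y §v,
  wr2 dhat y x §v])

/-- `j1[x]` is the nearest vertex to `x` in the hitting set, `nPow[x]` its distance. -/
def findCenters : Cmd Loc := .loop x §n (block [
  wr1 nPow §x §inf,
  .loop y §n (when (rd2 inD 0 §y * rd2 adj §x §y) (when (.lt (rd2 dhat §x §y) (rd1 nPow §x))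
    (block [wr1 nPow §x (rd2 dhat §x §y), wr1 j1 §x §y])))])

/-- Paths from the sources over the vertices `w` that use one more edge. -/
def explore : Cmd Loc := .loop w §n (when (.lt (rd1 degPow §w) §inf) (block [
  wr0 j (rd1 p §w),
  .loop x §n (when (rd2 adj §w §x * .lt (rd2 dhat §w §x) (rd1 nPow §w))
    (.loop e (rd1 deg §x) (block [
      wr0 y (rd2 lst §x §e),
      wr0 v (rd1 degPow §w + rd2 dhat §w §x + 1),
      lowerEst §j §y])))]))

/-- Adjacency lists of the edges with an endpoint at distance at least two from the hitting set. -/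
def buildSparse : Cmd Loc := block [
  .loop x §n (wr1 cnt §x 0),
  .loop x §n (.loop y §n
    (when (rd2 (bk 0) §x §y * (no (.lt (rd1 nPow §x) 2) + no (.lt (rd1 nPow §y) 2)))
      (push §x §y)))]

/-- Dijkstra's algorithm from all sources. -/
def runSources : Cmd Loc := .loop t §n (when (rd1 siz §t) (block [wr0 w §t, dijkstra]))

/-- Paths over the nearest source. -/
def combine : Cmd Loc := .loop x §n (when (.lt (rd1 degPow §x) §inf) (block [
  wr0 j (rd1 p §x),
  .loop y §n (block [
    wr0 v (rd1 degPow §x + rd2 dhat §j §y),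
    lowerEst §x §y])]))

/-- The hitting set becomes the set of sources. -/
def advance : Cmd Loc := .loop x §n (block [
  wr1 siz §x (rd2 inD 0 §x),
  wr1 p §x (rd1 j1 §x),
  wr1 degPow §x (rd1 nPow §x)])

variable {H : SimpleGraph ℕ} {N M : ℕ}

/-- The hypotheses on `x` and `y` say that the index expressions do not read `dhat`, so that the two
writes address a symmetric pair of entries. -/
theorem lowerEst_spec {s a b v₀ : ℕ} {σ : Mem Loc} {x y : Exp Loc} (ha : a < N) (hb : b < N)
    (hx : ∀ τ : Mem Loc, (∀ z, z ≠ dhat → τ z = σ z) → x.val τ = a)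
    (hy : ∀ τ : Mem Loc, (∀ z, z ≠ dhat → τ z = σ z) → y.val τ = b)
    (hv : σ v 0 0 = v₀) (hM : 4 * N ≤ M) (hE : IsEst H N (σ dhat)) (hs : tdist H N a b ≤ v₀) :
    (lowerEst x y).wp M (fun τ r => IsEst H N (τ dhat) ∧ EstLE N (τ dhat) (σ dhat) ∧
      τ dhat a b ≤ v₀ ∧ r = s) σ s := by
  have hle := hE.le a ha b hb
  simp only [lowerEst, wp_block_cons, wp_block_nil, wp_when, wp_wr2, val_lt, val_rd0, val_rd2, hv,
    hx σ (fun _ _ => rfl), hy σ (fun _ _ => rfl), hx _ (fun z hz => Mem.set_of_ne σ hz _ _ _),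
    hy _ (fun z hz => Mem.set_of_ne σ hz _ _ _),
    Mem.set_of_ne, Mem.set_same, ne_eq, reduceCtorEq, not_false_eq_true]
  refine ⟨fun h _ => ?_, fun h => ⟨hE, EstLE.refl _, ?_, trivial⟩⟩
  · have h' : v₀ < σ dhat a b := by by_contra hc; simp [hc] at h
    refine ⟨by omega, fun _ => ⟨by omega, ?_⟩⟩
    have := hE.update (D' := ((σ.set dhat a b v₀).set dhat b a v₀) dhat) hs h'.le ha hb
      (by intro x y; simp only [Mem.set_same]; clear * -; grind)
    refine ⟨this.1, this.2, ?_, trivial⟩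
    split_ifs with hc1 hc2
    · exact le_rfl
    · exact le_rfl
    · exact absurd ⟨trivial, trivial⟩ hc2
  · by_contra hc
    simp [not_le.1 hc] at h

/-- `c x` is a nearest vertex to `x` in the set `{y | S y ≠ 0}` and `r x` is its distance. -/
def IsCenter (H : SimpleGraph ℕ) (N : ℕ) (S c r : ℕ → ℕ) : Prop :=
  ∀ x < N, (∀ y < N, S y ≠ 0 → r x ≤ tdist H N x y) ∧ r x ≤ 4 * N ∧
    (r x < 4 * N → c x < N ∧ S (c x) ≠ 0 ∧ tdist H N x (c x) = r x)

/-- Only chosen vertices inside the ball of x are compared. That their minimum is attained by a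
globally nearest chosen vertex is part of `HasBall.nearest`. -/
theorem findCenters_spec {s : ℕ} {σ : Mem Loc} (hM : 4 * N + 4 ≤ M) (hI : InputData H N σ)
    (hE : IsEst H N (σ dhat)) :
    findCenters.wp M (fun τ r => (∀ x < N,
      (∀ y < N, σ inD 0 y ≠ 0 → σ adj x y ≠ 0 → τ nPow x 0 ≤ σ dhat x y) ∧ τ nPow x 0 ≤ 4 * N ∧
      (τ nPow x 0 < 4 * N → τ j1 x 0 < N ∧ σ inD 0 (τ j1 x 0) ≠ 0 ∧ σ adj x (τ j1 x 0) ≠ 0 ∧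
        τ nPow x 0 = σ dhat x (τ j1 x 0))) ∧ r = s + N * (N + 1)) σ s := by
  unfold findCenters
  refine wp_loop N (fun t τ r => (∀ x < t,
      (∀ y < N, σ inD 0 y ≠ 0 → σ adj x y ≠ 0 → τ nPow x 0 ≤ σ dhat x y) ∧ τ nPow x 0 ≤ 4 * N ∧
      (τ nPow x 0 < 4 * N → τ j1 x 0 < N ∧ σ inD 0 (τ j1 x 0) ≠ 0 ∧ σ adj x (τ j1 x 0) ≠ 0 ∧
        τ nPow x 0 = σ dhat x (τ j1 x 0))) ∧ r = s + t * (N + 1)) (by simpa using hI.n)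
    (fun _ => by omega) (by simp) ?_ (fun τ r _ h => h)
  rintro t ht τ r hfr ⟨h1, h2⟩
  have e1 : τ n = σ n := hfr n (by decide)
  have e2 : τ inf = σ inf := hfr inf (by decide)
  have e3 : τ dhat = σ dhat := hfr dhat (by decide)
  have e4 : τ adj = σ adj := hfr adj (by decide)
  have e5 : τ inD = σ inD := hfr inD (by decide)
  simp only [wp_block_cons, wp_block_nil, wp_wr1, val_rd0, val_rd1, Mem.set_of_ne, Mem.set_same, ne_eq, reduceCtorEq,
    not_false_eq_true, and_self, if_true, e2, hI.inf]
  refine fun _ => ⟨by omega, ?_⟩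
  refine wp_loop N (fun u ρ q =>
      (∀ x, x ≠ t → ρ nPow x = τ nPow x ∧ ρ j1 x = τ j1 x) ∧
      (∀ y < u, σ inD 0 y ≠ 0 → σ adj t y ≠ 0 → ρ nPow t 0 ≤ σ dhat t y) ∧ ρ nPow t 0 ≤ 4 * N ∧
      (ρ nPow t 0 < 4 * N → ρ j1 t 0 < N ∧ σ inD 0 (ρ j1 t 0) ≠ 0 ∧ σ adj t (ρ j1 t 0) ≠ 0 ∧
        ρ nPow t 0 = σ dhat t (ρ j1 t 0)) ∧ q = r + 1 + u) (by simpa [e1] using hI.n)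
    (fun _ => by omega) ?_ ?_ ?_
  · refine ⟨fun x hx => ⟨?_, by simp⟩, by simp, by simp, by simp, rfl⟩
    funext i; simp [hx]
  · rintro u hu ρ q hfr' ⟨g1, g2, g3, g4, g5⟩
    have f1 : ρ x 0 0 = t := by rw [hfr' x (by decide)]; simp
    have f3 : ρ dhat = σ dhat := by rw [hfr' dhat (by decide)]; simpa using e3
    have f4 : ρ adj = σ adj := by rw [hfr' adj (by decide)]; simpa using e4
    have f5 : ρ inD = σ inD := by rw [hfr' inD (by decide)]; simpa using e5
    have hle := hE.le t ht u hu
    simp only [wp_block_cons, wp_block_nil, wp_when, wp_wr1, val_rd0, val_rd1, val_rd2, val_mul, val_lt, val_zero,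
      Mem.set_of_ne, Mem.set_same, ne_eq, reduceCtorEq, mul_eq_zero, not_or,
      not_false_eq_true, and_self, if_true, f1, f3, f4, f5, ite_eq_right_iff, one_ne_zero,
      imp_false, not_lt]
    refine ⟨fun ⟨h3, h4⟩ => ⟨fun h5 _ => ?_, fun h5 => ?_⟩, fun h3 => ?_⟩
    · rw [not_le] at h5
      refine ⟨by omega, fun _ => ⟨by omega, fun x hx => ?_, fun y hy hy1 hy2 => ?_, by omega,
        fun _ => ⟨hu, h3, h4, trivial⟩, by omega⟩⟩
      · obtain ⟨k1, k2⟩ := g1 x hx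
        refine ⟨?_, ?_⟩ <;> funext i <;> simp [hx, k1, k2]
      · rcases Nat.lt_succ_iff_lt_or_eq.1 hy with hy | rfl
        · exact h5.le.trans (g2 y hy hy1 hy2)
        · exact le_rfl
    · refine ⟨fun x hx => g1 x hx, fun y hy hy1 hy2 => ?_, g3, g4, by omega⟩
      rcases Nat.lt_succ_iff_lt_or_eq.1 hy with hy | rfl
      · exact g2 y hy hy1 hy2
      · exact h5
    · refine ⟨fun x hx => g1 x hx, fun y hy hy1 hy2 => ?_, g3, g4, by omega⟩
      rcases Nat.lt_succ_iff_lt_or_eq.1 hy with hy | rfl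
      · exact g2 y hy hy1 hy2
      · rcases h3 with h3 | h3 <;> contradiction
  · rintro ρ q - ⟨g1, g2, g3, g4, g5⟩
    refine ⟨fun x hx => ?_, by rw [g5, h2]; ring⟩
    by_cases hxt : x = t
    · rw [hxt]; exact ⟨g2, g3, g4⟩
    · obtain ⟨k1, k2⟩ := g1 x hxt
      rw [k1, k2]; exact h1 x (by omega)

/-- A walk goes from the source p(w) to w, on to x within the ball, and along one more edge. Only
those x are scanned that are strictly closer to w than the next source, which bounds the total
degree. The additional edge is what lets the two halves of a path meet in `two_approx_step`. -/
theorem explore_spec {s B : ℕ} {σ : Mem Loc} (hH : OnRange H N) (hM : 16 * N + 4 ≤ M)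
    (hI : InputData H N σ) (hE : IsEst H N (σ dhat))
    (hC : ∀ w < N, σ degPow w 0 < 4 * N → σ p w 0 < N ∧ tdist H N w (σ p w 0) = σ degPow w 0)
    (hex : ∀ w < N, ∀ x < N, σ adj w x ≠ 0 → σ dhat w x = tdist H N w x)
    (hB : ∀ w < N, ∑ x ∈ (Finset.range N).filter
      (fun x => σ adj w x ≠ 0 ∧ tdist H N w x < σ nPow w 0), gdeg H N x ≤ B) :
    explore.wp M (fun τ r => IsEst H N (τ dhat) ∧ EstLE N (τ dhat) (σ dhat) ∧
      (∀ w < N, σ degPow w 0 < 4 * N → ∀ x < N, σ adj w x ≠ 0 → tdist H N w x < σ nPow w 0 →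
        ∀ y, H.Adj x y → τ dhat (σ p w 0) y ≤ σ degPow w 0 + tdist H N w x + 1) ∧
      r ≤ s + N * (1 + N + B)) σ s := by
  unfold explore
  refine wp_loop N (fun t τ r => IsEst H N (τ dhat) ∧ EstLE N (τ dhat) (σ dhat) ∧
      (∀ w < t, σ degPow w 0 < 4 * N → ∀ x < N, σ adj w x ≠ 0 → tdist H N w x < σ nPow w 0 →
        ∀ y, H.Adj x y → τ dhat (σ p w 0) y ≤ σ degPow w 0 + tdist H N w x + 1) ∧
      r ≤ s + t * (1 + N + B)) (by simpa using hI.n)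
    (fun _ => by omega) ⟨hE, EstLE.refl _, by simp, by simp⟩ ?_ (fun τ r _ h => h)
  rintro w₀ hw τ r hfr ⟨h1, h2, h3, h4⟩
  have e1 : τ n = σ n := hfr n (by decide)
  have e2 : τ inf = σ inf := hfr inf (by decide)
  have e4 : τ degPow = σ degPow := hfr degPow (by decide)
  have e5 : τ p = σ p := hfr p (by decide)
  have e6 : τ adj = σ adj := hfr adj (by decide)
  have e7 : τ nPow = σ nPow := hfr nPow (by decide)
  have e8 : τ Loc.deg = σ Loc.deg := hfr Loc.deg (by decide)
  have e9 : τ lst = σ lst := hfr lst (by decide)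
  simp only [wp_block_cons, wp_block_nil, wp_when, wp_wr0, val_rd0, val_rd1, val_lt, Mem.set_of_ne, Mem.set_same, ne_eq, reduceCtorEq,
    not_false_eq_true, and_self, if_true, e2, hI.inf, e4, e5, ite_eq_right_iff, one_ne_zero,
      imp_false, not_lt]
  refine ⟨fun h5 _ => ?_, fun h5 => ⟨h1, h2, fun w hw' hr => ?_, by nlinarith⟩⟩
  swap
  · rcases Nat.lt_succ_iff_lt_or_eq.1 hw' with hw' | rfl
    · exact h3 w hw' hr
    · omega
  rw [not_le] at h5
  obtain ⟨hpN, hpd⟩ := hC w₀ hw h5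
  refine ⟨by omega, ?_⟩
  obtain ⟨p₀, hp₀⟩ : ∃ p₀, σ p w₀ 0 = p₀ := ⟨_, rfl⟩
  rw [hp₀] at hpN hpd
  rw [hp₀]
  refine wp_loop N (fun u ρ q => IsEst H N (ρ dhat) ∧ EstLE N (ρ dhat) (τ dhat) ∧
      (∀ x < u, σ adj w₀ x ≠ 0 → tdist H N w₀ x < σ nPow w₀ 0 →
        ∀ y, H.Adj x y → ρ dhat p₀ y ≤ σ degPow w₀ 0 + tdist H N w₀ x + 1) ∧
      q = r + 1 + u + ∑ x ∈ (Finset.range u).filter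
        (fun x => σ adj w₀ x ≠ 0 ∧ tdist H N w₀ x < σ nPow w₀ 0), gdeg H N x)
    (by simpa [e1] using hI.n)
    (fun _ => by omega) ⟨by simpa using h1, by simpa using EstLE.refl _, by simp, by simp⟩ ?_ ?_
  · rintro x₀ hx₀ ρ q hfr' ⟨g1, g2, g3, g4⟩
    have f1 : ρ w 0 0 = w₀ := by rw [hfr' w (by decide)]; simp
    have f2 : ρ j 0 0 = p₀ := by rw [hfr' j (by decide)]; simp
    have f4 : ρ degPow = σ degPow := by rw [hfr' degPow (by decide)]; simpa using e4
    have f6 : ρ adj = σ adj := by rw [hfr' adj (by decide)]; simpa using e6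
    have f7 : ρ nPow = σ nPow := by rw [hfr' nPow (by decide)]; simpa using e7
    have f8 : ρ Loc.deg = σ Loc.deg := by rw [hfr' Loc.deg (by decide)]; simpa using e8
    have f9 : ρ lst = σ lst := by rw [hfr' lst (by decide)]; simpa using e9
    -- The loop changes the matrix that it reads. The entries inside the balls are already exact,
    -- and a valid estimate that only decreases keeps them exact.
    have hexact : ∀ D, IsEst H N D → EstLE N D (σ dhat) → σ adj w₀ x₀ ≠ 0 →
        D w₀ x₀ = tdist H N w₀ x₀ := fun D hD hle ha =>
      le_antisymm ((hle w₀ hw x₀ hx₀).trans (hex w₀ hw x₀ hx₀ ha).le) (hD.sound w₀ hw x₀ hx₀)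
    simp only [wp_when, val_rd0, val_rd1, val_rd2, val_mul, val_lt,
      Mem.set_of_ne, Mem.set_same, ne_eq, reduceCtorEq, mul_eq_zero, not_or,
      not_false_eq_true, and_self, if_true, f1, f6, f7, ite_eq_right_iff, one_ne_zero,
      imp_false, not_lt]
    simp only [ne_eq] at g4
    rw [Finset.range_add_one, Finset.filter_insert]
    refine ⟨fun ⟨h6, h7⟩ => ?_, fun h6 => ?_⟩
    · have hd := hexact _ g1 (g2.trans h2) h6
      rw [hd, not_le] at h7
      rw [if_pos ⟨h6, h7⟩, Finset.sum_insert (by simp)]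
      have hle := hE.le w₀ hw x₀ hx₀
      refine wp_loop (gdeg H N x₀) (fun e π k => IsEst H N (π dhat) ∧ EstLE N (π dhat) (ρ dhat) ∧
        (∀ i < e, π dhat p₀ (σ lst x₀ i) ≤ σ degPow w₀ 0 + tdist H N w₀ x₀ + 1) ∧ k = q + 1 + e)
        (by simpa [f8] using hI.deg x₀ hx₀) (fun _ => (gdeg_le H N _).trans (by omega))
        ⟨by simpa using g1, by simpa using EstLE.refl _, by simp, rfl⟩ ?_ ?_
      · rintro e₀ he π k hfr'' ⟨k1, k2, k3, k4⟩
        have i1 : π w 0 0 = w₀ := by rw [hfr'' w (by decide)]; simpa using f1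
        have i2 : π j 0 0 = p₀ := by rw [hfr'' j (by decide)]; simpa using f2
        have i3 : π x 0 0 = x₀ := by rw [hfr'' x (by decide)]; simp
        have i4 : π degPow = σ degPow := by rw [hfr'' degPow (by decide)]; simpa using f4
        have i9 : π lst = σ lst := by rw [hfr'' lst (by decide)]; simpa using f9
        obtain ⟨y₀, hy₀⟩ : ∃ y₀, σ lst x₀ e₀ = y₀ := ⟨_, rfl⟩
        have hadj : H.Adj x₀ y₀ := hy₀ ▸ hI.list x₀ hx₀ e₀ he
        have hy₀N : y₀ < N := hH.lt_right hadj
        have hd' := hexact _ k1 (k2.trans (g2.trans h2)) h6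
        have htle := tdist_le (y := x₀) hH hw
        simp only [wp_block_cons, wp_block_nil, wp_wr0, val_rd0, val_rd1, val_rd2, val_add, val_one,
          Mem.set_of_ne, Mem.set_same, ne_eq, reduceCtorEq,
          not_false_eq_true, and_self, if_true, i1, i2, i3, i4, i9, hy₀, hd']
        refine fun _ => ⟨by omega, fun _ => ⟨by omega, ?_⟩⟩
        refine wp_mono _ (lowerEst_spec (H := H) (N := N) (a := p₀) (b := y₀)
          (v₀ := σ degPow w₀ 0 + tdist H N w₀ x₀ + 1) hpN hy₀N ?_ ?_ (by simp) (by omega)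
          (by simpa using k1) ?_) ?_
        · intro μ hμ; simp [hμ j (by decide), i2]
        · intro μ hμ; simp [hμ y (by decide)]
        · have t1 := tdist_triangle hH hpN w₀ y₀
          have t2 := tdist_triangle hH hw x₀ y₀
          rw [tdist_comm p₀ w₀, hpd] at t1
          rw [tdist_adj hadj] at t2
          omega
        · rintro μ l ⟨m1, m2, m3, m4⟩
          simp only [Mem.set_of_ne, ne_eq, reduceCtorEq, not_false_eq_true] at m2
          refine ⟨m1, m2.trans k2, fun i hi => ?_, by omega⟩
          rcases Nat.lt_succ_iff_lt_or_eq.1 hi with hi | rfl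
          · exact (m2 p₀ hpN _ (hH.lt_right (hI.list x₀ hx₀ i (by omega)))).trans (k3 i hi)
          · rw [hy₀]; exact m3
      · rintro π k - ⟨k1, k2, k3, k4⟩
        refine ⟨k1, k2.trans g2, fun x hx ha hlt y hy => ?_, by omega⟩
        rcases Nat.lt_succ_iff_lt_or_eq.1 hx with hx | rfl
        · exact (k2 p₀ hpN y (hH.lt_right hy)).trans (g3 x hx ha hlt y hy)
        · obtain ⟨e, he, rfl⟩ := hI.mem x y hy
          exact k3 e he
    · have hno : ¬ (σ adj w₀ x₀ ≠ 0 ∧ tdist H N w₀ x₀ < σ nPow w₀ 0) := by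
        rintro ⟨k1, k2⟩
        rcases h6 with h6 | h6
        · exact k1 h6
        · rw [hexact _ g1 (g2.trans h2) k1] at h6; omega
      rw [if_neg hno]
      refine ⟨g1, g2, fun x hx ha hlt => ?_, by omega⟩
      rcases Nat.lt_succ_iff_lt_or_eq.1 hx with hx | rfl
      · exact g3 x hx ha hlt
      · exact absurd ⟨ha, hlt⟩ hno
  · rintro ρ q - ⟨g1, g2, g3, g4⟩
    refine ⟨g1, g2.trans h2, fun w hw' hr x hx ha hlt y hy => ?_, ?_⟩
    · rcases Nat.lt_succ_iff_lt_or_eq.1 hw' with hw' | rfl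
      · exact (g2 _ (hC w (by omega) hr).1 y (hH.lt_right hy)).trans (h3 w hw' hr x hx ha hlt y hy)
      · rw [hp₀]; exact g3 x hx ha hlt y hy
    · have := hB w₀ hw
      nlinarith

-- The threshold 2 is chosen because a vertex at distance at least 2 from the next sources has a
-- light ball of radius 1, hence a small degree; see `HasBall.nearest`.
open Classical in
theorem buildSparse_spec {s : ℕ} {σ : Mem Loc} (hH : OnRange H N) (hM : N + 4 ≤ M)
    (hI : InputData H N σ) :
    buildSparse.wp M (fun τ r => (∀ x < N, τ cnt x 0 = ((Finset.range N).filter fun y =>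
        H.Adj x y ∧ (2 ≤ σ nPow x 0 ∨ 2 ≤ σ nPow y 0)).card) ∧
      (∀ x < N, ∀ e < τ cnt x 0, τ nbr x e < N) ∧
      (∀ x y, H.Adj x y → (2 ≤ σ nPow x 0 ∨ 2 ≤ σ nPow y 0) → ∃ e < τ cnt x 0, τ nbr x e = y) ∧
      r = s + N + N * (N + 1)) σ s := by
  unfold buildSparse
  simp only [wp_block_cons, wp_block_nil]
  refine wp_loop N (fun t τ r => (∀ c < t, τ cnt c 0 = 0) ∧ r = s + t) (by simp [hI.n])
    (fun _ => by omega) (by simp) ?_ ?_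
  · rintro t ht τ r hfr ⟨h1, h2⟩
    simp only [wp_wr1, val_rd0, val_zero, Mem.set_same, Mem.set_of_ne, ne_eq, reduceCtorEq,
      not_false_eq_true, and_self, if_true]
    refine fun _ => ⟨by omega, fun c hc => ?_, by omega⟩
    by_cases hct : c = t
    · simp [hct]
    · simpa [hct] using h1 c (by omega)
  rintro τ r hfr ⟨h1, rfl⟩
  have e1 : τ n = σ n := hfr n (by decide)
  have e2 : τ (bk 0) = σ (bk 0) := hfr (bk 0) (by decide)
  have e3 : τ nPow = σ nPow := hfr nPow (by decide)
  refine wp_loop N (fun t ρ r => (∀ x < t, ρ cnt x 0 = ((Finset.range N).filter fun y =>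
        H.Adj x y ∧ (2 ≤ σ nPow x 0 ∨ 2 ≤ σ nPow y 0)).card) ∧
      (∀ x, t ≤ x → x < N → ρ cnt x 0 = 0) ∧
      (∀ x < t, ∀ e < ρ cnt x 0, ρ nbr x e < N) ∧
      (∀ x < t, ∀ y, H.Adj x y → (2 ≤ σ nPow x 0 ∨ 2 ≤ σ nPow y 0) →
        ∃ e < ρ cnt x 0, ρ nbr x e = y) ∧
      r = s + N + t * (N + 1)) (by simpa [e1] using hI.n)
    (fun _ => by omega) ?_ ?_ ?_
  · exact ⟨by simp, fun x _ hx => h1 x hx, by simp, by simp, by simp⟩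
  · rintro t ht ρ r hfr' ⟨g1, g2, g3, g4, g5⟩
    have f1 : ρ n = σ n := by rw [hfr' n (by decide), e1]
    have f2 : ρ (bk 0) = σ (bk 0) := by rw [hfr' (bk 0) (by decide), e2]
    have f3 : ρ nPow = σ nPow := by rw [hfr' nPow (by decide), e3]
    refine wp_loop N (fun u π k => (∀ x, x ≠ t → π cnt x = ρ cnt x ∧ π nbr x = ρ nbr x) ∧
        π cnt t 0 = ((Finset.range u).filter fun y =>
          H.Adj t y ∧ (2 ≤ σ nPow t 0 ∨ 2 ≤ σ nPow y 0)).card ∧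
        (∀ e < π cnt t 0, π nbr t e < N) ∧
        (∀ y < u, H.Adj t y → (2 ≤ σ nPow t 0 ∨ 2 ≤ σ nPow y 0) → ∃ e < π cnt t 0, π nbr t e = y) ∧
        k = r + 1 + u) (by simpa [f1] using hI.n) (fun _ => by omega) ?_ ?_ ?_
    · simp [g2 t le_rfl ht]
    · rintro u hu π k hfr'' ⟨k1, k2, k3, k4, k5⟩
      have i1 : π x 0 0 = t := by rw [hfr'' x (by decide)]; simp
      have i2 : π (bk 0) = σ (bk 0) := by rw [hfr'' (bk 0) (by decide)]; simpa using f2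
      have i3 : π nPow = σ nPow := by rw [hfr'' nPow (by decide)]; simpa using f3
      have hle : ((Finset.range u).filter fun y =>
          H.Adj t y ∧ (2 ≤ σ nPow t 0 ∨ 2 ≤ σ nPow y 0)).card ≤ u :=
        (Finset.card_le_card (Finset.filter_subset _ _)).trans (by simp)
      have hiff : σ (bk 0) t u * ((if (if σ nPow t 0 < 2 then 1 else 0) = 0 then 1 else 0) +
          if (if σ nPow u 0 < 2 then 1 else 0) = 0 then 1 else 0) = 0 ↔
          ¬ (H.Adj t u ∧ (2 ≤ σ nPow t 0 ∨ 2 ≤ σ nPow u 0)) := by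
        rw [← hI.input t ht u hu]
        by_cases c1 : σ (bk 0) t u = 0 <;> by_cases c2 : σ nPow t 0 < 2 <;>
          by_cases c3 : σ nPow u 0 < 2 <;> simp [c1, c2, c3]
      rw [Finset.range_add_one, Finset.filter_insert]
      simp only [push, wp_block_cons, wp_block_nil, wp_when, wp_wr1, wp_wr2, val_rd0, val_rd1, val_rd2, val_mul, val_lt,
        val_add, val_no, val_one, val_two,
        Mem.set_of_ne, Mem.set_same, ne_eq, reduceCtorEq, Loc.bk.injEq,
        not_false_eq_true, and_self, if_true, i1, i2, i3, hiff, not_not]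
      refine ⟨fun h => ?_, fun h => ?_⟩
      · rw [if_pos h, Finset.card_insert_of_notMem (by simp)]
        refine fun _ => ⟨by omega, fun _ => ⟨by omega, fun x hx => ?_, by simp [k2], fun e he => ?_,
          fun y hy hy1 hy2 => ?_, by omega⟩⟩
        · obtain ⟨m1, m2⟩ := k1 x hx
          refine ⟨?_, ?_⟩ <;> funext i <;> simp [hx, m1, m2]
        · split_ifs with hc
          · exact hu
          · exact k3 e (by simp at he hc; omega)
        · rcases Nat.lt_succ_iff_lt_or_eq.1 hy with hy | rfl
          · obtain ⟨e, he, he'⟩ := k4 y hy hy1 hy2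
            exact ⟨e, by simp; omega, by rw [if_neg (by omega), he']⟩
          · exact ⟨π cnt t 0, by simp, by simp⟩
      · rw [if_neg h]
        refine ⟨fun x hx => k1 x hx, k2, k3, fun y hy hy1 hy2 => ?_, by omega⟩
        rcases Nat.lt_succ_iff_lt_or_eq.1 hy with hy | rfl
        · exact k4 y hy hy1 hy2
        · exact absurd ⟨hy1, hy2⟩ h
    · rintro π k - ⟨k1, k2, k3, k4, k5⟩
      refine ⟨fun x hx => ?_, fun x hx hxN => ?_, fun x hx => ?_, fun x hx y hy => ?_,
        by rw [k5, g5]; ring⟩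
      · by_cases hxt : x = t
        · rw [hxt]; exact k2
        · rw [(k1 x hxt).1]; exact g1 x (by omega)
      · rw [(k1 x (by omega)).1]; exact g2 x (by omega) hxN
      · by_cases hxt : x = t
        · rw [hxt]; exact k3
        · rw [(k1 x hxt).1, (k1 x hxt).2]; exact g3 x (by omega)
      · by_cases hxt : x = t
        · rw [hxt] at hy ⊢; exact k4 y (hH.lt_right hy) hy
        · rw [(k1 x hxt).1, (k1 x hxt).2]; exact g4 x (by omega) y hy
  · rintro ρ r - ⟨g1, g2, g3, g4, g5⟩
    exact ⟨g1, g3, fun x y hy => g4 x (hH _ _ hy) y hy, g5⟩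

end TwoApproxLevel
-- The phases of one round: balls, searches from the sources, combination
section TwoApproxPhases
open Loc

/-- Grow a ball around every vertex. -/
def balls : Cmd Loc := .loop w §n growBall

variable {H : SimpleGraph ℕ} {N M : ℕ}

/-- The row `w` of `A` is the indicator of a ball around `w` in which `D` is exact, and `f` tells
whether the ball has weight at least `θ`. -/
def HasBall (H : SimpleGraph ℕ) (N θ w : ℕ) (A D : ℕ → ℕ → ℕ) (f : ℕ) : Prop :=
  ∃ ρ, IsGrown H N θ w ρ ∧ (∀ y < N, A w y = if y ∈ gball H N w ρ then 1 else 0) ∧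
    (∀ y ∈ gball H N w ρ, D w y = tdist H N w y) ∧
    f = (if θ ≤ ∑ y ∈ gball H N w ρ, gwt H N y then 1 else 0)

theorem balls_spec {s q : ℕ} {σ : Mem Loc} (hH : OnRange H N)
    (hM : 8 * (N + 2) ^ 4 ≤ M) (hI : InputData H N σ) (hq : σ j2 0 0 = q)
    (hE : IsEst H N (σ dhat)) (hd : ∀ x < N, σ dhat x x = 0) :
    balls.wp M (fun τ r => IsEst H N (τ dhat) ∧ EstLE N (τ dhat) (σ dhat) ∧
      (∀ w < N, HasBall H N (q * gsize H N) w (τ adj) (τ dhat) (τ hi 0 w)) ∧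
      r ≤ s + N * (3 * N + 2 + q * gsize H N / N)) σ s := by
  have hNM : N ≤ M := by nlinarith [Nat.zero_le (N ^ 4), Nat.zero_le (N ^ 3), Nat.zero_le (N^2)]
  unfold balls
  refine wp_loop N (fun t τ r => IsEst H N (τ dhat) ∧ EstLE N (τ dhat) (σ dhat) ∧
      (∀ w < t, HasBall H N (q * gsize H N) w (τ adj) (τ dhat) (τ hi 0 w)) ∧
      r ≤ s + t * (3 * N + 2 + q * gsize H N / N)) (by simpa using hI.n)
    (fun _ => hNM) ⟨hE, EstLE.refl _, by simp, by simp⟩ ?_ (fun τ r _ h => h)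
  rintro w₀ hw τ r hfr ⟨h1, h2, h3, h4⟩
  have hIτ : InputData H N (τ.set w 0 0 w₀) := by
    refine hI.congr ?_ ?_ ?_ ?_ ?_ ?_
    · simpa using hfr n (by decide)
    · simpa using hfr inf (by decide)
    · simpa using hfr Loc.deg (by decide)
    · simpa using hfr lst (by decide)
    · simpa using hfr (bk 3) (by decide)
    · simpa using hfr (bk 0) (by decide)
  refine wp_mono _ (growBall_spec (q := q) hH hw hM hIτ (by simp)
    (by simpa [hfr j2 (by decide)] using hq) (by simpa using h1) ?_) ?_
  · have := h2 w₀ hw w₀ hw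
    rw [hd w₀ hw] at this
    simpa using this
  · rintro ρ k ⟨R, g1, g2, g3, g4, g5⟩
    have hle : EstLE N (ρ dhat) (τ dhat) := by simpa using g2.le
    refine ⟨g2.est, hle.trans h2, fun w' hw' => ?_, by nlinarith⟩
    rcases Nat.lt_succ_iff_lt_or_eq.1 hw' with hw' | rfl
    · obtain ⟨R', k1, k2, k3, k4⟩ := h3 w' hw'
      refine ⟨R', k1, fun y hy => ?_, fun y hy => ?_, ?_⟩
      · rw [g2.other w' (by omega), ← k2 y hy]; simp
      · have hyN := (mem_gball.1 hy).1
        exact le_antisymm ((hle w' (by omega) y hyN).trans (k3 y hy).le)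
          (g2.est.sound w' (by omega) y hyN)
      · rw [g4 w' (by omega), ← k4]; simp
    · exact ⟨R, g1, g2.ind, g2.exact, g3⟩

/-- Later searches see estimates lowered by earlier ones. As entries only decrease, the inequalities
may be stated for the matrix at the start, and the order of the sources does not matter. -/
theorem runSources_spec {s C : ℕ} {σ : Mem Loc} (hH : OnRange H N) (hM : 9 * N + C + 1 ≤ M)
    (hn : σ n 0 0 = N) (hinf : σ inf 0 0 = 4 * N) (hE : IsEst H N (σ dhat))
    (hnbr : ∀ x < N, ∀ e < σ cnt x 0, σ nbr x e < N)
    (hC : ∑ x ∈ Finset.range N, σ cnt x 0 ≤ C) :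
    runSources.wp M (fun τ r => IsEst H N (τ dhat) ∧ EstLE N (τ dhat) (σ dhat) ∧
      (∀ z < N, σ siz z 0 ≠ 0 → ∃ f : ℕ → ℕ, (∀ x < N, f x ≤ σ dhat z x) ∧
        (∀ x < N, ∀ e < σ cnt x 0, f (σ nbr x e) ≤ f x + σ dhat x (σ nbr x e)) ∧
        ∀ x < N, τ dhat z x ≤ f x) ∧
      r ≤ s + N + ((Finset.range N).filter fun z => σ siz z 0 ≠ 0).card * (16 * N + 2 * C)) σ s := by
  unfold runSources
  refine wp_loop N (fun t τ r => IsEst H N (τ dhat) ∧ EstLE N (τ dhat) (σ dhat) ∧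
      (∀ z < t, σ siz z 0 ≠ 0 → ∃ f : ℕ → ℕ, (∀ x < N, f x ≤ σ dhat z x) ∧
        (∀ x < N, ∀ e < σ cnt x 0, f (σ nbr x e) ≤ f x + σ dhat x (σ nbr x e)) ∧
        ∀ x < N, τ dhat z x ≤ f x) ∧
      r ≤ s + t + ((Finset.range t).filter fun z => σ siz z 0 ≠ 0).card * (16 * N + 2 * C))
    (by simpa using hn) (fun _ => by omega) ⟨hE, EstLE.refl _, by simp, by simp⟩ ?_
    (fun τ r _ h => h)
  rintro z₀ hz τ r hfr ⟨h1, h2, h3, h4⟩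
  have e1 : τ siz = σ siz := hfr siz (by decide)
  have e2 : τ n = σ n := hfr n (by decide)
  have e3 : τ inf = σ inf := hfr inf (by decide)
  have e4 : τ cnt = σ cnt := hfr cnt (by decide)
  have e5 : τ nbr = σ nbr := hfr nbr (by decide)
  rw [Finset.range_add_one, Finset.filter_insert]
  simp only [wp_block_cons, wp_block_nil, wp_when, wp_wr0, val_rd0, val_rd1, Mem.set_of_ne, Mem.set_same, ne_eq,
    reduceCtorEq, not_false_eq_true, and_self, if_true, e1]
  refine ⟨fun h _ => ⟨by omega, ?_⟩, fun h => ?_⟩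
  · rw [if_pos h, Finset.card_insert_of_notMem (by simp)]
    refine wp_mono _ (dijkstra_spec (N := N) (w₀ := z₀) (C := C) (by omega) hz (by simpa [e2] using hn)
      (by simpa [e3] using hinf) (by simp) (by simpa [e4, e5] using hnbr) (by simpa [e4] using hC)
      (by simpa using h1.le) (by simpa using h1.pos)) ?_
    rintro ρ k ⟨f, g1, g2, g3, g4, g5, g6⟩
    simp only [Mem.set_of_ne, ne_eq, reduceCtorEq, not_false_eq_true] at g2 g3 g4 g5
    obtain ⟨k1, k2⟩ := h1.dijkstra hH hz g2 g4 g5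
    refine ⟨k1, k2.trans h2, fun z hz' hs => ?_, ?_⟩
    · rcases Nat.lt_succ_iff_lt_or_eq.1 hz' with hz' | rfl
      · obtain ⟨f', i1, i2, i3⟩ := h3 z hz' hs
        exact ⟨f', i1, i2, fun x hx => (k2 z (by omega) x hx).trans (i3 x hx)⟩
      · refine ⟨f, fun x hx => (g2 x hx).trans (h2 z hz x hx), fun x hx e he => ?_, fun x hx => ?_⟩
        · rw [← e4] at he
          have := g3 x hx e he
          rw [e5] at this
          exact this.trans (Nat.add_le_add_left
            (h2 x hx _ (hnbr x hx e (by rwa [← e4]))) _)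
        · rw [g5, if_pos ⟨rfl, hx⟩]
    · simp only [ne_eq] at h4; nlinarith
  · rw [if_neg (by simpa using h)]
    refine ⟨h1, h2, fun z hz' hs => ?_, by simp only [ne_eq] at h4 ⊢; omega⟩
    rcases Nat.lt_succ_iff_lt_or_eq.1 hz' with hz' | rfl
    · exact h3 z hz' hs
    · exact absurd h hs

theorem combine_spec {s : ℕ} {σ : Mem Loc} (hH : OnRange H N) (hM : 9 * N + 1 ≤ M)
    (hn : σ n 0 0 = N) (hinf : σ inf 0 0 = 4 * N) (hE : IsEst H N (σ dhat))
    (hC : ∀ w < N, σ degPow w 0 < 4 * N → σ p w 0 < N ∧ tdist H N w (σ p w 0) = σ degPow w 0) :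
    combine.wp M (fun τ r => IsEst H N (τ dhat) ∧ EstLE N (τ dhat) (σ dhat) ∧
      (∀ x < N, σ degPow x 0 < 4 * N → ∀ y < N,
        τ dhat x y ≤ σ degPow x 0 + σ dhat (σ p x 0) y) ∧
      r ≤ s + N * (N + 1)) σ s := by
  unfold combine
  refine wp_loop N (fun t τ r => IsEst H N (τ dhat) ∧ EstLE N (τ dhat) (σ dhat) ∧
      (∀ x < t, σ degPow x 0 < 4 * N → ∀ y < N,
        τ dhat x y ≤ σ degPow x 0 + σ dhat (σ p x 0) y) ∧
      r ≤ s + t * (N + 1))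
    (by simpa using hn) (fun _ => by omega) ⟨hE, EstLE.refl _, by simp, by simp⟩ ?_
    (fun τ r _ h => h)
  rintro x₀ hx τ r hfr ⟨h1, h2, h3, h4⟩
  have e1 : τ degPow = σ degPow := hfr degPow (by decide)
  have e2 : τ n = σ n := hfr n (by decide)
  have e3 : τ inf = σ inf := hfr inf (by decide)
  have e4 : τ p = σ p := hfr p (by decide)
  simp only [wp_block_cons, wp_block_nil, wp_when, wp_wr0, val_rd0, val_rd1, val_lt, Mem.set_of_ne, Mem.set_same, ne_eq,
    reduceCtorEq, not_false_eq_true, and_self, if_true, e1, e3, e4, hinf, ite_eq_right_iff, one_ne_zero,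
      imp_false, not_lt]
  refine ⟨fun h _ => ?_, fun h => ⟨h1, h2, fun x hx' hr => ?_, by nlinarith⟩⟩
  swap
  · rcases Nat.lt_succ_iff_lt_or_eq.1 hx' with hx' | rfl
    · exact h3 x hx' hr
    · omega
  rw [not_le] at h
  obtain ⟨hp, hpd⟩ := hC x₀ hx h
  refine ⟨by omega, ?_⟩
  refine wp_loop N (fun u ρ q => IsEst H N (ρ dhat) ∧ EstLE N (ρ dhat) (τ dhat) ∧
      (∀ y < u, ρ dhat x₀ y ≤ σ degPow x₀ 0 + σ dhat (σ p x₀ 0) y) ∧ q = r + 1 + u)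
    (by simpa [e2] using hn) (fun _ => by omega)
    ⟨by simpa using h1, by simpa using EstLE.refl _, by simp, by simp⟩ ?_ ?_
  · rintro y₀ hy ρ q hfr' ⟨g1, g2, g3, g4⟩
    have f1 : ρ degPow = σ degPow := by rw [hfr' degPow (by decide)]; simpa using e1
    have f2 : ρ x 0 0 = x₀ := by rw [hfr' x (by decide)]; simp
    have f3 : ρ j 0 0 = σ p x₀ 0 := by rw [hfr' j (by decide)]; simp
    have hle := g1.le _ hp y₀ hy
    simp only [wp_block_cons, wp_block_nil, wp_wr0, val_rd0, val_rd1, val_rd2, val_add, Mem.set_of_ne, Mem.set_same, ne_eq,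
      reduceCtorEq, not_false_eq_true, and_self, if_true, f1, f2, f3]
    refine fun _ => ⟨by omega, ?_⟩
    refine wp_mono _ (lowerEst_spec (H := H) (N := N) (a := x₀) (b := y₀)
      (v₀ := σ degPow x₀ 0 + ρ dhat (σ p x₀ 0) y₀) hx hy ?_ ?_ (by simp) (by omega)
      (by simpa using g1) ?_) ?_
    · intro μ hμ; simp [hμ x (by decide), f2]
    · intro μ hμ; simp [hμ y (by decide)]
    · have := tdist_triangle hH hx (σ p x₀ 0) y₀
      have := g1.sound _ hp y₀ hy
      omega
    · rintro μ l ⟨m1, m2, m3, m4⟩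
      simp only [Mem.set_of_ne, ne_eq, reduceCtorEq, not_false_eq_true] at m2
      refine ⟨m1, m2.trans g2, fun y hy' => ?_, by omega⟩
      rcases Nat.lt_succ_iff_lt_or_eq.1 hy' with hy' | rfl
      · exact (m2 x₀ hx y (by omega)).trans (g3 y hy')
      · exact m3.trans (Nat.add_le_add_left ((g2.trans h2) _ hp y hy) _)
  · rintro ρ q - ⟨g1, g2, g3, g4⟩
    refine ⟨g1, g2.trans h2, fun x hx' hr y hy => ?_, by nlinarith⟩
    rcases Nat.lt_succ_iff_lt_or_eq.1 hx' with hx' | rfl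
    · exact (g2 x (by omega) y hy).trans (h3 x hx' hr y hy)
    · exact g3 y hy

theorem advance_spec {s : ℕ} {σ : Mem Loc} (hM : N ≤ M) (hn : σ n 0 0 = N) :
    advance.wp M (fun τ r => (∀ x < N, τ siz x 0 = σ inD 0 x ∧ τ p x 0 = σ j1 x 0 ∧
      τ degPow x 0 = σ nPow x 0) ∧ r = s + N) σ s := by
  unfold advance
  refine wp_loop N (fun t τ r => (∀ x < t, τ siz x 0 = σ inD 0 x ∧ τ p x 0 = σ j1 x 0 ∧
      τ degPow x 0 = σ nPow x 0) ∧ r = s + t)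
    (by simpa using hn) (fun _ => hM) (by simp) ?_ (fun τ r _ h => h)
  rintro x₀ hx τ r hfr ⟨h1, h2⟩
  have e1 : τ inD = σ inD := hfr inD (by decide)
  have e2 : τ j1 = σ j1 := hfr j1 (by decide)
  have e3 : τ nPow = σ nPow := hfr nPow (by decide)
  simp only [wp_block_cons, wp_block_nil, wp_wr1, val_rd0, val_rd1, val_rd2, val_zero, Mem.set_of_ne, Mem.set_same, ne_eq,
    reduceCtorEq, not_false_eq_true, and_self, if_true, e1, e2, e3]
  -- The copied cells are bounded because all cells are.
  refine fun hb => ⟨by rw [← e1]; simpa using hb inD 0 x₀, fun hb => ⟨by rw [← e2]; simpa using hb j1 x₀ 0,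
    fun hb => ⟨by rw [← e3]; simpa using hb nPow x₀ 0, fun x hx' => ?_, by omega⟩⟩⟩
  by_cases hxx : x = x₀
  · simp [hxx]
  · simpa [hxx] using h1 x (by omega)

end TwoApproxPhases
-- The sources of the next scale
section TwoApproxCenters
open Loc

variable {H : SimpleGraph ℕ} {N M : ℕ}

/-- In the last round there are no further sources, otherwise these form a hitting set for the
balls. -/
def nextCenters : Cmd Loc := .ite §(bk 1) (.loop x §n (wr1 nPow §x §inf)) (block [
  wr0 i 0,
  .loop x §n (wr2 inD 0 §x 0),
  balls,
  hittingSet,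
  findCenters,
  explore])

theorem IsGrown.reachable_le {θ w ρ y : ℕ} (h : IsGrown H N θ w ρ)
    (hs : ∑ y ∈ gball H N w ρ, gwt H N y < θ) (hy : y < N) (hd : tdist H N w y < 4 * N) :
    y ∈ gball H N w ρ :=
  mem_gball.2 ⟨hy, h.full hs y hy (reachable_of_tdist_lt hd)⟩

/-- Facts on the nearest vertices in a hitting set of the balls. -/
theorem HasBall.nearest {q w f : ℕ} {A D : ℕ → ℕ → ℕ} {S : ℕ → ℕ} {r c : ℕ} (hH : OnRange H N)
    (hw : w < N) (h : HasBall H N (q * gsize H N) w A D f)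
    (hit : f = 1 → ∃ y < N, InNbhd A w y ∧ S y ≠ 0)
    (h1 : ∀ y < N, S y ≠ 0 → A w y ≠ 0 → r ≤ D w y) (h2 : r ≤ 4 * N)
    (h3 : r < 4 * N → c < N ∧ S c ≠ 0 ∧ A w c ≠ 0 ∧ r = D w c) :
    ((∀ y < N, S y ≠ 0 → r ≤ tdist H N w y) ∧ r ≤ 4 * N ∧
      (r < 4 * N → c < N ∧ S c ≠ 0 ∧ tdist H N w c = r)) ∧
    (2 ≤ r → gdeg H N w + 1 ≤ q) ∧
    (∀ y < N, A w y ≠ 0 → D w y = tdist H N w y) ∧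
    (∀ y < N, tdist H N w y < r → A w y ≠ 0) ∧
    ∑ x ∈ (Finset.range N).filter (fun x => A w x ≠ 0 ∧ tdist H N w x < r), gdeg H N x ≤
      q * gsize H N / N := by
  obtain ⟨ρ, g1, g2, g3, g4⟩ := h
  have hA : ∀ y < N, (A w y ≠ 0 ↔ y ∈ gball H N w ρ) := by
    intro y hy; rw [g2 y hy]; split_ifs with h <;> simp [h]
  have hwB : w ∈ gball H N w ρ := mem_gball.2 ⟨hw, by rw [tdist_self]; omega⟩
  -- A heavy ball is hit, and the estimates in it are exact, so the nearest chosen vertex is within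
  -- its radius.
  have hbig : q * gsize H N ≤ ∑ y ∈ gball H N w ρ, gwt H N y → r ≤ ρ := by
    intro hle
    obtain ⟨y, hy, hy1, hy2⟩ := hit (by rw [g4, if_pos hle])
    have hyB : y ∈ gball H N w ρ := by
      by_cases hwy : w = y
      · rwa [← hwy]
      · unfold InNbhd at hy1
        rw [if_neg hwy] at hy1
        exact (hA y hy).1 hy1
    have := h1 y hy hy2 ((hA y hy).2 hyB)
    rw [g3 y hyB] at this
    exact this.trans (mem_gball.1 hyB).2
  -- A light ball is the whole component, and a heavy one has radius at least r. In both cases every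
  -- vertex closer than r lies in the ball, so no chosen vertex outside of it can be nearer.
  have hball : ∀ y < N, tdist H N w y < r → A w y ≠ 0 := by
    intro y hy hlt
    rw [hA y hy]
    rcases Nat.lt_or_ge (∑ y ∈ gball H N w ρ, gwt H N y) (q * gsize H N) with h | h
    · exact g1.reachable_le h hy (by omega)
    · exact mem_gball.2 ⟨hy, by have := hbig h; omega⟩
  refine ⟨⟨fun y hy hS => ?_, h2, fun hlt => ?_⟩, fun hr => ?_,
    fun y hy ha => g3 y ((hA y hy).1 ha), hball, ?_⟩
  · by_contra hlt
    have ha := hball y hy (by omega)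
    have := h1 y hy hS ha
    rw [g3 y ((hA y hy).1 ha)] at this
    exact hlt this
  · obtain ⟨k1, k2, k3, k4⟩ := h3 hlt
    exact ⟨k1, k2, by rw [k4, g3 c ((hA c k1).1 k3)]⟩
  -- The ball of radius 1 is light: either the search went beyond radius 1, or the final ball is
  -- light and contains it. A heavy ball of radius at most 1 would give r ≤ 1.
  · have hsum : ∑ y ∈ gball H N w 1, gwt H N y < q * gsize H N := by
      by_contra hge
      rcases Nat.lt_or_ge 1 ρ with h1ρ | h1ρ
      · exact hge (g1.small 1 h1ρ)
      · rcases Nat.lt_or_ge (∑ y ∈ gball H N w ρ, gwt H N y) (q * gsize H N) with h | h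
        · refine hge (lt_of_le_of_lt (Finset.sum_le_sum_of_subset fun y hy => ?_) h)
          obtain ⟨k1, k2⟩ := mem_gball.1 hy
          exact g1.reachable_le h k1 (by omega)
        · have := hbig h; omega
    -- The ball of radius 1 has at least deg + 1 vertices, each of weight at least `gsize`.
    have hcard : (gdeg H N w + 1) * gsize H N ≤ ∑ y ∈ gball H N w 1, gwt H N y := by
      classical
      have hsub : insert w ((Finset.range N).filter (H.Adj w)) ⊆ gball H N w 1 := by
        intro y hy
        rcases Finset.mem_insert.1 hy with rfl | hy
        · exact mem_gball.2 ⟨hw, by rw [tdist_self]; omega⟩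
        · rw [Finset.mem_filter, Finset.mem_range] at hy
          exact mem_gball.2 ⟨hy.1, (tdist_adj hy.2).le⟩
      have h2 := Finset.card_le_card hsub
      rw [Finset.card_insert_of_notMem (by simp)] at h2
      have h3 : (gball H N w 1).card * gsize H N ≤ ∑ y ∈ gball H N w 1, gwt H N y := by
        rw [← smul_eq_mul]
        exact Finset.card_nsmul_le_sum _ _ _ fun y _ => by unfold gwt; omega
      refine le_trans (Nat.mul_le_mul_right _ ?_) h3
      unfold gdeg; convert h2
    have := lt_of_le_of_lt hcard hsum
    exact (lt_of_mul_lt_mul_right this (Nat.zero_le _)).le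
  -- For a light ball its total weight gives the bound. For a heavy ball r ≤ ρ, so that only layers
  -- inside the last light ball are counted.
  · rcases Nat.lt_or_ge (∑ y ∈ gball H N w ρ, gwt H N y) (q * gsize H N) with h | h
    · rw [Nat.le_div_iff_mul_le (by omega), Finset.sum_mul]
      refine le_trans ?_ h.le
      refine le_trans (Finset.sum_le_sum_of_subset (t := gball H N w ρ) fun y hy => ?_)
        (Finset.sum_le_sum fun y _ => ?_)
      · rw [Finset.mem_filter, Finset.mem_range] at hy
        exact (hA y hy.1).1 hy.2.1
      · unfold gwt; nlinarith
    · refine le_trans ?_ (sum_gdeg_le hw g1.small)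
      refine le_trans (Finset.sum_le_sum_of_subset fun y hy => ?_)
        (Finset.sum_le_sum fun y _ => Nat.le_succ _)
      rw [Finset.mem_filter] at hy ⊢
      have := hbig h
      exact ⟨hy.1, by omega⟩

/-- The total weight is 2N · `gsize` and a heavy ball weighs at least q · `gsize`. The greedy bound
thus reads |S| q ≤ 2N H_N, after `gsize`, which is positive, has been cancelled. -/
theorem nextCenters_spec {s q : ℕ} {σ : Mem Loc} (hH : OnRange H N) (hN : 1 ≤ N)
    (hM : 8 * (N + 2) ^ 4 ≤ M) (hI : InputData H N σ) (hq : σ j2 0 0 = q)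
    (hE : IsEst H N (σ dhat)) (hd : ∀ x < N, σ dhat x x = 0)
    (hC : IsCenter H N (fun x => σ siz x 0) (fun x => σ p x 0) (fun x => σ degPow x 0)) :
    nextCenters.wp M (fun τ r => IsEst H N (τ dhat) ∧ EstLE N (τ dhat) (σ dhat) ∧
      (σ (bk 1) 0 0 ≠ 0 → ∀ x < N, τ nPow x 0 = 4 * N) ∧
      (σ (bk 1) 0 0 = 0 →
        IsCenter H N (fun x => τ inD 0 x) (fun x => τ j1 x 0) (fun x => τ nPow x 0) ∧
        (∀ x < N, τ nPow x 0 < 4 * N → τ dhat x (τ j1 x 0) ≤ τ nPow x 0) ∧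
        (∀ x < N, 2 ≤ τ nPow x 0 → gdeg H N x + 1 ≤ q) ∧
        ((((Finset.range N).filter fun y => τ inD 0 y ≠ 0).card : ℝ) * q ≤ 2 * N * harmonic N) ∧
        ∀ w < N, σ degPow w 0 < 4 * N → ∀ x < N, tdist H N w x < τ nPow w 0 →
          ∀ y, H.Adj x y → τ dhat (σ p w 0) y ≤ σ degPow w 0 + tdist H N w x + 1) ∧
      r ≤ s + 13 * N ^ 2 + 6 * N + 2 * (q * gsize H N)) σ s := by
  have hNM : 20 * N + 4 ≤ M := by nlinarith [Nat.zero_le (N ^ 4), Nat.zero_le (N ^ 3), Nat.zero_le (N^2)]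
  have hWN : N * (q * gsize H N / N) ≤ q * gsize H N := Nat.mul_div_le _ _
  unfold nextCenters
  rw [wp_ite]
  refine ⟨fun hlast => ?_, fun hlast => ?_⟩
  · rw [val_rd0] at hlast
    refine wp_loop N (fun t τ r => (∀ x < t, τ nPow x 0 = 4 * N) ∧ r = s + t)
      (by simpa using hI.n) (fun _ => by omega) (by simp) ?_ ?_
    · rintro x₀ hx τ r hfr ⟨h1, h2⟩
      have e2 : τ inf = σ inf := hfr inf (by decide)
      simp only [wp_wr1, val_rd0, Mem.set_of_ne, Mem.set_same, ne_eq,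
        reduceCtorEq, not_false_eq_true, and_self, if_true, e2, hI.inf]
      refine fun _ => ⟨by omega, fun x hx' => ?_, by omega⟩
      by_cases hxx : x = x₀
      · simp [hxx]
      · simpa [hxx] using h1 x (by omega)
    · rintro τ r hfr ⟨h1, h2⟩
      have e : τ dhat = σ dhat := hfr dhat (by decide)
      rw [e]
      exact ⟨hE, EstLE.refl _, fun _ => h1, fun h => absurd h hlast, by nlinarith⟩
  · rw [val_rd0] at hlast
    simp only [wp_block_cons, wp_block_nil, wp_wr0, val_zero]
    refine fun _ => ⟨by omega, ?_⟩
    -- clear the new set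
    refine wp_loop N (fun t τ r => (∀ x < t, τ inD 0 x = 0) ∧ r = s + t)
      (by simpa using hI.n) (fun _ => by omega) (by simp) ?_ ?_
    · rintro x₀ hx τ r hfr ⟨h1, h2⟩
      simp only [wp_wr2, val_rd0, val_zero, Mem.set_of_ne, Mem.set_same, ne_eq,
        reduceCtorEq, not_false_eq_true, and_self, if_true]
      refine fun _ => ⟨by omega, fun x hx' => ?_, by omega⟩
      by_cases hxx : x = x₀
      · simp [hxx]
      · simpa [hxx] using h1 x (by omega)
    rintro τ r hfr ⟨h1, rfl⟩
    have fr1 : ∀ b, b ≠ i → b ≠ x → b ≠ inD → τ b = σ b := by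
      intro b hb1 hb2 hb3
      rw [hfr b (by simp [Cmd.mods, wr2, hb2, hb3]), Mem.set_of_ne _ hb1]
    have hi1 : τ i 0 0 = 0 := by rw [hfr i (by decide)]; simp
    have hI1 : InputData H N τ := hI.congr (fr1 _ (by decide) (by decide) (by decide))
      (fr1 _ (by decide) (by decide) (by decide)) (fr1 _ (by decide) (by decide) (by decide))
      (fr1 _ (by decide) (by decide) (by decide)) (fr1 _ (by decide) (by decide) (by decide))
      (fr1 _ (by decide) (by decide) (by decide))
    have ed : τ dhat = σ dhat := fr1 _ (by decide) (by decide) (by decide)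
    have eq1 : τ j2 0 0 = q := by rw [fr1 _ (by decide) (by decide) (by decide), hq]
    have ep : τ p = σ p := fr1 _ (by decide) (by decide) (by decide)
    have edp : τ degPow = σ degPow := fr1 _ (by decide) (by decide) (by decide)
    clear hfr fr1
    -- the balls
    refine wp_use (balls_spec hH hM hI1 eq1 (ed ▸ hE) (ed ▸ hd)) ?_
    rintro ρ k hfr ⟨g1, g2, g3, g4⟩
    rw [ed] at g2
    have hi2 : ρ i 0 0 = 0 := by rw [hfr i (by decide), hi1]
    have hI2 : InputData H N ρ := hI1.congr (hfr _ (by decide)) (hfr _ (by decide))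
      (hfr _ (by decide)) (hfr _ (by decide)) (hfr _ (by decide)) (hfr _ (by decide))
    have ep2 : ρ p = σ p := by rw [hfr _ (by decide), ep]
    have edp2 : ρ degPow = σ degPow := by rw [hfr _ (by decide), edp]
    have eD : ρ inD = τ inD := hfr _ (by decide)
    clear hfr
    -- the hitting set
    refine wp_use (hittingSet_spec (N := N) (i₀ := 0) hI2.n hi2 (by omega) ?_ (fun y => gwt H N y)
      ((q * gsize H N : ℕ) : ℝ) (Nat.cast_nonneg _) (fun _ _ => Nat.cast_nonneg _) ?_ ?_) ?_
    · intro x hx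
      obtain ⟨R, -, -, -, h⟩ := g3 x hx
      rw [h]; split_ifs <;> omega
    · intro x hx h
      obtain ⟨R, k1, k2, k3, k4⟩ := g3 x hx
      rw [k4] at h
      have hle : q * gsize H N ≤ ∑ y ∈ gball H N x R, gwt H N y := by
        by_contra hc; rw [if_neg hc] at h; omega
      rw [← Nat.cast_sum]
      refine Nat.cast_le.2 (hle.trans (Finset.sum_le_sum_of_subset fun y hy => ?_))
      have hyN := (mem_gball.1 hy).1
      rw [Finset.mem_filter, Finset.mem_range]
      refine ⟨hyN, ?_⟩
      unfold InNbhd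
      rw [k2 y hyN, if_pos hy]; omega
    · intro y hy; rw [eD]; exact h1 y hy
    rintro π k' hfr ⟨m1, -, -, m4, m5⟩
    have hI3 : InputData H N π := hI2.congr (hfr _ (by decide)) (hfr _ (by decide))
      (hfr _ (by decide)) (hfr _ (by decide)) (hfr _ (by decide)) (hfr _ (by decide))
    have ep3 : π p = σ p := by rw [hfr _ (by decide), ep2]
    have edp3 : π degPow = σ degPow := by rw [hfr _ (by decide), edp2]
    have ed3 : π dhat = ρ dhat := hfr _ (by decide)
    have ea3 : π adj = ρ adj := hfr _ (by decide)
    clear hfr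
    -- the nearest vertices
    refine wp_use (findCenters_spec (by omega) hI3 (ed3 ▸ g1)) ?_
    rintro κ l hfr ⟨n1, n2⟩
    have hI4 : InputData H N κ := hI3.congr (hfr _ (by decide)) (hfr _ (by decide))
      (hfr _ (by decide)) (hfr _ (by decide)) (hfr _ (by decide)) (hfr _ (by decide))
    have ep4 : κ p = σ p := by rw [hfr _ (by decide), ep3]
    have edp4 : κ degPow = σ degPow := by rw [hfr _ (by decide), edp3]
    have ed4 : κ dhat = ρ dhat := by rw [hfr _ (by decide), ed3]
    have ea4 : κ adj = ρ adj := by rw [hfr _ (by decide), ea3]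
    have eD4 : κ inD = π inD := hfr _ (by decide)
    clear hfr
    rw [ed3, ea3] at n1
    have hnear := fun w hw => HasBall.nearest (S := fun y => π inD 0 y) hH hw (g3 w hw)
      (fun h => ⟨_, (m1 w hw h).1, (m1 w hw h).2.1, by have := (m1 w hw h).2.2; simp [this]⟩)
      (n1 w hw).1 (n1 w hw).2.1 (n1 w hw).2.2
    refine wp_use (explore_spec (B := q * gsize H N / N) hH (by omega) hI4 (ed4 ▸ g1) ?_ ?_ ?_) ?_
    · rw [ep4, edp4]; intro w hw h; exact ⟨((hC w hw).2.2 h).1, ((hC w hw).2.2 h).2.2⟩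
    · rw [ed4, ea4]; exact fun w hw => (hnear w hw).2.2.1
    · rw [ea4]; exact fun w hw => (hnear w hw).2.2.2.2
    rintro μ z hfr ⟨o1, o2, o3, o4⟩
    rw [ed4] at o2
    have eD5 : μ inD = π inD := by rw [hfr _ (by decide), eD4]
    have ej5 : μ j1 = κ j1 := hfr _ (by decide)
    have en5 : μ nPow = κ nPow := hfr _ (by decide)
    refine ⟨o1, o2.trans g2, fun h => absurd hlast h, fun _ => ⟨?_, ?_, ?_, ?_, ?_⟩, ?_⟩
    · rw [eD5, ej5, en5]; exact fun w hw => (hnear w hw).1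
    · rw [en5, ej5]
      intro x hx h
      obtain ⟨k1, -, -, k2⟩ := (n1 x hx).2.2 h
      rw [k2]; exact o2 x hx _ k1
    · rw [en5]; exact fun w hw => (hnear w hw).2.1
    · rw [eD5]
      rw [← Nat.cast_sum, sum_gwt] at m4
      push_cast at m4
      have hW : (0 : ℝ) < gsize H N := by
        have : N ≤ gsize H N := by
          unfold gsize
          calc N = ∑ x ∈ Finset.range N, 1 := by simp
            _ ≤ _ := Finset.sum_le_sum fun x _ => by omega
        exact_mod_cast (by omega : 0 < gsize H N)
      refine le_of_mul_le_mul_right ?_ hW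
      linarith
    · rw [en5]
      rw [ea4, ep4, edp4] at o3
      exact fun w hw h x hx hlt y hy => o3 w hw h x hx ((hnear w hw).2.2.2.1 x hx hlt) hlt y hy
    · nlinarith

end TwoApproxCenters
-- One round, its stretch and its cost
section TwoApproxRound
open Loc

variable {H : SimpleGraph ℕ} {N M : ℕ}

/-- The distance to a set is 1-Lipschitz, also when it is cut off at 4 N. -/
theorem IsCenter.lipschitz {S c r : ℕ → ℕ} (hH : OnRange H N) (h : IsCenter H N S c r) {x y : ℕ}
    (hx : x < N) (hy : y < N) : r x ≤ r y + tdist H N x y := by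
  rcases Nat.lt_or_ge (r y) (4 * N) with hlt | hge
  · obtain ⟨h1, h2, h3⟩ := (h y hy).2.2 hlt
    have h4 := (h x hx).1 _ h1 h2
    have := tdist_triangle hH hx y (c y)
    omega
  · have := (h x hx).2.1
    omega

/-- Paths over the nearest source `p u` of `u` are good enough if `u` is close to the current
sources and both `u` and `v` are far from the next ones. -/
theorem two_approx_step {S S' p p' r r' : ℕ → ℕ} {D₁ D₂ D₃ : ℕ → ℕ → ℕ} {u v : ℕ}
    (hH : OnRange H N) (hC : IsCenter H N S p r) (hu : u < N) (hv : v < N)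
    (hr : H.Reachable u v) (hru : 2 * r u ≤ H.dist u v) (hD₁ : D₁ (p u) u ≤ r u)
    (hsrc : ∀ z < N, S z ≠ 0 → ∃ f : ℕ → ℕ, (∀ x < N, f x ≤ D₁ z x) ∧
      (∀ x y, H.Adj x y → (2 ≤ r' x ∨ 2 ≤ r' y) → f y ≤ f x + 1) ∧ ∀ x < N, D₂ z x ≤ f x)
    (hcomb : ∀ x < N, r x < 4 * N → ∀ y < N, D₃ x y ≤ r x + D₂ (p x) y)
    (hnext : (∀ x < N, r' x = 4 * N) ∨ (IsCenter H N S' p' r' ∧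
      ∀ w < N, r w < 4 * N → ∀ x < N, tdist H N w x < r' w →
          ∀ y, H.Adj x y → D₁ (p w) y ≤ r w + tdist H N w x + 1)) :
    D₃ u v ≤ 2 * H.dist u v ∨ 2 * r' u ≤ H.dist u v ∨ 2 * r' v ≤ H.dist u v := by
  by_contra hcon
  simp only [not_or, not_le] at hcon
  obtain ⟨hc1, hc2, hc3⟩ := hcon
  have hdN := dist_lt_of_onRange hH hu hr
  have hru4 : r u < 4 * N := by omega
  obtain ⟨hpN, hpS, hpd⟩ := (hC u hu).2.2 hru4
  obtain ⟨f, hf1, hf2, hf3⟩ := hsrc (p u) hpN hpS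
  obtain ⟨P, hP⟩ := exists_route hr
  set m := H.dist u v with hm
  have hPN : ∀ i ≤ m, P i < N := fun i hi => hP.lt hH hv hi
  -- The search from p(u) is followed from the i-th vertex of a shortest path on, where all
  -- remaining edges are sparse. In the last round every edge is sparse and i = 0. Otherwise i = m/2
  -- + 1: the vertex at position m/2 is closer to u than the next sources, so exploration reaches
  -- its successor.
  have hstart : ∃ i ≤ m, f (P i) ≤ r u + i ∧
      ∀ k, i ≤ k → k < m → 2 ≤ r' (P k) ∨ 2 ≤ r' (P (k + 1)) := by
    rcases hnext with hlast | ⟨hC', hex⟩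
    · refine ⟨0, Nat.zero_le _, ?_, fun k _ hk => Or.inl ?_⟩
      · rw [hP.1]; exact (hf1 u hu).trans hD₁
      · rw [hlast _ (hPN k hk.le)]; omega
    · rcases Nat.eq_zero_or_pos m with h0 | hpos
      · refine ⟨0, Nat.zero_le _, ?_, fun k _ hk => by omega⟩
        rw [hP.1]; exact (hf1 u hu).trans hD₁
      · have hd1 : tdist H N u (P (m / 2)) ≤ m / 2 := by
          have := hP.tdist_le (N := N) (i := 0) (j := m / 2) (Nat.zero_le _) (by omega)
          rwa [hP.1] at this
        refine ⟨m / 2 + 1, by omega, ?_, fun k hk hk' => Or.inr ?_⟩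
        · refine (hf1 _ (hPN _ (by omega))).trans ((hex u hu hru4 (P (m / 2)) (hPN _ (by omega))
            (by omega) _ (hP.2.2 _ (by omega))).trans ?_)
          omega
        -- From position m/2 + 2 on, the distance to v is at most m - m/2 - 2, while r'(v) > m/2.
        -- Hence r' is at least 2 there.
        · have h1 := hC'.lipschitz hH hv (hPN (k + 1) (by omega))
          have h2 := hP.tdist_le (N := N) (i := k + 1) (j := m) (by omega) le_rfl
          rw [hP.2.1, tdist_comm] at h2
          omega
  obtain ⟨i, him, hi1, hi2⟩ := hstart
  have hwalk : ∀ k, i + k ≤ m → f (P (i + k)) ≤ r u + (i + k) := by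
    intro k
    induction k with
    | zero => intro _; simpa using hi1
    | succ k ih =>
      intro hk
      have := hf2 _ _ (hP.2.2 (i + k) (by omega)) (hi2 (i + k) (by omega) (by omega))
      have := ih (by omega)
      rw [← Nat.add_assoc]
      omega
  have hfv := hwalk (m - i) (by omega)
  rw [show i + (m - i) = m by omega, hP.2.1] at hfv
  -- The search from p(u) reaches v within r(u) + m. The way from u to p(u) adds r(u), and 2 r(u) ≤
  -- m.
  have h1 := hf3 v hv
  have h2 := hcomb u hu hru4 v hv
  omega

/-- One round at the scale `2 * j2`. -/
def round : Cmd Loc := block [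
  wr0 j2 (§j2 + §j2),
  wr0 (bk 1) (.lt §n (§j2 * §j2)),
  nextCenters,
  buildSparse,
  runSources,
  combine,
  advance,
  wr0 (bk 2) §(bk 1)]

/-- The state before the round `a`. -/
structure RoundInv (H : SimpleGraph ℕ) (N a : ℕ) (τ : Mem Loc) : Prop where
  input : InputData H N τ
  est : IsEst H N (τ dhat)
  diag : ∀ x < N, τ dhat x x = 0
  scale : τ j2 0 0 = 2 ^ a
  sq : 2 ^ a * 2 ^ a ≤ N
  center : IsCenter H N (fun x => τ siz x 0) (fun x => τ p x 0) (fun x => τ degPow x 0)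
  src : ∀ x < N, τ degPow x 0 < 4 * N → τ dhat x (τ p x 0) ≤ τ degPow x 0
  near : ∀ u < N, ∀ v < N, H.Reachable u v → τ dhat u v ≤ 2 * H.dist u v ∨
    2 * τ degPow u 0 ≤ H.dist u v ∨ 2 * τ degPow v 0 ≤ H.dist u v
  card : (((Finset.range N).filter fun z => τ siz z 0 ≠ 0).card : ℝ) * 2 ^ a ≤ 2 * N * harmonic N

theorem one_le_harmonic (hN : 1 ≤ N) : (1 : ℝ) ≤ harmonic N := by
  have h1 := harmonic_mono hN
  have h2 : harmonic 1 = 1 := by simp [harmonic]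
  rw [h2] at h1
  exact_mod_cast h1

open Classical in
/-- The number of edges with an endpoint in a set of vertices of small degree. -/
theorem sum_sparse_le (hH : OnRange H N) (P : ℕ → Prop) (q : ℕ) (h : ∀ x < N, P x → gdeg H N x ≤ q) :
    ∑ x ∈ Finset.range N, ((Finset.range N).filter fun y => H.Adj x y ∧ (P x ∨ P y)).card ≤
      2 * (N * q) := by
  -- A pair is charged to x if x has the property, and otherwise to y. After exchanging the order of
  -- summation both charges are sums of small degrees.
  have h1 : ∀ x ∈ Finset.range N, ((Finset.range N).filter fun y => H.Adj x y ∧ (P x ∨ P y)).card ≤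
      (if P x then gdeg H N x else 0) +
        ((Finset.range N).filter fun y => H.Adj x y ∧ P y).card := by
    intro x _
    split_ifs with hx
    · refine le_trans (Finset.card_le_card fun y hy => ?_) (Nat.le_add_right _ _)
      rw [Finset.mem_filter] at hy ⊢
      exact ⟨hy.1, hy.2.1⟩
    · rw [zero_add]
      refine Finset.card_le_card fun y hy => ?_
      rw [Finset.mem_filter] at hy ⊢
      exact ⟨hy.1, hy.2.1, hy.2.2.resolve_left hx⟩
  have h2 : ∑ x ∈ Finset.range N, (if P x then gdeg H N x else 0) ≤ N * q := by
    refine (Finset.sum_le_card_nsmul _ _ q fun x hx => ?_).trans (by simp)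
    split_ifs with hP
    · exact h x (Finset.mem_range.1 hx) hP
    · exact Nat.zero_le _
  have h3 : ∑ x ∈ Finset.range N, ((Finset.range N).filter fun y => H.Adj x y ∧ P y).card =
      ∑ y ∈ Finset.range N, (if P y then gdeg H N y else 0) := by
    simp only [Finset.card_filter]
    rw [Finset.sum_comm]
    refine Finset.sum_congr rfl fun y _ => ?_
    split_ifs with hP
    · unfold gdeg
      rw [Finset.card_filter]
      refine Finset.sum_congr rfl fun x _ => ?_
      simp [hP, H.adj_comm]
    · simp [hP]
  have := Finset.sum_le_sum h1
  rw [Finset.sum_add_distrib, h3] at this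
  omega

/-- The number of steps of a round. -/
theorem round_time {N W C R k s : ℕ} {Q h : ℝ} (hN : (1 : ℝ) ≤ N) (hh : 1 ≤ h) (hQ : 1 ≤ Q)
    (hQN : Q * Q ≤ N) (hR : (R : ℝ) * Q ≤ 2 * N * h)
    (hC : (C : ℝ) ≤ 4 * N * Q ∨ (C ≤ W ∧ (N : ℝ) ≤ 4 * (Q * Q)))
    (hk : (k : ℝ) ≤ s + 26 * N ^ 2 + 4 * (Q * W) + R * (16 * N + 2 * C)) :
    (k : ℝ) ≤ s + 100 * (N ^ 2 + W * Real.sqrt N) * h := by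
  set z := Real.sqrt N with hz
  have hz0 : 0 ≤ z := Real.sqrt_nonneg _
  have hzz : z * z = N := Real.mul_self_sqrt (by linarith)
  have hQz : Q ≤ z := Real.le_sqrt_of_sq_le (by nlinarith)
  have hW0 : (0 : ℝ) ≤ W := Nat.cast_nonneg _
  have hR0 : (0 : ℝ) ≤ R := Nat.cast_nonneg _
  have hR1 : (R : ℝ) ≤ 2 * N * h := le_trans (by nlinarith) hR
  have e1 : (R : ℝ) * (16 * N) ≤ 32 * (N ^ 2 * h) := by nlinarith
  have e2 : Q * W ≤ W * z * h := by
    have : Q * W ≤ z * W := mul_le_mul_of_nonneg_right hQz hW0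
    have : 0 ≤ W * z := mul_nonneg hW0 hz0
    nlinarith
  have e3 : (N : ℝ) ^ 2 ≤ N ^ 2 * h := le_mul_of_one_le_right (by positivity) hh
  have e4 : 0 ≤ (N : ℝ) ^ 2 * h := by positivity
  have e5 : 0 ≤ W * z * h := by positivity
  have e6 : (R : ℝ) * (2 * C) ≤ 16 * (N ^ 2 * h) + 8 * (W * z * h) := by
    -- In an ordinary round the number of sources, about N h / Q, and the number of edges, about N
    -- Q, multiply to N² h. In the last round Q is at least √N / 2, so there are only O(√N h)
    -- sources for the whole graph.
    rcases hC with hC | ⟨hC, hQ'⟩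
    · have : (R : ℝ) * (2 * C) ≤ R * (2 * (4 * N * Q)) := by gcongr
      have : 8 * (N : ℝ) * (R * Q) ≤ 8 * N * (2 * N * h) := by gcongr
      nlinarith
    · have hz2 : z ≤ 2 * Q := Real.sqrt_le_iff.2 ⟨by linarith, by nlinarith⟩
      have h1 : (R : ℝ) * z ≤ 4 * N * h := by nlinarith
      have h2 : (R : ℝ) ≤ 4 * z * h := by
        have : 0 < z := lt_of_lt_of_le (by linarith) hQz
        refine le_of_mul_le_mul_right ?_ this
        nlinarith
      have h3 : (C : ℝ) ≤ W := by exact_mod_cast hC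
      have : (R : ℝ) * (2 * C) ≤ (4 * z * h) * (2 * W) := by gcongr
      nlinarith
  nlinarith

/-- Each pair is already 2-approximated or has an end u with 2 r(u) ≤ d(u,v), and `two_approx_step`
passes this alternative on to the next scale. The round after which q² would exceed N is the last
one and leaves no exceptional pairs. -/
theorem round_spec {s a : ℕ} {σ : Mem Loc} (hH : OnRange H N) (hN : 1 ≤ N)
    (hM : 8 * (N + 2) ^ 4 ≤ M) (hR : RoundInv H N a σ) :
    round.wp M (fun τ r => ((τ (bk 2) 0 0 = 0 ∧ RoundInv H N (a + 1) τ) ∨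
      (τ (bk 2) 0 0 = 1 ∧ IsEst H N (τ dhat) ∧
        ∀ u < N, ∀ v < N, H.Reachable u v → τ dhat u v ≤ 2 * H.dist u v)) ∧
      (r : ℝ) ≤ s + 100 * (N ^ 2 + gsize H N * Real.sqrt N) * harmonic N) σ s := by
  classical
  have hNM : 4 * N * N + 4 * N * (N + 1) + 30 * N + 4 ≤ M := by
    nlinarith [Nat.zero_le (N ^ 4), Nat.zero_le (N ^ 3), Nat.zero_le (N^2)]
  have hq1 : 1 ≤ 2 ^ a := Nat.one_le_two_pow
  have hqN : 2 ^ a ≤ N := le_trans (by nlinarith) hR.sq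
  unfold round
  simp only [wp_block_cons, wp_block_nil, wp_wr0, val_add, val_lt, val_mul, val_rd0, Mem.set_of_ne, Mem.set_same,
    ne_eq, reduceCtorEq, not_false_eq_true, and_self, if_true, hR.scale, hR.input.n]
  refine fun _ => ⟨by omega, fun _ => ⟨by split_ifs <;> omega, ?_⟩⟩
  have hq2 : 2 ^ a + 2 ^ a = 2 ^ (a + 1) := by ring
  set q := 2 ^ a + 2 ^ a with hq
  refine wp_use (nextCenters_spec (q := q) hH hN hM (hR.input.congr (by simp) (by simp) (by simp)
    (by simp) (by simp) (by simp)) (by simp) (by simpa using hR.est) (by simpa using hR.diag)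
    (by simpa using hR.center)) ?_
  rintro τ k hfr ⟨h1, h2, h3, h4, h5⟩
  have e1 : τ n = σ n := by rw [hfr _ (by decide)]; simp
  have e2 : τ inf = σ inf := by rw [hfr _ (by decide)]; simp
  have e3 : τ degPow = σ degPow := by rw [hfr _ (by decide)]; simp
  have e4 : τ p = σ p := by rw [hfr _ (by decide)]; simp
  have e5 : τ siz = σ siz := by rw [hfr _ (by decide)]; simp
  have e6 : τ (bk 1) 0 0 = if N < q * q then 1 else 0 := by rw [hfr _ (by decide)]; simp
  have e7 : τ j2 0 0 = q := by rw [hfr _ (by decide)]; simp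
  have hI1 : InputData H N τ := hR.input.congr e1 e2 (by rw [hfr _ (by decide)]; simp)
    (by rw [hfr _ (by decide)]; simp) (by rw [hfr _ (by decide)]; simp)
    (by rw [hfr _ (by decide)]; simp)
  simp only [Mem.set_of_ne, Mem.set_same, ne_eq, reduceCtorEq, not_false_eq_true, and_self, if_true]
    at h2 h3 h4
  clear hfr
  -- the sparse graph
  refine wp_use (buildSparse_spec hH (by omega) hI1) ?_
  rintro ρ k' hfr ⟨i1, i2, i3, i4⟩
  have f0 : ∀ z, z ∉ buildSparse.mods → ρ z = τ z := hfr
  -- The total length of the adjacency lists: 2N · 2^(a+1) by the degree bound in an ordinary round,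
  -- and the size of the whole graph in the last one.
  obtain ⟨C, hC1, hC2, hC3⟩ : ∃ C, ∑ x ∈ Finset.range N, ρ cnt x 0 ≤ C ∧ 9 * N + C + 1 ≤ M ∧
      ((C : ℝ) ≤ 4 * N * 2 ^ a ∨ (C ≤ gsize H N ∧ (N : ℝ) ≤ 4 * (2 ^ a * 2 ^ a))) := by
    rw [Finset.sum_congr rfl fun x hx => i1 x (Finset.mem_range.1 hx)]
    by_cases hlast : N < q * q
    · refine ⟨gsize H N, ?_, by have := gsize_le H N; nlinarith, Or.inr ⟨le_rfl, ?_⟩⟩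
      · unfold gsize gdeg
        refine Finset.sum_le_sum fun x _ => Nat.le_succ_of_le (Finset.card_le_card fun y hy => ?_)
        rw [Finset.mem_filter] at hy ⊢
        exact ⟨hy.1, hy.2.1⟩
      · have : N ≤ 4 * (2 ^ a * 2 ^ a) := by
          have : q * q = 4 * (2 ^ a * 2 ^ a) := by rw [hq]; ring
          omega
        exact_mod_cast this
    · have hdeg := (h4 (by simp [hlast])).2.2.1
      refine ⟨2 * (N * q), ?_, ?_, Or.inl ?_⟩
      · convert sum_sparse_le hH (fun x => 2 ≤ τ nPow x 0) q
          fun x hx hx2 => by have := hdeg x hx hx2; omega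
      · nlinarith
      · rw [hq]; push_cast; nlinarith
  have hI2 : InputData H N ρ := hI1.congr (f0 _ (by decide)) (f0 _ (by decide))
      (f0 _ (by decide)) (f0 _ (by decide)) (f0 _ (by decide)) (f0 _ (by decide))
  have ed : ρ dhat = τ dhat := f0 _ (by decide)
  refine wp_use (runSources_spec hH hC2 hI2.n hI2.inf (ed ▸ h1) i2 hC1) ?_
  rintro π l hfr' ⟨j1', j2', j3', j4'⟩
  rw [ed] at j2' j3'
  rw [f0 siz (by decide), e5] at j3' j4'
  have f1 : ∀ z, z ∉ runSources.mods → z ∉ buildSparse.mods → π z = τ z := fun z hz hz' => by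
    rw [hfr' z hz, f0 z hz']
  refine wp_use (combine_spec hH (by omega) (by rw [f1 _ (by decide) (by decide), hI1.n])
    (by rw [f1 _ (by decide) (by decide), hI1.inf]) j1' ?_) ?_
  · rw [f1 degPow (by decide) (by decide), f1 p (by decide) (by decide), e3, e4]
    exact fun w hw h => ⟨((hR.center w hw).2.2 h).1, ((hR.center w hw).2.2 h).2.2⟩
  rintro κ l' hfr'' ⟨c1, c2, c3, c4⟩
  rw [f1 degPow (by decide) (by decide), f1 p (by decide) (by decide), e3, e4] at c3
  have f2 : ∀ z, z ∉ combine.mods → z ∉ runSources.mods → z ∉ buildSparse.mods → κ z = τ z :=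
    fun z hz hz' hz'' => by rw [hfr'' z hz, f1 z hz' hz'']
  refine wp_use (advance_spec (N := N) (by omega) (by rw [f2 _ (by decide) (by decide) (by decide), hI1.n])) ?_
  rintro μ m hfr3 ⟨m1, m2⟩
  have f3 : ∀ z, z ∉ advance.mods → z ∉ combine.mods → z ∉ runSources.mods →
      z ∉ buildSparse.mods → μ z = τ z :=
    fun z hz hz' hz'' hz3 => by rw [hfr3 z hz, f2 z hz' hz'' hz3]
  rw [f2 inD (by decide) (by decide) (by decide), f2 j1 (by decide) (by decide) (by decide),
    f2 nPow (by decide) (by decide) (by decide)] at m1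
  have ed3 : μ dhat = κ dhat := hfr3 _ (by decide)
  have g1 : μ (bk 1) 0 0 = if N < q * q then 1 else 0 := by
    rw [f3 _ (by decide) (by decide) (by decide) (by decide), e6]
  simp only [wp_wr0, val_rd0, g1, Mem.set_of_ne, Mem.set_same, ne_eq, reduceCtorEq, not_false_eq_true,
    and_self, if_true]
  refine fun _ => ⟨by split_ifs <;> omega, ?_, ?_⟩
  · have hle : EstLE N (κ dhat) (σ dhat) := c2.trans (j2'.trans h2)
    have hsrc' : ∀ z < N, σ siz z 0 ≠ 0 → ∃ f : ℕ → ℕ, (∀ x < N, f x ≤ τ dhat z x) ∧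
        (∀ x y, H.Adj x y → (2 ≤ τ nPow x 0 ∨ 2 ≤ τ nPow y 0) → f y ≤ f x + 1) ∧
        ∀ x < N, π dhat z x ≤ f x := by
      intro z hz hS
      obtain ⟨f, k1, k2, k3⟩ := j3' z hz hS
      refine ⟨f, k1, fun x y hxy h2 => ?_, k3⟩
      obtain ⟨e, he, rfl⟩ := i3 x y hxy h2
      have := k2 x (hH _ _ hxy) e he
      have := h1.adj _ (hH _ _ hxy) _ (hH.lt_right hxy) hxy
      omega
    have hstep : ∀ u < N, ∀ v < N, H.Reachable u v → 2 * σ degPow u 0 ≤ H.dist u v →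
        κ dhat u v ≤ 2 * H.dist u v ∨ 2 * τ nPow u 0 ≤ H.dist u v ∨
          2 * τ nPow v 0 ≤ H.dist u v := by
      intro u hu v hv hr hru
      have hdN := dist_lt_of_onRange hH hu hr
      refine two_approx_step (S := fun x => σ siz x 0) (p := fun x => σ p x 0)
        (r := fun x => σ degPow x 0) (r' := fun x => τ nPow x 0) (S' := fun x => τ inD 0 x)
        (p' := fun x => τ j1 x 0) hH hR.center hu hv hr hru ?_ hsrc' c3 ?_
      · have h4 : σ degPow u 0 < 4 * N := by omega
        have hpN := ((hR.center u hu).2.2 h4).1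
        have := hR.src u hu h4
        rw [hR.est.symm _ hu _ hpN] at this
        exact (h2 _ hpN _ hu).trans this
      · by_cases hlast : N < q * q
        · exact Or.inl (h3 (by simp [hlast]))
        · have := h4 (by simp [hlast])
          exact Or.inr ⟨this.1, this.2.2.2.2⟩
    -- The alternative with v in place of u follows by symmetry of the distances and of the
    -- estimate.
    have hnear : ∀ u < N, ∀ v < N, H.Reachable u v → κ dhat u v ≤ 2 * H.dist u v ∨
        2 * τ nPow u 0 ≤ H.dist u v ∨ 2 * τ nPow v 0 ≤ H.dist u v := by
      intro u hu v hv hr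
      rcases hR.near u hu v hv hr with h | h | h
      · exact Or.inl ((hle u hu v hv).trans h)
      · exact hstep u hu v hv hr h
      · have := hstep v hv u hu hr.symm (by rwa [SimpleGraph.dist_comm])
        rw [SimpleGraph.dist_comm, c1.symm v hv u hu] at this
        tauto
    rw [ed3]
    -- In the last round all next distances are 4 N, which exceeds half of any finite distance. Only
    -- the first alternative survives.
    by_cases hlast : N < q * q
    · refine Or.inr ⟨by simp [hlast], c1, fun u hu v hv hr => ?_⟩
      have hdN := dist_lt_of_onRange hH hu hr
      have hl := h3 (by simp [hlast])
      rcases hnear u hu v hv hr with h | h | h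
      · exact h
      · rw [hl u hu] at h; omega
      · rw [hl v hv] at h; omega
    · obtain ⟨o1, o2, o3, o4, o5⟩ := h4 (by simp [hlast])
      refine Or.inl ⟨by simp [hlast], ?_⟩
      constructor
      · refine hI1.congr ?_ ?_ ?_ ?_ ?_ ?_
        · simpa using f3 n (by decide) (by decide) (by decide) (by decide)
        · simpa using f3 inf (by decide) (by decide) (by decide) (by decide)
        · simpa using f3 Loc.deg (by decide) (by decide) (by decide) (by decide)
        · simpa using f3 lst (by decide) (by decide) (by decide) (by decide)
        · simpa using f3 (bk 3) (by decide) (by decide) (by decide) (by decide)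
        · simpa using f3 (bk 0) (by decide) (by decide) (by decide) (by decide)
      · simpa [ed3] using c1
      · intro x hx
        have := hle x hx x hx
        rw [hR.diag x hx] at this
        simpa [ed3] using this
      · have := f3 j2 (by decide) (by decide) (by decide) (by decide)
        simp [this, e7, hq2]
      · rw [← hq2]; omega
      · intro x hx
        obtain ⟨k1, k2, k3⟩ := o1 x hx
        simp only [Mem.set_of_ne, ne_eq, reduceCtorEq, not_false_eq_true, (m1 x hx).2.1,
          (m1 x hx).2.2]
        refine ⟨fun y hy hS => k1 y hy (by rwa [(m1 y hy).1] at hS), k2, fun h => ?_⟩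
        obtain ⟨t1, t2, t3⟩ := k3 h
        exact ⟨t1, by rwa [(m1 _ t1).1], t3⟩
      · intro x hx
        simp only [Mem.set_of_ne, ne_eq, reduceCtorEq, not_false_eq_true, (m1 x hx).2.1,
          (m1 x hx).2.2, ed3]
        intro h
        exact ((c2.trans j2') x hx _ ((o1 x hx).2.2 h).1).trans (o2 x hx h)
      · intro u hu v hv hr
        simp only [Mem.set_of_ne, ne_eq, reduceCtorEq, not_false_eq_true, (m1 u hu).2.2,
          (m1 v hv).2.2, ed3]
        exact hnear u hu v hv hr
      · rw [hq] at o4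
        have hset : (Finset.range N).filter (fun z => (μ.set (bk 2) 0 0
            (if N < q * q then 1 else 0)) siz z 0 ≠ 0) =
            (Finset.range N).filter (fun y => τ inD 0 y ≠ 0) := by
          refine Finset.filter_congr fun x hx => ?_
          simp [(m1 x (Finset.mem_range.1 hx)).1]
        rw [hset]
        push_cast at o4
        rw [pow_succ]
        convert o4 using 2
        ring
  · have hNR : (1 : ℝ) ≤ N := by exact_mod_cast hN
    refine round_time (W := gsize H N) (C := C) (Q := 2 ^ a) hNR (one_le_harmonic hN)
      (by exact_mod_cast hq1) (by exact_mod_cast hR.sq) hR.card hC3 ?_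
    have hcard : ((Finset.range N).filter fun z => σ siz z 0 ≠ 0).card * (16 * N + 2 * C) =
        ((Finset.range N).filter fun z => ¬ σ siz z 0 = 0).card * (16 * N + 2 * C) := rfl
    have e : q * gsize H N = 2 * (2 ^ a * gsize H N) := by rw [hq]; ring
    have : m ≤ s + 26 * N ^ 2 + 4 * (2 ^ a * gsize H N) +
        ((Finset.range N).filter fun z => σ siz z 0 ≠ 0).card * (16 * N + 2 * C) := by
      have : N ≤ N ^ 2 := Nat.le_self_pow (by norm_num) N
      have : N * (N + 1) = N ^ 2 + N := by ring
      omega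
    exact_mod_cast this

/-- The program for two-approximate distances. -/
def twoApprox : Cmd Loc := block [prepare, .loop (bk 5) §n (when (no §(bk 2)) round)]

/-- The loop has N passes, but only logarithmically many of them are active; after the last round a
flag turns the remaining ones into no-ops. -/
theorem twoApprox_spec {s : ℕ} {σ : Mem Loc} (hH : OnRange H N) (hN : 1 ≤ N)
    (hn : σ n 0 0 = N) (hM : 8 * (N + 2) ^ 4 ≤ M)
    (hA : ∀ x < N, ∀ y < N, σ (bk 0) x y ≠ 0 ↔ H.Adj x y)
    (hz : ∀ a i j, a ≠ n → a ≠ bk 0 → σ a i j = 0) :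
    twoApprox.wp M (fun τ r => IsEst H N (τ dhat) ∧
      (∀ u < N, ∀ v < N, H.Reachable u v → τ dhat u v ≤ 2 * H.dist u v) ∧
      (r : ℝ) ≤ s + 4 * N ^ 2 + (Nat.log 2 N + 1) *
        (100 * (N ^ 2 + gsize H N * Real.sqrt N) * harmonic N)) σ s := by
  have hNM : N ≤ M := by nlinarith [Nat.zero_le (N ^ 4), Nat.zero_le (N ^ 3), Nat.zero_le (N^2)]
  have hhar := one_le_harmonic hN
  set K : ℝ := 100 * (N ^ 2 + gsize H N * Real.sqrt N) * harmonic N with hK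
  have hK0 : 0 ≤ K := by positivity
  unfold twoApprox
  simp only [wp_block_cons, wp_block_nil]
  refine wp_use (prepare_spec hH hn hM hA hz) ?_
  rintro τ r hfr ⟨h1, h2, h3, h4, h5, h6⟩
  have hdiag : ∀ x < N, τ dhat x x = 0 := fun x hx => (h3 x hx).2.2.2
  refine wp_loop N (fun t ρ k =>
    (ρ (bk 2) 0 0 = 0 ∧ RoundInv H N t ρ ∧ (k : ℝ) ≤ r + t + t * K) ∨
    (ρ (bk 2) 0 0 = 1 ∧ (IsEst H N (ρ dhat) ∧
      ∀ u < N, ∀ v < N, H.Reachable u v → ρ dhat u v ≤ 2 * H.dist u v) ∧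
      (k : ℝ) ≤ r + t + (Nat.log 2 N + 1) * K)) (by simpa using h1.n) (fun _ => hNM) ?_ ?_ ?_
  · refine Or.inl ⟨h5, ⟨h1, h2, hdiag, by simpa using h4, by simpa using hN, fun x hx => ?_,
      fun x hx _ => ?_, fun u hu v hv _ => ?_, ?_⟩, by simp⟩
    · obtain ⟨k1, k2, k3, -⟩ := h3 x hx
      simp only [k2, k3, tdist_self]
      exact ⟨fun _ _ _ => Nat.zero_le _, Nat.zero_le _, fun _ => ⟨hx, by omega, trivial⟩⟩
    · rw [(h3 x hx).2.1, hdiag x hx]; exact Nat.zero_le _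
    · rw [(h3 u hu).2.2.1]; exact Or.inr (Or.inl (Nat.zero_le _))
    · have : (((Finset.range N).filter fun z => τ siz z 0 ≠ 0).card : ℝ) ≤ N := by
        exact_mod_cast (Finset.card_le_card (Finset.filter_subset _ _)).trans (by simp)
      have hN0 : (0 : ℝ) ≤ N := Nat.cast_nonneg _
      rw [pow_zero, mul_one]
      nlinarith
  · rintro t ht ρ k - h
    have hclear : RoundInv H N t ρ → RoundInv H N t (ρ.set (bk 5) 0 0 t) := by
      rintro ⟨a1, a2, a3, a4, a5, a6, a7, a8, a9⟩
      exact ⟨a1.congr (by simp) (by simp) (by simp) (by simp) (by simp) (by simp), by simpa using a2,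
        by simpa using a3, by simpa using a4, a5, by simpa using a6, by simpa using a7,
        by simpa using a8, by simpa using a9⟩
    rw [wp_when]
    simp only [val_no, val_rd0, Mem.set_of_ne, ne_eq, reduceCtorEq, Loc.bk.injEq, Nat.reduceEqDiff,
      not_false_eq_true]
    rcases h with ⟨g1, g2, g3⟩ | ⟨g1, g2, g3⟩
    · refine ⟨fun _ => ?_, fun h => by simp [g1] at h⟩
      refine wp_mono _ (round_spec hH hN hM (hclear g2)) ?_
      rintro π l ⟨m1, m2⟩
      push_cast at m2 ⊢
      rcases m1 with ⟨m1, m3⟩ | ⟨m1, m3⟩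
      · exact Or.inl ⟨m1, m3, by linarith⟩
      · refine Or.inr ⟨m1, m3, ?_⟩
        -- An active round t has 4^t ≤ N, and a fortiori 2^t ≤ N.
        have : t ≤ Nat.log 2 N := Nat.le_log_of_pow_le (by norm_num)
          (le_trans (Nat.le_mul_of_pos_left _ (by positivity)) g2.sq)
        have : (t : ℝ) ≤ Nat.log 2 N := by exact_mod_cast this
        nlinarith
    · refine ⟨fun h => by simp [g1] at h, fun _ => Or.inr ⟨by simpa using g1, by simpa using g2, ?_⟩⟩
      push_cast; linarith
  · rintro ρ k - h
    have hrR : (r : ℝ) ≤ s + N ^ 2 + 2 * N := by exact_mod_cast h6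
    have hNR : (1 : ℝ) ≤ N := by exact_mod_cast hN
    rcases h with ⟨g1, g2, g3⟩ | ⟨g1, g2, g3⟩
    -- The flag is set in the end, since 4^N > N.
    · have h1 := g2.sq
      have h2 : N < 2 ^ N := Nat.lt_two_pow_self
      nlinarith
    · exact ⟨g2.1, g2.2, by nlinarith⟩

end TwoApproxRound
/-! ### From programs on memories to programs on graphs -/

section Transfer

/-- The graph on the natural numbers that is `G` on `0, …, n - 1`. -/
def onNat {n : ℕ} (G : SimpleGraph (Fin n)) : SimpleGraph ℕ where
  Adj x y := ∃ u v : Fin n, G.Adj u v ∧ (u : ℕ) = x ∧ (v : ℕ) = y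
  symm := ⟨fun _ _ ⟨u, v, h, hu, hv⟩ => ⟨v, u, h.symm, hv, hu⟩⟩
  loopless := ⟨fun _ ⟨u, v, h, hu, hv⟩ => h.ne (Fin.ext (hu.trans hv.symm))⟩

variable {n : ℕ} {G : SimpleGraph (Fin n)}

theorem onNat_adj {x y : ℕ} :
    (onNat G).Adj x y ↔ ∃ u v : Fin n, G.Adj u v ∧ (u : ℕ) = x ∧ (v : ℕ) = y := Iff.rfl

theorem onRange_onNat (G : SimpleGraph (Fin n)) : OnRange (onNat G) n := by
  intro x y h
  obtain ⟨u, v, -, rfl, -⟩ := onNat_adj.1 h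
  exact u.2

theorem onNat_walk {x y : ℕ} (w : (onNat G).Walk x y) : ∀ u : Fin n, (u : ℕ) = x →
    ∃ v : Fin n, (v : ℕ) = y ∧ ∃ w' : G.Walk u v, w'.length = w.length := by
  induction w with
  | nil => exact fun u hu => ⟨u, hu, SimpleGraph.Walk.nil, rfl⟩
  | cons h w ih =>
    intro u hu
    obtain ⟨u', v', hadj, h1, h2⟩ := onNat_adj.1 h
    obtain rfl : u = u' := Fin.ext (hu.trans h1.symm)
    obtain ⟨v, hv, w', hw'⟩ := ih v' h2
    exact ⟨v, hv, SimpleGraph.Walk.cons hadj w', by simp [hw']⟩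

theorem walk_onNat {u v : Fin n} (w : G.Walk u v) :
    ∃ w' : (onNat G).Walk u v, w'.length = w.length :=
  ⟨w.map (⟨fun u => (u : ℕ), fun {u v} h => ⟨u, v, h, rfl, rfl⟩⟩ : G →g onNat G),
    SimpleGraph.Walk.length_map _ _⟩

theorem onNat_reachable {u v : Fin n} : (onNat G).Reachable u v ↔ G.Reachable u v := by
  constructor
  · rintro ⟨w⟩
    obtain ⟨v', hv, w', -⟩ := onNat_walk w u rfl
    obtain rfl : v' = v := Fin.ext hv
    exact w'.reachable
  · rintro ⟨w⟩
    exact (walk_onNat w).choose.reachable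

theorem onNat_dist {u v : Fin n} (h : G.Reachable u v) : (onNat G).dist u v = G.dist u v := by
  apply le_antisymm
  · obtain ⟨w, hw⟩ := h.exists_walk_length_eq_dist
    obtain ⟨w', hw'⟩ := walk_onNat w
    rw [← hw, ← hw']; exact SimpleGraph.dist_le _
  · obtain ⟨w, hw⟩ := (onNat_reachable.2 h).exists_walk_length_eq_dist
    obtain ⟨v', hv, w', hw'⟩ := onNat_walk w u rfl
    obtain rfl : v' = v := Fin.ext hv
    rw [← hw, ← hw']; exact SimpleGraph.dist_le _

theorem edist_eq_dist {u v : Fin n} (h : G.Reachable u v) : G.edist u v = G.dist u v := by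
  rw [SimpleGraph.dist, ENat.natCast_toNat (SimpleGraph.edist_ne_top_iff_reachable.2 h)]

/-- The number 4n works as ∞ because a finite distance is below n, so twice a finite distance is
never read as infinite. Conversely an entry below 4n forces the pair to be connected. -/
theorem isApprox_of_bounds {D : ℕ → ℕ → ℕ} {k : ℕ}
    (h1 : ∀ x < n, ∀ y < n, tdist (onNat G) n x y ≤ D x y)
    (h2 : ∀ x < n, ∀ y < n, (onNat G).Reachable x y → k ≤ (onNat G).dist x y →
      D x y ≤ 2 * (onNat G).dist x y) : IsApprox 2 0 k G (estimate D) := by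
  refine ⟨fun u v => ?_, fun u v huv => ?_⟩
  · unfold estimate
    split_ifs with hD
    · have h := h1 u u.2 v v.2
      have hr : (onNat G).Reachable u v := reachable_of_tdist_lt (h.trans_lt hD)
      rw [tdist_of_reachable hr, onNat_dist (onNat_reachable.1 hr)] at h
      rw [edist_eq_dist (onNat_reachable.1 hr)]
      exact_mod_cast h
    · exact le_top
  · by_cases hr : G.Reachable u v
    · rw [edist_eq_dist hr] at huv ⊢
      have hr' := onNat_reachable.2 hr
      have hd := onNat_dist hr
      have h := h2 u u.2 v v.2 hr' (by rw [hd]; exact_mod_cast huv)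
      have hlt := dist_lt_of_onRange (onRange_onNat G) u.2 hr'
      rw [hd] at h hlt
      unfold estimate
      rw [if_pos (by omega)]
      simpa using (by exact_mod_cast h : ((D u v : ℕ) : ℕ∞) ≤ 2 * (G.dist u v : ℕ∞))
    · have : G.edist u v = ⊤ := by
        by_contra hne; exact hr (SimpleGraph.edist_ne_top_iff_reachable.1 hne)
      rw [this]; simp

theorem sum_gdeg_onNat (G : SimpleGraph (Fin n)) : gsize (onNat G) n = 2 * G.edgeSet.ncard + n := by
  classical
  have hdeg : ∀ u : Fin n, gdeg (onNat G) n u = G.degree u := by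
    intro u
    unfold gdeg
    rw [← G.card_neighborFinset_eq_degree, ← Finset.card_map Fin.valEmbedding]
    congr 1
    ext y
    simp only [Finset.mem_filter, Finset.mem_range, Finset.mem_map, SimpleGraph.mem_neighborFinset,
      onNat_adj, Fin.valEmbedding_apply]
    constructor
    · rintro ⟨-, u', v, h, h1, rfl⟩
      obtain rfl : u' = u := Fin.ext h1
      exact ⟨v, h, rfl⟩
    · rintro ⟨v, h, rfl⟩
      exact ⟨v.2, u, v, h, rfl, rfl⟩
  unfold gsize
  rw [Finset.sum_range, Finset.sum_add_distrib]
  simp only [hdeg, Finset.sum_const, Finset.card_univ, Fintype.card_fin, smul_eq_mul, mul_one]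
  rw [G.sum_degrees_eq_twice_card_edges, Set.ncard_eq_toFinset_card', SimpleGraph.edgeFinset]

variable {X : Type} [DecidableEq X] {N A O : X}

theorem bdd_inputMem {M : ℕ} (hn : n ≤ M) (h1 : 1 ≤ M) (G : SimpleGraph (Fin n)) :
    Bdd M (inputMem N A G) := by
  intro a i j
  unfold inputMem
  split_ifs <;> omega

theorem inputMem_n (G : SimpleGraph (Fin n)) : inputMem N A G N 0 0 = n := by simp [inputMem]

theorem inputMem_adj (h : A ≠ N) (G : SimpleGraph (Fin n)) (x y : ℕ) :
    inputMem N A G A x y ≠ 0 ↔ (onNat G).Adj x y := by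
  simp [inputMem, h, onNat_adj]

theorem inputMem_le (h : A ≠ N) (G : SimpleGraph (Fin n)) (x y : ℕ) :
    inputMem N A G A x y ≤ 1 := by
  unfold inputMem; rw [if_neg h, if_pos rfl]; split_ifs <;> omega

theorem inputMem_other {a : X} (hN : a ≠ N) (hA : a ≠ A) (G : SimpleGraph (Fin n)) (i j : ℕ) :
    inputMem N A G a i j = 0 := by simp [inputMem, hN, hA]

/-- The law of a program with a weakest precondition is a point mass, so its support is one outcome.
For n = 0 there is nothing to show. -/
theorem computes_of_wp {P : Cmd X} {k : ℕ} (h : ∀ n, 1 ≤ n → ∀ G : SimpleGraph (Fin n), ∃ M,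
    n ≤ M ∧ 1 ≤ M ∧ P.wp M (fun τ _ => IsApprox 2 0 k G (estimate (τ O))) (inputMem N A G) 0) :
    Computes P N A O 2 0 k := by
  intro n G r hr
  rcases Nat.eq_zero_or_pos n with rfl | hn
  · exact ⟨fun u => u.elim0, fun u => u.elim0⟩
  · obtain ⟨M, h1, h2, h3⟩ := h n hn G
    obtain ⟨τ, q, t, hrun, -, hQ, -⟩ := wp_sound P (bdd_inputMem h1 h2 G) h3
    rw [hrun, PMF.support_pure, Set.mem_singleton_iff] at hr
    rw [hr]; exact hQ

theorem one_le_log_add_two (hn : 1 ≤ n) : 1 ≤ Real.log (n + 2) := by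
  rw [Real.le_log_iff_exp_le (by positivity)]
  have h1 := Real.exp_one_lt_d9
  have : (1 : ℝ) ≤ n := by exact_mod_cast hn
  linarith

theorem natLog_le_log (m : ℕ) : (Nat.log 2 m : ℝ) ≤ 2 * Real.log m := by
  rcases Nat.eq_zero_or_pos m with rfl | hm
  · simp
  · have h1 : (2 : ℝ) ^ Nat.log 2 m ≤ m := by exact_mod_cast Nat.pow_log_le_self 2 (by omega)
    have h2 := Real.log_le_log (by positivity) h1
    rw [Real.log_pow] at h2
    have h3 := Real.log_two_gt_d9
    have : (0 : ℝ) ≤ Nat.log 2 m := Nat.cast_nonneg _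
    nlinarith

theorem len_add_two_le (hn : 1 ≤ n) : (len (n + 2) : ℝ) ≤ 4 * Real.log (n + 2) := by
  have h1 : Nat.size (n + 2) ≤ Nat.log 2 (n + 2) + 1 := by
    rw [Nat.size_le]; exact Nat.lt_pow_succ_log_self (by norm_num) _
  have h2 := natLog_le_log (n + 2)
  have h3 := one_le_log_add_two hn
  have h4 : (Nat.size (n + 2) : ℝ) ≤ Nat.log 2 (n + 2) + 1 := by exact_mod_cast h1
  push_cast at h2
  unfold len
  push_cast
  linarith

theorem len_pow_le (x e : ℕ) : len (x ^ e) ≤ e * len x + 2 := by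
  induction e with
  | zero => simp [len]
  | succ e ih =>
    have := len_mul_le (x ^ e) x
    rw [pow_succ]
    nlinarith

theorem harmonic_le_log (hn : 1 ≤ n) : (harmonic n : ℝ) ≤ 2 * Real.log (n + 2) := by
  have h1 := harmonic_le_one_add_log n
  have h2 : Real.log n ≤ Real.log (n + 2) :=
    Real.log_le_log (by exact_mod_cast hn) (by linarith)
  have h3 := one_le_log_add_two hn
  linarith

/-- The numbers are bounded by a polynomial in n, so `len M` is O(log n) and contributes two
logarithms. The additional unit in `wp_sound` is absorbed because T ≥ 1. -/
theorem runsInExpected_of_wp {P : Cmd X} {T : ℕ → ℕ → ℝ} {a e c : ℕ} {C : ℝ} (ha : 1 ≤ a) (he : 1 ≤ e)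
    (hC : 0 ≤ C) (hT : ∀ n m, 1 ≤ n → 1 ≤ T n m)
    (h : ∀ n, 1 ≤ n → ∀ G : SimpleGraph (Fin n), P.wp (a * (n + 2) ^ e)
      (fun _ r => (r : ℝ) ≤ C * T n G.edgeSet.ncard * Real.log (n + 2) ^ c) (inputMem N A G) 0) :
    RunsInExpected P N A T := by
  refine ⟨P.weight * ((len a + 2) + 4 * e) ^ 2 * (C + 1), 2 + c, fun n G hn => ?_⟩
  have hpow : n + 2 ≤ (n + 2) ^ e := Nat.le_self_pow (by omega) _
  have hM : n + 2 ≤ a * (n + 2) ^ e := hpow.trans (Nat.le_mul_of_pos_left _ ha)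
  obtain ⟨τ, q, t, hrun, -, hQ, ht⟩ := wp_sound P (bdd_inputMem (by omega) (by omega) G) (h n hn G)
  unfold Cmd.expectedTime
  rw [hrun, tsum_eq_single (τ, t) (fun r hr => by simp [hr])]
  simp only [PMF.pure_apply, if_true, one_mul]
  rw [← ENNReal.ofReal_natCast]
  refine ENNReal.ofReal_le_ofReal ?_
  set L := Real.log ((n : ℝ) + 2) with hL
  have hL1 : 1 ≤ L := one_le_log_add_two hn
  have hlen : (len (a * (n + 2) ^ e) : ℝ) ≤ ((len a + 2) + 4 * e) * L := by
    have h1 := len_mul_le a ((n + 2) ^ e)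
    have h2 := len_pow_le (n + 2) e
    have h3 : (len (a * (n + 2) ^ e) : ℝ) ≤ len a + (e * len (n + 2) + 2) := by
      exact_mod_cast h1.trans (Nat.add_le_add_left h2 _)
    have h4 := mul_le_mul_of_nonneg_left (len_add_two_le hn) (Nat.cast_nonneg (α := ℝ) e)
    have h5 : (0 : ℝ) ≤ len a := Nat.cast_nonneg _
    nlinarith
  have hT1 := hT n G.edgeSet.ncard hn
  have hLc : 1 ≤ L ^ c := one_le_pow₀ hL1
  have hTL : 1 ≤ T n G.edgeSet.ncard * L ^ c := one_le_mul_of_one_le_of_one_le hT1 hLc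
  have hq : (q : ℝ) + 1 ≤ (C + 1) * (T n G.edgeSet.ncard * L ^ c) := by
    rw [zero_add] at hQ
    linarith
  have ht' : (t : ℝ) ≤ P.weight * (len (a * (n + 2) ^ e) : ℝ) ^ 2 * (q + 1) := by exact_mod_cast ht
  refine ht'.trans ?_
  calc (P.weight : ℝ) * (len (a * (n + 2) ^ e) : ℝ) ^ 2 * (q + 1)
      ≤ P.weight * (((len a + 2) + 4 * e) * L) ^ 2 * ((C + 1) * (T n G.edgeSet.ncard * L ^ c)) := by
        gcongr
    _ = _ := by rw [pow_add]; ring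

end Transfer

/-! ### The subroutine -/

section Subroutine
open Loc

/-- The names of the arrays of the subroutine. -/
def code : Loc → ℕ
  | .n => 0 | .adj => 3 | .dhat => 2 | .inf => 4 | .x => 5 | .y => 6 | .i => 7 | .j => 8
  | .j1 => 9 | .j2 => 10 | .p => 11 | .q => 12 | .t => 13 | .w => 14 | .b => 15 | .e => 16
  | .v => 17 | .best => 18 | .left => 19 | .deg => 20 | .degPow => 21 | .nPow => 22 | .hi => 23
  | .need => 24 | .c => 25 | .inD => 26 | .rep => 27 | .lst => 28 | .siz => 29 | .cnt => 30
  | .nbr => 31 | .d => 32 | .bcnt => 33 | .bucket => 34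
  | .bk 0 => 1
  | .bk (a + 1) => 35 + a

theorem code_injective : Function.Injective code := by
  intro a b h
  rcases a with _ | _ | _ | _ | _ | _ | _ | _ | _ | _ | _ | _ | _ | _ | _ | _ | _ | _ | _ | _ | _ | _ |
    _ | _ | _ | _ | _ | _ | _ | _ | _ | _ | _ | _ | _ | (_ | a) <;>
  rcases b with _ | _ | _ | _ | _ | _ | _ | _ | _ | _ | _ | _ | _ | _ | _ | _ | _ | _ | _ | _ | _ | _ |
    _ | _ | _ | _ | _ | _ | _ | _ | _ | _ | _ | _ | _ | (_ | b) <;>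
  first
    | rfl
    | (simp only [code] at h; omega)
    | (simp only [code] at h; rw [show a = b by omega])

/-- The subroutine `BK2APASP`. -/
def bk2apasp : Cmd ℕ := twoApprox.map code

theorem bk2apasp_spec {H : SimpleGraph ℕ} {N M s : ℕ} {σ : Mem ℕ} (hH : OnRange H N) (hN : 1 ≤ N)
    (hn : σ 0 0 0 = N) (hM : 8 * (N + 2) ^ 4 ≤ M)
    (hA : ∀ x < N, ∀ y < N, σ 1 x y ≠ 0 ↔ H.Adj x y)
    (hz : ∀ a i j, a ≠ 0 → a ≠ 1 → σ a i j = 0) :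
    bk2apasp.wp M (fun τ r => IsEst H N (τ 2) ∧
      (∀ u < N, ∀ v < N, H.Reachable u v → τ 2 u v ≤ 2 * H.dist u v) ∧
      (r : ℝ) ≤ s + 4 * N ^ 2 + (Nat.log 2 N + 1) *
        (100 * (N ^ 2 + gsize H N * Real.sqrt N) * harmonic N)) σ s := by
  refine wp_map code_injective twoApprox (twoApprox_spec (σ := fun a => σ (code a)) hH hN hn hM hA ?_)
  intro a i j h1 h2
  exact hz _ i j (fun h => h1 (code_injective h)) (fun h => h2 (code_injective h))

theorem isBK2APASP_bk2apasp : IsBK2APASP bk2apasp := by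
  have key : ∀ n, 1 ≤ n → ∀ G : SimpleGraph (Fin n), _ := fun n hn G =>
    bk2apasp_spec (s := 0) (M := 8 * (n + 2) ^ 4) (σ := inputMem 0 1 G) (onRange_onNat G) hn
      (inputMem_n G) le_rfl (fun x _ y _ => inputMem_adj (by norm_num) G x y)
      (fun a i j h0 h1 => inputMem_other h0 h1 G i j)
  have hpow : ∀ n : ℕ, n + 2 ≤ 8 * (n + 2) ^ 4 := fun n =>
    (Nat.le_self_pow (by norm_num) _).trans (Nat.le_mul_of_pos_left _ (by norm_num))
  constructor
  · refine computes_of_wp fun n hn G => ⟨8 * (n + 2) ^ 4, by have := hpow n; omega,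
      by have := hpow n; omega, wp_mono _ (key n hn G) ?_⟩
    rintro τ r ⟨h1, h2, -⟩
    exact isApprox_of_bounds h1.sound fun x hx y hy hr _ => h2 x hx y hy hr
  -- Of the two logarithms in the iteration count, one comes from the number of rounds and one from
  -- the harmonic number.
  · refine runsInExpected_of_wp (a := 8) (e := 4) (c := 2) (C := 2000) (by norm_num) (by norm_num)
      (by norm_num) (fun n m hn => ?_) fun n hn G => wp_mono _ (key n hn G) ?_
    · have : (1 : ℝ) ≤ n := by exact_mod_cast hn
      have : 0 ≤ (m : ℝ) * Real.sqrt n := by positivity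
      nlinarith
    · rintro τ r ⟨-, -, h⟩
      refine h.trans ?_
      rw [sum_gdeg_onNat]
      push_cast
      have hn1 : (1 : ℝ) ≤ n := by exact_mod_cast hn
      set L := Real.log ((n : ℝ) + 2) with hL
      have hL1 : 1 ≤ L := one_le_log_add_two hn
      have h1 : (Nat.log 2 n : ℝ) + 1 ≤ 3 * L := by
        have := natLog_le_log n
        have : Real.log n ≤ L := Real.log_le_log (by linarith) (by linarith)
        linarith
      have h2 : (harmonic n : ℝ) ≤ 2 * L := harmonic_le_log hn
      have h0 : (0 : ℝ) ≤ harmonic n := by linarith [one_le_harmonic hn]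
      have hz : Real.sqrt n ≤ n := Real.sqrt_le_iff.2 ⟨by linarith, by nlinarith⟩
      set m : ℝ := (G.edgeSet.ncard : ℝ)
      have hm : 0 ≤ m := Nat.cast_nonneg _
      have hmz : 0 ≤ m * Real.sqrt n := by positivity
      have h3 : (n : ℝ) ^ 2 + (2 * m + n) * Real.sqrt n ≤ 2 * (m * Real.sqrt n + n ^ 2) := by nlinarith
      have hT : 0 ≤ m * Real.sqrt n + (n : ℝ) ^ 2 := by positivity
      calc (0 : ℝ) + 4 * (n : ℝ) ^ 2 + (Nat.log 2 n + 1) *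
            (100 * (n ^ 2 + (2 * m + n) * Real.sqrt n) * harmonic n)
          ≤ (0 : ℝ) + 4 * (m * Real.sqrt n + (n : ℝ) ^ 2) * L ^ 2 + (3 * L) *
            (100 * (2 * (m * Real.sqrt n + n ^ 2)) * (2 * L)) := by
            have : 4 * (n : ℝ) ^ 2 ≤ 4 * (m * Real.sqrt n + (n : ℝ) ^ 2) * L ^ 2 := by
              have : 1 ≤ L ^ 2 := one_le_pow₀ hL1
              nlinarith
            gcongr
        _ ≤ 2000 * (m * Real.sqrt n + n ^ 2) * L ^ 2 := by
            have : 0 ≤ (m * Real.sqrt n + (n : ℝ) ^ 2) * L ^ 2 := by positivity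
            nlinarith

end Subroutine
/-! ### The stretch of the long multiplicative algorithm -/

section Stretch

variable {H : SimpleGraph ℕ} {N l : ℕ} {hi inD rep : ℕ → ℕ → ℕ}

/-- The edges of `E_j`. -/
def LevelEdge (H : SimpleGraph ℕ) (hi : ℕ → ℕ → ℕ) (j x y : ℕ) : Prop :=
  H.Adj x y ∧ (hi (j - 1) x = 0 ∨ hi (j - 1) y = 0)

theorem LevelEdge.symm {j x y : ℕ} (h : LevelEdge H hi j x y) : LevelEdge H hi j y x :=
  ⟨h.1.symm, h.2.symm⟩

/-- `y` is `x` or a chosen vertex in the closed neighbourhood of `x`. -/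
def Near (l : ℕ) (hi rep : ℕ → ℕ → ℕ) (ε y x : ℕ) : Prop :=
  (ε = 0 ∧ y = x) ∨ (ε = 1 ∧ ∃ i, 1 ≤ i ∧ i < l ∧ hi i x ≠ 0 ∧ y = rep i x)

/-- The edges of the graph of phase `j`, without the star. -/
inductive PhaseEdge (H : SimpleGraph ℕ) (N l : ℕ) (hi inD rep : ℕ → ℕ → ℕ) (j : ℕ) : ℕ → ℕ → Prop
  | level {x y : ℕ} : LevelEdge H hi j x y → PhaseEdge H N l hi inD rep j x y
  | rep {i x : ℕ} : 1 ≤ i → i < l → hi i x ≠ 0 → H.Adj x (rep i x) →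
      PhaseEdge H N l hi inD rep j x (rep i x)
  | rep' {i x : ℕ} : 1 ≤ i → i < l → hi i x ≠ 0 → H.Adj x (rep i x) →
      PhaseEdge H N l hi inD rep j (rep i x) x
  | prod {i i' x y : ℕ} : 1 ≤ i → i ≤ l → 1 ≤ i' → i' ≤ l → j + i + i' ≤ 2 * l + 1 → x < N → y < N →
      inD i x ≠ 0 → inD i' y ≠ 0 → PhaseEdge H N l hi inD rep j x y

/-- The properties of the decomposition that the stretch depends on. -/
structure Levels (H : SimpleGraph ℕ) (N l : ℕ) (hi inD rep : ℕ → ℕ → ℕ) : Prop where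
  lo : ∀ x < N, hi 0 x = 0
  mono : ∀ i, i < l → ∀ x < N, hi i x ≠ 0 → hi (i + 1) x ≠ 0
  rep : ∀ i, 1 ≤ i → i < l → ∀ x < N, hi i x ≠ 0 →
    rep i x < N ∧ (rep i x = x ∨ H.Adj x (rep i x)) ∧ inD i (rep i x) ≠ 0

theorem Levels.mono_le (h : Levels H N l hi inD rep) {i j x : ℕ} (hij : i ≤ j) (hj : j ≤ l)
    (hx : x < N) (hi' : hi i x ≠ 0) : hi j x ≠ 0 := by
  induction j, hij using Nat.le_induction with
  | base => exact hi'
  | succ j hij ih => exact h.mono j (by omega) x hx (ih (by omega))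

/-- The additive error after phase `j`. -/
def stageErr (l i₀ j : ℕ) : ℕ := 4 + 2 * (j + (i₀ + 1) / 2 - (l + 1))

/-- The guarantee for the estimates `D` from the vertices in `D_j` after phase `j`. -/
structure Stage (H : SimpleGraph ℕ) (N l : ℕ) (hi inD rep : ℕ → ℕ → ℕ) (j : ℕ) (D : ℕ → ℕ → ℕ) :
    Prop where
  base : ∀ P m x y w z ε ε', IsRoute H P m x y → y < N →
    (∀ i < m, LevelEdge H hi j (P i) (P (i + 1))) → w < N → z < N → inD j w ≠ 0 →
    Near l hi rep ε w x → Near l hi rep ε' z y → D w z ≤ ε + m + ε'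
  far : ∀ i₀, 1 ≤ i₀ → i₀ < j → ∀ P m x y w z ε ε', IsRoute H P m x y → y < N →
    (∀ i < m, LevelEdge H hi i₀ (P i) (P (i + 1))) →
    ∀ p < m, hi i₀ (P p) ≠ 0 → hi i₀ (P (p + 1)) ≠ 0 → w < N → z < N → inD j w ≠ 0 →
    Near l hi rep ε w x → Near l hi rep ε' z y → D w z ≤ ε + m + ε' + stageErr l i₀ j

/-- The guarantees are upper bounds and the estimates only decrease, so they persist through later
phases. -/
theorem Stage.mono {j : ℕ} {D D' : ℕ → ℕ → ℕ} (h : Stage H N l hi inD rep j D) (hle : EstLE N D' D) :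
    Stage H N l hi inD rep j D' := by
  constructor
  · intro P m x y w z ε ε' h1 h2 h3 h4 h5 h6 h7 h8
    exact (hle w h4 z h5).trans (h.base P m x y w z ε ε' h1 h2 h3 h4 h5 h6 h7 h8)
  · intro i₀ g1 g2 P m x y w z ε ε' h1 h2 h3 p hp g3 g4 h4 h5 h6 h7 h8
    exact (hle w h4 z h5).trans
      (h.far i₀ g1 g2 P m x y w z ε ε' h1 h2 h3 p hp g3 g4 h4 h5 h6 h7 h8)

theorem IsRoute.segment {P : ℕ → ℕ} {m x y a b : ℕ} (h : IsRoute H P m x y) (hab : a ≤ b) (hb : b ≤ m) :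
    IsRoute H (fun i => P (a + i)) (b - a) (P a) (P b) :=
  ⟨rfl, by simp only; rw [show a + (b - a) = b by omega], fun i hi => h.2.2 (a + i) (by omega)⟩

theorem IsRoute.backward {P : ℕ → ℕ} {m x y b : ℕ} (h : IsRoute H P m x y) (hb : b ≤ m) :
    IsRoute H (fun i => P (b - i)) b (P b) x := by
  have h1 := (h.segment (Nat.zero_le b) hb).reverse
  simp only [Nat.zero_add, Nat.sub_zero, h.1] at h1
  exact h1

theorem levelEdge_backward {P : ℕ → ℕ} {m b c : ℕ}
    (h : ∀ i < m, LevelEdge H hi c (P i) (P (i + 1))) (hb : b ≤ m) :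
    ∀ i < b, LevelEdge H hi c (P (b - i)) (P (b - (i + 1))) := by
  intro i hi'
  have := (h (b - (i + 1)) (by omega)).symm
  rwa [show b - (i + 1) + 1 = b - i by omega] at this

section Phase

variable {j : ℕ} {D : ℕ → ℕ → ℕ} {f : ℕ → ℕ}

theorem phase_walk (hH : OnRange H N) (hE : IsEst H N D)
    (hf : ∀ x y, PhaseEdge H N l hi inD rep j x y → f y ≤ f x + D x y) {P : ℕ → ℕ} {a : ℕ} :
    ∀ b, a ≤ b → (∀ i, a ≤ i → i < b → LevelEdge H hi j (P i) (P (i + 1))) →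
      f (P b) ≤ f (P a) + (b - a) := by
  intro b hab
  induction b, hab using Nat.le_induction with
  | base => intro _; omega
  | succ b hab ih =>
    intro h
    have h1 := ih fun i h1 h2 => h i h1 (by omega)
    have h2 := h b hab (by omega)
    have h3 := hf _ _ (PhaseEdge.level h2)
    have h4 := hE.adj _ (hH _ _ h2.1) _ (hH.lt_right h2.1) h2.1
    omega

theorem phase_near (hH : OnRange H N) (hL : Levels H N l hi inD rep) (hE : IsEst H N D)
    (hf : ∀ x y, PhaseEdge H N l hi inD rep j x y → f y ≤ f x + D x y) {ε z x : ℕ} (hx : x < N)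
    (h : Near l hi rep ε z x) : f z ≤ f x + ε ∧ f x ≤ f z + ε := by
  rcases h with ⟨rfl, rfl⟩ | ⟨rfl, i, h1, h2, h3, rfl⟩
  · exact ⟨le_rfl, le_rfl⟩
  · obtain ⟨g1, g2, -⟩ := hL.rep i h1 h2 x hx h3
    rcases g2 with g2 | g2
    · rw [g2]; omega
    · have e1 := hf _ _ (PhaseEdge.rep h1 h2 h3 g2)
      have e2 := hf _ _ (PhaseEdge.rep' h1 h2 h3 g2)
      have e3 := hE.adj _ hx _ g1 g2
      have e4 := hE.adj _ g1 _ hx g2.symm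
      omega

/-- Let e be the last edge of the path outside E_j and c < j its exact level. The far end of e has a
vertex a of D_c in its closed neighbourhood; behind e the path lies in E_j, and E* joins a to it.
There are two ways from w to a. The star edge wa carries what the search from a found in phase c, at
the price of two steps more than the error of that phase. Alternatively one goes over a chosen
vertex a' in D_{i₀} near an end of an edge of exact level i₀: the star edge wa' and the product edge
a'a both carry values from phase i₀, in which the whole path was present, and the error is 4. The
product is available while j + ⌈i₀/2⌉ ≤ l + 1, and afterwards the error grows by at most 2 per
phase. This is what `stageErr` records. -/
theorem Stage.step {D' : ℕ → ℕ → ℕ} (hH : OnRange H N) (hL : Levels H N l hi inD rep) (hj : 1 ≤ j)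
    (hjl : j ≤ l) (hE : IsEst H N D)
    (hprev : ∀ c, 1 ≤ c → c < j → Stage H N l hi inD rep c D)
    (hphase : ∀ w < N, inD j w ≠ 0 → ∃ f : ℕ → ℕ, f w = 0 ∧ (∀ x < N, f x ≤ D w x) ∧
      (∀ x y, PhaseEdge H N l hi inD rep j x y → f y ≤ f x + D x y) ∧ ∀ x < N, D' w x ≤ f x) :
    Stage H N l hi inD rep j D' := by
  classical
  constructor
  -- The whole path lies in the phase graph with weights at most 1, and E* supplies the steps at
  -- both ends.
  · intro P m x y w z ε ε' hP hy hlev hw hz hD hwx hzy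
    obtain ⟨f, f0, f1, f2, f3⟩ := hphase w hw hD
    have hx : x < N := by have := hP.lt hH hy (Nat.zero_le m); rwa [hP.1] at this
    have h1 := (phase_near hH hL hE f2 hx hwx).2
    have h2 := (phase_near hH hL hE f2 hy hzy).1
    have h3 := phase_walk hH hE f2 (P := P) (a := 0) m (Nat.zero_le _) fun i _ h => hlev i h
    rw [hP.1, hP.2.1] at h3
    have := f3 z hz
    omega
  · intro i₀ hi₁ hi₂ P m x y w z ε ε' hP hy hlev p hp hp1 hp2 hw hz hD hwx hzy
    obtain ⟨f, f0, f1, f2, f3⟩ := hphase w hw hD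
    have hPN : ∀ i ≤ m, P i < N := fun i hi => hP.lt hH hy hi
    have hx : x < N := by have := hPN 0 (Nat.zero_le m); rwa [hP.1] at this
    -- the last edge that is not in `E_j`
    let bad : ℕ → Prop := fun i => i < m ∧ ¬ LevelEdge H hi j (P i) (P (i + 1))
    have hbadp : bad p := by
      refine ⟨hp, fun h => ?_⟩
      rcases h.2 with h | h
      · exact hL.mono_le (by omega) (by omega) (hPN p hp.le) hp1 h
      · exact hL.mono_le (by omega) (by omega) (hPN (p + 1) hp) hp2 h
    obtain ⟨c', hc'⟩ : ∃ c', c' = Nat.findGreatest bad m := ⟨_, rfl⟩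
    have hbad : bad c' := hc' ▸ Nat.findGreatest_spec (P := bad) hp.le hbadp
    have hpc : p ≤ c' := hc' ▸ Nat.le_findGreatest (P := bad) hp.le hbadp
    have hgood : ∀ i, c' + 1 ≤ i → i < m → LevelEdge H hi j (P i) (P (i + 1)) := by
      intro i h1 h2
      by_contra hne
      exact Nat.findGreatest_is_greatest (P := bad) (n := m) (k := i) (by omega) h2.le ⟨h2, hne⟩
    -- its level
    obtain ⟨c, hc⟩ : ∃ c, c = Nat.findGreatest
      (fun i => LevelEdge H hi i (P c') (P (c' + 1))) (j - 1) := ⟨_, rfl⟩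
    have hlevc := hlev c' hbad.1
    have hci : i₀ ≤ c := hc ▸ Nat.le_findGreatest
      (P := fun i => LevelEdge H hi i (P c') (P (c' + 1))) (by omega) hlevc
    have hcj : c ≤ j - 1 := hc ▸ Nat.findGreatest_le _
    have hnot : ¬ LevelEdge H hi (c + 1) (P c') (P (c' + 1)) := by
      rcases Nat.lt_or_ge c (j - 1) with h | h
      · exact Nat.findGreatest_is_greatest (P := fun i => LevelEdge H hi i (P c') (P (c' + 1)))
          (n := j - 1) (k := c + 1) (by omega) (by omega)
      · have := hbad.2
        rwa [show j = c + 1 by omega] at this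
    have hic : hi c (P (c' + 1)) ≠ 0 := fun h => hnot ⟨hlevc.1, Or.inr (by simpa using h)⟩
    have hcN : P (c' + 1) < N := hPN _ hbad.1
    obtain ⟨hrN, -, hrD⟩ := hL.rep c (by omega) (by omega) _ hcN hic
    have hnear : Near l hi rep 1 (rep c (P (c' + 1))) (P (c' + 1)) :=
      Or.inr ⟨rfl, c, by omega, by omega, hic, rfl⟩
    -- from the chosen vertex to the end
    have e1 := (phase_near hH hL hE f2 hcN hnear).2
    have e2 := phase_walk hH hE f2 (P := P) (a := c' + 1) m hbad.1 hgood
    rw [hP.2.1] at e2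
    have e3 := (phase_near hH hL hE f2 hy hzy).1
    have e4 := f3 z hz
    have hstage : f (rep c (P (c' + 1))) + 1 ≤ ε + (c' + 1) + stageErr l i₀ j := by
      have hrouteb := hP.backward (b := c' + 1) hbad.1
      have hlevb := levelEdge_backward hlev (b := c' + 1) hbad.1
      have hw' : Near l hi rep ε w x := hwx
      -- Beyond this bound the product edge may be missing, and the star edge to a is used. Then the
      -- subtraction in `stageErr` at j is not truncated to zero, so j > c yields the two extra
      -- units; if c = i₀, phase c was exact on the path and 2 alone suffices.
      rcases Nat.lt_or_ge (l + 1) (j + (i₀ + 1) / 2) with hopt | hopt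
      · have hd := f1 _ hrN
        rw [hE.symm _ hw _ hrN] at hd
        rcases Nat.lt_or_ge i₀ c with hlt | hge
        · have h1 := (hprev c (by omega) (by omega)).far i₀ hi₁ hlt _ _ _ _
            (rep c (P (c' + 1))) w 1 ε hrouteb hx hlevb (c' - p) (by omega)
            (by rw [show c' + 1 - (c' - p) = p + 1 by omega]; exact hp2)
            (by rw [show c' + 1 - (c' - p + 1) = p by omega]; exact hp1)
            hrN hw hrD hnear hw'
          unfold stageErr at h1 ⊢
          omega
        · obtain rfl : c = i₀ := by omega
          have h1 := (hprev c (by omega) (by omega)).base _ _ _ _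
            (rep c (P (c' + 1))) w 1 ε hrouteb hx hlevb hrN hw hrD hnear hw'
          unfold stageErr
          omega
      · -- over the chosen vertex near `P p`
        obtain ⟨hzN, -, hzD⟩ := hL.rep i₀ hi₁ (by omega) _ (hPN p hp.le) hp1
        have hnz : Near l hi rep 1 (rep i₀ (P p)) (P p) := Or.inr ⟨rfl, i₀, hi₁, by omega, hp1, rfl⟩
        have h1 := (hprev i₀ hi₁ hi₂).base _ _ _ _ (rep i₀ (P p)) w 1 ε
          (hP.backward hp.le) hx (levelEdge_backward hlev hp.le) hzN hw hzD hnz hw'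
        have h2 := (hprev i₀ hi₁ hi₂).base _ _ _ _ (rep i₀ (P p)) (rep c (P (c' + 1))) 1 1
          (hP.segment (a := p) (b := c' + 1) (by omega) hbad.1) hcN
          (fun i hi => hlev (p + i) (by have := hbad.1; omega)) hzN hrN hzD hnz hnear
        have h3 := f1 _ hzN
        rw [hE.symm _ hw _ hzN] at h3
        -- The product is admitted: c ≤ j - 1 and j ≤ l + 1 - ⌈i₀/2⌉ give j + i₀ + c ≤ 2j - 1 + i₀ ≤
        -- 2l + 1. The excess 4 is one for each of the two edges at a', one for the step to a, and
        -- one for the step back from a.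
        have h4 := f2 _ _ (PhaseEdge.prod (i := i₀) (i' := c) hi₁ (by omega) (by omega) (by omega)
          (by omega) hzN hrN hzD hrD)
        unfold stageErr
        omega
    have := hbad.1
    omega

end Phase

/-- The estimates after the last phase. -/
theorem Stage.final {k : ℕ} {D : ℕ → ℕ → ℕ} (hH : OnRange H N) (hL : Levels H N l hi inD rep)
    (hk : 4 ≤ k) (hkE : Even k) (hl : l = 2 * (k - 1)) (hD : ∀ x < N, inD l x ≠ 0)
    (hS : Stage H N l hi inD rep l D) {u v m : ℕ} {P : ℕ → ℕ} (hP : IsRoute H P m u v) (hu : u < N)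
    (hv : v < N) (hmk : k ≤ m) :
    D u v ≤ 2 * m ∨ ∀ i < m, LevelEdge H hi (k - 1) (P i) (P (i + 1)) := by
  classical
  by_contra hcon
  rw [not_or] at hcon
  obtain ⟨hc1, hc2⟩ := hcon
  let good : ℕ → Prop := fun j => ∀ i < m, LevelEdge H hi j (P i) (P (i + 1))
  have hPN : ∀ i ≤ m, P i < N := fun i hi => hP.lt hH hv hi
  have hgood1 : good 1 := fun i hi' => ⟨hP.2.2 i hi', Or.inl (hL.lo _ (hPN i hi'.le))⟩
  -- The exact level of the path; it is at most k - 2 because the path is not inside E_{k-1}.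
  obtain ⟨i₀, hi₀⟩ : ∃ i₀, i₀ = Nat.findGreatest good (k - 2) := ⟨_, rfl⟩
  have hg : good i₀ := hi₀ ▸ Nat.findGreatest_spec (P := good) (by omega) hgood1
  have h1 : 1 ≤ i₀ := hi₀ ▸ Nat.le_findGreatest (P := good) (by omega) hgood1
  have h2 : i₀ ≤ k - 2 := hi₀ ▸ Nat.findGreatest_le _
  have hnot : ¬ good (i₀ + 1) := by
    rcases Nat.lt_or_ge i₀ (k - 2) with h | h
    · exact Nat.findGreatest_is_greatest (P := good) (n := k - 2) (k := i₀ + 1) (by omega) (by omega)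
    · rwa [show i₀ + 1 = k - 1 by omega]
  simp only [good, not_forall] at hnot
  obtain ⟨p, hp, hnp⟩ := hnot
  have hp1 : hi i₀ (P p) ≠ 0 := fun h => hnp ⟨hP.2.2 p hp, Or.inl (by simpa using h)⟩
  have hp2 : hi i₀ (P (p + 1)) ≠ 0 := fun h => hnp ⟨hP.2.2 p hp, Or.inr (by simpa using h)⟩
  have := hS.far i₀ h1 (by omega) P m u v u v 0 0 hP hv hg p hp hp1 hp2 hu hv (hD u hu)
    (Or.inl ⟨rfl, rfl⟩) (Or.inl ⟨rfl, rfl⟩)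
  -- For j = l the error is 2 + 2⌈i₀/2⌉, and evenness of k gives 2⌈i₀/2⌉ ≤ k - 2. So the error is at
  -- most k ≤ m.
  obtain ⟨k', rfl⟩ := hkE
  unfold stageErr at this
  omega

end Stretch
/-! ### Initialization and decomposition -/

section Decomposition
open Loc

variable {H : SimpleGraph ℕ} {N M l : ℕ}

open Classical in
/-- The array `A` is the adjacency matrix of `H`. -/
def IsMatrix (H : SimpleGraph ℕ) (N : ℕ) (A : ℕ → ℕ → ℕ) : Prop :=
  ∀ x < N, ∀ y < N, A x y = if H.Adj x y then 1 else 0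

theorem IsMatrix.ne_zero {A : ℕ → ℕ → ℕ} (h : IsMatrix H N A) {x y : ℕ} (hx : x < N) (hy : y < N) :
    A x y ≠ 0 ↔ H.Adj x y := by
  rw [h x hx y hy]; split_ifs with h <;> simp [h]

theorem initEstimate_spec {s : ℕ} {σ : Mem Loc} (hH : OnRange H N) (hM : 4 * N + 1 ≤ M)
    (hn : σ n 0 0 = N) (hA : IsMatrix H N (σ adj)) :
    initEstimate.wp M (fun τ r => τ inf 0 0 = 4 * N ∧ IsEst H N (τ dhat) ∧ r = s + N * (N + 1)) σ s := by
  classical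
  unfold initEstimate
  simp only [wp_block_cons, wp_block_nil, wp_wr0, val_mul, val_four, val_rd0, hn]
  refine fun _ => ⟨by omega, ?_⟩
  refine wp_loop N (fun t τ r =>
    (∀ x < t, ∀ y < N, τ dhat x y = if H.Adj x y then 1 else 4 * N) ∧ r = s + t * (N + 1))
    (by simpa using hn) (fun _ => by omega) (by simp) ?_ ?_
  · rintro t ht τ r hfr ⟨h1, h2⟩
    have e1 : τ n = σ n := by rw [hfr n (by decide)]; simp
    have e2 : τ adj = σ adj := by rw [hfr adj (by decide)]; simp
    have e3 : τ inf 0 0 = 4 * N := by rw [hfr inf (by decide)]; simp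
    refine wp_loop N (fun u ρ q => (∀ y < u, ρ dhat t y = if H.Adj t y then 1 else 4 * N) ∧
      (∀ x, x ≠ t → ρ dhat x = τ dhat x) ∧ q = r + 1 + u) (by simpa [e1] using hn)
      (fun _ => by omega) (by simp) ?_ ?_
    · rintro u hu ρ q hfr' ⟨g1, g2, g3⟩
      have f1 : ρ x 0 0 = t := by rw [hfr' x (by decide)]; simp
      have f2 : ρ adj = σ adj := by rw [hfr' adj (by decide)]; simpa using e2
      have f3 : ρ inf 0 0 = 4 * N := by rw [hfr' inf (by decide)]; simpa using e3
      simp only [wp_ite, wp_wr2, val_rd0, val_rd2, val_one, Mem.set_of_ne, Mem.set_same, ne_eq,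
        reduceCtorEq, not_false_eq_true, and_self, if_true, f1, f2, f3]
      have key : ∀ v, v = (if H.Adj t u then 1 else 4 * N) →
          (∀ y < u + 1, (if t = t ∧ y = u then v else ρ dhat t y) =
            if H.Adj t y then 1 else 4 * N) := by
        rintro v rfl y hy
        by_cases hyu : y = u
        · simp [hyu]
        · simpa [hyu] using g1 y (by omega)
      have hadj := hA.ne_zero ht hu
      refine ⟨fun h _ => ⟨by omega, ?_, ?_, by omega⟩, fun h _ => ⟨by omega, ?_, ?_, by omega⟩⟩
      · simpa using key 1 (by rw [if_pos (hadj.1 h)])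
      · intro x hx; rw [← g2 x hx]; funext i; simp [hx]
      · simpa using key (4 * N) (by rw [if_neg (fun h' => hadj.2 h' h)])
      · intro x hx; rw [← g2 x hx]; funext i; simp [hx]
    · rintro ρ q - ⟨g1, g2, g3⟩
      refine ⟨fun x hx y hy => ?_, by rw [g3, h2]; ring⟩
      by_cases hxt : x = t
      · rw [hxt]; exact g1 y hy
      · rw [g2 x hxt]; exact h1 x (by omega) y hy
  · rintro τ r hfr ⟨h1, h2⟩
    refine ⟨by rw [hfr inf (by decide)]; simp, ⟨fun x hx y hy => ?_, fun x hx y hy => ?_,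
      fun x hx y hy => ?_, fun x hx y hy hxy => ?_⟩, h2⟩
    · rw [h1 x hx y hy, h1 y hy x hx, H.adj_comm]
    · rw [h1 x hx y hy]
      split_ifs with h
      · rw [tdist_adj h]
      · exact tdist_le hH hx
    · rw [h1 x hx y hy]; split_ifs <;> omega
    · rw [h1 x hx y hy, if_pos hxy]

/-- The truth value of `deg x ≥ s_i`. -/
noncomputable def highDeg (H : SimpleGraph ℕ) (N l i x : ℕ) : ℕ :=
  if i = 0 then 0 else if i = l then 1 else if N ^ (l - i) ≤ gdeg H N x ^ l then 1 else 0

theorem highDeg_le (i x : ℕ) : highDeg H N l i x ≤ 1 := by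
  unfold highDeg; split_ifs <;> omega

theorem thresholds_spec {s : ℕ} {σ : Mem Loc} (hN : 1 ≤ N) (hl : 1 ≤ l)
    (hM : N ^ l ≤ M) (hM' : 4 * N + l + 4 ≤ M)
    (hn : σ n 0 0 = N) (hA : IsMatrix H N (σ adj)) (hdeg : ∀ x, σ deg x 0 = 0) :
    (thresholds l).wp M (fun τ r => (∀ i ≤ l, ∀ x < N, τ hi i x = highDeg H N l i x) ∧
      r ≤ s + (l + 1) + N * (N + 2 * l + 2)) σ s := by
  classical
  have hpow : ∀ t ≤ l, N ^ t ≤ M := fun t ht => (Nat.pow_le_pow_right hN ht).trans hM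
  have hdpow : ∀ x, ∀ t ≤ l, gdeg H N x ^ t ≤ M := fun x t ht =>
    (Nat.pow_le_pow_left (gdeg_le H N x) t).trans (hpow t ht)
  unfold thresholds
  simp only [wp_block_cons, wp_block_nil, wp_wr1, val_zero, val_one]
  refine fun _ => ⟨by omega, ?_⟩
  refine wp_loop1 (fun t τ r => (∀ i < t, τ nPow i 0 = N ^ i) ∧ r = s + t) (fun _ => by omega) ?_ ?_ ?_
  · intro τ hfr
    refine ⟨fun i hi => ?_, rfl⟩
    obtain rfl : i = 0 := by omega
    rw [hfr nPow (by decide)]; simp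
  · rintro t ht1 htl τ r hfr ⟨h1, h2⟩
    have e1 : τ n = σ n := by rw [hfr n (by decide)]; simp
    simp only [wp_wr1, val_rd0, val_rd1, val_mul, val_sub, val_one, Mem.set_of_ne, Mem.set_same, ne_eq,
      reduceCtorEq, not_false_eq_true, and_self, if_true, e1, hn, h1 (t - 1) (by omega)]
    have hp : N ^ (t - 1) * N = N ^ t := by rw [← pow_succ, Nat.sub_add_cancel ht1]
    rw [hp]
    refine fun _ => ⟨hpow t htl, fun i hi => ?_, by omega⟩
    by_cases hit : i = t
    · simp [hit]
    · simpa [hit] using h1 i (by omega)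
  rintro τ r hfr ⟨h1, rfl⟩
  have e1 : τ n = σ n := by rw [hfr n (by decide)]; simp
  have e2 : τ adj = σ adj := by rw [hfr adj (by decide)]; simp
  have e3 : τ deg = σ deg := by rw [hfr deg (by decide)]; simp
  clear hfr
  refine wp_loop N (fun t ρ r => (∀ i ≤ l, ∀ x < t, ρ hi i x = highDeg H N l i x) ∧
    (∀ x, t ≤ x → ρ deg x 0 = 0) ∧ r = s + (l + 1) + t * (N + 2 * l + 2))
    (by simpa [e1] using hn) (fun _ => by omega) ?_ ?_ ?_
  · simp [e3, hdeg]
  swap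
  · rintro ρ r - ⟨g1, -, g3⟩
    exact ⟨g1, g3.le⟩
  rintro x₀ hx ρ r hfr ⟨g1, g2, g3⟩
  have f1 : ρ n = σ n := by rw [hfr n (by simp [Cmd.mods, block, wr1, wr2, loop1, when]), e1]
  have f2 : ρ adj = σ adj := by rw [hfr adj (by simp [Cmd.mods, block, wr1, wr2, loop1, when]), e2]
  have f3 : ρ nPow = τ nPow := hfr nPow (by simp [Cmd.mods, block, wr1, wr2, loop1, when])
  simp only [wp_block_cons, wp_block_nil]
  refine wp_loop N (fun u π k => π deg x₀ 0 = ((Finset.range u).filter (H.Adj x₀)).card ∧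
    (∀ x, x ≠ x₀ → π deg x = ρ deg x) ∧ k = r + 1 + u) (by simpa [f1] using hn)
    (fun _ => by omega) (by simp [g2]) ?_ ?_
  · rintro u hu π k hfr' ⟨k1, k2, k3⟩
    have i1 : π x 0 0 = x₀ := by rw [hfr' x (by decide)]; simp
    have i2 : π adj = σ adj := by rw [hfr' adj (by decide)]; simpa using f2
    have hle : ((Finset.range u).filter (H.Adj x₀)).card ≤ u :=
      (Finset.card_le_card (Finset.filter_subset _ _)).trans (by simp)
    rw [Finset.range_add_one, Finset.filter_insert]
    simp only [wp_wr1, val_rd0, val_rd1, val_rd2, val_add, Mem.set_of_ne, Mem.set_same, ne_eq,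
      reduceCtorEq, not_false_eq_true, and_self, if_true, i1, i2, k1, hA x₀ hx u hu]
    refine fun _ => ⟨by split_ifs <;> omega, ?_, fun x hx' => ?_, by omega⟩
    · split_ifs with h
      · rw [Finset.card_insert_of_notMem (by simp)]
      · rfl
    · rw [← k2 x hx']; funext i; simp [hx']
  rintro π k hfr' ⟨k1, k2, rfl⟩
  have i1 : π x 0 0 = x₀ := by rw [hfr' x (by decide)]; simp
  have i3 : π nPow = τ nPow := by rw [hfr' nPow (by decide)]; simpa using f3
  have i4 : π hi = ρ hi := by rw [hfr' hi (by decide)]; simp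
  have k1' : π deg x₀ 0 = gdeg H N x₀ := k1
  clear hfr'
  simp only [wp_wr1, val_rd0, val_one, i1]
  refine fun _ => ⟨by omega, ?_⟩
  refine wp_loop1 (fun t κ q => κ degPow x₀ 0 = gdeg H N x₀ ^ (t - 1) ∧ q = r + 1 + N + t)
    (fun _ => by omega) ?_ ?_ ?_
  · intro κ hκ
    refine ⟨?_, rfl⟩
    rw [hκ degPow (by decide)]; simp
  · rintro t ht1 htl κ q hfr' ⟨m1, m2⟩
    have j1 : κ x 0 0 = x₀ := by rw [hfr' x (by decide)]; simpa using i1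
    have j2 : κ deg x₀ 0 = gdeg H N x₀ := by rw [hfr' deg (by decide)]; simpa using k1'
    simp only [wp_wr1, val_rd0, val_rd1, val_mul, Mem.set_of_ne, Mem.set_same, ne_eq,
      reduceCtorEq, not_false_eq_true, and_self, if_true, j1, j2, m1]
    have hp : gdeg H N x₀ ^ (t - 1) * gdeg H N x₀ = gdeg H N x₀ ^ t := by
      rw [← pow_succ, Nat.sub_add_cancel ht1]
    rw [hp]
    exact fun _ => ⟨hdpow _ t htl, by simp, by omega⟩
  rintro κ q hfr' ⟨m1, rfl⟩
  have j1 : κ x 0 0 = x₀ := by rw [hfr' x (by decide)]; simpa using i1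
  have j2 : κ deg = π deg := by rw [hfr' deg (by decide)]; simp
  have j3 : κ nPow = τ nPow := by rw [hfr' nPow (by decide)]; simpa using i3
  have j4 : κ hi = ρ hi := by rw [hfr' hi (by decide)]; simpa using i4
  clear hfr'
  simp only [wp_wr2, val_rd0, val_zero, j1]
  refine fun _ => ⟨by omega, ?_⟩
  refine wp_loop1 (fun t μ z => (∀ i < t, i < l → μ hi i x₀ = highDeg H N l i x₀) ∧
    (∀ i x, x ≠ x₀ → μ hi i x = ρ hi i x) ∧ z = r + 1 + N + (l + 1) + t)
    (fun _ => by omega) ?_ ?_ ?_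
  · intro μ hμ
    rw [hμ hi (by decide)]
    refine ⟨fun i hi _ => ?_, fun i x hx' => by simp [hx', j4], rfl⟩
    obtain rfl : i = 0 := by omega
    simp [highDeg]
  · rintro t ht1 htl μ z hfr' ⟨n1, n2, n3⟩
    have o1 : μ x 0 0 = x₀ := by rw [hfr' x (by simp [Cmd.mods, block, wr1, wr2, loop1, when])]; simpa using j1
    have o2 : μ degPow x₀ 0 = gdeg H N x₀ ^ l := by rw [hfr' degPow (by simp [Cmd.mods, block, wr1, wr2, loop1, when])]; simpa using m1
    have o3 : μ nPow (l - t) 0 = N ^ (l - t) := by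
      rw [hfr' nPow (by simp [Cmd.mods, block, wr1, wr2, loop1, when])]; simpa [j3] using h1 (l - t) (by omega)
    simp only [wp_wr2, val_rd0, val_rd1, val_no, val_lt, val_lit, val_sub, Mem.set_of_ne, Mem.set_same, ne_eq,
      reduceCtorEq, not_false_eq_true, and_self, if_true, o1, o2, o3]
    refine fun _ => ⟨by split_ifs <;> omega, fun i hi hil => ?_, fun i x hx' => by simp [hx', n2 i x hx'],
      by omega⟩
    by_cases hit : i = t
    · subst hit
      have h0 : i ≠ 0 := by omega
      have h2 : i ≠ l := by omega
      simp only [and_self, if_true, highDeg, h0, h2, if_false]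
      by_cases hc : N ^ (l - i) ≤ gdeg H N x₀ ^ l
      · simp [hc, not_lt.2 hc]
      · simp [hc, not_le.1 hc]
    · simpa [hit] using n1 i (by omega) hil
  rintro μ z hfr' ⟨n1, n2, rfl⟩
  have o1 : μ x 0 0 = x₀ := by rw [hfr' x (by simp [Cmd.mods, block, wr1, wr2, loop1, when])]; simpa using j1
  have o2 : μ deg = π deg := by rw [hfr' deg (by simp [Cmd.mods, block, wr1, wr2, loop1, when])]; simpa using j2
  simp only [wp_wr2, val_rd0, val_one, val_lit, o1]
  refine fun _ => ⟨by omega, fun i hi' x hx' => ?_, fun x hx' => ?_, ?_⟩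
  · by_cases hxx : x = x₀
    · subst hxx
      by_cases hil : i = l
      · subst hil
        have h0 : i ≠ 0 := by omega
        simp [highDeg, h0]
      · simpa [hil] using n1 i (by omega) (by omega)
    · simpa [hxx, n2 i x hxx] using g1 i hi' x (by omega)
  · have hne : x ≠ x₀ := by omega
    simp only [Mem.set_of_ne, ne_eq, reduceCtorEq, not_false_eq_true, o2, k2 x hne]
    exact g2 x (by omega)
  · rw [g3, Nat.sub_add_cancel hl]; ring

end Decomposition
-- The hitting sets D_i and their sizes
section Decomposition2
open Loc

variable {H : SimpleGraph ℕ} {N M l : ℕ} {R h : ℝ}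

/-- The result of `decompose`. -/
structure Decomposed (H : SimpleGraph ℕ) (N l : ℕ) (R h : ℝ) (τ : Mem Loc) : Prop where
  n : τ n 0 0 = N
  inf : τ inf 0 0 = 4 * N
  matrix : IsMatrix H N (τ adj)
  hi : ∀ i ≤ l, ∀ x < N, τ hi i x = highDeg H N l i x
  rep : ∀ i, 1 ≤ i → i < l → ∀ x < N, τ Loc.hi i x ≠ 0 →
    τ rep i x < N ∧ (τ rep i x = x ∨ H.Adj x (τ rep i x)) ∧ τ inD i (τ rep i x) ≠ 0
  last : ∀ x < N, τ inD l x ≠ 0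
  entry : ∀ i, 1 ≤ i → i ≤ l → ∀ p < τ siz i 0, τ lst i p < N ∧ τ inD i (τ lst i p) ≠ 0
  mem : ∀ i, 1 ≤ i → i ≤ l → ∀ x < N, τ inD i x ≠ 0 → ∃ p < τ siz i 0, τ lst i p = x
  siz_le : ∀ i, 1 ≤ i → i ≤ l → τ siz i 0 ≤ N
  siz_real : ∀ i, 1 ≤ i → i ≤ l → (τ siz i 0 : ℝ) ≤ l * R ^ i * h

theorem Decomposed.congr {τ τ' : Mem Loc} (hD : Decomposed H N l R h τ) (h1 : τ' Loc.n = τ Loc.n)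
    (h2 : τ' Loc.inf = τ Loc.inf) (h3 : τ' adj = τ adj) (h4 : τ' Loc.hi = τ Loc.hi)
    (h5 : τ' Loc.rep = τ Loc.rep) (h6 : τ' inD = τ inD) (h7 : τ' lst = τ lst) (h8 : τ' siz = τ siz) :
    Decomposed H N l R h τ' := by
  obtain ⟨a1, a2, a3, a4, a5, a6, a7, a8, a9, a10⟩ := hD
  constructor <;> simp only [h1, h2, h3, h4, h5, h6, h7, h8] <;> assumption

/-- The test on integers deg^l ≥ N^(l-i) is the comparison of deg with s_i = R^(l-i), raised to the
power l. -/
theorem highDeg_real (hl : 1 ≤ l) (hR : 0 ≤ R) (hRl : R ^ l = N) {i x : ℕ} (hi : i ≠ 0) (hil : i < l) :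
    highDeg H N l i x ≠ 0 ↔ R ^ (l - i) ≤ gdeg H N x := by
  have h1 : (N ^ (l - i) ≤ gdeg H N x ^ l) ↔ R ^ (l - i) ≤ gdeg H N x := by
    rw [← pow_le_pow_iff_left₀ (pow_nonneg hR _) (Nat.cast_nonneg _) (by omega : l ≠ 0), ← pow_mul,
      mul_comm, pow_mul, hRl]
    exact_mod_cast Iff.rfl
  rw [← h1]
  simp [highDeg, hi, hil.ne]

/-- The thresholds decrease with i, which makes the edge sets E_i decreasing. -/
theorem highDeg_mono (hN : 1 ≤ N) {i x : ℕ} (hil : i < l) (h : highDeg H N l i x ≠ 0) :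
    highDeg H N l (i + 1) x ≠ 0 := by
  unfold highDeg at h ⊢
  by_cases h1 : i = 0
  · simp [h1] at h
  · rw [if_neg h1, if_neg hil.ne] at h
    rw [if_neg (by omega)]
    by_cases h2 : i + 1 = l
    · simp [h2]
    · rw [if_neg h2]
      have h3 : N ^ (l - i) ≤ gdeg H N x ^ l := by by_contra hc; simp [hc] at h
      rw [if_pos ((Nat.pow_le_pow_right hN (by omega)).trans h3)]
      omega

theorem Decomposed.levels {τ : Mem Loc} (hN : 1 ≤ N) (hD : Decomposed H N l R h τ) :
    Levels H N l (τ Loc.hi) (τ inD) (τ Loc.rep) := by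
  refine ⟨fun x hx => ?_, fun i hi x hx hh => ?_, hD.rep⟩
  · rw [hD.hi 0 (Nat.zero_le _) x hx]; simp [highDeg]
  · rw [hD.hi i (by omega) x hx] at hh
    rw [hD.hi (i + 1) (by omega) x hx]
    exact highDeg_mono hN hi hh

/-- At level i every set to be hit has at least R^(l-i) elements out of N = R^l, so the greedy set
has at most R^i H_N elements. Uniting the first i of these sets gives the factor i ≤ l. -/
theorem decompose_spec {s : ℕ} {σ : Mem Loc} (hN : 1 ≤ N) (hl : 1 ≤ l) (hR : 1 ≤ R)
    (hRl : R ^ l = N) (hh : h = harmonic N)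
    (hM : N ^ l ≤ M) (hM' : 4 * N + l + 4 ≤ M)
    (hn : σ n 0 0 = N) (hinf : σ inf 0 0 = 4 * N) (hA : IsMatrix H N (σ adj))
    (hz : ∀ a ∈ [deg, inD, siz], ∀ i j, σ a i j = 0) :
    (decompose l).wp M (fun τ r => Decomposed H N l R h τ ∧ r ≤ s + 25 * l * N ^ 2) σ s := by
  have hh1 : 1 ≤ h := hh ▸ one_le_harmonic hN
  unfold decompose
  simp only [wp_block_cons, wp_block_nil]
  refine wp_use (thresholds_spec hN hl hM hM' hn hA fun x => hz deg (by simp) x 0) ?_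
  rintro τ r hfr ⟨h1, h2⟩
  have fr1 : ∀ a ∈ [Loc.n, Loc.inf, adj, inD, siz], τ a = σ a := by
    intro a ha
    refine hfr a ?_
    simp only [List.mem_cons, List.not_mem_nil, or_false] at ha
    rcases ha with rfl | rfl | rfl | rfl | rfl <;>
      simp [thresholds, Cmd.mods, block, wr1, wr2, loop1, when]
  have e1 : τ n 0 0 = N := by rw [fr1 n (by simp), hn]
  have e2 : IsMatrix H N (τ adj) := by rw [fr1 adj (by simp)]; exact hA
  have e3 : ∀ i j, τ inD i j = 0 := by rw [fr1 inD (by simp)]; exact hz inD (by simp)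
  clear hfr
  -- the hitting sets
  refine wp_loop1 (fun t ρ q =>
    (∀ i, 1 ≤ i → i < t → (∀ x < N, τ hi i x ≠ 0 →
      ρ rep i x < N ∧ (ρ rep i x = x ∨ H.Adj x (ρ rep i x)) ∧ ρ inD i (ρ rep i x) ≠ 0)) ∧
    (∀ i, i < t → (((Finset.range N).filter fun y => ρ inD i y ≠ 0).card : ℝ) ≤ i * R ^ i * h) ∧
    (∀ i, t ≤ i → ∀ y < N, ρ inD i y = 0) ∧
    q ≤ r + t + (t - 1) * (8 * N ^ 2 + N)) (fun _ => by omega) ?_ ?_ ?_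
  · intro ρ hρ
    rw [hρ inD (by decide)]
    refine ⟨fun i h1 h2 => by omega, fun i hi => ?_, fun i _ y _ => e3 i y, by simp⟩
    obtain rfl : i = 0 := by omega
    simp [e3]
  · rintro t ht1 htl ρ q hfr ⟨g1, g2, g3, g4⟩
    have f1 : ρ n 0 0 = N := by rw [hfr n (by decide), e1]
    have f2 : ρ adj = τ adj := hfr adj (by decide)
    have f3 : ρ hi = τ hi := hfr hi (by decide)
    simp only [wp_block_cons, wp_block_nil]
    -- All weights are 1 and the threshold is s_t. The neighbours alone provide that many elements
    -- of the closed neighbourhood.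
    refine wp_use (hittingSet_spec (N := N) (i₀ := t) (by simpa using f1) (by simp) (by omega) ?_
      (fun _ => 1) (R ^ (l - t)) (by positivity) (by simp) ?_ ?_) ?_
    · intro x hx
      simp only [Mem.set_of_ne, ne_eq, reduceCtorEq, not_false_eq_true, f3]
      rw [h1 t (by omega) x hx]; exact highDeg_le _ _
    · intro x hx hx1
      simp only [Mem.set_of_ne, ne_eq, reduceCtorEq, not_false_eq_true, f3, f2] at hx1 ⊢
      rw [h1 t (by omega) x hx] at hx1
      have h3 := (highDeg_real (H := H) (N := N) (x := x) hl (by linarith) hRl (by omega : t ≠ 0)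
        (by omega)).1 (by omega)
      refine h3.trans ?_
      rw [Finset.sum_const, nsmul_eq_mul, mul_one, Nat.cast_le]
      classical
      unfold gdeg
      refine Finset.card_le_card fun y hy => ?_
      rw [Finset.mem_filter, Finset.mem_range] at hy ⊢
      refine ⟨hy.1, ?_⟩
      unfold InNbhd
      have := (e2.ne_zero hx hy.1).2 hy.2
      omega
    · intro y hy
      simpa using g3 t le_rfl y hy
    rintro π k hfr' ⟨m1, m2, m3, m4, m5⟩
    simp only [Mem.set_of_ne, ne_eq, reduceCtorEq, not_false_eq_true, f3, f2] at m1 m2 m3 m4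
    have i1 : π n 0 0 = N := by rw [hfr' n (by decide)]; simpa using f1
    have i2 : π i 0 0 = t := by rw [hfr' i (by decide)]; simp
    clear hfr'
    refine wp_loop N (fun u κ z => (∀ i, i ≠ t → κ inD i = ρ inD i) ∧ (∀ y, π inD t y ≠ 0 → κ inD t y ≠ 0) ∧
      (∀ y, κ inD t y ≠ 0 → π inD t y ≠ 0 ∨ ρ inD (t - 1) y ≠ 0) ∧ z = k + u) (by simpa using i1)
      (fun _ => by omega) ⟨m2, fun _ h => h, fun _ h => Or.inl h, rfl⟩ ?_ ?_
    · rintro u hu κ z hfr' ⟨n1, n2, n3, n4⟩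
      have j1 : κ i 0 0 = t := by rw [hfr' i (by decide), i2]
      simp only [wp_when, wp_wr2, val_rd0, val_rd2, val_sub, val_one, Mem.set_of_ne, Mem.set_same, ne_eq,
        reduceCtorEq, not_false_eq_true, and_self, if_true, j1, n1 (t - 1) (by omega)]
      refine ⟨fun hc _ => ⟨by omega, fun i hi => ?_, fun y hy => ?_, fun y hy => ?_, by omega⟩,
        fun hc => ⟨n1, n2, n3, by omega⟩⟩
      · rw [← n1 i hi]; funext y; simp [hi]
      · by_cases hyu : y = u
        · simp [hyu]
        · simpa [hyu] using n2 y hy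
      · by_cases hyu : y = u
        · exact Or.inr (hyu ▸ hc)
        · exact n3 y (by simpa [hyu] using hy)
    · rintro κ z hfr' ⟨n1, n2, n3, n4⟩
      have j1 : κ rep = π rep := hfr' rep (by decide)
      rw [j1]
      refine ⟨fun i hi1 hi2 x hx hhi => ?_, fun i hi => ?_, fun i hi y hy => ?_, ?_⟩
      · by_cases hit : i = t
        · subst hit
          have hone : τ hi i x = 1 := by
            have := highDeg_le (H := H) (N := N) (l := l) i x
            rw [← h1 i (by omega) x hx] at this
            omega
          obtain ⟨p1, p2, p3⟩ := m1 x hx hone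
          refine ⟨p1, ?_, n2 _ (by omega)⟩
          unfold InNbhd at p2
          by_cases hxr : x = π rep i x
          · exact Or.inl hxr.symm
          · rw [if_neg hxr, add_zero] at p2
            exact Or.inr ((e2.ne_zero hx p1).1 p2)
        · rw [m3 i hit, n1 i hit]
          exact g1 i hi1 (by omega) x hx hhi
      · by_cases hit : i = t
        · subst hit
          have hcard : (((Finset.range N).filter fun y => κ inD i y ≠ 0).card : ℝ) ≤
              ((Finset.range N).filter fun y => π inD i y ≠ 0).card +
              ((Finset.range N).filter fun y => ρ inD (i - 1) y ≠ 0).card := by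
            rw [← Nat.cast_add, Nat.cast_le]
            refine le_trans (Finset.card_le_card fun y hy => ?_) (Finset.card_union_le _ _)
            rw [Finset.mem_union, Finset.mem_filter, Finset.mem_filter]
            rw [Finset.mem_filter] at hy
            rcases n3 y hy.2 with hy' | hy'
            · exact Or.inl ⟨hy.1, hy'⟩
            · exact Or.inr ⟨hy.1, hy'⟩
          have h3 := g2 (i - 1) (by omega)
          have h4 : (((Finset.range N).filter fun y => π inD i y ≠ 0).card : ℝ) ≤ R ^ i * h := by
            simp only [Finset.sum_const, Finset.card_range, nsmul_eq_mul, mul_one] at m4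
            rw [← hh, ← hRl] at m4
            have hpos : 0 < R ^ (l - i) := by positivity
            refine le_of_mul_le_mul_right (m4.trans (le_of_eq ?_)) hpos
            rw [show R ^ l = R ^ i * R ^ (l - i) by rw [← pow_add]; congr 1; omega]
            ring
          -- D_{i-1} is bounded at level i - 1 and enlarged to the scale R^i, so that the two
          -- summands add up to i R^i h.
          have h5 : ((i - 1 : ℕ) : ℝ) * R ^ (i - 1) * h ≤ ((i - 1 : ℕ) : ℝ) * R ^ i * h := by
            gcongr
            omega
          have h6 : ((i - 1 : ℕ) : ℝ) = i - 1 := by push_cast [ht1]; ring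
          rw [h6] at h5 h3
          calc _ ≤ _ := hcard
            _ ≤ R ^ i * h + ((i : ℝ) - 1) * R ^ i * h := add_le_add h4 (h3.trans h5)
            _ = _ := by ring
        · rw [n1 i hit]; exact g2 i (by omega)
      · rw [n1 i (by omega)]; exact g3 i (by omega) y hy
      · obtain ⟨t', rfl⟩ : ∃ t', t = t' + 1 := ⟨t - 1, by omega⟩
        simp only [Nat.add_sub_cancel] at g4 ⊢
        nlinarith
  rintro ρ q hfr ⟨g1, g2, g3, g4⟩
  have fr2 : ∀ a ∈ [Loc.n, Loc.inf, adj, hi, siz], ρ a = τ a := by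
    intro a ha
    refine hfr a ?_
    simp only [List.mem_cons, List.not_mem_nil, or_false] at ha
    rcases ha with rfl | rfl | rfl | rfl | rfl <;> decide
  clear hfr
  -- the last level
  refine wp_loop N (fun u κ z => (∀ i, i ≠ l → κ inD i = ρ inD i) ∧ (∀ y < u, κ inD l y ≠ 0) ∧
    z = q + u) (by simpa [fr2 n (by simp)] using e1) (fun _ => by omega) (by simp) ?_ ?_
  · rintro u hu κ z - ⟨n1, n2, n3⟩
    simp only [wp_wr2, val_lit, val_rd0, val_one, Mem.set_of_ne, Mem.set_same, ne_eq,
        reduceCtorEq, not_false_eq_true, and_self, if_true]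
    refine fun _ => ⟨by omega, fun i hi => ?_, fun y hy => ?_, by omega⟩
    · rw [← n1 i hi]; funext y; simp [hi]
    · by_cases hyu : y = u
      · simp [hyu]
      · simpa [hyu] using n2 y (by omega)
  rintro κ z hfr ⟨n1, n2, rfl⟩
  have fr3 : ∀ a ∈ [Loc.n, Loc.inf, adj, hi, siz], κ a = τ a := by
    intro a ha
    rw [← fr2 a ha]
    refine hfr a ?_
    simp only [List.mem_cons, List.not_mem_nil, or_false] at ha
    rcases ha with rfl | rfl | rfl | rfl | rfl <;> simp [Cmd.mods, wr2]
  have erep : κ rep = ρ rep := hfr rep (by simp [Cmd.mods, wr2])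
  clear hfr
  -- the lists
  refine wp_loop1 (fun t μ z =>
    (∀ i, 1 ≤ i → i < t → (∀ p < μ siz i 0, μ lst i p < N ∧ κ inD i (μ lst i p) ≠ 0) ∧
      (∀ x < N, κ inD i x ≠ 0 → ∃ p < μ siz i 0, μ lst i p = x) ∧
      μ siz i 0 = ((Finset.range N).filter fun y => κ inD i y ≠ 0).card) ∧
    (∀ i, t ≤ i → μ siz i 0 = 0) ∧ z = q + N + t + (t - 1) * N) (fun _ => by omega) ?_ ?_ ?_
  · intro μ hμ
    refine ⟨fun i h1 h2 => by omega, fun i _ => ?_, by simp⟩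
    rw [hμ siz (by decide), fr3 siz (by simp), fr1 siz (by simp)]
    exact hz siz (by simp) _ _
  · rintro t ht1 htl μ z hfr ⟨o1, o2, o3⟩
    have f1 : μ n 0 0 = N := by rw [hfr n (by decide), fr3 n (by simp), e1]
    have f2 : μ inD = κ inD := hfr inD (by decide)
    refine wp_loop N (fun u ν k => (∀ i, i ≠ t → ν lst i = μ lst i ∧ ν siz i = μ siz i) ∧
      (∀ p < ν siz t 0, ν lst t p < N ∧ κ inD t (ν lst t p) ≠ 0) ∧
      (∀ x < u, κ inD t x ≠ 0 → ∃ p < ν siz t 0, ν lst t p = x) ∧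
      ν siz t 0 = ((Finset.range u).filter fun y => κ inD t y ≠ 0).card ∧ k = z + 1 + u)
      (by simpa using f1) (fun _ => by omega) ?_ ?_ ?_
    · simp [o2]
    · rintro u hu ν k hfr' ⟨p1, p2, p3, p4, p5⟩
      have i1 : ν i 0 0 = t := by rw [hfr' i (by decide)]; simp
      have i2 : ν inD = κ inD := by rw [hfr' inD (by decide)]; simpa using f2
      have hle : ((Finset.range u).filter fun y => κ inD t y ≠ 0).card ≤ u :=
        (Finset.card_le_card (Finset.filter_subset _ _)).trans (by simp)
      rw [Finset.range_add_one, Finset.filter_insert]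
      simp only [wp_when, wp_block_cons, wp_block_nil, wp_wr1, wp_wr2, val_rd0, val_rd1, val_rd2, val_add,
        val_one, Mem.set_of_ne, Mem.set_same, ne_eq,
        reduceCtorEq, not_false_eq_true, and_self, if_true, i1, i2]
      refine ⟨fun hc _ => ⟨by omega, fun _ => ⟨by simp only [ne_eq] at p4 hle; omega, fun i hi => ?_, fun p hp => ?_, fun x hx hx' => ?_,
        ?_, by omega⟩⟩, fun hc => ?_⟩
      · obtain ⟨q1, q2⟩ := p1 i hi
        rw [← q1, ← q2]
        refine ⟨?_, ?_⟩ <;> funext y <;> simp [hi]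
      · by_cases hps : p = ν siz t 0
        · simp only [hps, if_true]; exact ⟨hu, hc⟩
        · simp only [hps, if_false]; exact p2 p (by omega)
      · rcases Nat.lt_succ_iff_lt_or_eq.1 hx with hx | rfl
        · obtain ⟨p, hp, rfl⟩ := p3 x hx hx'
          exact ⟨p, by omega, by simp [hp.ne]⟩
        · exact ⟨ν siz t 0, by omega, by simp⟩
      · rw [if_pos (by simpa using hc), Finset.card_insert_of_notMem (by simp), p4]
      · rw [if_neg (by simpa using hc)]
        refine ⟨p1, p2, fun x hx hx' => ?_, p4, by omega⟩
        rcases Nat.lt_succ_iff_lt_or_eq.1 hx with hx | rfl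
        · exact p3 x hx hx'
        · exact absurd hc hx'
    · rintro ν k - ⟨p1, p2, p3, p4, p5⟩
      refine ⟨fun i hi1 hi2 => ?_, fun i hi => ?_, ?_⟩
      · by_cases hit : i = t
        · rw [hit]; exact ⟨p2, p3, p4⟩
        · obtain ⟨q1, q2⟩ := p1 i hit
          rw [q1, q2]; exact o1 i hi1 (by omega)
      · rw [(p1 i (by omega)).2]; exact o2 i (by omega)
      · obtain ⟨t', rfl⟩ : ∃ t', t = t' + 1 := ⟨t - 1, by omega⟩
        simp only [Nat.add_sub_cancel] at o3 ⊢
        rw [p5, o3]; ring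
  · rintro μ z hfr ⟨o1, o2, o3⟩
    have fr4 : ∀ a ∈ [Loc.n, Loc.inf, adj, hi], μ a = τ a := by
      intro a ha
      have : μ a = κ a := by
        refine hfr a ?_
        simp only [List.mem_cons, List.not_mem_nil, or_false] at ha
        rcases ha with rfl | rfl | rfl | rfl <;> decide
      rw [this]
      refine fr3 a ?_
      simp only [List.mem_cons, List.not_mem_nil, or_false] at ha ⊢
      tauto
    have eD : μ inD = κ inD := hfr inD (by decide)
    have er : μ rep = ρ rep := by rw [hfr rep (by decide), erep]
    refine ⟨⟨?_, ?_, ?_, ?_, ?_, ?_, ?_, ?_, ?_, ?_⟩, ?_⟩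
    · rw [fr4 n (by simp), e1]
    · rw [fr4 inf (by simp), fr1 inf (by simp), hinf]
    · rw [fr4 adj (by simp)]; exact e2
    · rw [fr4 hi (by simp)]; exact h1
    · rw [fr4 hi (by simp), eD, er]
      intro i hi1 hi2 x hx hhi
      rw [n1 i (by omega)]
      exact g1 i hi1 (by omega) x hx hhi
    · rw [eD]; exact n2
    · rw [eD]; exact fun i h1 h2 => (o1 i h1 (by omega)).1
    · rw [eD]; exact fun i h1 h2 => (o1 i h1 (by omega)).2.1
    · intro i h1 h2
      rw [(o1 i h1 (by omega)).2.2]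
      exact (Finset.card_le_card (Finset.filter_subset _ _)).trans (by simp)
    · intro i h1 h2
      rw [(o1 i h1 (by omega)).2.2]
      -- D_l is the whole vertex set and no greedy set; its size is bounded by N = R^l directly.
      by_cases hil : i = l
      · subst hil
        have hc : (((Finset.range N).filter fun y => κ inD i y ≠ 0).card : ℝ) ≤ N := by
          exact_mod_cast (Finset.card_le_card (Finset.filter_subset _ _)).trans (by simp)
        rw [hRl]
        have h3 : (1 : ℝ) ≤ i := by exact_mod_cast hl
        have h4 : (N : ℝ) ≤ i * N := le_mul_of_one_le_left (Nat.cast_nonneg _) h3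
        have h5 : (i : ℝ) * N ≤ i * N * h := le_mul_of_one_le_right (by positivity) hh1
        linarith
      · rw [n1 i hil]
        refine (g2 i (by omega)).trans ?_
        have : (i : ℝ) ≤ l := by exact_mod_cast h2
        gcongr
    · rw [o3]
      obtain ⟨l', rfl⟩ : ∃ l', l = l' + 1 := ⟨l - 1, by omega⟩
      simp only [Nat.add_sub_cancel] at g4 ⊢
      have a1 : N ≤ N ^ 2 := Nat.le_self_pow (by norm_num) N
      have a2 : l' * N ≤ l' * N ^ 2 := Nat.mul_le_mul_left _ a1
      have a3 : l' ≤ l' * N ^ 2 := Nat.le_mul_of_pos_right _ (by omega)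
      have a4 : N * (N + 2 * (l' + 1) + 2) = N ^ 2 + 2 * (l' * N) + 4 * N := by ring
      have a5 : l' * (8 * N ^ 2 + N) = 8 * (l' * N ^ 2) + l' * N := by ring
      have a6 : 25 * (l' + 1) * N ^ 2 = 25 * (l' * N ^ 2) + 25 * N ^ 2 := by ring
      have a7 : (l' + 1) * N = l' * N + N := by ring
      omega

end Decomposition2
/-! ### The graphs of the phases -/

section PhaseGraph
open Loc

variable {H : SimpleGraph ℕ} {N M l : ℕ} {R h : ℝ}

/-- The adjacency lists contain the edges in `E` and have total length at most `T`. -/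
structure Adjs (N : ℕ) (E : ℕ → ℕ → Prop) (T : ℕ) (τ : Mem Loc) : Prop where
  lt : ∀ x < N, ∀ e < τ cnt x 0, τ nbr x e < N
  mem : ∀ x y, E x y → ∃ e < τ cnt x 0, τ nbr x e = y
  sum : ∑ x ∈ Finset.range N, τ cnt x 0 ≤ T

variable {E E' : ℕ → ℕ → Prop} {T T' s : ℕ} {σ : Mem Loc}

theorem Adjs.mono (hA : Adjs N E T σ) (hE : ∀ x y, E' x y → E x y) (hT : T ≤ T') : Adjs N E' T' σ :=
  ⟨hA.lt, fun x y h => hA.mem x y (hE x y h), hA.sum.trans hT⟩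

theorem Adjs.congr {τ : Mem Loc} (hA : Adjs N E T σ) (h1 : τ cnt = σ cnt) (h2 : τ nbr = σ nbr) :
    Adjs N E T τ := by
  obtain ⟨a1, a2, a3⟩ := hA
  constructor <;> simp only [h1, h2] <;> assumption

/-- The expressions `X` and `Y` may not depend on the two arrays being written, as `X` is evaluated
again after the first write. -/
theorem push_spec {a b : ℕ} {X Y : Exp Loc} (hA : Adjs N E T σ) (ha : a < N) (hb : b < N)
    (hX : ∀ τ : Mem Loc, (∀ z, z ≠ nbr → z ≠ cnt → τ z = σ z) → X.val τ = a)
    (hY : ∀ τ : Mem Loc, (∀ z, z ≠ nbr → z ≠ cnt → τ z = σ z) → Y.val τ = b)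
    (hM : N + T + 1 ≤ M) :
    (push X Y).wp M (fun τ r => Adjs N (fun x y => E x y ∨ (x = a ∧ y = b)) (T + 1) τ ∧ r = s) σ s := by
  have hle : σ cnt a 0 ≤ T := (Finset.single_le_sum (f := fun x => σ cnt x 0)
    (fun _ _ => Nat.zero_le _) (Finset.mem_range.2 ha)).trans hA.sum
  have hX0 := hX σ fun _ _ _ => rfl
  have hY0 := hY σ fun _ _ _ => rfl
  have hX1 := hX (σ.set nbr a (σ cnt a 0) b) fun z hz _ => Mem.set_of_ne σ hz _ _ _
  simp only [push, wp_block_cons, wp_block_nil, wp_wr1, wp_wr2, val_rd1, val_add, val_one, hX0, hY0, hX1,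
    Mem.set_of_ne, ne_eq, reduceCtorEq, not_false_eq_true]
  refine fun _ => ⟨by omega, fun _ => ⟨by omega, ⟨fun x hx e he => ?_, fun x y hxy => ?_, ?_⟩, trivial⟩⟩
  · simp only [Mem.set_of_ne, Mem.set_same, ne_eq, reduceCtorEq, not_false_eq_true, and_true] at he ⊢
    split_ifs with hc
    · exact hb
    · refine hA.lt x hx e ?_
      split_ifs at he with hxa
      · subst hxa
        have : e ≠ σ cnt x 0 := fun h => hc ⟨rfl, h⟩
        omega
      · exact he
  · simp only [Mem.set_of_ne, Mem.set_same, ne_eq, reduceCtorEq, not_false_eq_true, and_true]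
    rcases hxy with hxy | ⟨rfl, rfl⟩
    · obtain ⟨e, he, he'⟩ := hA.mem x y hxy
      refine ⟨e, ?_, ?_⟩
      · split_ifs with hxa
        · subst hxa; omega
        · exact he
      · rw [if_neg]
        · exact he'
        · rintro ⟨rfl, rfl⟩; omega
    · exact ⟨σ cnt x 0, by simp, by simp⟩
  · simp only [Mem.set_same, Mem.set_of_ne, ne_eq, reduceCtorEq, not_false_eq_true, and_true]
    have := hA.sum
    rw [← Finset.add_sum_erase _ _ (Finset.mem_range.2 ha)] at this ⊢
    rw [Finset.sum_congr rfl (g := fun x => σ cnt x 0)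
      (fun x hx => by rw [if_neg (Finset.ne_of_mem_erase hx)])]
    rw [if_pos rfl]
    omega

/-- All pairs from two levels of the decomposition. -/
theorem pushPairs_spec {a b : ℕ} (hA : Adjs N E T σ) (hD : Decomposed H N l R h σ)
    (ha : σ j1 0 0 = a) (hb : σ j2 0 0 = b) (ha1 : 1 ≤ a) (hal : a ≤ l) (hb1 : 1 ≤ b) (hbl : b ≤ l)
    (hM : N + T + σ siz a 0 * σ siz b 0 + 1 ≤ M) :
    (Cmd.loop p (rd1 siz §j1) (.loop q (rd1 siz §j2)
      (push (rd2 lst §j1 §p) (rd2 lst §j2 §q)))).wp M (fun τ r => Adjs N (fun x y => E x y ∨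
        ∃ u < σ siz a 0, ∃ v < σ siz b 0, x = σ lst a u ∧ y = σ lst b v)
        (T + σ siz a 0 * σ siz b 0) τ ∧ r = s + σ siz a 0 * (σ siz b 0 + 1)) σ s := by
  have h1 := hD.siz_le a ha1 hal
  have h2 := hD.siz_le b hb1 hbl
  refine wp_loop (σ siz a 0) (fun t τ r => Adjs N (fun x y => E x y ∨
        ∃ u < t, ∃ v < σ siz b 0, x = σ lst a u ∧ y = σ lst b v)
        (T + t * σ siz b 0) τ ∧ r = s + t * (σ siz b 0 + 1)) (by simp [ha]) (fun _ => by omega)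
    ⟨hA.mono (by simp) (by omega), by simp⟩ ?_ (fun τ r _ h => h)
  rintro t ht τ r hfr ⟨g1, g2⟩
  have e1 : τ siz = σ siz := hfr siz (by decide)
  have e2 : τ lst = σ lst := hfr lst (by decide)
  have e3 : τ j1 = σ j1 := hfr j1 (by decide)
  have e4 : τ j2 = σ j2 := hfr j2 (by decide)
  have hmul : t * σ siz b 0 + σ siz b 0 ≤ σ siz a 0 * σ siz b 0 := by nlinarith
  refine wp_loop (σ siz b 0) (fun m ρ k => Adjs N (fun x y => (E x y ∨
        ∃ u < t, ∃ v < σ siz b 0, x = σ lst a u ∧ y = σ lst b v) ∨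
        ∃ v < m, x = σ lst a t ∧ y = σ lst b v) (T + t * σ siz b 0 + m) ρ ∧ k = r + 1 + m)
    (by simp [e1, e4, hb]) (fun _ => by omega) ⟨(g1.congr (by simp) (by simp)).mono (by simp) (by omega),
      by simp⟩ ?_ ?_
  · rintro m hm ρ k hfr' ⟨k1, k2⟩
    have f2 : ρ lst = σ lst := by rw [hfr' lst (by decide)]; simpa using e2
    have f3 : ρ j1 0 0 = a := by rw [hfr' j1 (by decide)]; simpa [e3] using ha
    have f4 : ρ j2 0 0 = b := by rw [hfr' j2 (by decide)]; simpa [e4] using hb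
    have f5 : ρ p 0 0 = t := by rw [hfr' p (by decide)]; simp
    refine wp_mono _ (push_spec (k1.congr (τ := ρ.set q 0 0 m) (by simp) (by simp))
      (hD.entry a ha1 hal t ht).1 (hD.entry b hb1 hbl m hm).1 ?_ ?_ (by omega)) ?_
    · intro μ hμ; simp [hμ lst (by decide) (by decide), hμ j1 (by decide) (by decide),
        hμ p (by decide) (by decide), f2, f3, f5]
    · intro μ hμ; simp [hμ lst (by decide) (by decide), hμ j2 (by decide) (by decide),
        hμ q (by decide) (by decide), f2, f4]
    · rintro μ z ⟨m1, m2⟩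
      refine ⟨m1.mono (fun x y hxy => ?_) (by omega), by omega⟩
      rcases hxy with hxy | ⟨v, hv, hxy⟩
      · exact Or.inl (Or.inl hxy)
      · rcases Nat.lt_succ_iff_lt_or_eq.1 hv with hv | rfl
        · exact Or.inl (Or.inr ⟨v, hv, hxy⟩)
        · exact Or.inr hxy
  · rintro ρ k - ⟨k1, k2⟩
    refine ⟨k1.mono (fun x y hxy => ?_) (by rw [Nat.succ_mul]; omega), by rw [k2, g2]; ring⟩
    rcases hxy with hxy | ⟨u, hu, hxy⟩
    · exact Or.inl (Or.inl hxy)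
    · rcases Nat.lt_succ_iff_lt_or_eq.1 hu with hu | rfl
      · exact Or.inl (Or.inr ⟨u, hu, hxy⟩)
      · exact Or.inr hxy

/-- The edges between the vertices and the chosen vertices in their neighbourhoods. -/
theorem pushReps_spec (hl : 1 ≤ l) (hA : Adjs N E T σ) (hD : Decomposed H N l R h σ)
    (hM : N + l + T + 2 * l * N + 1 ≤ M) :
    (loop1 i (l - 1) (.loop x §n (when (rd2 hi §i §x * rd2 adj §x (rd2 rep §i §x)) (block [
      push §x (rd2 rep §i §x),
      push (rd2 rep §i §x) §x])))).wp M (fun τ r => Adjs N (fun x y => E x y ∨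
        ∃ i z, 1 ≤ i ∧ i < l ∧ σ hi i z ≠ 0 ∧ H.Adj z (σ rep i z) ∧ z < N ∧
          ((x = z ∧ y = σ rep i z) ∨ (x = σ rep i z ∧ y = z)))
        (T + 2 * l * N) τ ∧ r ≤ s + l + l * N) σ s := by
  refine wp_loop1 (fun t τ r => Adjs N (fun x y => E x y ∨
        ∃ i z, 1 ≤ i ∧ i < t ∧ σ hi i z ≠ 0 ∧ H.Adj z (σ rep i z) ∧ z < N ∧
          ((x = z ∧ y = σ rep i z) ∨ (x = σ rep i z ∧ y = z)))
        (T + 2 * (t - 1) * N) τ ∧ r = s + t + (t - 1) * N) (fun _ => by omega) ?_ ?_ ?_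
  · intro τ hτ
    refine ⟨(hA.congr (hτ cnt (by decide)) (hτ nbr (by decide))).mono ?_ (by simp), by simp⟩
    rintro x y (h | ⟨i, z, h1, h2, -⟩)
    · exact h
    · omega
  · rintro t ht1 htl τ r hfr ⟨g1, g2⟩
    obtain ⟨t', rfl⟩ : ∃ t', t = t' + 1 := ⟨t - 1, by omega⟩
    simp only [Nat.add_sub_cancel] at g1 g2 ⊢
    have e1 : τ n 0 0 = N := by rw [hfr n (by decide), hD.n]
    have e2 : τ hi = σ hi := hfr hi (by decide)
    have e3 : τ rep = σ rep := hfr rep (by decide)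
    have e4 : τ adj = σ adj := hfr adj (by decide)
    have hmul : 2 * t' * N + 2 * N ≤ 2 * l * N := by
      have : t' + 1 ≤ l := by omega
      nlinarith
    refine wp_loop N (fun m ρ k => Adjs N (fun x y => (E x y ∨
        ∃ i z, 1 ≤ i ∧ i < t' + 1 ∧ σ hi i z ≠ 0 ∧ H.Adj z (σ rep i z) ∧ z < N ∧
          ((x = z ∧ y = σ rep i z) ∨ (x = σ rep i z ∧ y = z))) ∨
          ∃ z < m, σ hi (t' + 1) z ≠ 0 ∧ H.Adj z (σ rep (t' + 1) z) ∧
          ((x = z ∧ y = σ rep (t' + 1) z) ∨ (x = σ rep (t' + 1) z ∧ y = z)))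
        (T + 2 * t' * N + 2 * m) ρ ∧ k = r + 1 + m) (by simpa using e1) (fun _ => by omega)
        ⟨(g1.congr (by simp) (by simp)).mono (by simp) (by omega), by simp⟩ ?_ ?_
    · rintro z₀ hz ρ k hfr' ⟨k1, k2⟩
      have f1 : ρ i 0 0 = t' + 1 := by rw [hfr' i (by decide)]; simp
      have f2 : ρ hi = σ hi := by rw [hfr' hi (by decide)]; simpa using e2
      have f3 : ρ rep = σ rep := by rw [hfr' rep (by decide)]; simpa using e3
      have f4 : ρ adj = σ adj := by rw [hfr' adj (by decide)]; simpa using e4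
      simp only [wp_when, val_mul, val_rd2, val_rd0, Mem.set_of_ne, Mem.set_same, ne_eq, reduceCtorEq,
        not_false_eq_true, and_self, if_true, f1, f2, f3, f4, mul_eq_zero, not_or, wp_block_cons,
        wp_block_nil]
      refine ⟨fun ⟨hh, ha⟩ => ?_, fun hc => ⟨(k1.congr (τ := ρ.set x 0 0 z₀) (by simp) (by simp)).mono
        (fun x y hxy => ?_) (by omega), by omega⟩⟩
      · obtain ⟨r1, r2, -⟩ := hD.rep (t' + 1) ht1 (by omega) z₀ hz hh
        have hadj := (hD.matrix.ne_zero hz r1).1 ha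
        refine wp_use (push_spec (k1.congr (τ := ρ.set x 0 0 z₀) (by simp) (by simp)) hz r1
          ?_ ?_ (by omega)) ?_
        · intro μ hμ; simp [hμ x (by decide) (by decide)]
        · intro μ hμ; simp [hμ x (by decide) (by decide), hμ rep (by decide) (by decide),
            hμ i (by decide) (by decide), f1, f3]
        rintro π z hfr2 ⟨m1, m2⟩
        have i1 : π x 0 0 = z₀ := by rw [hfr2 x (by decide)]; simp
        have i2 : π i 0 0 = t' + 1 := by rw [hfr2 i (by decide)]; simpa using f1
        have i3 : π rep = σ rep := by rw [hfr2 rep (by decide)]; simpa using f3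
        refine wp_mono _ (push_spec m1 r1 hz ?_ ?_ (by omega)) ?_
        · intro μ hμ; simp [hμ x (by decide) (by decide), hμ rep (by decide) (by decide),
            hμ i (by decide) (by decide), i1, i2, i3]
        · intro μ hμ; simp [hμ x (by decide) (by decide), i1]
        rintro μ z' ⟨n1, n2⟩
        refine ⟨n1.mono (fun x y hxy => ?_) (by omega), by omega⟩
        rcases hxy with hxy | ⟨z, hz, hxy⟩
        · exact Or.inl (Or.inl (Or.inl hxy))
        · rcases Nat.lt_succ_iff_lt_or_eq.1 hz with hz | rfl
          · exact Or.inl (Or.inl (Or.inr ⟨z, hz, hxy⟩))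
          · rcases hxy.2.2 with hxy | hxy
            · exact Or.inl (Or.inr hxy)
            · exact Or.inr hxy
      · rcases hxy with hxy | ⟨z, hz', hxy⟩
        · exact Or.inl hxy
        · rcases Nat.lt_succ_iff_lt_or_eq.1 hz' with hz' | rfl
          · exact Or.inr ⟨z, hz', hxy⟩
          · rcases hc with hc | hc
            · exact absurd hc hxy.1
            · have r1 := (hD.rep (t' + 1) ht1 (by omega) z hz hxy.1).1
              exact absurd hc ((hD.matrix.ne_zero hz r1).2 hxy.2.1)
    · rintro ρ k - ⟨k1, k2⟩
      refine ⟨k1.mono (fun x y hxy => ?_) (by nlinarith), by rw [k2, g2]; ring⟩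
      rcases hxy with hxy | ⟨i, z, h1, h2, hxy⟩
      · exact Or.inl (Or.inl hxy)
      · rcases Nat.lt_succ_iff_lt_or_eq.1 h2 with h2 | rfl
        · exact Or.inl (Or.inr ⟨i, z, h1, h2, hxy⟩)
        · exact Or.inr ⟨z, hxy.2.2.1, hxy.1, hxy.2.1, hxy.2.2.2⟩
  · rintro τ r - ⟨g1, g2⟩
    obtain ⟨l', rfl⟩ : ∃ l', l = l' + 1 := ⟨l - 1, by omega⟩
    simp only [Nat.add_sub_cancel] at g1 g2
    exact ⟨g1.mono (fun x y hxy => hxy) (by nlinarith), by nlinarith⟩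

open Classical in
/-- The edges of `E_j`. -/
theorem pushLevel_spec {j₀ : ℕ} (hA : Adjs N E T σ) (hn : σ n 0 0 = N) (hm : IsMatrix H N (σ adj))
    (hH : OnRange H N) (hj : σ j 0 0 = j₀)
    (hM : N + T + N * N + 1 ≤ M) :
    (Cmd.loop x §n (.loop y §n (when (inE (§j - 1) §x §y) (push §x §y)))).wp M
      (fun τ r => Adjs N (fun x y => E x y ∨ LevelEdge H (σ hi) j₀ x y)
        (T + ∑ x ∈ Finset.range N, ((Finset.range N).filter
          fun y => H.Adj x y ∧ (σ hi (j₀ - 1) x = 0 ∨ σ hi (j₀ - 1) y = 0)).card) τ ∧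
        r = s + N * (N + 1)) σ s := by
  have hcard : ∀ x u, ((Finset.range u).filter
          fun y => H.Adj x y ∧ (σ hi (j₀ - 1) x = 0 ∨ σ hi (j₀ - 1) y = 0)).card ≤ u := fun x u =>
    (Finset.card_le_card (Finset.filter_subset _ _)).trans (by simp)
  have hsum : ∀ t, ∑ x ∈ Finset.range t, ((Finset.range N).filter
          fun y => H.Adj x y ∧ (σ hi (j₀ - 1) x = 0 ∨ σ hi (j₀ - 1) y = 0)).card ≤ t * N := fun t => by
    simpa using Finset.sum_le_card_nsmul (Finset.range t) _ N fun x _ => hcard x N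
  refine wp_loop N (fun t τ r => Adjs N (fun x y => E x y ∨ (x < t ∧ LevelEdge H (σ hi) j₀ x y))
        (T + ∑ x ∈ Finset.range t, ((Finset.range N).filter
          fun y => H.Adj x y ∧ (σ hi (j₀ - 1) x = 0 ∨ σ hi (j₀ - 1) y = 0)).card) τ ∧
        r = s + t * (N + 1)) (by simpa using hn) (fun _ => by omega)
    ⟨hA.mono (by simp) (by simp), by simp⟩ ?_ ?_
  · rintro x₀ hx τ r hfr ⟨g1, g2⟩
    have e1 : τ n 0 0 = N := by rw [hfr n (by decide), hn]
    have e2 : τ hi = σ hi := hfr hi (by decide)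
    have e3 : τ j = σ j := hfr j (by decide)
    have e4 : τ adj = σ adj := hfr adj (by decide)
    refine wp_loop N (fun u ρ k => Adjs N (fun x y => (E x y ∨ (x < x₀ ∧ LevelEdge H (σ hi) j₀ x y)) ∨
        (x = x₀ ∧ y < u ∧ LevelEdge H (σ hi) j₀ x y))
        (T + ∑ x ∈ Finset.range x₀, ((Finset.range N).filter
          fun y => H.Adj x y ∧ (σ hi (j₀ - 1) x = 0 ∨ σ hi (j₀ - 1) y = 0)).card +
          ((Finset.range u).filter
          fun y => H.Adj x₀ y ∧ (σ hi (j₀ - 1) x₀ = 0 ∨ σ hi (j₀ - 1) y = 0)).card) ρ ∧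
        k = r + 1 + u) (by simpa using e1) (fun _ => by omega)
      ⟨(g1.congr (by simp) (by simp)).mono (by simp) (by simp), by simp⟩ ?_ ?_
    · rintro y₀ hy ρ k hfr' ⟨k1, k2⟩
      have f1 : ρ x 0 0 = x₀ := by rw [hfr' x (by decide)]; simp
      have f2 : ρ hi = σ hi := by rw [hfr' hi (by decide)]; simpa using e2
      have f3 : ρ j 0 0 = j₀ := by rw [hfr' j (by decide)]; simpa [e3] using hj
      have f4 : ρ adj = σ adj := by rw [hfr' adj (by decide)]; simpa using e4
      have hiff : σ adj x₀ y₀ * (if σ hi (j₀ - 1) x₀ * σ hi (j₀ - 1) y₀ = 0 then 1 else 0) = 0 ↔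
          ¬ (H.Adj x₀ y₀ ∧ (σ hi (j₀ - 1) x₀ = 0 ∨ σ hi (j₀ - 1) y₀ = 0)) := by
        rw [← hm.ne_zero hx hy, ← mul_eq_zero]
        by_cases c1 : σ adj x₀ y₀ = 0 <;>
          by_cases c2 : σ hi (j₀ - 1) x₀ * σ hi (j₀ - 1) y₀ = 0 <;> simp [c1, c2]
      have hc1 := hcard x₀ y₀
      have hc2 := hsum x₀
      have hc3 : x₀ * N + N ≤ N * N := by nlinarith
      rw [Finset.range_add_one, Finset.filter_insert]
      simp only [inE, wp_when, val_mul, val_no, val_rd2, val_rd0, val_sub, val_one, Mem.set_of_ne, Mem.set_same,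
        ne_eq, reduceCtorEq, not_false_eq_true, and_self, if_true, f1, f2, f3, f4, hiff, not_not]
      refine ⟨fun hc => ?_, fun hc => ?_⟩
      · rw [if_pos hc, Finset.card_insert_of_notMem (by simp)]
        refine wp_mono _ (push_spec (k1.congr (τ := ρ.set y 0 0 y₀) (by simp) (by simp)) hx hy
          ?_ ?_ (by omega)) ?_
        · intro μ hμ; simp [hμ x (by decide) (by decide), f1]
        · intro μ hμ; simp [hμ y (by decide) (by decide)]
        rintro π z ⟨m1, m2⟩
        refine ⟨m1.mono (fun x y hxy => ?_) (by omega), by omega⟩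
        rcases hxy with hxy | ⟨rfl, h2, hxy⟩
        · exact Or.inl (Or.inl hxy)
        · rcases Nat.lt_succ_iff_lt_or_eq.1 h2 with h2 | rfl
          · exact Or.inl (Or.inr ⟨rfl, h2, hxy⟩)
          · exact Or.inr ⟨rfl, rfl⟩
      · rw [if_neg hc]
        refine ⟨(k1.congr (by simp) (by simp)).mono (fun x y hxy => ?_) le_rfl, by omega⟩
        rcases hxy with hxy | ⟨rfl, h2, hxy⟩
        · exact Or.inl hxy
        · rcases Nat.lt_succ_iff_lt_or_eq.1 h2 with h2 | rfl
          · exact Or.inr ⟨rfl, h2, hxy⟩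
          · exact absurd hxy hc
    · rintro ρ k - ⟨k1, k2⟩
      rw [Finset.sum_range_succ, ← Nat.add_assoc]
      refine ⟨k1.mono (fun x y hxy => ?_) le_rfl, by rw [k2, g2]; ring⟩
      rcases hxy with hxy | ⟨h1, hxy⟩
      · exact Or.inl (Or.inl hxy)
      · rcases Nat.lt_succ_iff_lt_or_eq.1 h1 with h1 | rfl
        · exact Or.inl (Or.inr ⟨h1, hxy⟩)
        · exact Or.inr ⟨rfl, hH.lt_right hxy.1, hxy⟩
  · rintro τ r - ⟨g1, g2⟩
    refine ⟨g1.mono (fun x y hxy => ?_) le_rfl, g2⟩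
    rcases hxy with hxy | hxy
    · exact Or.inl hxy
    · exact Or.inr ⟨hH _ _ hxy.1, hxy⟩

end PhaseGraph
-- The products of levels and the complete phase graph
section PhaseGraph2
open Loc

variable {H : SimpleGraph ℕ} {N M l : ℕ} {R h : ℝ}
variable {E E' : ℕ → ℕ → Prop} {T T' s : ℕ} {σ : Mem Loc}

/-- All products of two levels that belong to phase `j₀`. -/
theorem pushProducts_spec {B j₀ : ℕ} (hN : 1 ≤ N) (hA : Adjs N E T σ) (hD : Decomposed H N l R h σ)
    (hj : σ j 0 0 = j₀)
    (hB : ∀ i i', 1 ≤ i → i ≤ l → 1 ≤ i' → i' ≤ l → j₀ + i + i' ≤ 2 * l + 1 →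
      σ siz i 0 * σ siz i' 0 ≤ B)
    (hM : N + l + T + l * l * B + 1 ≤ M) :
    (loop1 j1 l (loop1 j2 l (when (.lt (§j + §j1 + §j2) (.lit (2 * l + 2)))
      (.loop p (rd1 siz §j1) (.loop q (rd1 siz §j2)
        (push (rd2 lst §j1 §p) (rd2 lst §j2 §q))))))).wp M (fun τ r => Adjs N (fun x y => E x y ∨
        ∃ i i', 1 ≤ i ∧ i ≤ l ∧ 1 ≤ i' ∧ i' ≤ l ∧ j₀ + i + i' ≤ 2 * l + 1 ∧
          ∃ u < σ siz i 0, ∃ v < σ siz i' 0, x = σ lst i u ∧ y = σ lst i' v)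
        (T + l * l * B) τ ∧ r ≤ s + 1 + l * (2 + l * (1 + 2 * N ^ 2))) σ s := by
  refine wp_loop1 (fun t τ r => Adjs N (fun x y => E x y ∨
        ∃ i i', 1 ≤ i ∧ i < t ∧ 1 ≤ i' ∧ i' ≤ l ∧ j₀ + i + i' ≤ 2 * l + 1 ∧
          ∃ u < σ siz i 0, ∃ v < σ siz i' 0, x = σ lst i u ∧ y = σ lst i' v)
        (T + (t - 1) * (l * B)) τ ∧ r ≤ s + 1 + (t - 1) * (2 + l * (1 + 2 * N ^ 2)))
    (fun _ => by omega) ?_ ?_ ?_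
  · intro τ hτ
    refine ⟨(hA.congr (hτ cnt (by decide)) (hτ nbr (by decide))).mono ?_ (by simp), by simp⟩
    rintro x y (h | ⟨i, i', h1, h2, -⟩)
    · exact h
    · omega
  · rintro t ht1 htl τ r hfr ⟨g1, g2⟩
    obtain ⟨a, rfl⟩ : ∃ a, t = a + 1 := ⟨t - 1, by omega⟩
    simp only [Nat.add_sub_cancel] at g1 g2 ⊢
    have hmul : a * (l * B) + l * B ≤ l * l * B := by
      calc a * (l * B) + l * B = (a + 1) * (l * B) := by ring
        _ ≤ l * (l * B) := Nat.mul_le_mul_right _ htl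
        _ = l * l * B := by ring
    have fr : ∀ z ∈ [Loc.n, Loc.inf, adj, hi, rep, inD, lst, siz, j], τ z = σ z := by
      intro z hz
      refine hfr z ?_
      simp only [List.mem_cons, List.not_mem_nil, or_false] at hz
      rcases hz with rfl | rfl | rfl | rfl | rfl | rfl | rfl | rfl | rfl <;>
        simp [push, Cmd.mods, block, wr1, wr2, loop1, when]
    have hDτ : Decomposed H N l R h τ := hD.congr (fr _ (by simp)) (fr _ (by simp)) (fr _ (by simp))
      (fr _ (by simp)) (fr _ (by simp)) (fr _ (by simp)) (fr _ (by simp)) (fr _ (by simp))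
    have e1 : τ siz = σ siz := fr _ (by simp)
    have e2 : τ lst = σ lst := fr _ (by simp)
    have e3 : τ j = σ j := fr _ (by simp)
    clear fr hfr
    refine wp_loop1 (fun t' ρ k => Adjs N (fun x y => (E x y ∨
        ∃ i i', 1 ≤ i ∧ i < a + 1 ∧ 1 ≤ i' ∧ i' ≤ l ∧ j₀ + i + i' ≤ 2 * l + 1 ∧
          ∃ u < σ siz i 0, ∃ v < σ siz i' 0, x = σ lst i u ∧ y = σ lst i' v) ∨
        ∃ i', 1 ≤ i' ∧ i' < t' ∧ j₀ + (a + 1) + i' ≤ 2 * l + 1 ∧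
          ∃ u < σ siz (a + 1) 0, ∃ v < σ siz i' 0, x = σ lst (a + 1) u ∧ y = σ lst i' v)
        (T + a * (l * B) + (t' - 1) * B) ρ ∧ k ≤ r + 2 + (t' - 1) * (1 + 2 * N ^ 2))
      (fun _ => by omega) ?_ ?_ ?_
    · intro ρ hρ
      refine ⟨(g1.congr (by rw [hρ _ (by decide)]; simp) (by rw [hρ _ (by decide)]; simp)).mono ?_
        (by simp), by simp⟩
      rintro x y (h | ⟨i', h1, h2, -⟩)
      · exact h
      · omega
    · rintro t' ht1' htl' ρ k hfr ⟨k1, k2⟩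
      obtain ⟨b, rfl⟩ : ∃ b, t' = b + 1 := ⟨t' - 1, by omega⟩
      simp only [Nat.add_sub_cancel] at k1 k2 ⊢
      have hmul' : b * B + B ≤ l * B := by
        rw [← Nat.succ_mul]; exact Nat.mul_le_mul_right _ htl'
      have fr : ∀ z ∈ [Loc.n, Loc.inf, adj, hi, rep, inD, lst, siz, j], ρ z = τ z := by
        intro z hz
        simp only [List.mem_cons, List.not_mem_nil, or_false] at hz
        rw [hfr z]
        · rcases hz with rfl | rfl | rfl | rfl | rfl | rfl | rfl | rfl | rfl <;> simp
        · rcases hz with rfl | rfl | rfl | rfl | rfl | rfl | rfl | rfl | rfl <;>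
            simp [push, Cmd.mods, block, wr1, wr2, loop1, when]
      have fj : ρ j1 0 0 = a + 1 := by
        rw [hfr j1 (by simp [push, Cmd.mods, block, wr1, wr2, loop1, when])]; simp
      have hDρ : Decomposed H N l R h (ρ.set j2 0 0 (b + 1)) := hDτ.congr
        (by simpa using fr _ (by simp)) (by simpa using fr _ (by simp)) (by simpa using fr _ (by simp))
        (by simpa using fr _ (by simp)) (by simpa using fr _ (by simp)) (by simpa using fr _ (by simp))
        (by simpa using fr _ (by simp)) (by simpa using fr _ (by simp))
      have f1 : ρ siz = σ siz := (fr _ (by simp)).trans e1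
      have f2 : ρ lst = σ lst := (fr _ (by simp)).trans e2
      have f3 : ρ j 0 0 = j₀ := by rw [fr j (by simp), e3, hj]
      clear fr hfr
      have hif : (if j₀ + (a + 1) + (b + 1) < 2 * l + 2 then 1 else 0) ≠ 0 ↔
        j₀ + (a + 1) + (b + 1) ≤ 2 * l + 1 := by split_ifs <;> simp <;> omega
      have hif' : (if j₀ + (a + 1) + (b + 1) < 2 * l + 2 then 1 else 0) = 0 ↔
        ¬ j₀ + (a + 1) + (b + 1) ≤ 2 * l + 1 := by rw [← hif, not_not]
      simp only [wp_when, val_lt, val_add, val_lit, val_rd0, Mem.set_of_ne, Mem.set_same, ne_eq, reduceCtorEq,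
        not_false_eq_true, and_self, if_true, f3, fj]
      refine ⟨fun hc => ?_, fun hc => ?_⟩
      · have hc := hif.1 hc
        have hBB := hB (a + 1) (b + 1) ht1 htl ht1' htl' hc
        have z1 : σ siz (a + 1) 0 ≤ N := hD.siz_le _ ht1 htl
        have z2 : σ siz (b + 1) 0 ≤ N := hD.siz_le _ ht1' htl'
        have hst : σ siz (a + 1) 0 * (σ siz (b + 1) 0 + 1) ≤ 2 * N ^ 2 := by
          calc σ siz (a + 1) 0 * (σ siz (b + 1) 0 + 1) ≤ N * (N + 1) := Nat.mul_le_mul z1 (by omega)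
            _ ≤ 2 * N ^ 2 := by nlinarith
        refine wp_mono _ (pushPairs_spec (a := a + 1) (b := b + 1) (k1.congr (by simp) (by simp)) hDρ
          (by simpa using fj) (by simp) ht1 htl ht1' htl' (by simp [f1]; omega)) ?_
        simp only [Mem.set_of_ne, ne_eq, reduceCtorEq, not_false_eq_true, f1, f2]
        rintro π z ⟨m1, rfl⟩
        refine ⟨m1.mono (fun x y hxy => ?_) ?_, ?_⟩
        · rcases hxy with hxy | ⟨i', h1, h2, h3⟩
          · exact Or.inl (Or.inl hxy)
          · rcases Nat.lt_succ_iff_lt_or_eq.1 h2 with h2 | rfl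
            · exact Or.inl (Or.inr ⟨i', h1, h2, h3⟩)
            · exact Or.inr h3.2
        · rw [Nat.succ_mul]; omega
        · rw [Nat.succ_mul]; omega
      · have hc := hif'.1 hc
        refine ⟨(k1.congr (by simp) (by simp)).mono (fun x y hxy => ?_) ?_, ?_⟩
        · rcases hxy with hxy | ⟨i', h1, h2, h3⟩
          · exact Or.inl hxy
          · rcases Nat.lt_succ_iff_lt_or_eq.1 h2 with h2 | rfl
            · exact Or.inr ⟨i', h1, h2, h3⟩
            · exact absurd h3.1 hc
        · rw [Nat.succ_mul]; omega
        · rw [Nat.succ_mul]; omega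
    · rintro ρ k - ⟨k1, k2⟩
      simp only [Nat.add_sub_cancel] at k1 k2
      refine ⟨k1.mono (fun x y hxy => ?_) (by rw [Nat.succ_mul]; omega), by rw [Nat.succ_mul]; omega⟩
      rcases hxy with hxy | ⟨i, i', h1, h2, h3⟩
      · exact Or.inl (Or.inl hxy)
      · rcases Nat.lt_succ_iff_lt_or_eq.1 h2 with h2 | rfl
        · exact Or.inl (Or.inr ⟨i, i', h1, h2, h3⟩)
        · exact Or.inr ⟨i', h3.1, by omega, h3.2.2⟩
  · rintro τ r - ⟨g1, g2⟩
    simp only [Nat.add_sub_cancel] at g1 g2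
    refine ⟨g1.mono (fun x y hxy => ?_) (by rw [mul_assoc]), g2⟩
    rcases hxy with hxy | ⟨i, i', h1, h2, h3⟩
    · exact Or.inl hxy
    · exact Or.inr ⟨i, i', h1, by omega, h3⟩

open Classical in
/-- The adjacency lists of the graph of phase `j₀`. -/
theorem buildGraph_spec {A B j₀ : ℕ} (hH : OnRange H N) (hN : 1 ≤ N) (hl : 1 ≤ l)
    (hD : Decomposed H N l R h σ) (hj : σ j 0 0 = j₀)
    (hA : ∑ x ∈ Finset.range N, ((Finset.range N).filter
      fun y => H.Adj x y ∧ (σ hi (j₀ - 1) x = 0 ∨ σ hi (j₀ - 1) y = 0)).card ≤ A)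
    (hB : ∀ i i', 1 ≤ i → i ≤ l → 1 ≤ i' → i' ≤ l → j₀ + i + i' ≤ 2 * l + 1 →
      σ siz i 0 * σ siz i' 0 ≤ B)
    (hM : N + l + N * N + (A + 2 * l * N + l * l * B) + 1 ≤ M) :
    (buildGraph l).wp M (fun τ r => Adjs N (PhaseEdge H N l (σ hi) (σ inD) (σ rep) j₀)
      (A + 2 * l * N + l * l * B) τ ∧ r ≤ s + 12 * l ^ 2 * N ^ 2) σ s := by
  unfold buildGraph
  simp only [wp_block_cons, wp_block_nil]
  refine wp_loop N (fun t τ r => (∀ x < t, τ cnt x 0 = 0) ∧ r = s + t) (by simpa using hD.n)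
    (fun _ => by omega) (by simp) ?_ ?_
  · rintro t ht τ r hfr ⟨h1, h2⟩
    simp only [wp_wr1, val_rd0, val_zero, Mem.set_same, Mem.set_of_ne, ne_eq, reduceCtorEq,
      not_false_eq_true, and_self, if_true]
    refine fun _ => ⟨by omega, fun c hc => ?_, by omega⟩
    by_cases hct : c = t
    · simp [hct]
    · simpa [hct] using h1 c (by omega)
  rintro τ r hfr ⟨h1, rfl⟩
  have fr1 : ∀ z, z ≠ x → z ≠ cnt → τ z = σ z := fun z h1 h2 => hfr z (by
    simp [Cmd.mods, wr1, h1, h2])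
  clear hfr
  have hA0 : Adjs N (fun _ _ => False) 0 τ := by
    refine ⟨fun x hx e he => ?_, fun _ _ h => h.elim, ?_⟩
    · rw [h1 x hx] at he; omega
    · rw [Finset.sum_eq_zero fun x hx => h1 x (Finset.mem_range.1 hx)]
  refine wp_use (pushLevel_spec (j₀ := j₀) hA0 (by rw [fr1 n (by decide) (by decide)]; exact hD.n)
    (by rw [fr1 adj (by decide) (by decide)]; exact hD.matrix) hH
    (by rw [fr1 j (by decide) (by decide)]; exact hj) (by omega)) ?_
  rintro ρ k hfr ⟨k1, rfl⟩
  rw [fr1 hi (by decide) (by decide)] at k1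
  have fr2 : ∀ z, z ≠ x → z ≠ cnt → z ≠ y → z ≠ nbr → ρ z = σ z := fun z h1 h2 h3 h4 => by
    rw [hfr z (by simp [Cmd.mods, wr1, wr2, push, block, when, h1, h2, h3, h4]), fr1 z h1 h2]
  clear hfr
  have hDρ : Decomposed H N l R h ρ := by apply hD.congr <;> apply fr2 <;> decide
  refine wp_use (pushReps_spec (T := A) hl (k1.mono (fun _ _ h => h) (by omega)) hDρ (by omega)) ?_
  rintro π z hfr ⟨m1, m2⟩
  rw [fr2 hi (by decide) (by decide) (by decide) (by decide),
    fr2 rep (by decide) (by decide) (by decide) (by decide)] at m1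
  have fr3 : ∀ z, z ≠ x → z ≠ cnt → z ≠ y → z ≠ nbr → z ≠ i → π z = σ z := fun z h1 h2 h3 h4 h5 => by
    rw [hfr z (by simp [Cmd.mods, wr1, wr2, push, block, when, loop1, h1, h2, h3, h4, h5]), fr2 z h1 h2 h3 h4]
  clear hfr
  have hDπ : Decomposed H N l R h π := by apply hD.congr <;> apply fr3 <;> decide
  have e1 : π siz = σ siz := by apply fr3 <;> decide
  have e2 : π lst = σ lst := by apply fr3 <;> decide
  refine wp_mono _ (pushProducts_spec (B := B) (j₀ := j₀) hN m1 hDπ ?_ (by rw [e1]; exact hB) (by omega)) ?_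
  · rw [fr3 j (by decide) (by decide) (by decide) (by decide) (by decide)]; exact hj
  rintro μ c ⟨n1, n2⟩
  refine ⟨n1.mono (fun x y hxy => ?_) le_rfl, ?_⟩
  · rw [e1, e2]
    cases hxy with
    | level h => exact Or.inl (Or.inl (Or.inr h))
    | rep a1 a2 a3 a4 => exact Or.inl (Or.inr ⟨_, _, a1, a2, a3, a4, hH _ _ a4, Or.inl ⟨rfl, rfl⟩⟩)
    | rep' a1 a2 a3 a4 => exact Or.inl (Or.inr ⟨_, _, a1, a2, a3, a4, hH _ _ a4, Or.inr ⟨rfl, rfl⟩⟩)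
    | prod a1 a2 a3 a4 a5 a6 a7 a8 a9 =>
      obtain ⟨u, hu, hu'⟩ := hD.mem _ a1 a2 _ a6 a8
      obtain ⟨v, hv, hv'⟩ := hD.mem _ a3 a4 _ a7 a9
      exact Or.inr ⟨_, _, a1, a2, a3, a4, a5, u, hu, v, hv, hu'.symm, hv'.symm⟩
  · have b1 : l ≤ l ^ 2 * N ^ 2 := by
      calc l = l * 1 * 1 := by ring
        _ ≤ l * l * N ^ 2 := Nat.mul_le_mul (Nat.mul_le_mul_left _ hl) (Nat.one_le_pow _ _ hN)
        _ = l ^ 2 * N ^ 2 := by ring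
    have b2 : l * N ≤ l ^ 2 * N ^ 2 := by
      rw [← mul_pow]; exact Nat.le_self_pow two_ne_zero _
    have b3 : N * N ≤ l ^ 2 * N ^ 2 := by
      rw [← sq]; exact Nat.le_mul_of_pos_left _ (by positivity)
    have b4 : N ≤ N * N := Nat.le_mul_self N
    have b5 : l * (2 + l * (1 + 2 * N ^ 2)) = 2 * l + l * l + 2 * (l ^ 2 * N ^ 2) := by ring
    have b6 : l * l ≤ l ^ 2 * N ^ 2 := by
      rw [← sq]; exact Nat.le_mul_of_pos_right _ (by positivity)
    have b7 : N * (N + 1) = N * N + N := by ring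
    rw [mul_assoc]
    omega

end PhaseGraph2
/-! ### The phases -/

section Phases
open Loc

variable {H : SimpleGraph ℕ} {N M l s : ℕ} {R h : ℝ} {σ : Mem Loc}

theorem PhaseEdge.lt_left {hi inD rep : ℕ → ℕ → ℕ} {j x y : ℕ} (hH : OnRange H N)
    (h : PhaseEdge H N l hi inD rep j x y) : x < N := by
  cases h with
  | level h => exact hH _ _ h.1
  | rep _ _ _ h => exact hH _ _ h
  | rep' _ _ _ h => exact hH.lt_right h
  | prod _ _ _ _ _ h => exact h

-- The searches of a phase update the matrix one after the other, but the edge inequalities are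
-- stated for the matrix at the start of the phase, which is the form that `Stage.step` needs. The
-- upper bounds persist because the entries only decrease.
open Classical in
theorem phase_spec {A B j₀ : ℕ} (hH : OnRange H N) (hN : 1 ≤ N) (hl : 1 ≤ l)
    (hD : Decomposed H N l R h σ) (hE : IsEst H N (σ dhat)) (hj : σ j 0 0 = j₀) (hj1 : 1 ≤ j₀)
    (hjl : j₀ ≤ l)
    (hA : ∑ x ∈ Finset.range N, ((Finset.range N).filter
      fun y => H.Adj x y ∧ (σ hi (j₀ - 1) x = 0 ∨ σ hi (j₀ - 1) y = 0)).card ≤ A)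
    (hB : ∀ i i', 1 ≤ i → i ≤ l → 1 ≤ i' → i' ≤ l → j₀ + i + i' ≤ 2 * l + 1 →
      σ siz i 0 * σ siz i' 0 ≤ B)
    (hM : 9 * N + l + N * N + (A + 2 * l * N + l * l * B) + 1 ≤ M) :
    (block [
      buildGraph l,
      .loop p (rd1 siz §j) (block [
        wr0 w (rd2 lst §j §p),
        dijkstra])]).wp M (fun τ r => IsEst H N (τ dhat) ∧ EstLE N (τ dhat) (σ dhat) ∧
        (∀ w < N, σ inD j₀ w ≠ 0 → ∃ f : ℕ → ℕ, f w = 0 ∧ (∀ x < N, f x ≤ σ dhat w x) ∧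
          (∀ x y, PhaseEdge H N l (σ hi) (σ inD) (σ rep) j₀ x y → f y ≤ f x + σ dhat x y) ∧
          ∀ x < N, τ dhat w x ≤ f x) ∧
        r ≤ s + 12 * l ^ 2 * N ^ 2 +
          σ siz j₀ 0 * (1 + 16 * N + 2 * (A + 2 * l * N + l * l * B))) σ s := by
  simp only [wp_block_cons, wp_block_nil]
  refine wp_use (buildGraph_spec hH hN hl hD hj hA hB (by omega)) ?_
  rintro τ r hfr ⟨h1, h2⟩
  obtain ⟨C, hC⟩ : ∃ C, C = A + 2 * l * N + l * l * B := ⟨_, rfl⟩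
  rw [← hC] at h1 hM ⊢
  have fr : ∀ z ∈ [Loc.n, Loc.inf, lst, siz, j, dhat], τ z = σ z := by
    intro z hz
    refine hfr z ?_
    simp only [List.mem_cons, List.not_mem_nil, or_false] at hz
    rcases hz with rfl | rfl | rfl | rfl | rfl | rfl <;>
      simp [buildGraph, push, Cmd.mods, block, wr1, wr2, loop1, when]
  have e1 : τ n 0 0 = N := by rw [fr n (by simp)]; exact hD.n
  have e2 : τ Loc.inf 0 0 = 4 * N := by rw [fr Loc.inf (by simp)]; exact hD.inf
  have e3 : τ lst = σ lst := fr _ (by simp)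
  have e4 : τ siz = σ siz := fr _ (by simp)
  have e5 : τ j 0 0 = j₀ := by rw [fr j (by simp)]; exact hj
  have e6 : τ dhat = σ dhat := fr _ (by simp)
  clear fr hfr
  have hsz := hD.siz_le j₀ hj1 hjl
  refine wp_loop (σ siz j₀ 0) (fun t ρ k => IsEst H N (ρ dhat) ∧ EstLE N (ρ dhat) (σ dhat) ∧
      (∀ q < t, ∃ f : ℕ → ℕ, f (σ lst j₀ q) = 0 ∧ (∀ x < N, f x ≤ σ dhat (σ lst j₀ q) x) ∧
        (∀ x y, PhaseEdge H N l (σ hi) (σ inD) (σ rep) j₀ x y → f y ≤ f x + σ dhat x y) ∧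
        ∀ x < N, ρ dhat (σ lst j₀ q) x ≤ f x) ∧ k ≤ r + t * (1 + 16 * N + 2 * C))
    (by simp [e5, e4]) (fun _ => by omega) ⟨e6 ▸ hE, e6 ▸ EstLE.refl _, by simp, by simp⟩ ?_ ?_
  · rintro t ht ρ k hfr ⟨k1, k2, k3, k4⟩
    have f1 : ρ n 0 0 = N := by rw [hfr n (by decide), e1]
    have f2 : ρ Loc.inf 0 0 = 4 * N := by rw [hfr Loc.inf (by decide), e2]
    have f3 : ρ lst = σ lst := by rw [hfr lst (by decide), e3]
    have f4 : ρ j 0 0 = j₀ := by rw [hfr j (by decide), e5]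
    have f5 : ρ cnt = τ cnt := hfr cnt (by decide)
    have f6 : ρ nbr = τ nbr := hfr nbr (by decide)
    clear hfr
    obtain ⟨w1, w2⟩ := hD.entry j₀ hj1 hjl t ht
    simp only [wp_block_cons, wp_block_nil, wp_wr0, val_rd0, val_rd2, Mem.set_of_ne, Mem.set_same, ne_eq,
      reduceCtorEq, not_false_eq_true, and_self, if_true, f3, f4]
    refine fun _ => ⟨by omega, ?_⟩
    refine wp_mono _ (dijkstra_spec (N := N) (w₀ := σ lst j₀ t) (C := C) (by omega) w1 (by simpa using f1)
      (by simpa using f2) (by simp) (by simpa [f5, f6] using h1.lt) (by simpa [f5] using h1.sum)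
      (by simpa using k1.le) (by simpa using k1.pos)) ?_
    simp only [Mem.set_of_ne, ne_eq, reduceCtorEq, not_false_eq_true, f5, f6]
    rintro π z ⟨f, g1, g2, g3, g4, g5, g6⟩
    obtain ⟨i1, i2⟩ := k1.dijkstra hH w1 g2 g4 g5
    refine ⟨i1, i2.trans k2, fun q hq => ?_, by rw [Nat.succ_mul]; omega⟩
    rcases Nat.lt_succ_iff_lt_or_eq.1 hq with hq | rfl
    · obtain ⟨f', q1, q2, q3, q4⟩ := k3 q hq
      exact ⟨f', q1, q2, q3, fun x hx =>
        (i2 _ (hD.entry j₀ hj1 hjl q (by omega)).1 x hx).trans (q4 x hx)⟩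
    · refine ⟨f, g1, fun x hx => (g2 x hx).trans (k2 _ w1 x hx), fun x y hxy => ?_, fun x hx => ?_⟩
      · have hx := hxy.lt_left hH
        obtain ⟨e, he, rfl⟩ := h1.mem x y hxy
        have := g3 x hx e he
        have := k2 x hx _ (h1.lt x hx e he)
        omega
      · rw [g5, if_pos ⟨rfl, hx⟩]
  · rintro ρ k - ⟨k1, k2, k3, k4⟩
    refine ⟨k1, k2, fun w hw hwD => ?_, by omega⟩
    obtain ⟨q, hq, rfl⟩ := hD.mem j₀ hj1 hjl w hw hwD
    exact k3 q hq

-- The guarantee of phase j rests on those of all earlier phases, so the invariant carries every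
-- stage so far. W bounds the cost of the searches in one phase.
open Classical in
theorem phases_spec {W : ℕ} (hH : OnRange H N) (hN : 1 ≤ N) (hl : 1 ≤ l)
    (hD : Decomposed H N l R h σ) (hE : IsEst H N (σ dhat))
    (hW : ∀ j, 1 ≤ j → j ≤ l → ∃ A B,
      ∑ x ∈ Finset.range N, ((Finset.range N).filter
        fun y => H.Adj x y ∧ (σ hi (j - 1) x = 0 ∨ σ hi (j - 1) y = 0)).card ≤ A ∧
      (∀ i i', 1 ≤ i → i ≤ l → 1 ≤ i' → i' ≤ l → j + i + i' ≤ 2 * l + 1 →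
        σ siz i 0 * σ siz i' 0 ≤ B) ∧
      9 * N + l + N * N + (A + 2 * l * N + l * l * B) + 1 ≤ M ∧
      σ siz j 0 * (1 + 16 * N + 2 * (A + 2 * l * N + l * l * B)) ≤ W) :
    (loop1 j l (block [
      buildGraph l,
      .loop p (rd1 siz §j) (block [
        wr0 w (rd2 lst §j §p),
        dijkstra])])).wp M (fun τ r => IsEst H N (τ dhat) ∧
        Stage H N l (σ hi) (σ inD) (σ rep) l (τ dhat) ∧
        r ≤ s + 1 + l * (1 + 12 * l ^ 2 * N ^ 2 + W)) σ s := by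
  have hlM : l + 1 ≤ M := by obtain ⟨A, B, -, -, h, -⟩ := hW 1 le_rfl hl; omega
  refine wp_loop1 (fun t τ r => IsEst H N (τ dhat) ∧
    (∀ c, 1 ≤ c → c < t → Stage H N l (σ hi) (σ inD) (σ rep) c (τ dhat)) ∧
    r ≤ s + 1 + (t - 1) * (1 + 12 * l ^ 2 * N ^ 2 + W)) (fun _ => hlM) ?_ ?_ ?_
  · intro τ hτ
    rw [hτ dhat (by decide)]
    exact ⟨hE, fun c _ _ => by omega, by simp⟩
  · rintro t ht1 htl τ r hfr ⟨g1, g2, g3⟩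
    have fr : ∀ z ∈ [Loc.n, Loc.inf, adj, hi, rep, inD, lst, siz], (τ.set j 0 0 t) z = σ z := by
      intro z hz
      simp only [List.mem_cons, List.not_mem_nil, or_false] at hz
      have : z ≠ j := by rcases hz with rfl | rfl | rfl | rfl | rfl | rfl | rfl | rfl <;> decide
      rw [Mem.set_of_ne _ this]
      refine hfr z ?_
      rcases hz with rfl | rfl | rfl | rfl | rfl | rfl | rfl | rfl <;>
        simp [buildGraph, dijkstra, enqueue, push, Cmd.mods, block, wr0, wr1, wr2, loop1, when]
    have hDτ : Decomposed H N l R h (τ.set j 0 0 t) := by apply hD.congr <;> apply fr <;> simp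
    have e1 : (τ.set j 0 0 t) siz = σ siz := fr _ (by simp)
    have e2 : (τ.set j 0 0 t) hi = σ hi := fr _ (by simp)
    have e3 : (τ.set j 0 0 t) inD = σ inD := fr _ (by simp)
    have e4 : (τ.set j 0 0 t) rep = σ rep := fr _ (by simp)
    obtain ⟨A, B, w1, w2, w3, w4⟩ := hW t ht1 htl
    refine wp_mono _ (phase_spec (A := A) (B := B) (j₀ := t) hH hN hl hDτ (by simpa using g1) (by simp)
      ht1 htl (by rw [e2]; exact w1) (by rw [e1]; exact w2) w3) ?_
    rw [e1, e2, e3, e4, Mem.set_of_ne _ (by decide : dhat ≠ j)]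
    rintro ρ k ⟨k1, k2, k3, k4⟩
    refine ⟨k1, fun c hc1 hc2 => ?_, ?_⟩
    · rcases Nat.lt_succ_iff_lt_or_eq.1 hc2 with hc2 | rfl
      · exact (g2 c hc1 hc2).mono k2
      · exact Stage.step hH (hD.levels hN) ht1 htl g1 g2 k3
    · obtain ⟨t', rfl⟩ : ∃ t', t = t' + 1 := ⟨t - 1, by omega⟩
      simp only [Nat.add_sub_cancel] at g3 ⊢
      rw [Nat.succ_mul]
      omega
  · rintro τ r - ⟨g1, g2, g3⟩
    exact ⟨g1, g2 l hl (by omega), by simpa using g3⟩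

end Phases

/-! ### The final call of the subroutine -/

section CallBK
open Loc

variable {H : SimpleGraph ℕ} {N M l s : ℕ} {R h : ℝ} {σ : Mem Loc}

/-- The subgraph of the edges of a level. -/
def levelGraph (H : SimpleGraph ℕ) (hi : ℕ → ℕ → ℕ) (j : ℕ) : SimpleGraph ℕ where
  Adj := LevelEdge H hi j
  symm := ⟨fun _ _ h => h.symm⟩
  loopless := ⟨fun _ h => h.1.ne rfl⟩

theorem bk_injective : Function.Injective bk := fun a b h => by injection h

/-- Distances in a subgraph dominate those in the graph, so the entrywise minimum remains an upper
bound for the distances and inherits both the old guarantee and stretch 2 within the level. -/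
theorem callBK_spec {j₀ : ℕ} (hH : OnRange H N) (hN : 1 ≤ N) (hD : Decomposed H N l R h σ)
    (hE : IsEst H N (σ dhat)) (hz : ∀ a i j, σ (bk a) i j = 0) (hjM : j₀ ≤ M)
    (hM : 8 * (N + 2) ^ 4 ≤ M) :
    (callBK bk2apasp j₀).wp M (fun τ r =>
      (∀ x < N, ∀ y < N, tdist H N x y ≤ τ dhat x y ∧ τ dhat x y ≤ σ dhat x y) ∧
      (∀ x < N, ∀ y < N, (levelGraph H (σ hi) (j₀ + 1)).Reachable x y →
        τ dhat x y ≤ 2 * (levelGraph H (σ hi) (j₀ + 1)).dist x y) ∧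
      (r : ℝ) ≤ s + 8 * N ^ 2 + (Nat.log 2 N + 1) *
        (100 * (N ^ 2 + gsize (levelGraph H (σ hi) (j₀ + 1)) N * Real.sqrt N) * harmonic N)) σ s := by
  have hN4 : 4 * N ≤ 8 * (N + 2) ^ 4 := by
    have := (Nat.le_self_pow (by norm_num : 4 ≠ 0) (N + 2))
    omega
  obtain ⟨H', hH'⟩ : ∃ H', H' = levelGraph H (σ hi) (j₀ + 1) := ⟨_, rfl⟩
  have hAdj : ∀ x y, H'.Adj x y ↔ H.Adj x y ∧ (σ hi j₀ x = 0 ∨ σ hi j₀ y = 0) := fun x y => by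
    rw [hH']; rfl
  have hle : H' ≤ H := fun x y hxy => ((hAdj x y).1 hxy).1
  have hHr : OnRange H' N := fun x y hxy => hH x y (hle hxy)
  rw [← hH']
  unfold callBK
  simp only [wp_block_cons, wp_block_nil, wp_wr0, val_rd0, hD.n]
  refine fun _ => ⟨by omega, ?_⟩
  refine wp_loop N (fun t τ r => (∀ x < t, ∀ y < N, τ (bk 1) x y ≠ 0 ↔ H'.Adj x y) ∧
    r = s + t * (N + 1)) (by simpa using hD.n) (fun _ => by omega) (by simp) ?_ ?_
  · rintro x₀ hx τ r hfr ⟨g1, g2⟩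
    have fr : ∀ z, z ≠ bk 0 → z ≠ bk 1 → z ≠ x → z ≠ y → τ z = σ z := fun z h1 h2 h3 h4 => by
      rw [hfr z (by simp [Cmd.mods, wr2, h1, h2, h3, h4]), Mem.set_of_ne _ h1]
    clear hfr
    refine wp_loop N (fun u ρ k => (∀ x < x₀, ∀ y < N, ρ (bk 1) x y ≠ 0 ↔ H'.Adj x y) ∧
      (∀ y < u, ρ (bk 1) x₀ y ≠ 0 ↔ H'.Adj x₀ y) ∧ k = r + 1 + u)
      (by simpa [fr n] using hD.n) (fun _ => by omega) (by simpa using g1) ?_ ?_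
    · rintro u hu ρ k hfr ⟨k1, k2, k3⟩
      have f1 : ρ x 0 0 = x₀ := by rw [hfr x (by simp [Cmd.mods, wr2])]; simp
      have f2 : ρ hi = σ hi := by rw [hfr hi (by simp [Cmd.mods, wr2])]; simpa using fr hi
      have f3 : ρ adj = σ adj := by rw [hfr adj (by simp [Cmd.mods, wr2])]; simpa using fr adj
      clear hfr
      simp only [inE, wp_wr2, val_rd2, val_rd0, val_mul, val_no, val_lit, Mem.set_of_ne, Mem.set_same, ne_eq,
        reduceCtorEq, not_false_eq_true, and_self, if_true, f1, f2, f3]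
      have hv : σ adj x₀ u * (if σ hi j₀ x₀ * σ hi j₀ u = 0 then 1 else 0) ≠ 0 ↔ H'.Adj x₀ u := by
        rw [hAdj, ← hD.matrix.ne_zero hx hu, ← mul_eq_zero]
        by_cases c1 : σ adj x₀ u = 0 <;>
          by_cases c2 : σ hi j₀ x₀ * σ hi j₀ u = 0 <;> simp [c1, c2]
      have hv1 : σ adj x₀ u * (if σ hi j₀ x₀ * σ hi j₀ u = 0 then 1 else 0) ≤ 1 := by
        rw [hD.matrix x₀ hx u hu]; split_ifs <;> simp
      refine fun _ => ⟨by omega, fun x hx' y hy => ?_, fun y hy => ?_, by omega⟩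
      · simpa [hx'.ne] using k1 x hx' y hy
      · rcases Nat.lt_succ_iff_lt_or_eq.1 hy with hy | rfl
        · simpa [hy.ne] using k2 y hy
        · simpa using hv
    · rintro ρ k - ⟨k1, k2, k3⟩
      refine ⟨fun x hx' => ?_, by rw [k3, g2]; ring⟩
      rcases Nat.lt_succ_iff_lt_or_eq.1 hx' with hx' | rfl
      · exact k1 x hx'
      · exact k2
  rintro τ r hfr ⟨g1, rfl⟩
  have fr : ∀ z, z ≠ bk 0 → z ≠ bk 1 → z ≠ x → z ≠ y → τ z = σ z := fun z h1 h2 h3 h4 => by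
    rw [hfr z (by simp [Cmd.mods, wr2, h1, h2, h3, h4]), Mem.set_of_ne _ h1]
  have e0 : τ (bk 0) 0 0 = N := by rw [hfr (bk 0) (by simp [Cmd.mods, wr2])]; simp
  clear hfr
  refine wp_use (wp_map bk_injective bk2apasp (bk2apasp_spec (σ := fun a => τ (bk a)) hHr hN e0 hM g1 ?_)) ?_
  · intro a i j h0 h1
    show τ (bk a) i j = 0
    rw [fr (bk a) (by simpa using h0) (by simpa using h1) (by simp) (by simp)]
    exact hz a i j
  rintro ρ k hfr ⟨k1, k2, k3⟩
  rw [mods_map] at hfr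
  have fr2 : ∀ z, (∀ a, z ≠ bk a) → z ≠ x → z ≠ y → ρ z = σ z := fun z h1 h2 h3 => by
    rw [hfr z, fr z (h1 0) (h1 1) h2 h3]
    rw [List.mem_map]
    rintro ⟨a, -, h⟩
    exact h1 a h.symm
  clear hfr fr
  have e1 : ρ dhat = σ dhat := by apply fr2 <;> simp
  have e2 : ρ n 0 0 = N := by rw [fr2 n (by simp) (by simp) (by simp)]; exact hD.n
  refine wp_loop N (fun t π c => (∀ x < t, ∀ y < N, π dhat x y = min (ρ (bk 2) x y) (σ dhat x y)) ∧
    (∀ x, t ≤ x → π dhat x = σ dhat x) ∧ c = k + t * (N + 1)) (by simpa using e2) (fun _ => by omega)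
    ⟨by simp, by simp [e1], by simp⟩ ?_ ?_
  · rintro x₀ hx π c hfr ⟨m1, m2, m3⟩
    have i1 : π n 0 0 = N := by rw [hfr n (by decide), e2]
    have i2 : π (bk 2) = ρ (bk 2) := hfr _ (by decide)
    clear hfr
    refine wp_loop N (fun u κ d => (∀ x < x₀, ∀ y < N, κ dhat x y = min (ρ (bk 2) x y) (σ dhat x y)) ∧
      (∀ x, x₀ + 1 ≤ x → κ dhat x = σ dhat x) ∧
      (∀ y < u, κ dhat x₀ y = min (ρ (bk 2) x₀ y) (σ dhat x₀ y)) ∧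
      (∀ y, u ≤ y → κ dhat x₀ y = σ dhat x₀ y) ∧ d = c + 1 + u) (by simpa using i1) (fun _ => by omega)
      ⟨by simpa using m1, by simpa using fun x hx => m2 x (by omega), by simp,
        by simp [m2 x₀ le_rfl], rfl⟩ ?_ ?_
    · rintro u hu κ d hfr ⟨n1, n2, n3, n4, n5⟩
      have j1 : κ x 0 0 = x₀ := by rw [hfr x (by decide)]; simp
      have j2 : κ (bk 2) = ρ (bk 2) := by rw [hfr _ (by decide)]; simpa using i2
      clear hfr
      have hlt : (if ρ (bk 2) x₀ u < σ dhat x₀ u then 1 else 0) ≠ 0 ↔ ρ (bk 2) x₀ u < σ dhat x₀ u := by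
        split_ifs with h <;> simp [h]
      simp only [wp_when, wp_wr2, val_lt, val_rd2, val_rd0, Mem.set_of_ne, Mem.set_same, ne_eq, reduceCtorEq,
        not_false_eq_true, and_self, if_true, j1, j2, n4 u le_rfl]
      refine ⟨fun hc _ => ?_, fun hc => ?_⟩
      · have hc := hlt.1 hc
        refine ⟨?_, fun x hx' y hy => ?_, fun x hx' => ?_, fun y hy => ?_, fun y hy => ?_, by omega⟩
        · have : ρ (bk 2) x₀ u ≤ 4 * N := k1.le x₀ hx u hu
          omega
        · simpa [hx'.ne] using n1 x hx' y hy
        · have : x ≠ x₀ := by omega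
          rw [← n2 x hx']; funext y; simp [this]
        · rcases Nat.lt_succ_iff_lt_or_eq.1 hy with hy | rfl
          · simpa [hy.ne] using n3 y hy
          · simp [hc.le]
        · have : y ≠ u := by omega
          simpa [this] using n4 y (by omega)
      · have hc : ¬ _ := fun h => hlt.2 h hc
        refine ⟨n1, n2, fun y hy => ?_, fun y hy => n4 y (by omega), by omega⟩
        rcases Nat.lt_succ_iff_lt_or_eq.1 hy with hy | rfl
        · exact n3 y hy
        · rw [n4 y le_rfl]; omega
    · rintro κ d - ⟨n1, n2, n3, n4, n5⟩
      refine ⟨fun x hx' => ?_, n2, by rw [n5, m3]; ring⟩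
      rcases Nat.lt_succ_iff_lt_or_eq.1 hx' with hx' | rfl
      · exact n1 x hx'
      · exact n3
  · rintro π c - ⟨m1, -, m3⟩
    refine ⟨fun x hx y hy => ?_, fun x hx y hy hr => ?_, ?_⟩
    · rw [m1 x hx y hy]
      exact ⟨le_min ((tdist_anti hH hle hx y).trans (k1.sound x hx y hy)) (hE.sound x hx y hy), min_le_right _ _⟩
    · rw [m1 x hx y hy]
      exact (min_le_left _ _).trans (k2 x hx y hy hr)
    · have hN1 : (1 : ℝ) ≤ N := by exact_mod_cast hN
      rw [m3]
      push_cast at k3 ⊢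
      nlinarith

end CallBK
/-! ### The running time of the phases -/

section Budget
open Loc

variable {H : SimpleGraph ℕ} {N M l s : ℕ} {R h : ℝ} {σ : Mem Loc}

/-- For i = 0, where s_0 = ∞, the bound still holds, because every degree is at most N = R^l. -/
theorem Decomposed.gdeg_le_floor (hl : 1 ≤ l) (hR : 1 ≤ R) (hRl : R ^ l = N) (hD : Decomposed H N l R h σ)
    {i x : ℕ} (hil : i < l) (hx : x < N) (hz : σ Loc.hi i x = 0) : gdeg H N x ≤ ⌊R ^ (l - i)⌋₊ := by
  refine Nat.le_floor ?_
  rcases Nat.eq_zero_or_pos i with rfl | hi0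
  · rw [Nat.sub_zero, hRl]; exact_mod_cast gdeg_le H N x
  · rw [hD.hi i hil.le x hx] at hz
    by_contra hc
    exact (highDeg_real hl (by linarith) hRl (by omega) hil).2 (not_le.1 hc).le hz

-- E_j contributes O(N R^(l-j+1)) entries and each product at most l² h² R^(2l+1-j). As N = R^l,
-- both have the exponent 2l+1-j, which the |D_j| ≤ l R^j h searches raise to 2l+1 for every j. The
-- restriction j + j₁ + j₂ ≤ 2l + 1 is what balances the products against E_j.
open Classical in
theorem Decomposed.phase_budget (hN : 1 ≤ N) (hl : 1 ≤ l) (hR : 1 ≤ R) (hRl : R ^ l = N) (hh : 1 ≤ h)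
    (hH : OnRange H N) (hD : Decomposed H N l R h σ)
    (hM : 9 * N + l + N * N + (2 * (N * N) + 2 * l * N + l * l * (N * N)) + 1 ≤ M) {j : ℕ}
    (hj1 : 1 ≤ j) (hjl : j ≤ l) : ∃ A B,
      ∑ x ∈ Finset.range N, ((Finset.range N).filter
        fun y => H.Adj x y ∧ (σ Loc.hi (j - 1) x = 0 ∨ σ Loc.hi (j - 1) y = 0)).card ≤ A ∧
      (∀ i i', 1 ≤ i → i ≤ l → 1 ≤ i' → i' ≤ l → j + i + i' ≤ 2 * l + 1 →
        σ siz i 0 * σ siz i' 0 ≤ B) ∧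
      9 * N + l + N * N + (A + 2 * l * N + l * l * B) + 1 ≤ M ∧
      σ siz j 0 * (1 + 16 * N + 2 * (A + 2 * l * N + l * l * B)) ≤
        ⌊27 * (l : ℝ) ^ 5 * h ^ 3 * R ^ (2 * l + 1)⌋₊ := by
  have hl1 : (1 : ℝ) ≤ l := by exact_mod_cast hl
  have hR0 : 0 ≤ R := by linarith
  obtain ⟨q, hq⟩ : ∃ q, q = ⌊R ^ (l - (j - 1))⌋₊ := ⟨_, rfl⟩
  have hqR : (q : ℝ) ≤ R ^ (l - (j - 1)) := hq ▸ Nat.floor_le (pow_nonneg hR0 _)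
  have hqN : q ≤ N := by
    have : (q : ℝ) ≤ N := hRl ▸ hqR.trans (pow_le_pow_right₀ hR (Nat.sub_le _ _))
    exact_mod_cast this
  obtain ⟨B₀, hB₀⟩ : ∃ B₀ : ℝ, B₀ = (l : ℝ) ^ 2 * h ^ 2 * R ^ (2 * l + 1 - j) := ⟨_, rfl⟩
  have hB0 : 0 ≤ B₀ := by rw [hB₀]; positivity
  -- The minimum serves two purposes: B₀ gives the running time, while N² keeps the lengths of the
  -- lists below M independently of the logarithmic factor.
  refine ⟨2 * (N * q), min ⌊B₀⌋₊ (N * N), ?_, fun i i' h1 h2 h3 h4 h5 => ?_, ?_, ?_⟩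
  · convert sum_sparse_le hH (fun x => σ Loc.hi (j - 1) x = 0) q fun x hx hz =>
      hq ▸ hD.gdeg_le_floor hl hR hRl (by omega) hx hz
  · refine le_min (Nat.le_floor ?_) (Nat.mul_le_mul (hD.siz_le i h1 h2) (hD.siz_le i' h3 h4))
    push_cast
    calc (σ siz i 0 : ℝ) * σ siz i' 0 ≤ (l * R ^ i * h) * (l * R ^ i' * h) := by
          have := hD.siz_real i h1 h2
          have := hD.siz_real i' h3 h4
          gcongr
      _ = l ^ 2 * h ^ 2 * R ^ (i + i') := by rw [pow_add]; ring
      _ ≤ B₀ := by rw [hB₀]; gcongr; first | exact hR | omega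
  · have h1 : N * q ≤ N * N := Nat.mul_le_mul_left _ hqN
    have h2 : l * l * min ⌊B₀⌋₊ (N * N) ≤ l * l * (N * N) := Nat.mul_le_mul_left _ (min_le_right _ _)
    omega
  · refine Nat.le_floor ?_
    have hB : ((min ⌊B₀⌋₊ (N * N) : ℕ) : ℝ) ≤ B₀ :=
      (Nat.cast_le.2 (min_le_left _ _)).trans (Nat.floor_le hB0)
    obtain ⟨Z, hZ⟩ : ∃ Z, Z = R ^ (2 * l + 1 - j) := ⟨_, rfl⟩
    have hZ1 : 1 ≤ Z := hZ ▸ one_le_pow₀ hR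
    have hNZ : (N : ℝ) ≤ Z := by rw [← hRl, hZ]; exact pow_le_pow_right₀ hR (by omega)
    -- The exponents add up: l + (l - (j - 1)) = 2l + 1 - j.
    have hNq : (N : ℝ) * q ≤ Z := by
      calc (N : ℝ) * q ≤ R ^ l * R ^ (l - (j - 1)) := by rw [hRl]; gcongr
        _ = Z := by rw [hZ, ← pow_add]; congr 1; omega
    have hjZ : R ^ j * Z = R ^ (2 * l + 1) := by rw [hZ, ← pow_add]; congr 1; omega
    obtain ⟨K, hK⟩ : ∃ K : ℝ, K = (l : ℝ) ^ 4 * h ^ 2 := ⟨_, rfl⟩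
    have hK1 : 1 ≤ K := by
      rw [hK]; exact one_le_mul_of_one_le_of_one_le (one_le_pow₀ hl1) (one_le_pow₀ hh)
    have hlK : (l : ℝ) ≤ K := by
      rw [hK]
      calc (l : ℝ) ≤ l ^ 4 := le_self_pow₀ hl1 (by norm_num)
        _ ≤ _ := le_mul_of_one_le_right (by positivity) (one_le_pow₀ hh)
    have hZ0 : 0 ≤ Z := by linarith
    have hin : (1 : ℝ) + 16 * N + 2 * (2 * (N * q) + 2 * l * N + l * l * (min ⌊B₀⌋₊ (N * N) : ℕ)) ≤
        27 * K * Z := by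
      have a1 : (l : ℝ) * l * (min ⌊B₀⌋₊ (N * N) : ℕ) ≤ K * Z := by
        calc (l : ℝ) * l * (min ⌊B₀⌋₊ (N * N) : ℕ) ≤ l * l * B₀ := by gcongr
          _ = K * Z := by rw [hB₀, hK, hZ]; ring
      have a2 : (l : ℝ) * N ≤ K * Z := by gcongr
      have a3 : Z ≤ K * Z := le_mul_of_one_le_left hZ0 hK1
      linarith
    push_cast at hin ⊢
    calc (σ siz j 0 : ℝ) * _ ≤ (l * R ^ j * h) * (27 * K * Z) := by
          have := hD.siz_real j hj1 hjl
          gcongr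
      _ = 27 * (l : ℝ) ^ 5 * h ^ 3 * (R ^ j * Z) := by rw [hK]; ring
      _ = _ := by rw [hjZ]

theorem Decomposed.gsize_le {i : ℕ} (hl : 1 ≤ l) (hR : 1 ≤ R) (hRl : R ^ l = N) (hH : OnRange H N)
    (hD : Decomposed H N l R h σ) (hil : i < l) :
    (gsize (levelGraph H (σ Loc.hi) (i + 1)) N : ℝ) ≤ 3 * N * R ^ (l - i) := by
  classical
  obtain ⟨q, hq⟩ : ∃ q, q = ⌊R ^ (l - i)⌋₊ := ⟨_, rfl⟩
  have hqR : (q : ℝ) ≤ R ^ (l - i) := hq ▸ Nat.floor_le (by positivity)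
  have h1 := sum_sparse_le hH (fun x => σ Loc.hi i x = 0) q fun x hx hz =>
    hq ▸ hD.gdeg_le_floor hl hR hRl hil hx hz
  have h2 : gsize (levelGraph H (σ Loc.hi) (i + 1)) N ≤ 2 * (N * q) + N := by
    unfold gsize
    rw [Finset.sum_add_distrib]
    refine Nat.add_le_add (le_trans (Finset.sum_le_sum fun x _ => ?_) h1) (by simp)
    refine Finset.card_le_card fun y hy => ?_
    simp only [Finset.mem_filter] at hy ⊢
    exact hy
  have h3 : (gsize (levelGraph H (σ Loc.hi) (i + 1)) N : ℝ) ≤ 2 * (N * q) + N := by exact_mod_cast h2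
  have h4 : (1 : ℝ) ≤ R ^ (l - i) := one_le_pow₀ hR
  have h5 : (0 : ℝ) ≤ N := Nat.cast_nonneg _
  nlinarith

end Budget

/-! ### Correctness and total running time of the algorithm -/

section Total
open Loc

variable {n k l : ℕ}

theorem longMultiplicativeAPASP_spec (hk : 4 ≤ k) (hkE : Even k) (hl : l = 2 * (k - 1)) (hn : 1 ≤ n)
    (G : SimpleGraph (Fin n)) :
    (longMultiplicativeAPASP bk2apasp k).wp ((8 + 9 * l ^ 2) * (n + 2) ^ (l + 4))
      (fun τ r => IsApprox 2 0 k G (estimate (τ dhat)) ∧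
        (r : ℝ) ≤ 3000 * l ^ 6 * (n : ℝ) ^ (2 + 1 / (2 * ((k : ℝ) - 1))) * Real.log (n + 2) ^ 3)
      (inputMem Loc.n adj G) 0 := by
  -- Large enough for the powers n^l in the degree tests, for the numbers up to 8 (n + 2)^4 in the
  -- subroutine, and for the list lengths, which are quadratic in n and in l.
  obtain ⟨M, hM⟩ : ∃ M, M = (8 + 9 * l ^ 2) * (n + 2) ^ (l + 4) := ⟨_, rfl⟩
  obtain ⟨H, hHdef⟩ : ∃ H, H = onNat G := ⟨_, rfl⟩
  have hH : OnRange H n := hHdef ▸ onRange_onNat G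
  have hl6 : 6 ≤ l := by omega
  have hn1 : (1 : ℝ) ≤ n := by exact_mod_cast hn
  -- the bounds on the numbers that occur
  have hMsq : (8 + 9 * l ^ 2) * (n + 2) ^ 2 ≤ M :=
    hM ▸ Nat.mul_le_mul_left _ (Nat.pow_le_pow_right (by omega) (by omega))
  have hMl : n ^ l ≤ M := by
    calc n ^ l ≤ (n + 2) ^ l := Nat.pow_le_pow_left (by omega) _
      _ ≤ (n + 2) ^ (l + 4) := Nat.pow_le_pow_right (by omega) (by omega)
      _ ≤ M := hM ▸ Nat.le_mul_of_pos_left _ (by omega)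
  have hM4 : 8 * (n + 2) ^ 4 ≤ M :=
    hM ▸ Nat.mul_le_mul (by omega) (Nat.pow_le_pow_right (by omega) (by omega))
  have hMbig : 9 * n + l + n * n + (2 * (n * n) + 2 * l * n + l * l * (n * n)) + 1 ≤ M := by
    refine le_trans ?_ hMsq
    nlinarith [mul_le_mul hl6 hn (by omega) (by omega), Nat.zero_le (l * l * n), Nat.zero_le (l * l * (n * n)),
      Nat.zero_le (l * n)]
  have hMk : 4 * n + l + 4 ≤ M := by
    refine le_trans ?_ hMsq
    nlinarith
  -- the real parameters
  obtain ⟨R, hRdef⟩ : ∃ R : ℝ, R = (n : ℝ) ^ (1 / (l : ℝ)) := ⟨_, rfl⟩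
  have hlR : (l : ℝ) ≠ 0 := by exact_mod_cast (by omega : l ≠ 0)
  have hR : 1 ≤ R := hRdef ▸ Real.one_le_rpow hn1 (by positivity)
  have hRl : R ^ l = n := by
    rw [hRdef, ← Real.rpow_natCast, ← Real.rpow_mul (by linarith), one_div, inv_mul_cancel₀ hlR,
      Real.rpow_one]
  -- Since 2(k-1) = l, the claimed bound n^(2+1/l) is the power R^(2l+1).
  have hT : (n : ℝ) ^ (2 + 1 / (2 * ((k : ℝ) - 1))) = R ^ (2 * l + 1) := by
    have h1 : (2 * ((k : ℝ) - 1)) = l := by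
      rw [hl]; push_cast [Nat.cast_sub (by omega : 1 ≤ k)]; ring
    rw [h1, Real.rpow_add (by linarith), ← hRdef, pow_succ, mul_comm 2 l, pow_mul, hRl]
    norm_cast
  -- This uses that l is twice k - 1.
  have hsqrt : Real.sqrt n = R ^ (k - 1) := by
    rw [← hRl, hl, mul_comm, pow_mul, Real.sqrt_sq (by positivity)]
  rw [hT, ← hM]
  obtain ⟨T, hTdef⟩ : ∃ T, T = R ^ (2 * l + 1) := ⟨_, rfl⟩
  have hT1 : 1 ≤ T := hTdef ▸ one_le_pow₀ hR
  have hnT : (n : ℝ) ^ 2 ≤ T := by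
    rw [← hRl, ← pow_mul, hTdef]; exact pow_le_pow_right₀ hR (by omega)
  have hh : (1 : ℝ) ≤ harmonic n := one_le_harmonic hn
  -- the program
  unfold longMultiplicativeAPASP
  rw [← hl]
  simp only [wp_block_cons, wp_block_nil]
  have hA0 : IsMatrix H n (inputMem Loc.n adj G adj) := by
    intro x hx y hy
    have h1 := inputMem_adj (N := Loc.n) (A := adj) (by decide) G x y
    have h2 := inputMem_le (N := Loc.n) (A := adj) (by decide) G x y
    rw [← hHdef] at h1
    split_ifs with hc
    · have := h1.2 hc; omega
    · by_contra h0; exact hc (h1.1 h0)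
  have hz0 : ∀ a, a ≠ Loc.n → a ≠ adj → ∀ i j, inputMem Loc.n adj G a i j = 0 :=
    fun a h1 h2 i j => inputMem_other h1 h2 G i j
  refine wp_use (initEstimate_spec hH (by omega) (inputMem_n G) hA0) ?_
  rintro τ r hfr ⟨h1, h2, rfl⟩
  have fr1 : ∀ z ∈ [Loc.n, adj, deg, inD, siz], τ z = inputMem Loc.n adj G z := by
    intro z hz
    simp only [List.mem_cons, List.not_mem_nil, or_false] at hz
    rcases hz with rfl | rfl | rfl | rfl | rfl <;> exact hfr _ (by decide)
  have bk1 : ∀ a i j, τ (bk a) i j = 0 := fun a i j => by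
    rw [hfr (bk a) (by simp [initEstimate, Cmd.mods, block, wr0, wr2])]; exact hz0 _ (by simp) (by simp) _ _
  clear hfr
  refine wp_use (decompose_spec (H := H) (R := R) hn (by omega) hR hRl rfl hMl (by omega)
    (by rw [fr1 _ (by simp)]; exact inputMem_n G) h1 (by rw [fr1 _ (by simp)]; exact hA0) ?_) ?_
  · intro a ha i j
    simp only [List.mem_cons, List.not_mem_nil, or_false] at ha
    rcases ha with rfl | rfl | rfl <;> rw [fr1 _ (by simp)] <;> exact hz0 _ (by decide) (by decide) _ _
  rintro ρ c hfr ⟨hD, hc⟩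
  have e1 : ρ dhat = τ dhat := hfr _ (by
    simp [decompose, thresholds, hittingSet, Cmd.mods, block, wr0, wr1, wr2, loop1, when])
  have bk2 : ∀ a i j, ρ (bk a) i j = 0 := fun a i j => by
    rw [hfr (bk a) (by
      simp [decompose, thresholds, hittingSet, Cmd.mods, block, wr0, wr1, wr2, loop1, when])]
    exact bk1 a i j
  clear hfr
  refine wp_use (phases_spec (W := ⌊27 * (l : ℝ) ^ 5 * (harmonic n : ℝ) ^ 3 * R ^ (2 * l + 1)⌋₊) hH hn (by omega)
    hD (e1 ▸ h2) fun j hj1 hjl => hD.phase_budget hn (by omega) hR hRl hh hH hMbig hj1 hjl) ?_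
  rintro π d hfr ⟨hE, hS, hd⟩
  have fr3 : ∀ z ∈ [Loc.n, Loc.inf, adj, hi, rep, inD, lst, siz], π z = ρ z := by
    intro z hz
    refine hfr z ?_
    simp only [List.mem_cons, List.not_mem_nil, or_false] at hz
    rcases hz with rfl | rfl | rfl | rfl | rfl | rfl | rfl | rfl <;>
      simp [buildGraph, dijkstra, enqueue, push, Cmd.mods, block, wr0, wr1, wr2, loop1, when]
  have bk3 : ∀ a i j, π (bk a) i j = 0 := fun a i j => by
    rw [hfr (bk a) (by
      simp [buildGraph, dijkstra, enqueue, push, Cmd.mods, block, wr0, wr1, wr2, loop1, when])]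
    exact bk2 a i j
  clear hfr
  have hDπ : Decomposed H n l R (harmonic n) π := by apply hD.congr <;> apply fr3 <;> simp
  refine wp_mono _ (callBK_spec (j₀ := k - 2) hH hn hDπ hE bk3 (by omega) hM4) ?_
  rintro κ e ⟨q1, q2, q3⟩
  rw [← fr3 hi (by simp), ← fr3 inD (by simp), ← fr3 rep (by simp)] at hS
  refine ⟨isApprox_of_bounds (fun x hx y hy => hHdef ▸ (q1 x hx y hy).1) fun x hx y hy hr hkd => ?_, ?_⟩
  · rw [← hHdef] at hr hkd ⊢
    obtain ⟨P, hP⟩ := exists_route hr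
    rcases Stage.final hH (hDπ.levels hn) hk hkE hl hDπ.last hS hP hx hy hkd with h | h
    · exact (q1 x hx y hy).2.trans h
    -- The path lies inside E_{k-1}, so its length bounds the distance in the graph that is given to
    -- the subroutine.
    · have hP' : IsRoute (levelGraph H (π hi) (k - 2 + 1)) P (H.dist x y) x y := by
        refine ⟨hP.1, hP.2.1, fun i hi' => ?_⟩
        rw [show k - 2 + 1 = k - 1 by omega]; exact h i hi'
      have hw' : ∃ w : (levelGraph H (π hi) (k - 2 + 1)).Walk x y, w.length = H.dist x y := by
        have := hP'.reachable_aux 0 (H.dist x y) (by omega)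
        rwa [Nat.zero_add, hP.1, hP.2.1] at this
      obtain ⟨w', hw'⟩ := hw'
      refine (q2 x hx y hy w'.reachable).trans ?_
      have := SimpleGraph.dist_le w'
      omega
  · rw [← hTdef]
    obtain ⟨L, hL⟩ : ∃ L, L = Real.log ((n : ℝ) + 2) := ⟨_, rfl⟩
    have hL1 : 1 ≤ L := hL ▸ one_le_log_add_two hn
    have hh2 : (harmonic n : ℝ) ≤ 2 * L := hL ▸ harmonic_le_log hn
    have hlog : (Nat.log 2 n : ℝ) + 1 ≤ 3 * L := by
      have := natLog_le_log n
      have : Real.log n ≤ L := hL ▸ Real.log_le_log (by linarith) (by linarith)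
      linarith
    -- The exponents are l + (l - (k - 2)) + (k - 1) = 2l + 1, the same as for the phases. This
    -- balance is the reason for the choice l₀ = k - 2.
    have hg : (gsize (levelGraph H (π hi) (k - 2 + 1)) n : ℝ) * Real.sqrt n ≤ 3 * T := by
      calc (gsize (levelGraph H (π hi) (k - 2 + 1)) n : ℝ) * Real.sqrt n
          ≤ (3 * n * R ^ (l - (k - 2))) * R ^ (k - 1) := by
            rw [hsqrt]
            have := hDπ.gsize_le (by omega) hR hRl hH (by omega : k - 2 < l)
            exact mul_le_mul_of_nonneg_right this (by positivity)
        _ = 3 * (R ^ l * R ^ (l - (k - 2)) * R ^ (k - 1)) := by rw [hRl]; ring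
        _ = 3 * T := by rw [hTdef, ← pow_add, ← pow_add]; congr 2; omega
    rw [← hL]
    have hl1 : (1 : ℝ) ≤ l := by exact_mod_cast (by omega : 1 ≤ l)
    have hBK : ((Nat.log 2 n : ℝ) + 1) * (100 * (n ^ 2 +
        gsize (levelGraph H (π hi) (k - 2 + 1)) n * Real.sqrt n) * harmonic n) ≤ 2400 * (T * L ^ 3) := by
      calc _ ≤ (3 * L) * (100 * (T + 3 * T) * (2 * L)) := by gcongr
        _ = 2400 * (T * L ^ 2) := by ring
        _ ≤ 2400 * (T * L ^ 3) := by
          gcongr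
          all_goals first | exact hL1 | norm_num
    have hW : ((⌊27 * (l : ℝ) ^ 5 * (harmonic n : ℝ) ^ 3 * R ^ (2 * l + 1)⌋₊ : ℕ) : ℝ) ≤
        216 * l ^ 5 * (T * L ^ 3) := by
      refine (Nat.floor_le (by positivity)).trans ?_
      rw [← hTdef]
      calc 27 * (l : ℝ) ^ 5 * (harmonic n : ℝ) ^ 3 * T ≤ 27 * (l : ℝ) ^ 5 * (2 * L) ^ 3 * T := by gcongr
        _ = _ := by ring
    obtain ⟨U, hU⟩ : ∃ U, U = T * L ^ 3 := ⟨_, rfl⟩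
    rw [← hU] at hBK hW
    have hTU : T ≤ U := hU ▸ le_mul_of_one_le_right (by linarith) (one_le_pow₀ hL1)
    have hc' : (c : ℝ) ≤ 0 + n * (n + 1) + 25 * l * n ^ 2 := by exact_mod_cast hc
    obtain ⟨W, hWdef⟩ : ∃ W, W = ⌊27 * (l : ℝ) ^ 5 * (harmonic n : ℝ) ^ 3 * R ^ (2 * l + 1)⌋₊ := ⟨_, rfl⟩
    rw [← hWdef] at hd hW
    have hd' : (d : ℝ) ≤ c + 1 + l * (1 + 12 * l ^ 2 * n ^ 2 + W) := by exact_mod_cast hd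
    have hnU : (n : ℝ) ^ 2 ≤ U := hnT.trans hTU
    have hU1 : 1 ≤ U := hT1.trans hTU
    have hnn : (n : ℝ) * (n + 1) ≤ 2 * U := by nlinarith
    have hl6' : (1 : ℝ) ≤ l ^ 6 := one_le_pow₀ hl1
    have hll : (l : ℝ) ≤ l ^ 6 := le_self_pow₀ hl1 (by norm_num)
    have hl3 : (l : ℝ) ^ 3 ≤ l ^ 6 := pow_le_pow_right₀ hl1 (by norm_num)
    have t1 : 25 * (l : ℝ) * n ^ 2 ≤ 25 * (l ^ 6 * U) := by
      rw [mul_assoc]; gcongr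
    have t2 : (l : ℝ) * (1 + 12 * l ^ 2 * n ^ 2 + W) ≤ 229 * (l ^ 6 * U) := by
      calc (l : ℝ) * (1 + 12 * l ^ 2 * n ^ 2 + W)
          = l * 1 + 12 * (l ^ 3 * n ^ 2) + l * W := by ring
        _ ≤ l ^ 6 * U + 12 * (l ^ 6 * U) + l * (216 * l ^ 5 * U) := by gcongr
        _ = 229 * (l ^ 6 * U) := by ring
    have t3 : U ≤ l ^ 6 * U := le_mul_of_one_le_left (by linarith) hl6'
    have t4 : 3000 * (l : ℝ) ^ 6 * T * L ^ 3 = 3000 * (l ^ 6 * U) := by rw [hU]; ring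
    rw [t4]
    linarith

end Total
end Apsp

theorem mainTheorem4 :
    ∃ BK : Apsp.Cmd ℕ, Apsp.IsBK2APASP BK ∧
      ∀ k : ℕ, 4 ≤ k → Even k →
        Apsp.Computes (Apsp.longMultiplicativeAPASP BK k) .n .adj .dhat 2 0 k ∧
        Apsp.RunsInExpected (Apsp.longMultiplicativeAPASP BK k) .n .adj
          (fun n _ => (n : ℝ) ^ (2 + 1 / (2 * ((k : ℝ) - 1)))) := by
  refine ⟨Apsp.bk2apasp, Apsp.isBK2APASP_bk2apasp, fun k hk hkE => ⟨?_, ?_⟩⟩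
  · refine Apsp.computes_of_wp fun n hn G => ⟨_, ?_, ?_,
      Apsp.wp_mono _ (Apsp.longMultiplicativeAPASP_spec hk hkE rfl hn G) fun τ r h => h.1⟩
    all_goals
      have := Nat.le_self_pow (by omega : 2 * (k - 1) + 4 ≠ 0) (n + 2)
      have := Nat.le_mul_of_pos_left ((n + 2) ^ (2 * (k - 1) + 4))
        (by omega : 0 < 8 + 9 * (2 * (k - 1)) ^ 2)
      omega
  · refine Apsp.runsInExpected_of_wp (by omega : 1 ≤ 8 + 9 * (2 * (k - 1)) ^ 2)
      (by omega : 1 ≤ 2 * (k - 1) + 4) (C := 3000 * ((2 * (k - 1) : ℕ) : ℝ) ^ 6) (by positivity)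
      (fun n m hn => ?_) fun n hn G =>
        Apsp.wp_mono _ (Apsp.longMultiplicativeAPASP_spec hk hkE rfl hn G) fun τ r h => h.2
    have : (4 : ℝ) ≤ k := by exact_mod_cast hk
    exact Real.one_le_rpow (by exact_mod_cast hn) (by
      have : (0 : ℝ) < 2 * ((k : ℝ) - 1) := by linarith
      positivity)
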